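/- **Setting.** Let $F_1,\dots,F_m$ ($m\ge 1$) be probability distributions on Polish spaces, with supports $\Xi_i$. Let $\mathcal P_i$ be the convex hull of $F_i$ and all Dirac measures on $\Xi_i$, and let $\psi$ be a real functional on $\prod_i\mathcal P_i$. A simulation run driven by $P=(P_1,\dots,P_m)$ is an unbiased random replication $\hat\psi(P)$ of $\psi(P)$; put $\tau^2(P)=\mathbb E_P[(\hat\psi-\psi(P))^2]$ and $\mu_4(P)=\mathbb E_P[(\hat\psi-\psi(P))^4]$. For each $i$ there are i.i.d. data $X_{i,1},\dots,X_{i,n_i}\sim F_i$, independent across $i$, with empirical distribution $\widehat F_i$. Consider a sequence of data sizes with $n_i\to\infty$ for every $i$; all asymptotic statements are along this sequence. Put $n=\frac1m\sum_i n_i$. For a subsample ratio $0<\theta\le1$ put $s_i=\lfloor\theta n_i\rfloor$ and $s=\frac1m\sum_i s_i$, and let $\widehat F^*_{i}$ be the empirical distribution of $s_i$ points drawn uniformly with replacement from the $i$-th data set, independently across $i$. $\mathbb E_*$ is expectation conditional on the data. Write $\widehat F=(\widehat F_i)_i$, $F=(F_i)_i$, $\widehat F^*=(\widehat F^*_i)_i$.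 The input variance is $\sigma_I^2=\mathrm{Var}[\psi(\widehat F)]$. *Algorithm.* Draw $B$ independent resamples $\widehat F^{*,b}$ of $\widehat F^*$; for each, run $R$ independent simulations $\hat\psi_{b,r}$ driven by $\widehat F^{*,b}$. With $\bar\psi^b=\frac1R\sum_r\hat\psi_{b,r}$, $\bar{\bar\psi}=\frac1B\sum_b\bar\psi^b$ and $V=\frac1{B(R-1)}\sum_{b,r}(\hat\psi_{b,r}-\bar\psi^b)^2$, output $$\hat\sigma^2_{SVB}=\theta\Big(\tfrac1{B-1}\sum_{b}(\bar\psi^b-\bar{\bar\psi})^2-\tfrac VR\Big).$$ **Assumptions** (all functions involved are measurable). 1. *Balanced data:* $\max_i n_i/\min_i n_i\le c$ for a finite constant $c$. 2. *Third order differentiability:* for every $P\in\prod_i\mathcal P_i$ there are influence functions $g_i(P;\cdot)$, $g_{ij}(P;\cdot,\cdot)$, $g_{ijk}(P;\cdot,\cdot,\cdot)$ on the supports, integrable under products of elements of the $\mathcal P_i$, symmetric under simultaneous permutation of indices and arguments, with $\int g_i(P;x)\,dP_i(x)=0$, $\int g_{ij}(P;x,y)\,dP_j(y)=0$, $\int g_{ijk}(P;x,y,z)\,dP_k(z)=0$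 for all $x,y$, such that for all $P,Q\in\prod_i\mathcal P_i$ and $P_i^{\nu_i}=(1-\nu_i)P_i+\nu_iQ_i$, as $\nu\to0$ in $[0,1]^m$, $\psi(P^\nu)-\psi(P)$ equals $$\sum_i\nu_i\!\int\! g_i\,d(Q_i-P_i)+\frac12\sum_{i,j}\nu_i\nu_j\!\int\! g_{ij}\,d(Q_i-P_i)d(Q_j-P_j)+\frac16\sum_{i,j,k}\nu_i\nu_j\nu_k\!\int\! g_{ijk}\,d(Q_i-P_i)d(Q_j-P_j)d(Q_k-P_k)+o\big((\textstyle\sum_i\nu_i^2)^{3/2}\big).$$ For distributions $Q,P$ let $\epsilon_1(Q,P)$ and $\epsilon_3(Q,P)$ be $\psi(Q)-\psi(P)$ minus, respectively, the linear part and the full cubic part of this expansion at $P$ with all $\nu_i=1$. Write $g_i,g_{ij},g_{ijk}$ for the influence functions at $F$ and $\hat g_i,\hat g_{ij},\hat g_{ijk}$ for those at $\widehat F$. 3. *Smoothness at the truth:* $\mathbb E[\epsilon_1(\widehat F,F)^2]=o(n^{-1})$, $\sigma_i^2:=\mathrm{Var}_{F_i}[g_i(X_i)]>0$, $\mathbb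 E[g_i^4(X_i)]<\infty$; moreover $\mathbb E[\epsilon_3(\widehat F,F)^2]=o(n^{-3})$ and, for all $i_1,i_2,i_3$ and $j_2\le2$, $j_3\le3$, $\mathbb E[g_{i_1i_2}^4(X_{i_1,1},X_{i_2,j_2})]<\infty$ and $\mathbb E[g_{i_1i_2i_3}^2(X_{i_1,1},X_{i_2,j_2},X_{i_3,j_3})]<\infty$. 4. *Smoothness at the empirical models:* $\mathbb E[(\hat g_i-g_i)^4(X_{i,1})]\to0$; $\mathbb E_*[\epsilon_1(\overline F,\widehat F)^4]=o_p(s^{-2})$ for every choice $\overline F\in\prod_i\{\widehat F_i,\widehat F_i^*\}$; $\mathbb E_*[\epsilon_3(\widehat F^*,\widehat F)^2]=o_p(s^{-3})$; for all $i_1,i_2,i_3$, $j_2\le2$, $j_3\le3$, $\mathbb E[(\hat g_{i_1i_2}-g_{i_1i_2})^2(X_{i_1,1},X_{i_2,j_2})]\to0$ and $\mathbb E[(\hat g_{i_1i_2i_3}-g_{i_1i_2i_3})^2(X_{i_1,1},X_{i_2,j_2},X_{i_3,j_3})]\to0$; and the remainder $\epsilon_{g,i}$ in $\hat g_i(X_{i,1})=g_i(X_{i,1})+\sum_{j}\int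 g_{ij}(X_{i,1},x)\,d(\widehat F_j-F_j)(x)-\int g_i\,d(\widehat F_i-F_i)+\epsilon_{g,i}$ satisfies $\mathbb E[\epsilon_{g,i}^2]=o(n^{-1})$. 5. *Simulation noise:* $\tau^2(F)<\infty$, $\tau^2(\widehat F)\to\tau^2(F)$ in probability; and for every $\overline F\in\prod_i\{\widehat F_i,\widehat F_i^*\}$, $\mathbb E_*[(\tau^2(\overline F)-\tau^2(\widehat F))^2]=o_p(1)$ and $\mathbb E_*[\mu_4(\overline F)]=O_p(1)$. **Theorem.** Let $N$ be a simulation budget and $\theta$ a subsample ratio with $N=\omega(\theta n)$ and $\theta=\omega(n^{-1})$, and let $R=\Theta(\theta n)$ and $B=N/R$ (all of $N,B,R$ integers). Then, under the assumptions above, there are square-integrable random variables $\mathcal E$ with $$\hat\sigma^2_{SVB}-\sigma_I^2=\mathcal E+o_p\Big(\sqrt{\tfrac{\theta}{Nn}}+\theta^{-1}n^{-2}+n^{-3/2}\Big),\qquad \mathbb E[\mathcal E^2]=\Theta\Big(\frac{\theta}{Nn}+\mathcal R^2+\sum_{i=1}^m\frac{\lambda_i^T\Sigma_i\lambda_i}{n_i}\Big),$$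 where $\lambda_i=(1/n_i,2/n_1,\dots,2/n_m)^T$, $\Sigma_i$ is the covariance matrix of the vector $\big(g_i^2(X_i),\mathbb E_{X_1'}[g_1(X_1')g_{1i}(X_1',X_i)],\dots,\mathbb E_{X_m'}[g_m(X_m')g_{mi}(X_m',X_i)]\big)$, and $$\mathcal R=\sum_i\frac{\mathrm{Cov}(g_i(X_i),g_{ii}(X_i,X_i))}{n_is_i}+\sum_{i,j}\frac{\mathrm{Cov}\big(g_i(X_i),\mathbb E_{X_j'}[g_{ijj}(X_i,X_j',X_j')]\big)}{n_is_j}+\sum_i\frac{(\theta n_i-\lfloor\theta n_i\rfloor)\,\sigma_i^2}{n_is_i}+\sum_{i,j}\frac{\mathrm{Var}[g_{ij}(X_i,X_j')]}{2\,n_is_j},$$ with $X_i,X_i'$ independent copies with law $F_i$. -/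

import Mathlib

open MeasureTheory ProbabilityTheory Filter Topology Asymptotics
open scoped ENNReal NNReal

namespace SVB

noncomputable section

/-! ### Measures, samples and signed integrals -/

/-- The empirical distribution of the points `y 0, …, y (n - 1)`. -/
def emp {α : Type*} [MeasurableSpace α] {n : ℕ} (y : Fin n → α) : Measure α :=
  (n : ℝ≥0∞)⁻¹ • ∑ j, Measure.dirac (y j)

/-- The convex hull of a distribution `F` and of all Dirac measures on the support of `F`. -/
def hull {α : Type*} [TopologicalSpace α] [MeasurableSpace α] (F : Measure α) :
    Set (Measure α) :=
  {P | ∃ (l : ℕ) (a : ℝ≥0) (b : Fin l → ℝ≥0) (x : Fin l → α),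
    (∀ k, x k ∈ F.support) ∧ a + ∑ k, b k = 1 ∧
      P = a • F + ∑ k, b k • Measure.dirac (x k)}

/-- The integral of `f` with respect to the signed measure `Q - P`. -/
def sint {α : Type*} [MeasurableSpace α] (Q P : Measure α) (f : α → ℝ) : ℝ :=
  ∫ x, f x ∂Q - ∫ x, f x ∂P

section Taylor

variable {ι : Type*} [Fintype ι] {𝒳 : ι → Type*} [∀ i, MeasurableSpace (𝒳 i)]

/-- The perturbed distributions `(1 - w i) P i + w i Q i`. -/
def mix (w : ι → ℝ) (P Q : ∀ i, Measure (𝒳 i)) : ∀ i, Measure (𝒳 i) := fun i =>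
  ENNReal.ofReal (1 - w i) • P i + ENNReal.ofReal (w i) • Q i

/-- First order Taylor term in the direction `Q - P`, with weights `w`. -/
def taylor1 (w : ι → ℝ) (Q P : ∀ i, Measure (𝒳 i)) (f : ∀ i, 𝒳 i → ℝ) : ℝ :=
  ∑ i, w i * sint (Q i) (P i) (f i)

/-- Second order Taylor term (the integral with respect to the product of two signed measures
is written as an iterated integral). -/
def taylor2 (w : ι → ℝ) (Q P : ∀ i, Measure (𝒳 i)) (f : ∀ i j, 𝒳 i → 𝒳 j → ℝ) : ℝ :=
  (1 / 2) * ∑ i, ∑ j, w i * w j *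
    sint (Q i) (P i) fun x => sint (Q j) (P j) fun y => f i j x y

/-- Third order Taylor term. -/
def taylor3 (w : ι → ℝ) (Q P : ∀ i, Measure (𝒳 i))
    (f : ∀ i j k, 𝒳 i → 𝒳 j → 𝒳 k → ℝ) : ℝ :=
  (1 / 6) * ∑ i, ∑ j, ∑ k, w i * w j * w k *
    sint (Q i) (P i) fun x => sint (Q j) (P j) fun y => sint (Q k) (P k) fun z => f i j k x y z

variable (ψ : (∀ i, Measure (𝒳 i)) → ℝ)
  (g₁ : (∀ i, Measure (𝒳 i)) → ∀ i, 𝒳 i → ℝ)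
  (g₂ : (∀ i, Measure (𝒳 i)) → ∀ i j, 𝒳 i → 𝒳 j → ℝ)
  (g₃ : (∀ i, Measure (𝒳 i)) → ∀ i j k, 𝒳 i → 𝒳 j → 𝒳 k → ℝ)

/-- Remainder of the linear expansion of `ψ Q` around `P`. -/
def remainder1 (Q P : ∀ i, Measure (𝒳 i)) : ℝ :=
  ψ Q - ψ P - taylor1 (fun _ => 1) Q P (g₁ P)

/-- Remainder of the cubic expansion of `ψ Q` around `P`. -/
def remainder3 (Q P : ∀ i, Measure (𝒳 i)) : ℝ :=
  ψ Q - ψ P - taylor1 (fun _ => 1) Q P (g₁ P) - taylor2 (fun _ => 1) Q P (g₂ P)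
    - taylor3 (fun _ => 1) Q P (g₃ P)

/-- Third order Gateaux differentiability of `ψ` on the product of the hulls, with influence
functions `g₁`, `g₂`, `g₃`: these are integrable, symmetric and centred, and give the
third order Taylor expansion along every segment. -/
structure ThirdOrderDifferentiable [∀ i, TopologicalSpace (𝒳 i)]
    (F : ∀ i, Measure (𝒳 i)) : Prop where
  integrable₁ : ∀ P Q : ∀ i, Measure (𝒳 i), (∀ i, P i ∈ hull (F i)) → (∀ i, Q i ∈ hull (F i)) →
    ∀ i, Integrable (g₁ P i) (Q i)
  integrable₂ : ∀ P : ∀ i, Measure (𝒳 i), (∀ i, P i ∈ hull (F i)) → ∀ i j,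
    ∀ A ∈ hull (F i), ∀ B ∈ hull (F j),
      Integrable (fun p : 𝒳 i × 𝒳 j => g₂ P i j p.1 p.2) (A.prod B)
  integrable₃ : ∀ P : ∀ i, Measure (𝒳 i), (∀ i, P i ∈ hull (F i)) → ∀ i j k,
    ∀ A ∈ hull (F i), ∀ B ∈ hull (F j), ∀ C ∈ hull (F k),
      Integrable (fun p : 𝒳 i × 𝒳 j × 𝒳 k => g₃ P i j k p.1 p.2.1 p.2.2) (A.prod (B.prod C))
  symm₂ : ∀ P : ∀ i, Measure (𝒳 i), (∀ i, P i ∈ hull (F i)) → ∀ i j,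
    ∀ x ∈ (F i).support, ∀ y ∈ (F j).support, g₂ P i j x y = g₂ P j i y x
  symm₃ : ∀ P : ∀ i, Measure (𝒳 i), (∀ i, P i ∈ hull (F i)) → ∀ i j k,
    ∀ x ∈ (F i).support, ∀ y ∈ (F j).support, ∀ z ∈ (F k).support,
      g₃ P i j k x y z = g₃ P j i k y x z ∧ g₃ P i j k x y z = g₃ P i k j x z y
  centred₁ : ∀ P : ∀ i, Measure (𝒳 i), (∀ i, P i ∈ hull (F i)) → ∀ i,
    ∫ x, g₁ P i x ∂(P i) = 0
  centred₂ : ∀ P : ∀ i, Measure (𝒳 i), (∀ i, P i ∈ hull (F i)) → ∀ i j,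
    ∀ x ∈ (F i).support, ∫ y, g₂ P i j x y ∂(P j) = 0
  centred₃ : ∀ P : ∀ i, Measure (𝒳 i), (∀ i, P i ∈ hull (F i)) → ∀ i j k,
    ∀ x ∈ (F i).support, ∀ y ∈ (F j).support, ∫ z, g₃ P i j k x y z ∂(P k) = 0
  expansion : ∀ P Q : ∀ i, Measure (𝒳 i), (∀ i, P i ∈ hull (F i)) → (∀ i, Q i ∈ hull (F i)) →
    (fun w : ι → ℝ => ψ (mix w P Q) - ψ P
        - (taylor1 w Q P (g₁ P) + taylor2 w Q P (g₂ P) + taylor3 w Q P (g₃ P)))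
      =o[𝓝[Set.Icc 0 1] 0] (fun w : ι → ℝ => (∑ i, w i ^ 2) ^ (3 / 2 : ℝ))

end Taylor

/-! ### Stochastic orders -/

/-- `A k = o_p (b k)` under the laws `μ k`. -/
def IsLittleOp {Ω : ℕ → Type*} [∀ k, MeasurableSpace (Ω k)] (μ : ∀ k, Measure (Ω k))
    (A : ∀ k, Ω k → ℝ) (b : ℕ → ℝ) : Prop :=
  ∀ ε : ℝ, 0 < ε → Tendsto (fun k => μ k {ω | ε * |b k| < |A k ω|}) atTop (𝓝 0)

/-- `A k = O_p (1)` under the law `μ`, for `[0, ∞]`-valued `A k`. -/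
def IsBigOpOne {Ω : Type*} [MeasurableSpace Ω] (μ : Measure Ω) (A : ℕ → Ω → ℝ≥0∞) : Prop :=
  ∀ ε : ℝ≥0∞, 0 < ε → ∃ M : ℝ≥0∞, M ≠ ∞ ∧ ∀ᶠ k in atTop, μ {ω | M < A k ω} < ε

/-! ### Data, subsamples and the Monte Carlo algorithm -/

section Sampling

variable {ι : Type*} [Fintype ι] {𝒳 : ι → Type*} [∀ i, MeasurableSpace (𝒳 i)]

/-- The input data: `x i j` is the `(j + 1)`-st observation from input model `i`. -/
abbrev Data (𝒳 : ι → Type*) := ∀ i, ℕ → 𝒳 i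

/-- The law of the data: all observations are independent, those from model `i` have law `F i`. -/
def dataLaw (F : ∀ i, Measure (𝒳 i)) [∀ i, IsProbabilityMeasure (F i)] : Measure (Data 𝒳) :=
  Measure.pi fun i => Measure.infinitePi fun _ : ℕ => F i

/-- Choices of `s i` out of `n i` data indices, with replacement. -/
abbrev Idx (n s : ι → ℕ) := ∀ i, Fin (s i) → Fin (n i)

/-- The empirical input distributions of the first `n i` observations. -/
def empData (n : ι → ℕ) (x : Data 𝒳) : ∀ i, Measure (𝒳 i) := fun i =>
  emp fun j : Fin (n i) => x i j

/-- The resampled input distributions for the index choice `J`. -/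
def resample {n s : ι → ℕ} (x : Data 𝒳) (J : Idx n s) : ∀ i, Measure (𝒳 i) := fun i =>
  emp fun l : Fin (s i) => x i (J i l)

/-- Input distributions which are resampled for the models `i` with `c i = true` and are the
empirical ones for the other models. -/
def mixed {n s : ι → ℕ} (c : ι → Bool) (x : Data 𝒳) (J : Idx n s) : ∀ i, Measure (𝒳 i) :=
  fun i => if c i then resample x J i else empData n x i

variable [DecidableEq ι]

/-- Expectation over a uniform resample, given the data. -/
def bootMean {n s : ι → ℕ} (f : Idx n s → ℝ) : ℝ :=
  (∑ J, f J) / (Fintype.card (Idx n s) : ℝ)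

/-- Expectation over a uniform resample, given the data, of a `[0, ∞]`-valued quantity. -/
def bootMeanENN {n s : ι → ℕ} (f : Idx n s → ℝ≥0∞) : ℝ≥0∞ :=
  (∑ J, f J) / (Fintype.card (Idx n s) : ℝ≥0∞)

/-- The randomness of a whole experiment: the data, the `B` resamples, and a seed for each of the
`B * R` simulation runs. -/
abbrev Experiment (𝒳 : ι → Type*) (𝒰 : Type*) (n s : ι → ℕ) (B R : ℕ) :=
  Data 𝒳 × (Fin B → Idx n s) × (Fin B → Fin R → 𝒰)

/-- The law of a whole experiment: data, resamples (uniform with replacement) and seeds (of law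
`ρ`) are all independent. -/
def experimentLaw {𝒰 : Type*} [MeasurableSpace 𝒰] (F : ∀ i, Measure (𝒳 i))
    [∀ i, IsProbabilityMeasure (F i)] (ρ : Measure 𝒰) [IsProbabilityMeasure ρ]
    (n s : ι → ℕ) (B R : ℕ) : Measure (Experiment 𝒳 𝒰 n s B R) :=
  (dataLaw F).prod
    ((Measure.pi fun _ : Fin B => uniformOn (Set.univ : Set (Idx n s))).prod
      (Measure.pi fun _ : Fin B => Measure.pi fun _ : Fin R => ρ))

end Sampling

/-- Given `B` groups of `R` simulation outputs `y b r`, the rescaled ANOVA estimate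
`θ * ((B - 1)⁻¹ ∑ b, (ȳ b - ȳ)² - V / R)` of the between-group variance. -/
def anovaEstimate (θ : ℝ) {B R : ℕ} (y : Fin B → Fin R → ℝ) : ℝ :=
  let ybar : Fin B → ℝ := fun b => (∑ r, y b r) / R
  let ybarbar : ℝ := (∑ b, ybar b) / B
  let V : ℝ := (∑ b, ∑ r, (y b r - ybar b) ^ 2) / ((B : ℝ) * ((R : ℝ) - 1))
  θ * ((∑ b, (ybar b - ybarbar) ^ 2) / ((B : ℝ) - 1) - V / R)

section Problem

variable {ι : Type*} [Fintype ι] {𝒳 : ι → Type*} [∀ i, MeasurableSpace (𝒳 i)]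

/-- The average size `(1 / m) ∑ i, n i`. -/
def avg (n : ι → ℕ) : ℝ := (∑ i, (n i : ℝ)) / (Fintype.card ι : ℝ)

/-- The subsample sizes `⌊θ n i⌋`. -/
def subSize (θ : ℝ) (n : ι → ℕ) : ι → ℕ := fun i => ⌊θ * (n i : ℝ)⌋₊

/-- The Monte Carlo estimate produced by the proportionate subsampled variance bootstrap, where
`H P u` is the output of one simulation run with input distributions `P` and seed `u`. -/
def svbEstimate {𝒰 : Type*} (H : (∀ i, Measure (𝒳 i)) → 𝒰 → ℝ) (θ : ℝ) {n s : ι → ℕ} {B R : ℕ}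
    (ω : Experiment 𝒳 𝒰 n s B R) : ℝ :=
  anovaEstimate θ fun b r => H (resample ω.1 (ω.2.1 b)) (ω.2.2 b r)

/-- The input variance `Var[ψ(F̂₁, …, F̂ₘ)]`. -/
def inputVariance (F : ∀ i, Measure (𝒳 i)) [∀ i, IsProbabilityMeasure (F i)]
    (ψ : (∀ i, Measure (𝒳 i)) → ℝ) (n : ι → ℕ) : ℝ :=
  variance (fun x : Data 𝒳 => ψ (empData n x)) (dataLaw F)

/-- The variance of one simulation run with input distributions `P`. -/
def simVar {𝒰 : Type*} [MeasurableSpace 𝒰] (ρ : Measure 𝒰) (ψ : (∀ i, Measure (𝒳 i)) → ℝ)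
    (H : (∀ i, Measure (𝒳 i)) → 𝒰 → ℝ) (P : ∀ i, Measure (𝒳 i)) : ℝ :=
  ∫ u, (H P u - ψ P) ^ 2 ∂ρ

/-- The fourth central moment of one simulation run with input distributions `P`. -/
def simMoment4 {𝒰 : Type*} [MeasurableSpace 𝒰] (ρ : Measure 𝒰)
    (ψ : (∀ i, Measure (𝒳 i)) → ℝ) (H : (∀ i, Measure (𝒳 i)) → 𝒰 → ℝ)
    (P : ∀ i, Measure (𝒳 i)) : ℝ≥0∞ :=
  ∫⁻ u, ‖H P u - ψ P‖ₑ ^ 4 ∂ρ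

/-! ### The constants in the error -/

variable (F : ∀ i, Measure (𝒳 i)) (h₁ : ∀ i, 𝒳 i → ℝ) (h₂ : ∀ i j, 𝒳 i → 𝒳 j → ℝ)
  (h₃ : ∀ i j k, 𝒳 i → 𝒳 j → 𝒳 k → ℝ)

/-- The random vector `(g_i²(X_i), E[g_1(X'_1) g_{1i}(X'_1, X_i)], …, E[g_m(X'_m) g_{mi}(X'_m, X_i)])`
as a function of `X_i`; the first coordinate is the one with index `none`. -/
def zVec (i : ι) (a : Option ι) (x : 𝒳 i) : ℝ :=
  match a with
  | none => h₁ i x ^ 2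
  | some k => ∫ y, h₁ k y * h₂ k i y x ∂(F k)

/-- The covariance matrix `Σ_i` of `zVec`. -/
def SigmaMat (i : ι) : Matrix (Option ι) (Option ι) ℝ :=
  Matrix.of fun a b => covariance (zVec F h₁ h₂ i a) (zVec F h₁ h₂ i b) (F i)

/-- The vector `λ_i = (1 / n_i, 2 / n_1, …, 2 / n_m)`. -/
def lamVec (n : ι → ℕ) (i : ι) : Option ι → ℝ
  | none => 1 / (n i : ℝ)
  | some k => 2 / (n k : ℝ)

/-- The variance `∑ i, λ_iᵀ Σ_i λ_i / n_i`. -/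
def zVariance (n : ι → ℕ) : ℝ :=
  ∑ i, (lamVec n i ⬝ᵥ (SigmaMat F h₁ h₂ i).mulVec (lamVec n i)) / (n i : ℝ)

/-- The bias term `𝓡`. -/
def biasTerm (θ : ℝ) (n s : ι → ℕ) : ℝ :=
  (∑ i, 1 / ((n i : ℝ) * (s i : ℝ)) * covariance (h₁ i) (fun x => h₂ i i x x) (F i))
  + (∑ i, ∑ j, 1 / ((n i : ℝ) * (s j : ℝ)) *
      covariance (h₁ i) (fun x => ∫ y, h₃ i j j x y y ∂(F j)) (F i))
  + (∑ i, Int.fract (θ * (n i : ℝ)) * variance (h₁ i) (F i) / ((n i : ℝ) * (s i : ℝ)))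
  + (∑ i, ∑ j, variance (fun p : 𝒳 i × 𝒳 j => h₂ i j p.1 p.2) ((F i).prod (F j))
      / (2 * (n i : ℝ) * (s j : ℝ)))

end Problem

/-! ### Regularity conditions

`n k i` is the number of data from model `i` and `s k i` the subsample size, at stage `k`. -/

section Conditions

variable {ι : Type*} [Fintype ι] {𝒳 : ι → Type*} [∀ i, MeasurableSpace (𝒳 i)]
  {𝒰 : Type*} [MeasurableSpace 𝒰]
  (F : ∀ i, Measure (𝒳 i)) (ρ : Measure 𝒰)
  (ψ : (∀ i, Measure (𝒳 i)) → ℝ) (H : (∀ i, Measure (𝒳 i)) → 𝒰 → ℝ)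
  (g₁ : (∀ i, Measure (𝒳 i)) → ∀ i, 𝒳 i → ℝ)
  (g₂ : (∀ i, Measure (𝒳 i)) → ∀ i j, 𝒳 i → 𝒳 j → ℝ)
  (g₃ : (∀ i, Measure (𝒳 i)) → ∀ i j k, 𝒳 i → 𝒳 j → 𝒳 k → ℝ)
  (n s : ℕ → ι → ℕ)

/-- Measurability: at the true input models in the arguments of the influence functions, and at
empirical distributions jointly in the sample points and the other arguments. -/
structure MeasurableModel : Prop where
  g₁_true : ∀ i, Measurable (g₁ F i)
  g₂_true : ∀ i j, Measurable fun p : 𝒳 i × 𝒳 j => g₂ F i j p.1 p.2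
  g₃_true : ∀ i j k, Measurable fun p : 𝒳 i × 𝒳 j × 𝒳 k => g₃ F i j k p.1 p.2.1 p.2.2
  ψ_emp : ∀ p : ι → ℕ, Measurable fun y : ∀ i, Fin (p i) → 𝒳 i => ψ fun i => emp (y i)
  H_emp : ∀ p : ι → ℕ, Measurable fun q : (∀ i, Fin (p i) → 𝒳 i) × 𝒰 =>
    H (fun i => emp (q.1 i)) q.2
  g₁_emp : ∀ (p : ι → ℕ) (i : ι), Measurable fun q : (∀ i, Fin (p i) → 𝒳 i) × 𝒳 i =>
    g₁ (fun i => emp (q.1 i)) i q.2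
  g₂_emp : ∀ (p : ι → ℕ) (i j : ι), Measurable fun q : (∀ i, Fin (p i) → 𝒳 i) × 𝒳 i × 𝒳 j =>
    g₂ (fun i => emp (q.1 i)) i j q.2.1 q.2.2
  g₃_emp : ∀ (p : ι → ℕ) (i j k : ι),
    Measurable fun q : (∀ i, Fin (p i) → 𝒳 i) × 𝒳 i × 𝒳 j × 𝒳 k =>
      g₃ (fun i => emp (q.1 i)) i j k q.2.1 q.2.2.1 q.2.2.2

/-- A simulation run is an unbiased replication of `ψ`. -/
def UnbiasedSimulation [∀ i, TopologicalSpace (𝒳 i)] : Prop :=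
  ∀ P : ∀ i, Measure (𝒳 i), (∀ i, P i ∈ hull (F i)) →
    Integrable (H P) ρ ∧ ∫ u, H P u ∂ρ = ψ P

/-- Balanced data: all sizes grow, at comparable rates. -/
def BalancedData : Prop :=
  (∀ i, Tendsto (fun k => n k i) atTop atTop) ∧
    ∃ c : ℝ, 0 < c ∧ ∀ᶠ k in atTop, ∀ i j, (n k i : ℝ) ≤ c * (n k j : ℝ)

/-- Smoothness at the true input models. -/
structure SmoothAtTruth [∀ i, IsProbabilityMeasure (F i)] : Prop where
  remainder : Tendsto (fun k => ENNReal.ofReal (avg (n k)) *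
      ∫⁻ x, ‖remainder1 ψ g₁ (empData (n k) x) F‖ₑ ^ 2 ∂(dataLaw F)) atTop (𝓝 0)
  moment : ∀ i, MemLp (g₁ F i) 4 (F i)
  nondegenerate : ∀ i, 0 < variance (g₁ F i) (F i)

/-- Third order smoothness at the true input models. -/
structure ThirdSmoothAtTruth [∀ i, IsProbabilityMeasure (F i)] : Prop where
  remainder : Tendsto (fun k => ENNReal.ofReal (avg (n k)) ^ 3 *
      ∫⁻ x, ‖remainder3 ψ g₁ g₂ g₃ (empData (n k) x) F‖ₑ ^ 2 ∂(dataLaw F)) atTop (𝓝 0)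
  moment₂ : ∀ i₁ i₂, ∀ j₂ < 2,
    MemLp (fun x : Data 𝒳 => g₂ F i₁ i₂ (x i₁ 0) (x i₂ j₂)) 4 (dataLaw F)
  moment₃ : ∀ i₁ i₂ i₃, ∀ j₂ < 2, ∀ j₃ < 3,
    MemLp (fun x : Data 𝒳 => g₃ F i₁ i₂ i₃ (x i₁ 0) (x i₂ j₂) (x i₃ j₃)) 2 (dataLaw F)

/-- Smoothness at the empirical input models. -/
structure SmoothAtEmpirical [DecidableEq ι] [∀ i, IsProbabilityMeasure (F i)] : Prop where
  influence : ∀ i, Tendsto (fun k =>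
    ∫⁻ x, ‖g₁ (empData (n k) x) i (x i 0) - g₁ F i (x i 0)‖ₑ ^ 4 ∂(dataLaw F)) atTop (𝓝 0)
  remainder : ∀ c : ι → Bool, IsLittleOp (fun _ => dataLaw F)
    (fun k x => bootMean fun J : Idx (n k) (s k) =>
      remainder1 ψ g₁ (mixed c x J) (empData (n k) x) ^ 4)
    (fun k => (avg (s k) ^ 2)⁻¹)

/-- Third order smoothness at the empirical input models. -/
structure ThirdSmoothAtEmpirical [DecidableEq ι] [∀ i, IsProbabilityMeasure (F i)] : Prop where
  remainder : IsLittleOp (fun _ => dataLaw F)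
    (fun k x => bootMean fun J : Idx (n k) (s k) =>
      remainder3 ψ g₁ g₂ g₃ (resample x J) (empData (n k) x) ^ 2)
    (fun k => (avg (s k) ^ 3)⁻¹)
  influence₂ : ∀ i₁ i₂, ∀ j₂ < 2, Tendsto (fun k =>
    ∫⁻ x : Data 𝒳, ‖g₂ (empData (n k) x) i₁ i₂ (x i₁ 0) (x i₂ j₂)
      - g₂ F i₁ i₂ (x i₁ 0) (x i₂ j₂)‖ₑ ^ 2 ∂(dataLaw F)) atTop (𝓝 0)
  influence₃ : ∀ i₁ i₂ i₃, ∀ j₂ < 2, ∀ j₃ < 3, Tendsto (fun k =>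
    ∫⁻ x : Data 𝒳, ‖g₃ (empData (n k) x) i₁ i₂ i₃ (x i₁ 0) (x i₂ j₂) (x i₃ j₃)
      - g₃ F i₁ i₂ i₃ (x i₁ 0) (x i₂ j₂) (x i₃ j₃)‖ₑ ^ 2 ∂(dataLaw F)) atTop (𝓝 0)
  influence₁ : ∀ i, Tendsto (fun k => ENNReal.ofReal (avg (n k)) *
    ∫⁻ x : Data 𝒳, ‖g₁ (empData (n k) x) i (x i 0) - (g₁ F i (x i 0)
      + ∑ j, sint (empData (n k) x j) (F j) (fun y => g₂ F i j (x i 0) y)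
      - sint (empData (n k) x i) (F i) (g₁ F i))‖ₑ ^ 2 ∂(dataLaw F)) atTop (𝓝 0)

/-- Convergence of the empirical simulation variance (to a finite limit). -/
def ConvEmpiricalVariance [∀ i, IsProbabilityMeasure (F i)] : Prop :=
  MemLp (H F) 2 ρ ∧ IsLittleOp (fun _ => dataLaw F)
    (fun k x => simVar ρ ψ H (empData (n k) x) - simVar ρ ψ H F) (fun _ => 1)

/-- Convergence of the bootstrapped simulation variance. -/
def ConvBootstrapVariance [DecidableEq ι] [∀ i, IsProbabilityMeasure (F i)] : Prop :=
  ∀ c : ι → Bool, IsLittleOp (fun _ => dataLaw F)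
    (fun k x => bootMean fun J : Idx (n k) (s k) =>
      (simVar ρ ψ H (mixed c x J) - simVar ρ ψ H (empData (n k) x)) ^ 2) (fun _ => 1)

/-- Boundedness of the fourth moment of the simulation runs. -/
def BoundedFourthMoment [DecidableEq ι] [∀ i, IsProbabilityMeasure (F i)] : Prop :=
  ∀ c : ι → Bool, IsBigOpOne (dataLaw F)
    (fun k x => bootMeanENN fun J : Idx (n k) (s k) => simMoment4 ρ ψ H (mixed c x J))

end Conditions

end

end SVB

namespace SVB

set_option linter.unusedSectionVars false

noncomputable section

open Finset (sum_congr mul_sum sum_le_sum sum_nonneg measurable_fun_sum mem_univ card_univ sum_const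
  sum_sub_distrib single_le_sum sum_add_distrib sum_comm sum_div sum_mul abs_sum_le_sum_abs)
open Fintype (card card_fin sum_sigma)
open Filter.Eventually (of_forall)

/-! ### Calculus of stochastic orders on a fixed probability space -/

section StochasticOrder

variable {Ω : Type*} [MeasurableSpace Ω] {μ : Measure Ω}

/-- `A k → 0` in probability. -/
def OP (μ : Measure Ω) (A : ℕ → Ω → ℝ) : Prop :=
  ∀ ε : ℝ, 0 < ε → Tendsto (fun k => μ {ω | ε < |A k ω|}) atTop (𝓝 0)

/-- `A k` is bounded in probability. -/
def BP (μ : Measure Ω) (A : ℕ → Ω → ℝ) : Prop :=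
  ∀ ε : ℝ≥0∞, 0 < ε → ∃ M : ℝ, 0 < M ∧ ∀ᶠ k in atTop, μ {ω | M < |A k ω|} ≤ ε

theorem tendsto_measure_zero_of_le {s t : ℕ → Set Ω} (h : ∀ᶠ k in atTop, s k ≤ᵐ[μ] t k)
    (ht : Tendsto (fun k => μ (t k)) atTop (𝓝 0)) : Tendsto (fun k => μ (s k)) atTop (𝓝 0) :=
  tendsto_of_tendsto_of_tendsto_of_le_of_le' tendsto_const_nhds ht
    (of_forall fun _ => zero_le) (h.mono fun _ hk => measure_mono_ae hk)

theorem OP.mono {A B : ℕ → Ω → ℝ} (hB : OP μ B)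
    (h : ∀ᶠ k in atTop, ∀ᵐ ω ∂μ, |A k ω| ≤ |B k ω|) : OP μ A := fun ε hε =>
  tendsto_measure_zero_of_le
    (h.mono fun _ hk => hk.mono fun _ hω (h' : ε < _) => lt_of_lt_of_le h' hω) (hB ε hε)

theorem OP.congr {A B : ℕ → Ω → ℝ} (hB : OP μ B)
    (h : ∀ᶠ k in atTop, ∀ᵐ ω ∂μ, A k ω = B k ω) : OP μ A :=
  hB.mono (h.mono fun _ hk => hk.mono fun _ hω => by rw [hω])

theorem BP.mono {A B : ℕ → Ω → ℝ} (hB : BP μ B)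
    (h : ∀ᶠ k in atTop, ∀ᵐ ω ∂μ, |A k ω| ≤ |B k ω|) : BP μ A := fun ε hε => by
  obtain ⟨M, hM, h'⟩ := hB ε hε
  refine ⟨M, hM, ?_⟩
  filter_upwards [h, h'] with k h1 h2
  exact (measure_mono_ae (h1.mono fun _ hω (h' : M < _) => lt_of_lt_of_le h' hω)).trans h2

theorem BP.congr {A B : ℕ → Ω → ℝ} (hB : BP μ B)
    (h : ∀ᶠ k in atTop, ∀ᵐ ω ∂μ, A k ω = B k ω) : BP μ A :=
  hB.mono (h.mono fun _ hk => hk.mono fun _ hω => by rw [hω])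

theorem OP.add {A B : ℕ → Ω → ℝ} (hA : OP μ A) (hB : OP μ B) :
    OP μ (fun k ω => A k ω + B k ω) := fun ε hε => by
  have h := (hA (ε / 2) (by positivity)).add (hB (ε / 2) (by positivity))
  rw [add_zero] at h
  refine tendsto_of_tendsto_of_tendsto_of_le_of_le tendsto_const_nhds h (fun _ => zero_le)
    fun k => (measure_mono ?_).trans (measure_union_le _ _)
  intro ω (hω : ε < _)
  by_contra hc
  simp only [Set.mem_union, Set.mem_ofPred_eq, not_or, not_lt] at hc
  have := abs_add_le (A k ω) (B k ω)
  linarith [hc.1, hc.2]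

theorem BP.add {A B : ℕ → Ω → ℝ} (hA : BP μ A) (hB : BP μ B) :
    BP μ (fun k ω => A k ω + B k ω) := fun ε hε => by
  obtain ⟨M, hM, h1⟩ := hA (ε / 2) (ENNReal.half_pos hε.ne')
  obtain ⟨M', hM', h2⟩ := hB (ε / 2) (ENNReal.half_pos hε.ne')
  refine ⟨M + M', by positivity, ?_⟩
  filter_upwards [h1, h2] with k h1 h2
  refine (measure_mono (t := {ω | M < |A k ω|} ∪ {ω | M' < |B k ω|}) ?_).trans
    ((measure_union_le _ _).trans ((add_le_add h1 h2).trans (ENNReal.add_halves ε).le))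
  intro ω hω
  rw [Set.mem_ofPred_eq] at hω
  by_contra hc
  simp only [Set.mem_union, Set.mem_ofPred_eq, not_or, not_lt] at hc
  have := abs_add_le (A k ω) (B k ω)
  linarith [hc.1, hc.2]

theorem OP.mul_bp {A B : ℕ → Ω → ℝ} (hA : OP μ A) (hB : BP μ B) :
    OP μ (fun k ω => A k ω * B k ω) := fun ε hε => by
  rw [ENNReal.tendsto_nhds_zero]
  intro δ hδ
  obtain ⟨M, hM, h2⟩ := hB (δ / 2) (ENNReal.half_pos hδ.ne')
  have h1 := (ENNReal.tendsto_nhds_zero.1 (hA (ε / M) (by positivity))) (δ / 2)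
    (ENNReal.half_pos hδ.ne')
  filter_upwards [h1, h2] with k h1 h2
  refine (measure_mono (t := {ω | ε / M < |A k ω|} ∪ {ω | M < |B k ω|}) ?_).trans
    ((measure_union_le _ _).trans ((add_le_add h1 h2).trans (ENNReal.add_halves δ).le))
  intro ω hω
  rw [Set.mem_ofPred_eq] at hω
  by_contra hc
  simp only [Set.mem_union, Set.mem_ofPred_eq, not_or, not_lt] at hc
  have h3 : |A k ω * B k ω| ≤ ε / M * M := by
    rw [abs_mul]
    exact mul_le_mul hc.1 hc.2 (abs_nonneg _) (by positivity)
  rw [div_mul_cancel₀ _ hM.ne'] at h3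
  linarith

theorem BP.mul {A B : ℕ → Ω → ℝ} (hA : BP μ A) (hB : BP μ B) :
    BP μ (fun k ω => A k ω * B k ω) := fun ε hε => by
  obtain ⟨M, hM, h1⟩ := hA (ε / 2) (ENNReal.half_pos hε.ne')
  obtain ⟨M', hM', h2⟩ := hB (ε / 2) (ENNReal.half_pos hε.ne')
  refine ⟨M * M', by positivity, ?_⟩
  filter_upwards [h1, h2] with k h1 h2
  refine (measure_mono (t := {ω | M < |A k ω|} ∪ {ω | M' < |B k ω|}) ?_).trans
    ((measure_union_le _ _).trans ((add_le_add h1 h2).trans (ENNReal.add_halves ε).le))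
  intro ω hω
  rw [Set.mem_ofPred_eq] at hω
  by_contra hc
  simp only [Set.mem_union, Set.mem_ofPred_eq, not_or, not_lt] at hc
  have h3 : |A k ω * B k ω| ≤ M * M' := by
    rw [abs_mul]
    exact mul_le_mul hc.1 hc.2 (abs_nonneg _) (by positivity)
  linarith

theorem BP.of_le (A : ℕ → Ω → ℝ) {M : ℝ} (h : ∀ᶠ k in atTop, ∀ᵐ ω ∂μ, |A k ω| ≤ M) :
    BP μ A := fun ε _ => by
  refine ⟨|M| + 1, by positivity, ?_⟩
  filter_upwards [h] with k h
  have : μ {ω | |M| + 1 < |A k ω|} = 0 := by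
    rw [measure_eq_zero_iff_ae_notMem]
    filter_upwards [h] with ω hω (h' : _ < _)
    linarith [le_abs_self M]
  rw [this]; exact zero_le

theorem BP.const (c : ℝ) : BP μ (fun _ _ => c) :=
  BP.of_le _ (M := |c|) (by simp)

theorem BP.of_bdd {c : ℕ → ℝ} (h : c =O[atTop] fun _ => (1 : ℝ)) : BP μ (fun k _ => c k) := by
  obtain ⟨C, hC⟩ := h.bound
  refine BP.of_le _ (M := C) (hC.mono fun k hk => of_forall fun ω => ?_)
  simpa using hk

theorem OP.of_tendsto {c : ℕ → ℝ} (h : Tendsto c atTop (𝓝 0)) : OP μ (fun k _ => c k) :=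
  fun ε hε => by
    have h1 : ∀ᶠ k in atTop, |c k| < ε := by
      have := (tendsto_zero_iff_abs_tendsto_zero _).1 h
      exact (tendsto_order.1 this).2 _ hε
    refine tendsto_const_nhds.congr' (h1.mono fun k hk => ?_)
    have : {ω : Ω | ε < |c k|} = ∅ := by ext; simp [hk.le]
    simp [this]

theorem OP.zero : OP μ (fun _ _ => 0) := OP.of_tendsto tendsto_const_nhds

theorem OP.bp {A : ℕ → Ω → ℝ} (hA : OP μ A) : BP μ A := fun ε hε =>
  ⟨1, one_pos, ENNReal.tendsto_nhds_zero.1 (hA 1 one_pos) ε hε⟩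

theorem BP.mul_op {A B : ℕ → Ω → ℝ} (hA : BP μ A) (hB : OP μ B) :
    OP μ (fun k ω => A k ω * B k ω) := by
  simpa only [mul_comm] using hB.mul_bp hA

theorem OP.bdd_mul {A : ℕ → Ω → ℝ} {c : ℕ → ℝ} (hA : OP μ A)
    (h : c =O[atTop] fun _ => (1 : ℝ)) : OP μ (fun k ω => c k * A k ω) :=
  (BP.of_bdd h).mul_op hA

theorem BP.small_mul {A : ℕ → Ω → ℝ} {c : ℕ → ℝ} (hA : BP μ A)
    (h : Tendsto c atTop (𝓝 0)) : OP μ (fun k ω => c k * A k ω) :=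
  (OP.of_tendsto h).mul_bp hA

theorem OP.const_mul {A : ℕ → Ω → ℝ} (c : ℝ) (hA : OP μ A) : OP μ (fun k ω => c * A k ω) :=
  (BP.const c).mul_op hA

theorem BP.const_mul {A : ℕ → Ω → ℝ} (c : ℝ) (hA : BP μ A) : BP μ (fun k ω => c * A k ω) :=
  (BP.const c).mul hA

theorem OP.neg {A : ℕ → Ω → ℝ} (hA : OP μ A) : OP μ (fun k ω => -A k ω) :=
  hA.mono (by simp)

theorem OP.sub {A B : ℕ → Ω → ℝ} (hA : OP μ A) (hB : OP μ B) :
    OP μ (fun k ω => A k ω - B k ω) := by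
  simpa only [sub_eq_add_neg] using hA.add hB.neg

theorem BP.neg {A : ℕ → Ω → ℝ} (hA : BP μ A) : BP μ (fun k ω => -A k ω) :=
  hA.mono (by simp)

theorem BP.sub {A B : ℕ → Ω → ℝ} (hA : BP μ A) (hB : BP μ B) :
    BP μ (fun k ω => A k ω - B k ω) := by
  simpa only [sub_eq_add_neg] using hA.add hB.neg

theorem OP.sum {κ : Type*} {A : κ → ℕ → Ω → ℝ} (s : Finset κ) (h : ∀ i ∈ s, OP μ (A i)) :
    OP μ (fun k ω => ∑ i ∈ s, A i k ω) := by
  classical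
  induction s using Finset.induction_on with
  | empty => simpa using OP.zero
  | insert a s ha ih =>
    simp only [Finset.sum_insert ha]
    exact (h a (by simp)).add (ih fun i hi => h i (by simp [hi]))

theorem BP.sum {κ : Type*} {A : κ → ℕ → Ω → ℝ} (s : Finset κ) (h : ∀ i ∈ s, BP μ (A i)) :
    BP μ (fun k ω => ∑ i ∈ s, A i k ω) := by
  classical
  induction s using Finset.induction_on with
  | empty => simpa using BP.const (μ := μ) 0
  | insert a s ha ih =>
    simp only [Finset.sum_insert ha]
    exact (h a (by simp)).add (ih fun i hi => h i (by simp [hi]))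

theorem OP.abs {A : ℕ → Ω → ℝ} (hA : OP μ A) : OP μ (fun k ω => |A k ω|) :=
  hA.mono (by simp)

theorem BP.abs {A : ℕ → Ω → ℝ} (hA : BP μ A) : BP μ (fun k ω => |A k ω|) :=
  hA.mono (by simp)

theorem OP.sqrt {A : ℕ → Ω → ℝ} (hA : OP μ A) : OP μ (fun k ω => √(A k ω)) := fun ε hε => by
  refine tendsto_measure_zero_of_le (of_forall fun k => of_forall ?_)
    (hA (ε ^ 2) (by positivity))
  intro ω (hω : ε < |√(A k ω)|)
  rw [abs_of_nonneg (Real.sqrt_nonneg _)] at hω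
  exact lt_of_lt_of_le ((Real.lt_sqrt hε.le).1 hω) (le_abs_self _)

theorem BP.sqrt {A : ℕ → Ω → ℝ} (hA : BP μ A) : BP μ (fun k ω => √(A k ω)) := by
  refine ((BP.const 1).add hA.abs).mono (of_forall fun k => of_forall ?_)
  intro ω
  rw [abs_of_nonneg (Real.sqrt_nonneg _), abs_of_nonneg (a := 1 + |A k ω|) (by positivity)]
  rcases le_total (A k ω) 0 with h | h
  · rw [Real.sqrt_eq_zero_of_nonpos h]; positivity
  · rw [abs_of_nonneg h, Real.sqrt_le_left (by linarith)]
    nlinarith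

theorem OP.of_sq {A : ℕ → Ω → ℝ} (hA : OP μ (fun k ω => A k ω ^ 2)) : OP μ A :=
  hA.sqrt.mono (of_forall fun k => of_forall fun ω => by
    simp [Real.sqrt_sq_eq_abs])

theorem BP.of_sq {A : ℕ → Ω → ℝ} (hA : BP μ (fun k ω => A k ω ^ 2)) : BP μ A :=
  hA.sqrt.mono (of_forall fun k => of_forall fun ω => by
    simp [Real.sqrt_sq_eq_abs])

/-- Convergence in mean implies convergence in probability. -/
theorem OP.of_lintegral {A : ℕ → Ω → ℝ} (hm : ∀ k, AEMeasurable (A k) μ)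
    (h : Tendsto (fun k => ∫⁻ ω, ‖A k ω‖ₑ ∂μ) atTop (𝓝 0)) : OP μ A := fun ε hε => by
  have h1 : Tendsto (fun k => (∫⁻ ω, ‖A k ω‖ₑ ∂μ) / ENNReal.ofReal ε) atTop (𝓝 0) := by
    have := ENNReal.Tendsto.div_const h (b := ENNReal.ofReal ε) (Or.inr (by simpa using hε))
    simpa using this
  refine tendsto_of_tendsto_of_tendsto_of_le_of_le tendsto_const_nhds h1 (fun _ => zero_le)
    fun k => (measure_mono ?_).trans (meas_ge_le_lintegral_div (hm k).enorm (by simpa using hε)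
      ENNReal.ofReal_ne_top)
  intro ω (hω : ε < _)
  simp only [Set.mem_ofPred_eq, Real.enorm_eq_ofReal_abs]
  exact ENNReal.ofReal_le_ofReal hω.le

/-- Boundedness in mean implies boundedness in probability. -/
theorem BP.of_lintegral {A : ℕ → Ω → ℝ} (hm : ∀ k, AEMeasurable (A k) μ) {C : ℝ≥0∞} (hC : C ≠ ∞)
    (h : ∀ᶠ k in atTop, ∫⁻ ω, ‖A k ω‖ₑ ∂μ ≤ C) : BP μ A := fun ε hε => by
  by_cases hε' : ε = ∞
  · exact ⟨1, one_pos, of_forall fun k => by simp [hε']⟩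
  have hM : 0 < (C / ε).toReal + 1 := by positivity
  refine ⟨(C / ε).toReal + 1, hM, ?_⟩
  filter_upwards [h] with k hk
  have hne : C / ε ≠ ∞ := ENNReal.div_ne_top hC hε.ne'
  have h0 : ENNReal.ofReal ((C / ε).toReal + 1) ≠ 0 := by simpa using hM
  refine (measure_mono (t := {ω | ENNReal.ofReal ((C / ε).toReal + 1) ≤ ‖A k ω‖ₑ}) ?_).trans
    ((meas_ge_le_lintegral_div (hm k).enorm h0 ENNReal.ofReal_ne_top).trans ?_)
  · intro ω hω
    rw [Set.mem_ofPred_eq] at hω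
    simp only [Set.mem_ofPred_eq, Real.enorm_eq_ofReal_abs]
    exact ENNReal.ofReal_le_ofReal hω.le
  · rw [ENNReal.div_le_iff_le_mul (Or.inl h0) (Or.inl ENNReal.ofReal_ne_top)]
    calc _ ≤ C := hk
      _ = ε * (C / ε) := by rw [ENNReal.mul_div_cancel hε.ne' hε']
      _ ≤ _ := by
        gcongr
        rw [ENNReal.ofReal_add (by positivity) zero_le_one, ENNReal.ofReal_toReal hne]
        exact le_self_add

theorem isLittleOp_one_iff {A : ℕ → Ω → ℝ} :
    IsLittleOp (fun _ => μ) A (fun _ => 1) ↔ OP μ A := by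
  simp [IsLittleOp, OP]

theorem IsLittleOp.op {A : ℕ → Ω → ℝ} {b c : ℕ → ℝ} (h : IsLittleOp (fun _ => μ) A b)
    (hbc : (fun k => c k * b k) =O[atTop] fun _ => (1 : ℝ)) :
    OP μ (fun k ω => c k * A k ω) := fun ε hε => by
  obtain ⟨C, hC0, hC⟩ := hbc.exists_pos
  refine tendsto_measure_zero_of_le ?_ (h (ε / C) (by positivity))
  filter_upwards [hC.bound] with k hk
  refine of_forall fun ω (hω : ε < |c k * A k ω|) => ?_
  show ε / C * |b k| < |A k ω|
  rw [norm_mul, norm_one, mul_one, Real.norm_eq_abs, Real.norm_eq_abs] at hk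
  rw [abs_mul] at hω
  by_contra hc
  push Not at hc
  have h1 : |c k| * |A k ω| ≤ |c k| * (ε / C * |b k|) := by gcongr
  have h2 : |c k| * (ε / C * |b k|) = ε / C * (|c k| * |b k|) := by ring
  have h3 : ε / C * (|c k| * |b k|) ≤ ε / C * C := by gcongr
  rw [div_mul_cancel₀ _ hC0.ne'] at h3
  linarith

end StochasticOrder

/-! ### Moments of sums of degenerate kernels of independent coordinates -/

section Combinatorics

variable {I : Type*} [Fintype I] [DecidableEq I]

theorem sum_of_vanish_singletons (e : I → I → I → I → ℝ)
    (h1 : ∀ p q r s, p ≠ q → p ≠ r → p ≠ s → e p q r s = 0)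
    (h2 : ∀ p q r s, q ≠ p → q ≠ r → q ≠ s → e p q r s = 0)
    (h3 : ∀ p q r s, r ≠ p → r ≠ q → r ≠ s → e p q r s = 0)
    (h4 : ∀ p q r s, s ≠ p → s ≠ q → s ≠ r → e p q r s = 0) :
    ∑ p, ∑ q, ∑ r, ∑ s, e p q r s =
      ∑ p, ∑ r, (e p p r r + e p r p r + e p r r p) - 2 * ∑ p, e p p p p := by
  have key : ∀ p q r s, e p q r s =
      (if r = s then (if p = q then e p q r s else 0) else 0)
      + (if q = s then (if p = r then e p q r s else 0) else 0)
      + (if p = s then (if q = r then e p q r s else 0) else 0)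
      - 2 * (if q = s then (if p = r then (if p = q then e p q r s else 0) else 0) else 0) := by
    intro p q r s
    by_cases hpq : p = q
    · subst hpq
      by_cases hpr : p = r
      · subst hpr
        by_cases hps : p = s
        · subst hps; simp; ring
        · rw [h4 p p p s (Ne.symm hps) (Ne.symm hps) (Ne.symm hps)]; simp
      · by_cases hps : p = s
        · subst hps
          rw [h3 p p r p (Ne.symm hpr) (Ne.symm hpr) (Ne.symm hpr)]; simp
        · by_cases hrs : r = s
          · subst hrs; simp [hpr]
          · rw [h3 p p r s (Ne.symm hpr) (Ne.symm hpr) hrs]; simp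
    · by_cases hpr : p = r
      · subst hpr
        by_cases hqs : q = s
        · subst hqs; simp [hpq]
        · rw [h2 p q p s (Ne.symm hpq) (Ne.symm hpq) hqs]; simp
      · by_cases hps : p = s
        · subst hps
          by_cases hqr : q = r
          · subst hqr; simp [Ne.symm hpq]
          · rw [h2 p q r p (Ne.symm hpq) hqr (Ne.symm hpq)]; simp
        · rw [h1 p q r s hpq hpr hps]; simp
  have : ∀ p q r s, e p q r s = _ := key
  rw [mul_sum]
  calc ∑ p, ∑ q, ∑ r, ∑ s, e p q r s = ∑ p, ∑ q, ∑ r, ∑ s, (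
      (if r = s then (if p = q then e p q r s else 0) else 0)
      + (if q = s then (if p = r then e p q r s else 0) else 0)
      + (if p = s then (if q = r then e p q r s else 0) else 0)
      - 2 * (if q = s then (if p = r then (if p = q then e p q r s else 0) else 0) else 0)) := by
        refine sum_congr rfl fun p _ => sum_congr rfl fun q _ =>
          sum_congr rfl fun r _ => sum_congr rfl fun s _ => key p q r s
    _ = _ := by
        simp only [sum_add_distrib, sum_sub_distrib, ← mul_sum,
          Finset.sum_ite_eq, mem_univ, if_true, Finset.sum_ite_irrel, Finset.sum_const_zero]

theorem card_no_singletons_le [Nonempty I] {K : Type*} [Fintype K] [DecidableEq K] {h : ℕ}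
    (hK : card K ≤ 2 * h + 1) :
    (Finset.univ.filter fun w : K → I => ∀ a, ∃ b, b ≠ a ∧ w b = w a).card
      ≤ card I ^ h * h ^ card K := by
  classical
  have hc : card ((Fin h → I) × (K → Fin h)) = card I ^ h * h ^ card K := by
    simp
  rw [← hc, ← card_univ]
  refine (Finset.card_le_card (t := Finset.univ.image
    fun z : (Fin h → I) × (K → Fin h) => fun a => z.1 (z.2 a)) ?_).trans Finset.card_image_le
  intro w hw
  simp only [Finset.mem_filter, mem_univ, true_and] at hw
  have hcard : (Finset.univ.image w).card ≤ h := by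
    have h1 : (Finset.univ.image w).card * 2 ≤ (Finset.univ : Finset K).card := by
      refine Finset.mul_card_image_le_card (s := Finset.univ) (f := w) 2 ?_ |> fun h => by
        simpa [mul_comm] using h
      intro y hy
      obtain ⟨a, -, rfl⟩ := Finset.mem_image.1 hy
      obtain ⟨b, hb, hwb⟩ := hw a
      have : ({a, b} : Finset K) ⊆ Finset.univ.filter fun x => w x = w a := by
        intro x hx
        simp only [Finset.mem_insert, Finset.mem_singleton] at hx
        rcases hx with rfl | rfl <;> simp [hwb]
      calc 2 = ({a, b} : Finset K).card := (Finset.card_pair hb.symm).symm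
        _ ≤ _ := Finset.card_le_card this
    rw [card_univ] at h1
    omega
  simp only [Finset.mem_image, mem_univ, true_and, Prod.exists]
  rcases isEmpty_or_nonempty K with hKe | ⟨⟨a0⟩⟩
  · exact ⟨fun _ => Classical.arbitrary I, fun a => hKe.elim a, funext fun a => hKe.elim a⟩
  · let e := (Finset.univ.image w).equivFin
    have hlt : ∀ y : (Finset.univ.image w : Finset I), (e y : ℕ) < h := fun y =>
      lt_of_lt_of_le (e y).2 hcard
    refine ⟨fun j => if hj : (j : ℕ) < (Finset.univ.image w).card then (e.symm ⟨j, hj⟩ : I)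
      else w a0, fun a => ⟨e ⟨w a, by simp⟩, hlt _⟩, funext fun a => ?_⟩
    simp

/-- No value occurs exactly once among the entries of `t` and `t'`. -/
def NoSingleton (t t' : Fin 3 → I) : Prop :=
  ∀ a, ∃ b, b ≠ a ∧ Sum.elim t t' b = Sum.elim t t' a

instance (t t' : Fin 3 → I) : Decidable (NoSingleton t t') := by
  unfold NoSingleton; infer_instance

theorem NoSingleton.symm {t t' : Fin 3 → I} (h : NoSingleton t t') : NoSingleton t' t := by
  intro a
  obtain ⟨b, hb, h'⟩ := h a.swap
  refine ⟨b.swap, fun h => hb (by rw [← h, Sum.swap_swap]), ?_⟩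
  rcases a with a | a <;> rcases b with b | b <;> simpa using h'

/-- The number of triples `t'` such that no value occurs exactly once in `t` and `t'`. -/
def cubicWeight (t : Fin 3 → I) : ℕ := (Finset.univ.filter fun t' => NoSingleton t t').card

theorem sum_cubicWeight_le :
    ∑ p : I, ∑ q : I, ∑ r : I, (cubicWeight ![p, q, r] : ℝ) ≤ 729 * (card I : ℝ) ^ 3 := by
  rcases isEmpty_or_nonempty I with hI | hI
  · simp
  let eqv : (Fin 3 → I) ≃ I × I × I :=
    { toFun := fun t => (t 0, t 1, t 2)
      invFun := fun z => ![z.1, z.2.1, z.2.2]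
      left_inv := fun t => by ext i; fin_cases i <;> rfl
      right_inv := fun z => rfl }
  have h1 : ∑ p : I, ∑ q : I, ∑ r : I, (cubicWeight ![p, q, r] : ℝ)
      = ∑ t : Fin 3 → I, (cubicWeight t : ℝ) := by
    rw [← Fintype.sum_equiv eqv.symm (fun z => (cubicWeight ![z.1, z.2.1, z.2.2] : ℝ)) _
      fun z => rfl]
    simp only [Fintype.sum_prod_type]
  let NS := Finset.univ.filter fun w : Fin 3 ⊕ Fin 3 → I => ∀ a, ∃ b, b ≠ a ∧ w b = w a
  have hcard : (NS.card : ℝ) ≤ 729 * (card I : ℝ) ^ 3 := by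
    have := card_no_singletons_le (I := I) (K := Fin 3 ⊕ Fin 3) (h := 3) (by simp)
    simp only [Fintype.card_sum, card_fin] at this
    calc (NS.card : ℝ) ≤ ((card I ^ 3 * 3 ^ (3 + 3) : ℕ) : ℝ) := by exact_mod_cast this
      _ = _ := by push_cast; ring
  refine h1.le.trans (le_of_eq_of_le ?_ hcard)
  rw [← Nat.cast_sum]
  congr 1
  have h2 : ∀ t : Fin 3 → I, cubicWeight t = ∑ t', if NoSingleton t t' then 1 else 0 := fun t => by
    simp [cubicWeight]
  simp_rw [h2]
  rw [← Fintype.sum_prod_type (f := fun z : (Fin 3 → I) × (Fin 3 → I) =>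
    if NoSingleton z.1 z.2 then 1 else 0), Finset.card_filter]
  exact Fintype.sum_equiv (Equiv.sumArrowEquivProdArrow _ _ _).symm _ _ fun z => rfl

end Combinatorics

section Coordinates

variable {Ω : Type*} [MeasurableSpace Ω] {I : Type*} {α : I → Type*} [∀ p, MeasurableSpace (α p)]

/-- `u` replaces the `p`-th coordinate by an independent copy. -/
structure IsUpdate (μ : Measure Ω) (P : ∀ p, Measure (α p)) (X : ∀ p, Ω → α p) (p : I)
    (u : Ω × α p → Ω) : Prop where
  mp : MeasurePreserving u (μ.prod (P p)) μ
  same : ∀ z, X p (u z) = z.2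
  other : ∀ q, q ≠ p → ∀ z, X q (u z) = X q z.1

/-- The coordinates `X p` are independent with laws `P p`, and can be resampled one at a time. -/
structure IndepCoord (μ : Measure Ω) (P : ∀ p, Measure (α p)) (X : ∀ p, Ω → α p) : Prop where
  meas : ∀ p, Measurable (X p)
  exists_update : ∀ p, ∃ u : Ω × α p → Ω, IsUpdate μ P X p u

variable {μ : Measure Ω} [IsProbabilityMeasure μ] {P : ∀ p, Measure (α p)}
  [∀ p, IsProbabilityMeasure (P p)] {X : ∀ p, Ω → α p}

theorem IndepCoord.measurePreserving (h : IndepCoord μ P X) (p : I) :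
    MeasurePreserving (X p) μ (P p) := by
  obtain ⟨u, hu⟩ := h.exists_update p
  refine ⟨h.meas p, ?_⟩
  rw [← hu.mp.map_eq, Measure.map_map (h.meas p) hu.mp.measurable]
  have : X p ∘ u = Prod.snd := funext hu.same
  rw [this, Measure.map_snd_prod]
  simp

theorem IndepCoord.measurePreserving_pair (h : IndepCoord μ P X) {p q : I} (hpq : p ≠ q) :
    MeasurePreserving (fun ω => (X p ω, X q ω)) μ ((P p).prod (P q)) := by
  obtain ⟨u, hu⟩ := h.exists_update p
  have hm : Measurable fun ω => (X p ω, X q ω) := (h.meas p).prodMk (h.meas q)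
  refine ⟨hm, ?_⟩
  rw [← hu.mp.map_eq, Measure.map_map hm hu.mp.measurable]
  have h1 : (fun ω => (X p ω, X q ω)) ∘ u = Prod.map id (X q) ∘ Prod.swap := by
    funext z
    simp only [Function.comp_apply, hu.same, hu.other q hpq.symm]
    rfl
  have h2 : MeasurePreserving (Prod.map id (X q)) ((P p).prod μ) ((P p).prod (P q)) :=
    (MeasurePreserving.id (P p)).prod (h.measurePreserving q)
  rw [h1]
  exact (h2.comp Measure.measurePreserving_swap).map_eq

theorem IndepCoord.integral_comp (h : IndepCoord μ P X) {p : I} {f : α p → ℝ}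
    (hf : AEStronglyMeasurable f (P p)) : ∫ ω, f (X p ω) ∂μ = ∫ x, f x ∂P p := by
  rw [← (h.measurePreserving p).map_eq, integral_map (h.meas p).aemeasurable]
  rwa [(h.measurePreserving p).map_eq]

theorem IsUpdate.integral_eq_zero {p : I} {u : Ω × α p → Ω} (hu : IsUpdate μ P X p u)
    {f g : Ω → ℝ} (hfg : Integrable (fun ω => f ω * g ω) μ)
    (hf : ∀ᵐ ω ∂μ, ∫ y, f (u (ω, y)) ∂P p = 0) (hg : ∀ z, g (u z) = g z.1) :
    ∫ ω, f ω * g ω ∂μ = 0 := by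
  have hi : Integrable (fun z => f (u z) * g (u z)) (μ.prod (P p)) :=
    hu.mp.integrable_comp_of_integrable hfg
  have h1 : ∫ ω, f ω * g ω ∂μ = ∫ z, f (u z) * g (u z) ∂(μ.prod (P p)) := by
    conv_lhs => rw [← hu.mp.map_eq]
    rw [integral_map hu.mp.measurable.aemeasurable]
    rw [hu.mp.map_eq]; exact hfg.aestronglyMeasurable
  rw [h1, integral_prod _ hi]
  refine integral_eq_zero_of_ae ?_
  filter_upwards [hf] with ω hω
  simp only [hg, integral_mul_const, hω, zero_mul, Pi.zero_apply]

section Sums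

variable [Fintype I] [DecidableEq I]

theorem integral_sum_mul_sum {S T : Type*} [Fintype S] [Fintype T] {f : S → Ω → ℝ} {g : T → Ω → ℝ}
    (hf : ∀ s, MemLp (f s) 2 μ) (hg : ∀ t, MemLp (g t) 2 μ) :
    ∫ ω, (∑ s, f s ω) * (∑ t, g t ω) ∂μ = ∑ s, ∑ t, ∫ ω, f s ω * g t ω ∂μ := by
  have hi : ∀ s t, Integrable (fun ω => f s ω * g t ω) μ := fun s t => (hf s).integrable_mul (hg t)
  simp_rw [Finset.sum_mul_sum]
  rw [integral_finsetSum _ fun s _ => integrable_finsetSum _ fun t _ => hi s t]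
  exact sum_congr rfl fun s _ => integral_finsetSum _ fun t _ => hi s t

/-- Centred functions of one coordinate. -/
structure Kernel₁ (μ : Measure Ω) (P : ∀ p, Measure (α p)) (X : ∀ p, Ω → α p)
    (a : ∀ p, α p → ℝ) : Prop where
  memLp : ∀ p, MemLp (fun ω => a p (X p ω)) 2 μ
  centred : ∀ p, ∫ x, a p x ∂P p = 0

/-- Functions of two coordinates, degenerate off the diagonal. -/
structure Kernel₂ (μ : Measure Ω) (P : ∀ p, Measure (α p)) (X : ∀ p, Ω → α p)
    (b : ∀ p q, α p → α q → ℝ) : Prop where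
  memLp : ∀ p q, MemLp (fun ω => b p q (X p ω) (X q ω)) 2 μ
  left : ∀ p q, p ≠ q → ∀ᵐ ω ∂μ, ∫ x, b p q x (X q ω) ∂P p = 0
  right : ∀ p q, p ≠ q → ∀ᵐ ω ∂μ, ∫ y, b p q (X p ω) y ∂P q = 0

/-- Functions of three coordinates, centred in each coordinate that occurs only once. -/
structure Kernel₃ (μ : Measure Ω) (P : ∀ p, Measure (α p)) (X : ∀ p, Ω → α p)
    (c : ∀ p q r, α p → α q → α r → ℝ) : Prop where
  memLp : ∀ p q r, MemLp (fun ω => c p q r (X p ω) (X q ω) (X r ω)) 2 μ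
  left : ∀ p q r, p ≠ q → p ≠ r → ∀ᵐ ω ∂μ, ∫ x, c p q r x (X q ω) (X r ω) ∂P p = 0
  mid : ∀ p q r, q ≠ p → q ≠ r → ∀ᵐ ω ∂μ, ∫ x, c p q r (X p ω) x (X r ω) ∂P q = 0
  right : ∀ p q r, r ≠ p → r ≠ q → ∀ᵐ ω ∂μ, ∫ x, c p q r (X p ω) (X q ω) x ∂P r = 0

variable {a : ∀ p, α p → ℝ} {b b' : ∀ p q, α p → α q → ℝ} {c : ∀ p q r, α p → α q → α r → ℝ}

theorem IsUpdate.kernel₁ {p : I} {u : Ω × α p → Ω} (hu : IsUpdate μ P X p u)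
    (ha : Kernel₁ μ P X a) : ∀ᵐ ω ∂μ, ∫ y, a p (X p (u (ω, y))) ∂P p = 0 := by
  simp only [hu.same, ha.centred, eventually_true]

theorem IndepCoord.integral_sq_sum (h : IndepCoord μ P X) (ha : Kernel₁ μ P X a) :
    ∫ ω, (∑ p, a p (X p ω)) ^ 2 ∂μ = ∑ p, ∫ ω, a p (X p ω) ^ 2 ∂μ := by
  simp_rw [sq]
  rw [integral_sum_mul_sum ha.memLp ha.memLp]
  refine sum_congr rfl fun p _ => ?_
  rw [Finset.sum_eq_single p _ (by simp)]
  intro q _ hqp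
  obtain ⟨u, hu⟩ := h.exists_update p
  exact hu.integral_eq_zero ((ha.memLp p).integrable_mul (ha.memLp q)) (hu.kernel₁ ha)
    fun z => by rw [hu.other q hqp]

theorem IndepCoord.integral_sum_mul_kernel₂ (h : IndepCoord μ P X) (ha : Kernel₁ μ P X a)
    (hb : Kernel₂ μ P X b) :
    ∫ ω, (∑ p, a p (X p ω)) * (∑ p, ∑ q, b p q (X p ω) (X q ω)) ∂μ
      = ∑ p, ∫ ω, a p (X p ω) * b p p (X p ω) (X p ω) ∂μ := by
  rw [integral_sum_mul_sum (T := I) (g := fun p ω => ∑ q, b p q (X p ω) (X q ω)) ha.memLp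
    fun p => memLp_finsetSum _ fun q _ => hb.memLp p q]
  refine sum_congr rfl fun p _ => ?_
  have h0 : ∀ q r, (q ≠ p ∨ r ≠ p) → ∫ ω, a p (X p ω) * b q r (X q ω) (X r ω) ∂μ = 0 := by
    intro q r hqr
    have hi : Integrable (fun ω => a p (X p ω) * b q r (X q ω) (X r ω)) μ :=
      (ha.memLp p).integrable_mul (hb.memLp q r)
    by_cases hq : q = p
    · have hr : r ≠ p := by tauto
      have hqr' : r ≠ q := hq ▸ hr
      obtain ⟨u, hu⟩ := h.exists_update r
      simp_rw [mul_comm (a p _)] at hi ⊢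
      refine hu.integral_eq_zero hi ?_ fun z => by rw [hu.other p hr.symm]
      filter_upwards [hb.right q r hqr'.symm] with ω hω
      simpa [hu.same, hu.other q hqr'.symm] using hω
    · by_cases hr : r = p
      · have hqr' : q ≠ r := hr ▸ hq
        obtain ⟨u, hu⟩ := h.exists_update q
        simp_rw [mul_comm (a p _)] at hi ⊢
        refine hu.integral_eq_zero hi ?_ fun z => by rw [hu.other p (Ne.symm hq)]
        filter_upwards [hb.left q r hqr'] with ω hω
        simpa [hu.same, hu.other r hqr'.symm] using hω
      · obtain ⟨u, hu⟩ := h.exists_update p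
        refine hu.integral_eq_zero hi (hu.kernel₁ ha) fun z => ?_
        rw [hu.other q hq, hu.other r hr]
  have hi : ∀ q r, Integrable (fun ω => a p (X p ω) * b q r (X q ω) (X r ω)) μ := fun q r =>
    (ha.memLp p).integrable_mul (hb.memLp q r)
  simp_rw [mul_sum]
  rw [Finset.sum_eq_single p _ (by simp)]
  · rw [integral_finsetSum _ fun r _ => hi p r, Finset.sum_eq_single p _ (by simp)]
    intro r _ hr
    exact h0 p r (Or.inr hr)
  · intro q _ hq
    rw [integral_finsetSum _ fun r _ => hi q r]
    exact Finset.sum_eq_zero fun r _ => h0 q r (Or.inl hq)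

theorem IndepCoord.kernel₂_vanish_left (h : IndepCoord μ P X) (hb : Kernel₂ μ P X b) {p q : I}
    (hpq : p ≠ q) {g : Ω → ℝ} (hg : MemLp g 2 μ)
    (hfree : ∀ u : Ω × α p → Ω, IsUpdate μ P X p u → ∀ z, g (u z) = g z.1) :
    ∫ ω, b p q (X p ω) (X q ω) * g ω ∂μ = 0 := by
  obtain ⟨u, hu⟩ := h.exists_update p
  refine hu.integral_eq_zero ((hb.memLp p q).integrable_mul hg) ?_ (hfree u hu)
  filter_upwards [hb.left p q hpq] with ω hω
  simpa [hu.same, hu.other q hpq.symm] using hω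

theorem IndepCoord.kernel₂_vanish_right (h : IndepCoord μ P X) (hb : Kernel₂ μ P X b) {p q : I}
    (hpq : p ≠ q) {g : Ω → ℝ} (hg : MemLp g 2 μ)
    (hfree : ∀ u : Ω × α q → Ω, IsUpdate μ P X q u → ∀ z, g (u z) = g z.1) :
    ∫ ω, b p q (X p ω) (X q ω) * g ω ∂μ = 0 := by
  obtain ⟨u, hu⟩ := h.exists_update q
  refine hu.integral_eq_zero ((hb.memLp p q).integrable_mul hg) ?_ (hfree u hu)
  filter_upwards [hb.right p q hpq] with ω hω
  simpa [hu.same, hu.other p hpq] using hω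

theorem integral_double_sum_mul_double_sum {f g : I → I → Ω → ℝ}
    (hf : ∀ p q, MemLp (f p q) 2 μ) (hg : ∀ p q, MemLp (g p q) 2 μ) :
    ∫ ω, (∑ p, ∑ q, f p q ω) * (∑ r, ∑ s, g r s ω) ∂μ
      = ∑ p, ∑ q, ∑ r, ∑ s, ∫ ω, f p q ω * g r s ω ∂μ := by
  have := integral_sum_mul_sum (S := I × I) (T := I × I) (f := fun z => f z.1 z.2)
    (g := fun z => g z.1 z.2) (fun z => hf z.1 z.2) (fun z => hg z.1 z.2)
  simpa only [Fintype.sum_prod_type] using this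

/-- The second moment of a quadratic form in degenerate kernels. -/
theorem IndepCoord.integral_sq_kernel₂ (h : IndepCoord μ P X) (hb : Kernel₂ μ P X b)
    (hdiag : ∀ p, ∫ x, b p p x x ∂P p = 0) :
    ∫ ω, (∑ p, ∑ q, b p q (X p ω) (X q ω)) ^ 2 ∂μ
      = ∑ p, ∑ q, (∫ ω, b p q (X p ω) (X q ω) ^ 2 ∂μ
        + ∫ ω, b p q (X p ω) (X q ω) * b q p (X q ω) (X p ω) ∂μ)
        - ∑ p, ∫ ω, b p p (X p ω) (X p ω) ^ 2 ∂μ := by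
  simp_rw [sq]
  rw [integral_double_sum_mul_double_sum hb.memLp hb.memLp]
  have hL : ∀ p q r s, p ≠ q → p ≠ r → p ≠ s →
      ∫ ω, b p q (X p ω) (X q ω) * b r s (X r ω) (X s ω) ∂μ = 0 := fun p q r s hq hr hs =>
    h.kernel₂_vanish_left hb hq (hb.memLp r s) fun u hu z => by
      rw [hu.other r hr.symm, hu.other s hs.symm]
  have hR : ∀ p q r s, q ≠ p → q ≠ r → q ≠ s →
      ∫ ω, b p q (X p ω) (X q ω) * b r s (X r ω) (X s ω) ∂μ = 0 := fun p q r s hq hr hs =>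
    h.kernel₂_vanish_right hb hq.symm (hb.memLp r s) fun u hu z => by
      rw [hu.other r hr.symm, hu.other s hs.symm]
  rw [sum_of_vanish_singletons _ hL hR]
  · have hd : ∀ p r, ∫ ω, b p p (X p ω) (X p ω) * b r r (X r ω) (X r ω) ∂μ
        = if p = r then ∫ ω, b p p (X p ω) (X p ω) * b p p (X p ω) (X p ω) ∂μ else 0 := by
      intro p r
      split_ifs with hpr
      · subst hpr; rfl
      · obtain ⟨u, hu⟩ := h.exists_update p
        refine hu.integral_eq_zero ((hb.memLp p p).integrable_mul (hb.memLp r r))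
          (of_forall fun ω => ?_) fun z => by rw [hu.other r (Ne.symm hpr)]
        simpa only [hu.same] using hdiag p
    have hs : ∑ p, ∑ r, ∫ ω, b p p (X p ω) (X p ω) * b r r (X r ω) (X r ω) ∂μ
        = ∑ p, ∫ ω, b p p (X p ω) (X p ω) * b p p (X p ω) (X p ω) ∂μ :=
      sum_congr rfl fun p _ => by
        rw [sum_congr rfl fun r _ => hd p r]
        simp
    simp only [sum_add_distrib, hs]
    ring
  · intro p q r s h1 h2 h3
    rw [← hL r s p q h3 h1 h2]; exact integral_congr_ae (of_forall fun ω => mul_comm _ _)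
  · intro p q r s h1 h2 h3
    rw [← hR r s p q h3 h1 h2]; exact integral_congr_ae (of_forall fun ω => mul_comm _ _)

/-- The second moment of a quadratic form without diagonal. -/
theorem IndepCoord.integral_sq_kernel₂_le (h : IndepCoord μ P X) (hb : Kernel₂ μ P X b)
    (hdiag : ∀ p, ∫ x, b p p x x ∂P p = 0) {κ : ℝ}
    (hκ : ∀ p q, ∫ ω, b p q (X p ω) (X q ω) ^ 2 ∂μ ≤ κ) :
    ∫ ω, (∑ p, ∑ q, b p q (X p ω) (X q ω)) ^ 2 ∂μ ≤ 2 * (card I : ℝ) ^ 2 * κ := by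
  rw [h.integral_sq_kernel₂ hb hdiag]
  have h1 : 0 ≤ ∑ p, ∫ ω, b p p (X p ω) (X p ω) ^ 2 ∂μ :=
    sum_nonneg fun p _ => integral_nonneg fun ω => sq_nonneg _
  have h2 : ∀ p q, ∫ ω, b p q (X p ω) (X q ω) ^ 2 ∂μ
        + ∫ ω, b p q (X p ω) (X q ω) * b q p (X q ω) (X p ω) ∂μ ≤ 2 * κ := by
    intro p q
    have h3 : ∫ ω, b p q (X p ω) (X q ω) * b q p (X q ω) (X p ω) ∂μ ≤
        ∫ ω, (b p q (X p ω) (X q ω) ^ 2 + b q p (X q ω) (X p ω) ^ 2) / 2 ∂μ := by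
      refine integral_mono ((hb.memLp p q).integrable_mul (hb.memLp q p))
        (((hb.memLp p q).integrable_sq.add (hb.memLp q p).integrable_sq).div_const 2) fun ω => ?_
      nlinarith [sq_nonneg (b p q (X p ω) (X q ω) - b q p (X q ω) (X p ω))]
    rw [integral_div, integral_add (hb.memLp p q).integrable_sq (hb.memLp q p).integrable_sq] at h3
    linarith [hκ p q, hκ q p]
  have h4 := sum_le_sum fun p (_ : p ∈ Finset.univ) =>
    sum_le_sum fun q (_ : q ∈ Finset.univ) => h2 p q
  simp only [sum_const, card_univ, nsmul_eq_mul] at h4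
  nlinarith

theorem IndepCoord.integral_sum_mul_kernel₃ (h : IndepCoord μ P X) (ha : Kernel₁ μ P X a)
    (hc : Kernel₃ μ P X c)
    (hsymm₁ : ∀ p r, ∀ᵐ ω ∂μ, c r p r (X r ω) (X p ω) (X r ω) = c p r r (X p ω) (X r ω) (X r ω))
    (hsymm₂ : ∀ p r, ∀ᵐ ω ∂μ, c r r p (X r ω) (X r ω) (X p ω) = c p r r (X p ω) (X r ω) (X r ω)) :
    ∫ ω, (∑ p, a p (X p ω)) * (∑ p, ∑ q, ∑ r, c p q r (X p ω) (X q ω) (X r ω)) ∂μ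
      = 3 * ∑ p, ∑ r, ∫ ω, a p (X p ω) * c p r r (X p ω) (X r ω) (X r ω) ∂μ
        - 2 * ∑ p, ∫ ω, a p (X p ω) * c p p p (X p ω) (X p ω) (X p ω) ∂μ := by
  have h0 := integral_sum_mul_sum (T := I × I × I) (f := fun p ω => a p (X p ω))
    (g := fun z ω => c z.1 z.2.1 z.2.2 (X z.1 ω) (X z.2.1 ω) (X z.2.2 ω)) ha.memLp
    fun z => hc.memLp _ _ _
  simp only [Fintype.sum_prod_type] at h0
  rw [h0]
  have hi := fun p q r s => (ha.memLp p).integrable_mul (hc.memLp q r s)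
  have hi' := fun p q r s => (hc.memLp q r s).integrable_mul (ha.memLp p)
  rw [sum_of_vanish_singletons]
  · have e1 : ∀ p r, ∫ ω, a p (X p ω) * c r p r (X r ω) (X p ω) (X r ω) ∂μ
        = ∫ ω, a p (X p ω) * c p r r (X p ω) (X r ω) (X r ω) ∂μ := fun p r =>
      integral_congr_ae ((hsymm₁ p r).mono fun ω hω => by simp only [hω])
    have e2 : ∀ p r, ∫ ω, a p (X p ω) * c r r p (X r ω) (X r ω) (X p ω) ∂μ
        = ∫ ω, a p (X p ω) * c p r r (X p ω) (X r ω) (X r ω) ∂μ := fun p r =>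
      integral_congr_ae ((hsymm₂ p r).mono fun ω hω => by simp only [hω])
    simp only [e1, e2, sum_add_distrib]
    ring
  · intro p q r s hq hr hs
    obtain ⟨u, hu⟩ := h.exists_update p
    refine hu.integral_eq_zero (hi p q r s) (hu.kernel₁ ha) fun z => ?_
    rw [hu.other q hq.symm, hu.other r hr.symm, hu.other s hs.symm]
  · intro p q r s hp hr hs
    obtain ⟨u, hu⟩ := h.exists_update q
    simp_rw [mul_comm (a p _)]
    refine hu.integral_eq_zero (hi' p q r s) ?_ fun z => by rw [hu.other p hp.symm]
    filter_upwards [hc.left q r s hr hs] with ω hω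
    simpa [hu.same, hu.other r hr.symm, hu.other s hs.symm] using hω
  · intro p q r s hp hq hs
    obtain ⟨u, hu⟩ := h.exists_update r
    simp_rw [mul_comm (a p _)]
    refine hu.integral_eq_zero (hi' p q r s) ?_ fun z => by rw [hu.other p hp.symm]
    filter_upwards [hc.mid q r s hq hs] with ω hω
    simpa [hu.same, hu.other q hq.symm, hu.other s hs.symm] using hω
  · intro p q r s hp hq hr
    obtain ⟨u, hu⟩ := h.exists_update s
    simp_rw [mul_comm (a p _)]
    refine hu.integral_eq_zero (hi' p q r s) ?_ fun z => by rw [hu.other p hp.symm]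
    filter_upwards [hc.right q r s hq hr] with ω hω
    simpa [hu.same, hu.other q hq.symm, hu.other r hr.symm] using hω

/-- Bound for the second moment of a cubic form in degenerate kernels. -/
theorem IndepCoord.integral_sq_kernel₃_le (h : IndepCoord μ P X) (hc : Kernel₃ μ P X c) :
    ∫ ω, (∑ p, ∑ q, ∑ r, c p q r (X p ω) (X q ω) (X r ω)) ^ 2 ∂μ
      ≤ ∑ p, ∑ q, ∑ r, (cubicWeight ![p, q, r] : ℝ) *
        ∫ ω, c p q r (X p ω) (X q ω) (X r ω) ^ 2 ∂μ := by
  let C : (Fin 3 → I) → Ω → ℝ := fun t ω => c (t 0) (t 1) (t 2) (X _ ω) (X _ ω) (X _ ω)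
  have hC : ∀ t, MemLp (C t) 2 μ := fun t => hc.memLp _ _ _
  let eqv : (Fin 3 → I) ≃ I × I × I :=
    { toFun := fun t => (t 0, t 1, t 2)
      invFun := fun z => ![z.1, z.2.1, z.2.2]
      left_inv := fun t => by ext i; fin_cases i <;> rfl
      right_inv := fun z => rfl }
  have hsum : ∀ ω, ∑ p, ∑ q, ∑ r, c p q r (X p ω) (X q ω) (X r ω) = ∑ t, C t ω := fun ω => by
    rw [Fintype.sum_equiv eqv (fun t => C t ω)
      (fun z => c z.1 z.2.1 z.2.2 (X z.1 ω) (X z.2.1 ω) (X z.2.2 ω)) fun t => rfl]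
    simp only [Fintype.sum_prod_type]
  have hsq : ∀ ω, (∑ p, ∑ q, ∑ r, c p q r (X p ω) (X q ω) (X r ω)) ^ 2
      = (∑ t, C t ω) * ∑ t, C t ω := fun ω => by rw [hsum, sq]
  simp_rw [hsq]
  rw [integral_sum_mul_sum hC hC]
  have hbound : ∀ t t', ∫ ω, C t ω * C t' ω ∂μ ≤
      (∫ ω, C t ω ^ 2 ∂μ + ∫ ω, C t' ω ^ 2 ∂μ) / 2 := fun t t' => by
    have h3 : ∫ ω, C t ω * C t' ω ∂μ ≤ ∫ ω, (C t ω ^ 2 + C t' ω ^ 2) / 2 ∂μ := by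
      refine integral_mono ((hC t).integrable_mul (hC t'))
        (((hC t).integrable_sq.add (hC t').integrable_sq).div_const 2) fun ω => ?_
      nlinarith [sq_nonneg (C t ω - C t' ω)]
    rwa [integral_div, integral_add (hC t).integrable_sq (hC t').integrable_sq] at h3
  have hone : ∀ t t' : Fin 3 → I, ∀ k, (∀ l, l ≠ k → t l ≠ t k) → (∀ l, t' l ≠ t k) →
      ∫ ω, C t ω * C t' ω ∂μ = 0 := by
    intro t t' k h1 h2
    obtain ⟨u, hu⟩ := h.exists_update (t k)
    refine hu.integral_eq_zero ((hC t).integrable_mul (hC t')) ?_ fun z => ?_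
    · fin_cases k
      · filter_upwards [hc.left (t 0) (t 1) (t 2) (h1 1 (by decide)).symm
          (h1 2 (by decide)).symm] with ω hω
        simp only [C]
        rw [← hω]
        congr! 3
        · exact hu.same _
        · exact hu.other _ (h1 1 (by decide)) _
        · exact hu.other _ (h1 2 (by decide)) _
      · filter_upwards [hc.mid (t 0) (t 1) (t 2) (h1 0 (by decide)).symm
          (h1 2 (by decide)).symm] with ω hω
        simp only [C]
        rw [← hω]
        congr! 3
        · exact hu.other _ (h1 0 (by decide)) _
        · exact hu.same _
        · exact hu.other _ (h1 2 (by decide)) _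
      · filter_upwards [hc.right (t 0) (t 1) (t 2) (h1 0 (by decide)).symm
          (h1 1 (by decide)).symm] with ω hω
        simp only [C]
        rw [← hω]
        congr! 3
        · exact hu.other _ (h1 0 (by decide)) _
        · exact hu.other _ (h1 1 (by decide)) _
        · exact hu.same _
    · simp only [C, hu.other _ (h2 _)]
  have hzero : ∀ t t', ¬ NoSingleton t t' → ∫ ω, C t ω * C t' ω ∂μ = 0 := by
    intro t t' hn
    simp only [NoSingleton, not_forall, not_exists, not_and] at hn
    obtain ⟨a, ha⟩ := hn
    rcases a with k | k
    · exact hone t t' k (fun l hl => ha (Sum.inl l) (by simpa using hl)) fun l =>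
        ha (Sum.inr l) (by simp)
    · have := hone t' t k (fun l hl => ha (Sum.inr l) (by simpa using hl)) fun l =>
        ha (Sum.inl l) (by simp)
      rw [← this]; exact integral_congr_ae (of_forall fun ω => mul_comm _ _)
  have hle : ∀ t t', ∫ ω, C t ω * C t' ω ∂μ ≤ (if NoSingleton t t' then ∫ ω, C t ω ^ 2 ∂μ else 0) / 2
      + (if NoSingleton t' t then ∫ ω, C t' ω ^ 2 ∂μ else 0) / 2 := by
    intro t t'
    by_cases hm : NoSingleton t t'
    · rw [if_pos hm, if_pos hm.symm]
      linarith [hbound t t']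
    · rw [if_neg hm, if_neg fun h => hm h.symm, hzero t t' hm]
      simp
  calc ∑ t, ∑ t', ∫ ω, C t ω * C t' ω ∂μ
      ≤ ∑ t, ∑ t', ((if NoSingleton t t' then ∫ ω, C t ω ^ 2 ∂μ else 0) / 2
      + (if NoSingleton t' t then ∫ ω, C t' ω ^ 2 ∂μ else 0) / 2) :=
        sum_le_sum fun t _ => sum_le_sum fun t' _ => hle t t'
    _ = ∑ t, ∑ t', if NoSingleton t t' then ∫ ω, C t ω ^ 2 ∂μ else 0 := by
        simp only [sum_add_distrib]
        rw [sum_comm (f := fun t t' => (if NoSingleton t' t then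
          ∫ ω, C t' ω ^ 2 ∂μ else 0) / 2)]
        rw [← sum_add_distrib]
        refine sum_congr rfl fun t _ => ?_
        rw [← sum_add_distrib]
        exact sum_congr rfl fun t' _ => add_halves _
    _ = ∑ t, (cubicWeight t : ℝ) * ∫ ω, C t ω ^ 2 ∂μ := by
        refine sum_congr rfl fun t _ => ?_
        rw [cubicWeight, ← Finset.sum_filter, sum_const, nsmul_eq_mul]
    _ = _ := by
        rw [Fintype.sum_equiv eqv _ (fun z => (cubicWeight ![z.1, z.2.1, z.2.2] : ℝ) *
          ∫ ω, c z.1 z.2.1 z.2.2 (X z.1 ω) (X z.2.1 ω) (X z.2.2 ω) ^ 2 ∂μ) fun t => ?_]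
        · simp only [Fintype.sum_prod_type]
        · have : cubicWeight ![t 0, t 1, t 2] = cubicWeight t := congrArg _ (eqv.left_inv t)
          exact (congrArg (fun w : ℕ => (w : ℝ) * ∫ ω, C t ω ^ 2 ∂μ) this).symm

end Sums

end Coordinates

/-! ### Instances of independent coordinates -/

section Instances

theorem measurePreserving_pi_update {ι : Type*} [Fintype ι] [DecidableEq ι] {β : ι → Type*}
    [∀ i, MeasurableSpace (β i)] (ν : ∀ i, Measure (β i)) [∀ i, IsProbabilityMeasure (ν i)]
    {γ : Type*} [MeasurableSpace γ] (Q : Measure γ) [IsProbabilityMeasure Q] (i : ι)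
    {v : β i × γ → β i} (hv : MeasurePreserving v ((ν i).prod Q) (ν i)) :
    MeasurePreserving (fun z : (∀ i, β i) × γ => Function.update z.1 i (v (z.1 i, z.2)))
      ((Measure.pi ν).prod Q) (Measure.pi ν) := by
  have hm : Measurable (fun z : (∀ i, β i) × γ => Function.update z.1 i (v (z.1 i, z.2))) := by
    refine measurable_pi_iff.2 fun j => ?_
    by_cases hj : j = i
    · subst hj
      simp only [Function.update_self]
      exact hv.measurable.comp (by fun_prop)
    · simp only [Function.update_of_ne hj]
      fun_prop
  refine ⟨hm, (Measure.pi_eq fun t ht => ?_).symm⟩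
  rw [Measure.map_apply hm (MeasurableSet.univ_pi ht),
    Measure.prod_apply_symm (hm (MeasurableSet.univ_pi ht))]
  have h1 : ∀ y : γ, (fun x => (x, y)) ⁻¹' ((fun z : (∀ i, β i) × γ =>
      Function.update z.1 i (v (z.1 i, z.2))) ⁻¹' (Set.univ.pi t))
      = Set.univ.pi (Function.update t i ((fun x => (x, y)) ⁻¹' (v ⁻¹' (t i)))) := by
    intro y
    ext x
    simp only [Set.mem_preimage, Set.mem_univ_pi]
    refine forall_congr' fun j => ?_
    by_cases hj : j = i
    · subst hj; simp
    · simp [hj]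
  simp_rw [h1, Measure.pi_pi]
  have h2 : ∀ y : γ, ∏ j, (ν j) (Function.update t i ((fun x => (x, y)) ⁻¹' (v ⁻¹' (t i))) j)
      = (ν i) ((fun x => (x, y)) ⁻¹' (v ⁻¹' (t i))) * ∏ j ∈ Finset.univ.erase i, ν j (t j) := by
    intro y
    rw [← Finset.mul_prod_erase _ _ (mem_univ i)]
    simp only [Function.update_self]
    congr 1
    refine Finset.prod_congr rfl fun j hj => ?_
    rw [Function.update_of_ne (Finset.ne_of_mem_erase hj)]
  simp_rw [h2]
  rw [lintegral_mul_const _ (measurable_measure_prodMk_right (hv.measurable (ht i))),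
    ← Measure.prod_apply_symm (hv.measurable (ht i)), hv.measure_preimage (ht i).nullMeasurableSet,
    Finset.mul_prod_erase _ (fun j => ν j (t j)) (mem_univ i)]

theorem measurePreserving_infinitePi_update {J : Type*} [DecidableEq J] {β : J → Type*}
    [∀ j, MeasurableSpace (β j)] (ν : ∀ j, Measure (β j)) [∀ j, IsProbabilityMeasure (ν j)]
    (i : J) :
    MeasurePreserving (fun z : (∀ j, β j) × β i => Function.update z.1 i z.2)
      ((Measure.infinitePi ν).prod (ν i)) (Measure.infinitePi ν) := by
  have hm : Measurable (fun z : (∀ j, β j) × β i => Function.update z.1 i z.2) := by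
    refine measurable_pi_iff.2 fun j => ?_
    by_cases hj : j = i
    · subst hj
      simp only [Function.update_self]
      fun_prop
    · simp only [Function.update_of_ne hj]
      fun_prop
  refine ⟨hm, Measure.eq_infinitePi _ fun s t ht => ?_⟩
  have hms : MeasurableSet (Set.pi (s : Set J) t) :=
    MeasurableSet.pi s.countable_toSet fun j _ => ht j
  rw [Measure.map_apply hm hms]
  by_cases hi : i ∈ s
  · have h1 : (fun z : (∀ j, β j) × β i => Function.update z.1 i z.2) ⁻¹' (Set.pi (s : Set J) t)
        = (Set.pi ((s.erase i : Finset J) : Set J) t) ×ˢ (t i) := by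
      ext ⟨x, y⟩
      simp only [Set.mem_preimage, Set.mem_pi, Set.mem_prod, Finset.mem_coe, Finset.mem_erase]
      constructor
      · intro h
        exact ⟨fun j hj => by simpa [hj.1] using h j hj.2, by simpa using h i hi⟩
      · rintro ⟨h1, h2⟩ j hj
        by_cases hji : j = i
        · subst hji; simpa using h2
        · simpa [hji] using h1 j ⟨hji, hj⟩
    rw [h1, Measure.prod_prod, Measure.infinitePi_pi _ fun j _ => ht j, mul_comm,
      Finset.mul_prod_erase _ (fun j => ν j (t j)) hi]
  · have h1 : (fun z : (∀ j, β j) × β i => Function.update z.1 i z.2) ⁻¹' (Set.pi (s : Set J) t)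
        = (Set.pi (s : Set J) t) ×ˢ Set.univ := by
      ext ⟨x, y⟩
      simp only [Set.mem_preimage, Set.mem_pi, Set.mem_prod, Finset.mem_coe, Set.mem_univ, and_true]
      refine forall₂_congr fun j hj => ?_
      have : j ≠ i := fun h => hi (h ▸ hj)
      simp [this]
    rw [h1, Measure.prod_prod, Measure.infinitePi_pi _ fun j _ => ht j, measure_univ, mul_one]

theorem IndepCoord.comp_injective {Ω : Type*} [MeasurableSpace Ω] {I J : Type*} {α : I → Type*}
    [∀ p, MeasurableSpace (α p)] {μ : Measure Ω} {P : ∀ p, Measure (α p)} {X : ∀ p, Ω → α p}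
    (h : IndepCoord μ P X) {e : J → I} (he : Function.Injective e) :
    IndepCoord μ (fun j => P (e j)) (fun j => X (e j)) :=
  ⟨fun j => h.meas _, fun j => by
    obtain ⟨u, hu⟩ := h.exists_update (e j)
    exact ⟨u, hu.mp, hu.same, fun q hq => hu.other _ (he.ne hq)⟩⟩

theorem indepCoord_pi {I : Type*} [Fintype I] {α : I → Type*} [∀ p, MeasurableSpace (α p)]
    (P : ∀ p, Measure (α p)) [∀ p, IsProbabilityMeasure (P p)] :
    IndepCoord (Measure.pi P) P (fun p x => x p) := by
  classical
  refine ⟨fun p => measurable_pi_apply p, fun p => ⟨_, measurePreserving_pi_update P (P p) p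
    (v := Prod.snd) measurePreserving_snd, fun z => by simp, fun q hq z => by simp [hq]⟩⟩

variable {ι : Type*} [Fintype ι] {𝒳 : ι → Type*} [∀ i, MeasurableSpace (𝒳 i)]

instance (F : ∀ i, Measure (𝒳 i)) [∀ i, IsProbabilityMeasure (F i)] :
    IsProbabilityMeasure (dataLaw F) := by
  unfold dataLaw; infer_instance

theorem indepCoord_data (F : ∀ i, Measure (𝒳 i)) [∀ i, IsProbabilityMeasure (F i)] :
    IndepCoord (dataLaw F) (fun p : Σ _ : ι, ℕ => F p.1) (fun p x => x p.1 p.2) := by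
  classical
  refine ⟨fun p => by fun_prop, fun p => ⟨_, measurePreserving_pi_update _ (F p.1) p.1
    (measurePreserving_infinitePi_update (fun _ : ℕ => F p.1) p.2), fun z => by simp,
    fun q hq z => ?_⟩⟩
  obtain ⟨i, j⟩ := p
  obtain ⟨i', j'⟩ := q
  by_cases h : i' = i
  · subst h
    have : j' ≠ j := fun h => hq (by rw [h])
    simp [this]
  · simp [h]

theorem indepCoord_sample (F : ∀ i, Measure (𝒳 i)) [∀ i, IsProbabilityMeasure (F i)] (n : ι → ℕ) :
    IndepCoord (dataLaw F) (fun p : Σ i : ι, Fin (n i) => F p.1) (fun p x => x p.1 p.2) :=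
  (indepCoord_data F).comp_injective (e := fun p : Σ i : ι, Fin (n i) => ⟨p.1, (p.2 : ℕ)⟩) (by
    rintro ⟨i, a⟩ ⟨j, b⟩ h
    simp only [Sigma.mk.injEq] at h
    obtain ⟨rfl, h⟩ := h
    rw [Fin.ext (eq_of_heq h)])

theorem measurePreserving_prod_prod_comm {α β γ δ : Type*} [MeasurableSpace α]
    [MeasurableSpace β] [MeasurableSpace γ] [MeasurableSpace δ] (A : Measure α) (B : Measure β)
    (C : Measure γ) (D : Measure δ) [SFinite A] [SFinite B] [SFinite C] [SFinite D] :
    MeasurePreserving (fun z : (α × β) × (γ × δ) => ((z.1.1, z.2.1), (z.1.2, z.2.2)))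
      ((A.prod B).prod (C.prod D)) ((A.prod C).prod (B.prod D)) := by
  have hm : Measurable fun z : (α × β) × (γ × δ) => ((z.1.1, z.2.1), (z.1.2, z.2.2)) := by
    fun_prop
  refine ⟨hm, Measure.ext_of_lintegral _ fun f hf => ?_⟩
  rw [lintegral_map hf hm, lintegral_prod _ (by fun_prop), lintegral_prod _ (by fun_prop),
    lintegral_prod _ (by fun_prop), lintegral_prod _ (by fun_prop)]
  refine lintegral_congr fun a => ?_
  have h1 : ∀ b : β, ∫⁻ z : γ × δ, f ((a, z.1), (b, z.2)) ∂(C.prod D)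
      = ∫⁻ c, ∫⁻ d, f ((a, c), (b, d)) ∂D ∂C := fun b => by
    rw [lintegral_prod _ (by fun_prop)]
  have h2 : ∀ c : γ, ∫⁻ z : β × δ, f ((a, c), z) ∂(B.prod D)
      = ∫⁻ b, ∫⁻ d, f ((a, c), (b, d)) ∂D ∂B := fun c => by
    rw [lintegral_prod _ (by fun_prop)]
  simp_rw [h1, h2]
  rw [lintegral_lintegral_swap]
  exact (Measurable.lintegral_prod_right' (f := fun w : (β × γ) × δ =>
    f ((a, w.1.2), (w.1.1, w.2))) (by fun_prop)).aemeasurable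

theorem indepCoord_prod_pi {I : Type*} [Fintype I] {α β : Type*} [MeasurableSpace α]
    [MeasurableSpace β] (P : Measure α) [IsProbabilityMeasure P] (Q : Measure β)
    [IsProbabilityMeasure Q] :
    IndepCoord ((Measure.pi fun _ : I => P).prod (Measure.pi fun _ : I => Q))
      (fun _ => P.prod Q) (fun p z => (z.1 p, z.2 p)) := by
  classical
  refine ⟨fun p => by fun_prop, fun p => ?_⟩
  have h1 := measurePreserving_pi_update (fun _ : I => P) P p (v := Prod.snd) measurePreserving_snd
  have h2 := measurePreserving_pi_update (fun _ : I => Q) Q p (v := Prod.snd) measurePreserving_snd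
  refine ⟨fun z => (Function.update z.1.1 p z.2.1, Function.update z.1.2 p z.2.2), ⟨?_, ?_, ?_⟩⟩
  · have h3 := h1.prod h2
    exact h3.comp (measurePreserving_prod_prod_comm _ _ P Q)
  · intro z; simp
  · intro q hq z; simp [hq]

variable [DecidableEq ι]

theorem uniformOn_idx (n s : ι → ℕ) [∀ i, NeZero (n i)] :
    (uniformOn Set.univ : Measure (Idx n s)) =
      Measure.pi fun i => Measure.pi fun _ : Fin (s i) => uniformOn (Set.univ : Set (Fin (n i))) := by
  refine Measure.ext_of_singleton fun J => ?_
  rw [Measure.pi_singleton, uniformOn_univ]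
  simp_rw [Measure.pi_singleton, uniformOn_univ]
  simp only [Measure.count_singleton, Fintype.card_pi, card_fin, Finset.prod_const,
    card_univ, one_div, Nat.cast_prod, Nat.cast_pow]
  rw [ENNReal.prod_inv_distrib]
  · simp [ENNReal.inv_pow]
  · intro i _ j _ _
    exact Or.inr (ENNReal.pow_ne_top (ENNReal.natCast_ne_top _))

instance (n s : ι → ℕ) [∀ i, NeZero (n i)] :
    IsProbabilityMeasure (uniformOn (Set.univ : Set (Idx n s))) :=
  isProbabilityMeasure_uniformOn Set.finite_univ Set.univ_nonempty

instance (n : ℕ) [NeZero n] :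
    IsProbabilityMeasure (uniformOn (Set.univ : Set (Fin n))) :=
  isProbabilityMeasure_uniformOn Set.finite_univ Set.univ_nonempty

theorem indepCoord_idx (n s : ι → ℕ) [∀ i, NeZero (n i)] :
    IndepCoord (uniformOn Set.univ : Measure (Idx n s))
      (fun p : Σ i, Fin (s i) => uniformOn (Set.univ : Set (Fin (n p.1))))
      (fun p J => J p.1 p.2) := by
  rw [uniformOn_idx]
  refine ⟨fun p => by fun_prop, fun p => ⟨_, measurePreserving_pi_update _ _ p.1
    (measurePreserving_pi_update (fun _ : Fin (s p.1) => uniformOn (Set.univ : Set (Fin (n p.1))))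
      _ p.2 (v := Prod.snd) measurePreserving_snd), fun z => by simp, fun q hq z => ?_⟩⟩
  obtain ⟨i, j⟩ := p
  obtain ⟨i', j'⟩ := q
  by_cases h : i' = i
  · subst h
    have : j' ≠ j := fun h => hq (by rw [h])
    simp [this]
  · simp [h]

theorem integral_uniformOn_univ {α : Type*} [Fintype α] [MeasurableSpace α]
    [MeasurableSingletonClass α] (f : α → ℝ) :
    ∫ x, f x ∂(uniformOn (Set.univ : Set α)) = (∑ x, f x) / card α := by
  rw [integral_fintype (.of_finite)]
  simp only [Measure.real, uniformOn_univ, Measure.count_singleton, smul_eq_mul]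
  rw [sum_div]
  refine sum_congr rfl fun x _ => ?_
  simp
  ring

theorem bootMean_eq_integral {n s : ι → ℕ} (f : Idx n s → ℝ) :
    bootMean f = ∫ J, f J ∂(uniformOn Set.univ) := by
  rw [integral_uniformOn_univ, bootMean]

theorem lintegral_uniformOn_univ {α : Type*} [Fintype α] [MeasurableSpace α]
    [MeasurableSingletonClass α] (f : α → ℝ≥0∞) :
    ∫⁻ x, f x ∂(uniformOn (Set.univ : Set α)) = (∑ x, f x) / card α := by
  rw [lintegral_fintype]
  simp only [uniformOn_univ, Measure.count_singleton]
  simp only [ENNReal.div_eq_inv_mul, mul_one]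
  rw [mul_sum]
  exact sum_congr rfl fun x _ => mul_comm _ _

theorem bootMeanENN_eq_lintegral {n s : ι → ℕ} (f : Idx n s → ℝ≥0∞) :
    bootMeanENN f = ∫⁻ J, f J ∂(uniformOn Set.univ) := by
  rw [lintegral_uniformOn_univ, bootMeanENN]

end Instances

/-! ### Empirical distributions, the hull, and Taylor terms at empirical distributions -/

section Emp

variable {α : Type*} [MeasurableSpace α]

theorem integral_emp [MeasurableSingletonClass α] {n : ℕ} (y : Fin n → α) (f : α → ℝ) :
    ∫ x, f x ∂(emp y) = (∑ j, f (y j)) / n := by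
  rw [emp, integral_smul_measure, integral_finsetSum_measure fun j _ => ?_]
  · simp [div_eq_inv_mul]
  · exact integrable_dirac (by simp)

variable [TopologicalSpace α] {F : Measure α}

theorem self_mem_hull : F ∈ hull F := ⟨0, 1, Fin.elim0, Fin.elim0, fun k => k.elim0, by simp, by simp⟩

theorem dirac_mem_hull {x : α} (hx : x ∈ F.support) : Measure.dirac x ∈ hull F :=
  ⟨1, 0, fun _ => 1, fun _ => x, fun _ => hx, by simp, by simp⟩

theorem emp_mem_hull {n : ℕ} (hn : n ≠ 0) {y : Fin n → α} (hy : ∀ j, y j ∈ F.support) :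
    emp y ∈ hull F := by
  refine ⟨n, 0, fun _ => (n : ℝ≥0)⁻¹, y, hy, by simp [hn], ?_⟩
  rw [emp, Finset.smul_sum, zero_smul, zero_add]
  refine sum_congr rfl fun j _ => ?_
  rw [ENNReal.smul_def, ENNReal.coe_inv (by simpa using hn)]
  simp

theorem isProbabilityMeasure_of_mem_hull [IsProbabilityMeasure F] {P : Measure α}
    (hP : P ∈ hull F) : IsProbabilityMeasure P := by
  obtain ⟨l, a, b, x, -, h1, rfl⟩ := hP
  constructor
  simp only [Measure.add_apply, Measure.smul_apply, measure_univ, Measure.finsetSum_apply,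
    ENNReal.smul_def, smul_eq_mul, mul_one]
  exact_mod_cast congrArg ((↑) : ℝ≥0 → ℝ≥0∞) h1

theorem ae_mem_support_of_mem_hull [OpensMeasurableSpace α] [HereditarilyLindelofSpace α]
    {P : Measure α} (hP : P ∈ hull F) : ∀ᵐ x ∂P, x ∈ F.support := by
  obtain ⟨l, a, b, x, hx, -, rfl⟩ := hP
  have hs : MeasurableSet F.support := Measure.isClosed_support.measurableSet
  rw [ae_add_measure_iff]
  refine ⟨Measure.ae_smul_measure Measure.support_mem_ae a, ?_⟩
  rw [ae_iff, Measure.finsetSum_apply]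
  refine Finset.sum_eq_zero fun k _ => ?_
  have : (Measure.dirac (x k)) {a | a ∉ F.support} = 0 :=
    (Measure.dirac_apply' _ hs.compl).trans (by simp [hx k])
  rw [Measure.smul_apply, this, smul_zero]

theorem sint_emp [MeasurableSingletonClass α] {n : ℕ} {y : Fin n → α}
    {P : Measure α} {f g : α → ℝ} (hy : ∀ l, y l ∈ F.support)
    (hP : ∀ᵐ x ∂P, x ∈ F.support) (hfg : ∀ x ∈ F.support, f x = g x)
    (hg : ∫ x, g x ∂P = 0) : sint (emp y) P f = (∑ l, g (y l)) / n := by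
  rw [sint, integral_emp, integral_congr_ae (hP.mono hfg), hg, sub_zero]
  simp_rw [hfg _ (hy _)]

end Emp

section TaylorAtEmp

variable {ι : Type*} [Fintype ι] {𝒳 : ι → Type*} [∀ i, TopologicalSpace (𝒳 i)]
  [∀ i, PolishSpace (𝒳 i)] [∀ i, MeasurableSpace (𝒳 i)] [∀ i, BorelSpace (𝒳 i)]
  {F : ∀ i, Measure (𝒳 i)} [∀ i, IsProbabilityMeasure (F i)]
  {ψ : (∀ i, Measure (𝒳 i)) → ℝ}
  {g₁ : (∀ i, Measure (𝒳 i)) → ∀ i, 𝒳 i → ℝ}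
  {g₂ : (∀ i, Measure (𝒳 i)) → ∀ i j, 𝒳 i → 𝒳 j → ℝ}
  {g₃ : (∀ i, Measure (𝒳 i)) → ∀ i j k, 𝒳 i → 𝒳 j → 𝒳 k → ℝ}
  {P : ∀ i, Measure (𝒳 i)}

theorem ThirdOrderDifferentiable.centred₂_left (hd : ThirdOrderDifferentiable ψ g₁ g₂ g₃ F)
    (hP : ∀ i, P i ∈ hull (F i)) {i j : ι} {y : 𝒳 j} (hy : y ∈ (F j).support) :
    ∫ x, g₂ P i j x y ∂(P i) = 0 := by
  rw [← hd.centred₂ P hP j i y hy]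
  refine integral_congr_ae ?_
  filter_upwards [ae_mem_support_of_mem_hull (hP i)] with x hx
  exact hd.symm₂ P hP i j x hx y hy

theorem ThirdOrderDifferentiable.centred₃_mid (hd : ThirdOrderDifferentiable ψ g₁ g₂ g₃ F)
    (hP : ∀ i, P i ∈ hull (F i)) {i j k : ι} {x : 𝒳 i} {z : 𝒳 k}
    (hx : x ∈ (F i).support) (hz : z ∈ (F k).support) : ∫ y, g₃ P i j k x y z ∂(P j) = 0 := by
  rw [← hd.centred₃ P hP i k j x hx z hz]
  refine integral_congr_ae ?_
  filter_upwards [ae_mem_support_of_mem_hull (hP j)] with y hy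
  exact (hd.symm₃ P hP i j k x hx y hy z hz).2

theorem ThirdOrderDifferentiable.centred₃_left (hd : ThirdOrderDifferentiable ψ g₁ g₂ g₃ F)
    (hP : ∀ i, P i ∈ hull (F i)) {i j k : ι} {y : 𝒳 j} {z : 𝒳 k}
    (hy : y ∈ (F j).support) (hz : z ∈ (F k).support) : ∫ x, g₃ P i j k x y z ∂(P i) = 0 := by
  rw [← hd.centred₃_mid hP (i := j) (j := i) (k := k) hy hz]
  refine integral_congr_ae ?_
  filter_upwards [ae_mem_support_of_mem_hull (hP i)] with x hx
  exact (hd.symm₃ P hP i j k x hx y hy z hz).1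

theorem ThirdOrderDifferentiable.integrable₂_left (hd : ThirdOrderDifferentiable ψ g₁ g₂ g₃ F)
    (hP : ∀ i, P i ∈ hull (F i)) {i j : ι} {y : 𝒳 j} (hy : y ∈ (F j).support) :
    Integrable (fun x => g₂ P i j x y) (P i) := by
  have := isProbabilityMeasure_of_mem_hull (hP i)
  have h := hd.integrable₂ P hP i j _ (hP i) _ (dirac_mem_hull hy)
  rw [Measure.prod_dirac] at h
  exact h.comp_measurable (by fun_prop)

theorem ThirdOrderDifferentiable.integrable₃_left (hd : ThirdOrderDifferentiable ψ g₁ g₂ g₃ F)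
    (hP : ∀ i, P i ∈ hull (F i)) {i j k : ι} {y : 𝒳 j} {z : 𝒳 k}
    (hy : y ∈ (F j).support) (hz : z ∈ (F k).support) :
    Integrable (fun x => g₃ P i j k x y z) (P i) := by
  have := isProbabilityMeasure_of_mem_hull (hP i)
  have h := hd.integrable₃ P hP i j k _ (hP i) _ (dirac_mem_hull hy) _ (dirac_mem_hull hz)
  rw [Measure.dirac_prod_dirac, Measure.prod_dirac] at h
  exact h.comp_measurable (by fun_prop)

theorem ThirdOrderDifferentiable.integrable₃_mid (hd : ThirdOrderDifferentiable ψ g₁ g₂ g₃ F)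
    (hP : ∀ i, P i ∈ hull (F i)) {i j k : ι} {x : 𝒳 i} {z : 𝒳 k}
    (hx : x ∈ (F i).support) (hz : z ∈ (F k).support) :
    Integrable (fun y => g₃ P i j k x y z) (P j) := by
  have := isProbabilityMeasure_of_mem_hull (hP j)
  have h := hd.integrable₃ P hP i j k _ (dirac_mem_hull hx) _ (hP j) _ (dirac_mem_hull hz)
  rw [Measure.prod_dirac, Measure.dirac_prod] at h
  exact (h.comp_measurable (by fun_prop)).comp_measurable (by fun_prop)

variable {s : ι → ℕ} {y : ∀ i, Fin (s i) → 𝒳 i}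

theorem ThirdOrderDifferentiable.taylor1_emp (hd : ThirdOrderDifferentiable ψ g₁ g₂ g₃ F)
    (hP : ∀ i, P i ∈ hull (F i)) (hy : ∀ i l, y i l ∈ (F i).support) :
    taylor1 (fun _ => 1) (fun i => emp (y i)) P (g₁ P)
      = ∑ p : Σ i, Fin (s i), g₁ P p.1 (y p.1 p.2) / s p.1 := by
  rw [sum_sigma, taylor1]
  refine sum_congr rfl fun i _ => ?_
  rw [sint_emp (hy i) (ae_mem_support_of_mem_hull (hP i)) (fun x _ => rfl)
    (hd.centred₁ P hP i), one_mul, sum_div]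

theorem ThirdOrderDifferentiable.taylor2_emp (hd : ThirdOrderDifferentiable ψ g₁ g₂ g₃ F)
    (hP : ∀ i, P i ∈ hull (F i)) (hy : ∀ i l, y i l ∈ (F i).support) :
    taylor2 (fun _ => 1) (fun i => emp (y i)) P (g₂ P)
      = ∑ p : Σ i, Fin (s i), ∑ q : Σ i, Fin (s i),
        g₂ P p.1 q.1 (y p.1 p.2) (y q.1 q.2) / (2 * s p.1 * s q.1) := by
  have ae := fun i => ae_mem_support_of_mem_hull (hP i)
  simp_rw [sum_sigma]
  rw [taylor2, mul_sum]
  refine sum_congr rfl fun i _ => ?_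
  rw [mul_sum, sum_comm]
  refine sum_congr rfl fun j _ => ?_
  have h1 : ∀ x ∈ (F i).support, (sint (emp (y j)) (P j) fun y' => g₂ P i j x y')
      = (∑ l, g₂ P i j x (y j l)) / s j := fun x hx =>
    sint_emp (hy j) (ae j) (fun _ _ => rfl) (hd.centred₂ P hP i j x hx)
  rw [sint_emp (hy i) (ae i) h1]
  · simp_rw [sum_div, mul_sum]
    refine sum_congr rfl fun a _ => sum_congr rfl fun b _ => ?_
    ring
  · rw [integral_div, integral_finsetSum _ fun l _ => hd.integrable₂_left hP (hy j l)]
    simp [hd.centred₂_left hP (hy j _)]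

theorem ThirdOrderDifferentiable.taylor3_emp (hd : ThirdOrderDifferentiable ψ g₁ g₂ g₃ F)
    (hP : ∀ i, P i ∈ hull (F i)) (hy : ∀ i l, y i l ∈ (F i).support) :
    taylor3 (fun _ => 1) (fun i => emp (y i)) P (g₃ P)
      = ∑ p : Σ i, Fin (s i), ∑ q : Σ i, Fin (s i), ∑ r : Σ i, Fin (s i),
        g₃ P p.1 q.1 r.1 (y p.1 p.2) (y q.1 q.2) (y r.1 r.2)
          / (6 * s p.1 * s q.1 * s r.1) := by
  have ae := fun i => ae_mem_support_of_mem_hull (hP i)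
  simp_rw [sum_sigma]
  rw [taylor3, mul_sum]
  refine sum_congr rfl fun i _ => ?_
  rw [mul_sum, sum_comm]
  refine sum_congr rfl fun j _ => ?_
  simp_rw [sum_comm (s := (Finset.univ : Finset (Fin (s _)))) (t := (Finset.univ : Finset ι))]
  rw [mul_sum]
  refine sum_congr rfl fun k _ => ?_
  have h1 : ∀ x ∈ (F i).support, ∀ x' ∈ (F j).support,
      (sint (emp (y k)) (P k) fun z => g₃ P i j k x x' z)
      = (∑ m, g₃ P i j k x x' (y k m)) / s k := fun x hx x' hx' =>
    sint_emp (hy k) (ae k) (fun _ _ => rfl) (hd.centred₃ P hP i j k x hx x' hx')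
  have h2 : ∀ x ∈ (F i).support, (sint (emp (y j)) (P j) fun y' =>
      sint (emp (y k)) (P k) fun z => g₃ P i j k x y' z)
      = (∑ l, (∑ m, g₃ P i j k x (y j l) (y k m)) / s k) / s j := fun x hx => by
    refine sint_emp (hy j) (ae j) (h1 x hx) ?_
    rw [integral_div, integral_finsetSum _ fun l _ => hd.integrable₃_mid hP hx (hy k l)]
    simp [hd.centred₃_mid hP hx (hy k _)]
  rw [sint_emp (hy i) (ae i) h2]
  · simp_rw [sum_div, mul_sum]
    refine sum_congr rfl fun a _ => sum_congr rfl fun b _ =>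
      sum_congr rfl fun c _ => ?_
    ring
  · have hi := fun l m => hd.integrable₃_left hP (i := i) (hy j l) (hy k m)
    rw [integral_div, integral_finsetSum _ fun l _ =>
      (integrable_finsetSum _ fun m _ => hi l m).div_const _]
    have : ∀ l, ∫ x, (∑ m, g₃ P i j k x (y j l) (y k m)) / s k ∂(P i) = 0 := fun l => by
      rw [integral_div, integral_finsetSum _ fun m _ => hi l m]
      simp [hd.centred₃_left hP (hy j l) (hy k _)]
    simp [this]

end TaylorAtEmp

/-! ### Averages over finite index sets -/

section Average

/-- The average of `f` over a finite type. -/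
def av {κ : Type*} [Fintype κ] (f : κ → ℝ) : ℝ := (∑ z, f z) / card κ

variable {κ κ' : Type*} [Fintype κ] [Fintype κ']

theorem av_add (f g : κ → ℝ) : av (fun z => f z + g z) = av f + av g := by
  simp [av, sum_add_distrib, add_div]

theorem av_sub (f g : κ → ℝ) : av (fun z => f z - g z) = av f - av g := by
  simp [av, sum_sub_distrib, sub_div]

theorem av_const_mul (c : ℝ) (f : κ → ℝ) : av (fun z => c * f z) = c * av f := by
  simp [av, ← mul_sum, mul_div_assoc]

theorem av_nonneg {f : κ → ℝ} (h : ∀ z, 0 ≤ f z) : 0 ≤ av f :=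
  div_nonneg (sum_nonneg fun z _ => h z) (Nat.cast_nonneg _)

theorem av_mono {f g : κ → ℝ} (h : ∀ z, f z ≤ g z) : av f ≤ av g := by
  unfold av; gcongr; exact h _

theorem av_prod (f : κ → κ' → ℝ) : av (fun z : κ × κ' => f z.1 z.2) = av fun a => av fun b => f a b := by
  simp only [av, Fintype.sum_prod_type, Fintype.card_prod, Nat.cast_mul]
  rw [← sum_div, div_div, mul_comm]

theorem av_sum {ι : Type*} (s : Finset ι) (f : ι → κ → ℝ) :
    av (fun z => ∑ i ∈ s, f i z) = ∑ i ∈ s, av (f i) := by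
  simp only [av]
  rw [sum_comm, sum_div]

theorem av_mul_sq_le (f g : κ → ℝ) :
    (av fun z => f z * g z) ^ 2 ≤ (av fun z => f z ^ 2) * (av fun z => g z ^ 2) := by
  simp only [av]
  rw [div_mul_div_comm, div_pow, ← sq]
  gcongr
  exact Finset.sum_mul_sq_le_sq_mul_sq _ _ _

theorem abs_av_mul_le (f g : κ → ℝ) :
    |av fun z => f z * g z| ≤ √(av fun z => f z ^ 2) * √(av fun z => g z ^ 2) := by
  rw [← Real.sqrt_mul (av_nonneg fun z => sq_nonneg _), ← Real.sqrt_sq_eq_abs]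
  exact Real.sqrt_le_sqrt (av_mul_sq_le f g)

theorem av_sq_le (f : κ → ℝ) : (av f) ^ 2 ≤ av fun z => f z ^ 2 := by
  rcases isEmpty_or_nonempty κ with h | h
  · simp [av]
  · have := av_mul_sq_le f fun _ => 1
    have h1 : (av fun _ : κ => (1 : ℝ) ^ 2) = 1 := by simp [av]
    rw [h1] at this
    simpa using this

variable {Ω : Type*} [MeasurableSpace Ω] {μ : Measure Ω}

theorem lintegral_enorm_av_le {f : κ → Ω → ℝ} (hm : ∀ z, AEMeasurable (f z) μ) {C : ℝ≥0∞}
    (h : ∀ z, ∫⁻ ω, ‖f z ω‖ₑ ∂μ ≤ C) : ∫⁻ ω, ‖av fun z => f z ω‖ₑ ∂μ ≤ C := by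
  rcases isEmpty_or_nonempty κ with he | he
  · simp [av]
  have hc : (card κ : ℝ≥0∞) ≠ 0 := by simp
  calc ∫⁻ ω, ‖av fun z => f z ω‖ₑ ∂μ
      ≤ ∫⁻ ω, (∑ z, ‖f z ω‖ₑ) * (card κ : ℝ≥0∞)⁻¹ ∂μ := by
        refine lintegral_mono fun ω => ?_
        simp only [av]
        rw [div_eq_mul_inv, enorm_mul, enorm_inv (by simp)]
        gcongr
        · exact enorm_sum_le _ _
        · rw [Real.enorm_natCast]
    _ = (∑ z, ∫⁻ ω, ‖f z ω‖ₑ ∂μ) * (card κ : ℝ≥0∞)⁻¹ := by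
        rw [lintegral_mul_const'' _ (Finset.aemeasurable_fun_sum _ fun z _ => (hm z).enorm),
          lintegral_finsetSum' _ fun z _ => (hm z).enorm]
    _ ≤ (∑ _z : κ, C) * (card κ : ℝ≥0∞)⁻¹ := by gcongr; exact h _
    _ = C := by
        rw [sum_const, card_univ, nsmul_eq_mul, mul_comm, ← mul_assoc,
          ENNReal.inv_mul_cancel hc (by simp), one_mul]

theorem aemeasurable_av {f : κ → Ω → ℝ} (hm : ∀ z, AEMeasurable (f z) μ) :
    AEMeasurable (fun ω => av fun z => f z ω) μ :=
  (Finset.aemeasurable_fun_sum _ fun z _ => hm z).div_const _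

end Average

section AverageOrder

variable {κ : ℕ → Type*} [∀ k, Fintype (κ k)] {Ω : Type*} [MeasurableSpace Ω] {μ : Measure Ω}
  {f g f' g' : ∀ k, κ k → Ω → ℝ}

theorem OP.av_of_lintegral (hm : ∀ k z, AEMeasurable (f k z) μ) {δ : ℕ → ℝ≥0∞}
    (hδ : Tendsto δ atTop (𝓝 0)) (h : ∀ᶠ k in atTop, ∀ z, ∫⁻ ω, ‖f k z ω‖ₑ ∂μ ≤ δ k) :
    OP μ (fun k ω => av fun z => f k z ω) :=
  OP.of_lintegral (fun k => aemeasurable_av (hm k))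
    (tendsto_of_tendsto_of_tendsto_of_le_of_le' tendsto_const_nhds hδ
      (of_forall fun _ => zero_le)
      (h.mono fun k hk => lintegral_enorm_av_le (hm k) hk))

theorem BP.av_of_lintegral (hm : ∀ k z, AEMeasurable (f k z) μ) {C : ℝ≥0∞} (hC : C ≠ ∞)
    (h : ∀ᶠ k in atTop, ∀ z, ∫⁻ ω, ‖f k z ω‖ₑ ∂μ ≤ C) :
    BP μ (fun k ω => av fun z => f k z ω) :=
  BP.of_lintegral (fun k => aemeasurable_av (hm k)) hC
    (h.mono fun k hk => lintegral_enorm_av_le (hm k) hk)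

theorem OP.av_mul (hf : OP μ fun k ω => av fun z => f k z ω ^ 2)
    (hg : BP μ fun k ω => av fun z => g k z ω ^ 2) : OP μ fun k ω => av fun z => f k z ω * g k z ω :=
  (hf.sqrt.mul_bp hg.sqrt).mono (of_forall fun k => of_forall fun ω => by
    rw [abs_of_nonneg (a := √_ * √_) (by positivity)]
    exact abs_av_mul_le _ _)

theorem BP.av_mul (hf : BP μ fun k ω => av fun z => f k z ω ^ 2)
    (hg : BP μ fun k ω => av fun z => g k z ω ^ 2) : BP μ fun k ω => av fun z => f k z ω * g k z ω :=
  (hf.sqrt.mul hg.sqrt).mono (of_forall fun k => of_forall fun ω => by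
    rw [abs_of_nonneg (a := √_ * √_) (by positivity)]
    exact abs_av_mul_le _ _)

theorem BP.av_sq_add (hf : BP μ fun k ω => av fun z => f k z ω ^ 2)
    (hg : BP μ fun k ω => av fun z => g k z ω ^ 2) :
    BP μ fun k ω => av fun z => (f k z ω + g k z ω) ^ 2 :=
  ((hf.add hg).const_mul 2).mono (of_forall fun k => of_forall fun ω => by
    rw [← av_add, ← av_const_mul, abs_of_nonneg (av_nonneg fun z => sq_nonneg _),
      abs_of_nonneg (av_nonneg fun z => by positivity)]
    exact av_mono fun z => by nlinarith [sq_nonneg (f k z ω - g k z ω)])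

/-- Averages of products depend continuously on the factors in mean square. -/
theorem OP.av_mul_sub (hf : OP μ fun k ω => av fun z => (f' k z ω - f k z ω) ^ 2)
    (hg : OP μ fun k ω => av fun z => (g' k z ω - g k z ω) ^ 2)
    (hf' : BP μ fun k ω => av fun z => f k z ω ^ 2)
    (hg' : BP μ fun k ω => av fun z => g k z ω ^ 2) :
    OP μ fun k ω => (av fun z => f' k z ω * g' k z ω) - av fun z => f k z ω * g k z ω := by
  have h1 := (hf.av_mul hg').add ((hg.av_mul hf').add (hf.av_mul hg.bp))
  refine h1.congr (of_forall fun k => of_forall fun ω => ?_)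
  rw [← av_add, ← av_add, ← av_sub]
  congr 1
  funext z
  ring

end AverageOrder

/-! ### Exchangeability of the data -/

section Exchangeability

variable {ι : Type*} [Fintype ι] {𝒳 : ι → Type*} [∀ i, MeasurableSpace (𝒳 i)]

/-- The data with the observations of model `i` permuted by `σ i`. -/
def permData (σ : ι → Equiv.Perm ℕ) (x : Data 𝒳) : Data 𝒳 := fun i j => x i (σ i j)

theorem measurePreserving_permData (F : ∀ i, Measure (𝒳 i)) [∀ i, IsProbabilityMeasure (F i)]
    (σ : ι → Equiv.Perm ℕ) : MeasurePreserving (permData (𝒳 := 𝒳) σ) (dataLaw F) (dataLaw F) := by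
  refine measurePreserving_pi _ _ (f := fun i (y : ℕ → 𝒳 i) j => y (σ i j)) fun i => ?_
  have hm : Measurable fun (y : ℕ → 𝒳 i) j => y (σ i j) := by fun_prop
  refine ⟨hm, Measure.eq_infinitePi _ fun s t ht => ?_⟩
  rw [Measure.map_apply hm (MeasurableSet.pi s.countable_toSet fun j _ => ht j)]
  have h1 : (fun (y : ℕ → 𝒳 i) j => y (σ i j)) ⁻¹' (Set.pi (s : Set ℕ) t)
      = Set.pi ((s.map (σ i).toEmbedding : Finset ℕ) : Set ℕ) (fun j => t ((σ i).symm j)) := by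
    ext y
    simp only [Set.mem_preimage, Set.mem_pi, Finset.mem_coe, Finset.mem_map_equiv]
    exact ⟨fun h l hl => by simpa using h _ hl, fun h l hl => by simpa using h (σ i l) (by simpa)⟩
  rw [h1, Measure.infinitePi_pi _ fun j _ => ht _, Finset.prod_map]
  simp

theorem empData_permData {n : ι → ℕ} {σ : ι → Equiv.Perm ℕ} (hσ : ∀ i, ∀ j < n i, σ i j < n i)
    (x : Data 𝒳) : empData n (permData σ x) = empData n x := by
  funext i
  simp only [empData, emp, permData]
  congr 1
  let e : Fin (n i) → Fin (n i) := fun j => ⟨σ i j, hσ i j j.2⟩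
  have he : Function.Injective e := fun a b h => by
    simp only [e, Fin.mk.injEq] at h
    exact Fin.ext ((σ i).injective h)
  exact Fintype.sum_bijective e (Finite.injective_iff_bijective.1 he) _ _ fun j => rfl

theorem exists_perm_triple [DecidableEq ι] {n : ι → ℕ} (hn : ∀ i, 3 ≤ n i) {i j k : ι}
    {a b c : ℕ} (ha : a < n i) (hb : b < n j) (hc : c < n k) :
    ∃ j₂ < 2, ∃ j₃ < 3, ∃ σ : ι → Equiv.Perm ℕ, (∀ i, ∀ j < n i, σ i j < n i) ∧
      σ i 0 = a ∧ σ j j₂ = b ∧ σ k j₃ = c := by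
  have hswap : ∀ (m : ℕ) (x y l : ℕ), x < m → y < m → l < m → Equiv.swap x y l < m := by
    intro m x y l hx hy hl
    rw [Equiv.swap_apply_def]
    split_ifs <;> assumption
  have hinv : ∀ σ : ι → Equiv.Perm ℕ, (∀ i, ∀ j < n i, σ i j < n i) → ∀ i, ∀ l < n i,
      ∃ l' < n i, σ i l' = l := by
    intro σ hσ i l hl
    let e : Fin (n i) → Fin (n i) := fun j => ⟨σ i j, hσ i j j.2⟩
    have he : Function.Injective e := fun a b h => by
      simp only [e, Fin.mk.injEq] at h
      exact Fin.ext ((σ i).injective h)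
    obtain ⟨l', hl'⟩ := Finite.surjective_of_injective he ⟨l, hl⟩
    exact ⟨l', l'.2, congrArg Fin.val hl'⟩
  let ρ₁ : ι → Equiv.Perm ℕ := fun i' => if i' = i then Equiv.swap 0 a else 1
  have hρ₁ : ∀ i, ∀ j < n i, ρ₁ i j < n i := by
    intro i' l hl
    simp only [ρ₁]
    split_ifs with h
    · subst h; exact hswap _ _ _ _ (by linarith [hn i']) ha hl
    · simpa using hl
  have hρ₁a : ρ₁ i 0 = a := by simp [ρ₁]
  obtain ⟨b', hb'n, hb'⟩ := hinv ρ₁ hρ₁ j b hb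
  obtain ⟨j₂, hj₂, ρ₂, hρ₂, hρ₂0, hρ₂b⟩ : ∃ j₂ < 2, ∃ ρ₂ : ι → Equiv.Perm ℕ,
      (∀ i, ∀ j < n i, ρ₂ i j < n i) ∧ ρ₂ i 0 = 0 ∧ ρ₂ j j₂ = b' := by
    by_cases h : j = i ∧ b' = 0
    · exact ⟨0, by norm_num, 1, fun i j hj => by simpa using hj, by simp, by simp [h.2]⟩
    · refine ⟨1, by norm_num, fun i' => if i' = j then Equiv.swap 1 b' else 1, ?_, ?_, by simp⟩
      · intro i' l hl
        dsimp only
        split_ifs with h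
        · subst h; exact hswap _ _ _ _ (by linarith [hn i']) hb'n hl
        · simpa using hl
      · dsimp only
        split_ifs with h'
        · refine Equiv.swap_apply_of_ne_of_ne (by norm_num) fun h0 => h ⟨h'.symm, h0.symm⟩
        · simp
  have h12 : ∀ i, ∀ j < n i, (ρ₁ i * ρ₂ i) j < n i := fun i j hj => hρ₁ i _ (hρ₂ i j hj)
  obtain ⟨c', hc'n, hc'⟩ := hinv (fun i => ρ₁ i * ρ₂ i) h12 k c hc
  obtain ⟨j₃, hj₃, ρ₃, hρ₃, hρ₃0, hρ₃b, hρ₃c⟩ : ∃ j₃ < 3, ∃ ρ₃ : ι → Equiv.Perm ℕ,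
      (∀ i, ∀ j < n i, ρ₃ i j < n i) ∧ ρ₃ i 0 = 0 ∧ ρ₃ j j₂ = j₂ ∧ ρ₃ k j₃ = c' := by
    by_cases h : k = i ∧ c' = 0
    · exact ⟨0, by norm_num, 1, fun i j hj => by simpa using hj, by simp, by simp, by simp [h.2]⟩
    by_cases h' : k = j ∧ c' = j₂
    · exact ⟨j₂, by omega, 1, fun i j hj => by simpa using hj, by simp, by simp, by simp [h'.2]⟩
    refine ⟨2, by norm_num, fun i' => if i' = k then Equiv.swap 2 c' else 1, ?_, ?_, ?_, by simp⟩
    · intro i' l hl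
      dsimp only
      split_ifs with h
      · subst h; exact hswap _ _ _ _ (by linarith [hn i']) hc'n hl
      · simpa using hl
    · dsimp only
      split_ifs with h''
      · refine Equiv.swap_apply_of_ne_of_ne (by norm_num) fun h0 => h ⟨h''.symm, h0.symm⟩
      · simp
    · dsimp only
      split_ifs with h''
      · refine Equiv.swap_apply_of_ne_of_ne (by omega) fun h0 => h' ⟨h''.symm, h0.symm⟩
      · simp
  refine ⟨j₂, hj₂, j₃, hj₃, fun i => ρ₁ i * ρ₂ i * ρ₃ i,
    fun i j hj => h12 i _ (hρ₃ i j hj), ?_, ?_, ?_⟩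
  · simp [hρ₃0, hρ₂0, hρ₁a]
  · simp [hρ₃b, hρ₂b, hb']
  · simpa [hρ₃c] using hc'

variable [DecidableEq ι] (F : ∀ i, Measure (𝒳 i)) [∀ i, IsProbabilityMeasure (F i)]

theorem lintegral_triple_le {n : ι → ℕ} (hn : ∀ i, 3 ≤ n i) {i j k : ι}
    {G : (∀ i, Measure (𝒳 i)) → 𝒳 i → 𝒳 j → 𝒳 k → ℝ≥0∞}
    (hG : ∀ j₂ j₃, Measurable fun x : Data 𝒳 => G (empData n x) (x i 0) (x j j₂) (x k j₃))
    {C : ℝ≥0∞} (hC : ∀ j₂ < 2, ∀ j₃ < 3,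
      ∫⁻ x, G (empData n x) (x i 0) (x j j₂) (x k j₃) ∂(dataLaw F) ≤ C)
    {a b c : ℕ} (ha : a < n i) (hb : b < n j) (hc : c < n k) :
    ∫⁻ x, G (empData n x) (x i a) (x j b) (x k c) ∂(dataLaw F) ≤ C := by
  obtain ⟨j₂, hj₂, j₃, hj₃, σ, hσ, rfl, rfl, rfl⟩ := exists_perm_triple hn ha hb hc
  refine le_of_eq_of_le ?_ (hC j₂ hj₂ j₃ hj₃)
  rw [← (measurePreserving_permData F σ).lintegral_comp (hG j₂ j₃)]
  refine lintegral_congr fun x => ?_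
  rw [empData_permData hσ]
  rfl

theorem lintegral_pair_le {n : ι → ℕ} (hn : ∀ i, 3 ≤ n i) {i j : ι}
    {G : (∀ i, Measure (𝒳 i)) → 𝒳 i → 𝒳 j → ℝ≥0∞}
    (hG : ∀ j₂, Measurable fun x : Data 𝒳 => G (empData n x) (x i 0) (x j j₂))
    {C : ℝ≥0∞} (hC : ∀ j₂ < 2, ∫⁻ x, G (empData n x) (x i 0) (x j j₂) ∂(dataLaw F) ≤ C)
    {a b : ℕ} (ha : a < n i) (hb : b < n j) :
    ∫⁻ x, G (empData n x) (x i a) (x j b) ∂(dataLaw F) ≤ C :=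
  lintegral_triple_le F hn (k := i) (G := fun P x y _ => G P x y) (fun j₂ _ => hG j₂)
    (fun j₂ h _ _ => hC j₂ h) ha hb ha

theorem lintegral_single_le {n : ι → ℕ} (hn : ∀ i, 3 ≤ n i) {i : ι}
    {G : (∀ i, Measure (𝒳 i)) → 𝒳 i → ℝ≥0∞}
    (hG : Measurable fun x : Data 𝒳 => G (empData n x) (x i 0))
    {C : ℝ≥0∞} (hC : ∫⁻ x, G (empData n x) (x i 0) ∂(dataLaw F) ≤ C) {a : ℕ} (ha : a < n i) :
    ∫⁻ x, G (empData n x) (x i a) ∂(dataLaw F) ≤ C :=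
  lintegral_pair_le F hn (j := i) (G := fun P x _ => G P x) (fun _ => hG) (fun _ _ => hC) ha ha

theorem memLp_triple {i j k : ι} {h : 𝒳 i → 𝒳 j → 𝒳 k → ℝ} {p : ℝ≥0∞}
    (hC : ∀ j₂ < 2, ∀ j₃ < 3, MemLp (fun x : Data 𝒳 => h (x i 0) (x j j₂) (x k j₃)) p (dataLaw F))
    (a b c : ℕ) : MemLp (fun x : Data 𝒳 => h (x i a) (x j b) (x k c)) p (dataLaw F) := by
  obtain ⟨j₂, hj₂, j₃, hj₃, σ, -, rfl, rfl, rfl⟩ := exists_perm_triple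
    (n := fun _ => a + b + c + 3) (by intro i; omega) (i := i) (j := j) (k := k) (a := a) (b := b)
    (c := c) (by omega) (by omega) (by omega)
  exact (hC j₂ hj₂ j₃ hj₃).comp_measurePreserving (measurePreserving_permData F σ)

theorem memLp_pair {i j : ι} {h : 𝒳 i → 𝒳 j → ℝ} {p : ℝ≥0∞}
    (hC : ∀ j₂ < 2, MemLp (fun x : Data 𝒳 => h (x i 0) (x j j₂)) p (dataLaw F))
    (a b : ℕ) : MemLp (fun x : Data 𝒳 => h (x i a) (x j b)) p (dataLaw F) :=
  memLp_triple F (k := i) (h := fun x y _ => h x y) (fun j₂ h _ _ => hC j₂ h) a b a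

/-- The law of large numbers in probability along sample sizes tending to infinity. -/
theorem op_av_sub_integral {i : ι} {f : 𝒳 i → ℝ} (hfm : Measurable f) (hf : Integrable f (F i))
    {n : ℕ → ℕ} (hn : Tendsto n atTop atTop) :
    OP (dataLaw F) fun k x => (av fun a : Fin (n k) => f (x i a)) - ∫ y, f y ∂(F i) := by
  have hI := indepCoord_data F
  have hmp : ∀ a : ℕ, MeasurePreserving (fun x : Data 𝒳 => x i a) (dataLaw F) (F i) := fun a =>
    hI.measurePreserving ⟨i, a⟩
  have hae : ∀ᵐ x ∂(dataLaw F), Tendsto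
      (fun m : ℕ => (∑ a ∈ Finset.range m, f (x i a)) / m) atTop (𝓝 (∫ y, f y ∂(F i))) := by
    have h0 := strong_law_ae_real (μ := dataLaw F) (fun a (x : Data 𝒳) => f (x i a))
      ((hmp 0).integrable_comp_of_integrable hf) ?_ ?_
    · have : ∫ x : Data 𝒳, f (x i 0) ∂(dataLaw F) = ∫ y, f y ∂(F i) :=
        hI.integral_comp (p := ⟨i, 0⟩) hfm.aestronglyMeasurable
      simpa only [this] using h0
    · intro a b hab
      refine IndepFun.comp (φ := f) (ψ := f) ?_ hfm hfm
      rw [indepFun_iff_map_prod_eq_prod_map_map (hmp a).aemeasurable (hmp b).aemeasurable,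
        (hmp a).map_eq, (hmp b).map_eq]
      exact (hI.measurePreserving_pair (p := ⟨i, a⟩) (q := ⟨i, b⟩) (by simpa using hab)).map_eq
    · intro a
      exact (IdentDistrib.mk (hmp a).aemeasurable (hmp 0).aemeasurable
        ((hmp a).map_eq.trans (hmp 0).map_eq.symm)).comp hfm
  have hm := tendstoInMeasure_of_tendsto_ae (fun m => ?_) hae
  · have h2 := hm.comp hn
    intro ε hε
    have h3 := (tendstoInMeasure_iff_norm.1 h2) ε hε
    refine tendsto_measure_zero_of_le (of_forall fun k => of_forall
      fun x (hx : ε < _) => ?_) h3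
    show ε ≤ _
    simp only [Function.comp, Real.norm_eq_abs]
    refine hx.le.trans (le_of_eq ?_)
    rw [Finset.sum_range (fun a => f (x i a))]
    simp [av]
  · refine Measurable.aestronglyMeasurable ?_
    exact (measurable_fun_sum _ fun a _ => hfm.comp (hmp a).measurable).div_const _

end Exchangeability

/-! ### Variance of a third order von Mises expansion -/

section Variance

variable {Ω : Type*} [MeasurableSpace Ω] {μ : Measure Ω} [IsProbabilityMeasure μ]

theorem sq_integral_mul_le {f g : Ω → ℝ} (hf : MemLp f 2 μ) (hg : MemLp g 2 μ) :
    (∫ ω, f ω * g ω ∂μ) ^ 2 ≤ (∫ ω, f ω ^ 2 ∂μ) * ∫ ω, g ω ^ 2 ∂μ := by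
  have hfg : Integrable (fun ω => f ω * g ω) μ := hf.integrable_mul hg
  have key : ∀ t : ℝ, 0 ≤ (∫ ω, g ω ^ 2 ∂μ) * (t * t) + (2 * ∫ ω, f ω * g ω ∂μ) * t
      + ∫ ω, f ω ^ 2 ∂μ := by
    intro t
    have h0 : 0 ≤ ∫ ω, (f ω + t * g ω) ^ 2 ∂μ := integral_nonneg fun ω => sq_nonneg _
    have h1 : ∫ ω, (f ω + t * g ω) ^ 2 ∂μ
        = ∫ ω, (f ω ^ 2 + (2 * t) * (f ω * g ω)) + t ^ 2 * g ω ^ 2 ∂μ := by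
      congr 1; funext ω; ring
    have h2 : Integrable (fun ω => f ω ^ 2 + (2 * t) * (f ω * g ω)) μ :=
      hf.integrable_sq.add (hfg.const_mul _)
    rw [h1, integral_add h2 (hg.integrable_sq.const_mul _),
      integral_add hf.integrable_sq (hfg.const_mul _), integral_const_mul, integral_const_mul] at h0
    nlinarith
  have := discrim_le_zero key
  rw [discrim] at this
  nlinarith

theorem abs_covariance_le {f g : Ω → ℝ} (hf : MemLp f 2 μ) (hg : MemLp g 2 μ) :
    |covariance f g μ| ≤ √(variance f μ) * √(variance g μ) := by
  rw [← Real.sqrt_mul (variance_nonneg _ _), ← Real.sqrt_sq_eq_abs,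
    variance_eq_integral hf.aemeasurable, variance_eq_integral hg.aemeasurable]
  exact Real.sqrt_le_sqrt (sq_integral_mul_le (hf.sub (memLp_const _)) (hg.sub (memLp_const _)))

theorem variance_le_integral_sq {f : Ω → ℝ} (hf : MemLp f 2 μ) :
    variance f μ ≤ ∫ ω, f ω ^ 2 ∂μ := by
  rw [variance_eq_sub hf]
  have : ∫ ω, (f ^ 2) ω ∂μ = ∫ ω, f ω ^ 2 ∂μ := rfl
  linarith [sq_nonneg (∫ ω, f ω ∂μ)]

theorem variance_add_le {f g : Ω → ℝ} (hf : MemLp f 2 μ) (hg : MemLp g 2 μ) :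
    variance (fun ω => f ω + g ω) μ ≤ 2 * variance f μ + 2 * variance g μ := by
  rw [variance_fun_add hf hg]
  have h := abs_covariance_le hf hg
  have h1 := le_abs_self (covariance f g μ)
  nlinarith [sq_nonneg (√(variance f μ) - √(variance g μ)), Real.sq_sqrt (variance_nonneg f μ),
    Real.sq_sqrt (variance_nonneg g μ)]

/-- The variance of a sum with terms of decreasing order. -/
theorem abs_variance_sum_sub_le {L Q C e : Ω → ℝ} (hL : MemLp L 2 μ) (hQ : MemLp Q 2 μ)
    (hC : MemLp C 2 μ) (he : MemLp e 2 μ) (c₀ : ℝ) {qv cv ev : ℝ} (hq : variance Q μ ≤ qv)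
    (hc : variance C μ ≤ cv) (hev : variance e μ ≤ ev) :
    |variance (fun ω => c₀ + (L ω + Q ω + C ω + e ω)) μ
      - (variance L μ + 2 * covariance L Q μ + variance Q μ + 2 * covariance L C μ)|
    ≤ 2 * (√qv * √cv) + cv + 2 * (√(2 * (2 * variance L μ + 2 * qv) + 2 * cv) * √ev) + ev := by
  have hLQ : MemLp (fun ω => L ω + Q ω) 2 μ := hL.add hQ
  have hT : MemLp (fun ω => L ω + Q ω + C ω) 2 μ := hLQ.add hC
  have hTe : MemLp (fun ω => L ω + Q ω + C ω + e ω) 2 μ := hT.add he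
  have hcov : covariance (fun ω => L ω + Q ω) C μ = covariance L C μ + covariance Q C μ :=
    covariance_add_left hL hQ hC
  rw [variance_const_add hTe.aestronglyMeasurable, variance_fun_add hT he, variance_fun_add hLQ hC,
    variance_fun_add hL hQ, hcov]
  have h1 := abs_covariance_le hQ hC
  have h2 := abs_covariance_le hT he
  have h3 := variance_add_le hLQ hC
  have h4 := variance_add_le hL hQ
  have h5 : √(variance Q μ) * √(variance C μ) ≤ √qv * √cv := by gcongr
  have h6 : √(variance (fun ω => L ω + Q ω + C ω) μ) * √(variance e μ)
      ≤ √(2 * (2 * variance L μ + 2 * qv) + 2 * cv) * √ev := by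
    gcongr; linarith
  have h7 := variance_nonneg C μ
  have h8 := variance_nonneg e μ
  rw [abs_le]
  obtain ⟨h1a, h1b⟩ := abs_le.1 h1
  obtain ⟨h2a, h2b⟩ := abs_le.1 h2
  constructor <;> linarith

end Variance

section QuadraticVariance

variable {Ω : Type*} [MeasurableSpace Ω] {I : Type*} {α : I → Type*} [∀ p, MeasurableSpace (α p)]
  {μ : Measure Ω} [IsProbabilityMeasure μ] {P : ∀ p, Measure (α p)}
  [∀ p, IsProbabilityMeasure (P p)] {X : ∀ p, Ω → α p} [Fintype I] [DecidableEq I]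
  {b : ∀ p q, α p → α q → ℝ}

theorem IndepCoord.variance_kernel₂ (h : IndepCoord μ P X) (hb : Kernel₂ μ P X b)
    (hm : ∀ p, AEStronglyMeasurable (fun x => b p p x x) (P p)) :
    variance (fun ω => ∑ p, ∑ q, b p q (X p ω) (X q ω)) μ
      = ∑ p, ∑ q, (∫ ω, b p q (X p ω) (X q ω) ^ 2 ∂μ
        + ∫ ω, b p q (X p ω) (X q ω) * b q p (X q ω) (X p ω) ∂μ)
        + ∑ p, (variance (fun ω => b p p (X p ω) (X p ω)) μ
          - 2 * ∫ ω, b p p (X p ω) (X p ω) ^ 2 ∂μ) := by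
  let m : I → ℝ := fun p => ∫ x, b p p x x ∂P p
  have hmi : ∀ p, ∫ ω, b p p (X p ω) (X p ω) ∂μ = m p := fun p => h.integral_comp (hm p)
  let b' : ∀ p q, α p → α q → ℝ := fun p q x y => b p q x y - if p = q then m p else 0
  have hb' : Kernel₂ μ P X b' := by
    refine ⟨fun p q => (hb.memLp p q).sub (memLp_const _), fun p q hpq => ?_, fun p q hpq => ?_⟩
    · simpa [b', hpq] using hb.left p q hpq
    · simpa [b', hpq] using hb.right p q hpq
  have hint : ∀ p, Integrable (fun x => b p p x x) (P p) := fun p => by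
    have := (hb.memLp p p).integrable (by norm_num)
    exact ((h.measurePreserving p).integrable_comp (hm p)).1 this
  have hd : ∀ p, ∫ x, b' p p x x ∂P p = 0 := fun p => by
    simp only [b', if_true]
    rw [integral_sub (hint p) (integrable_const _)]
    simp [m]
  have h1 := h.integral_sq_kernel₂ hb' hd
  have hQ : MemLp (fun ω => ∑ p, ∑ q, b p q (X p ω) (X q ω)) 2 μ :=
    memLp_finsetSum _ fun p _ => memLp_finsetSum _ fun q _ => hb.memLp p q
  have hEQ : ∫ ω, (∑ p, ∑ q, b p q (X p ω) (X q ω)) ∂μ = ∑ p, m p := by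
    rw [integral_finsetSum _ fun p _ => integrable_finsetSum _ fun q _ =>
      (hb.memLp p q).integrable (by norm_num)]
    refine sum_congr rfl fun p _ => ?_
    rw [integral_finsetSum _ fun q _ => (hb.memLp p q).integrable (by norm_num),
      Finset.sum_eq_single p _ (by simp), hmi]
    intro q _ hq
    have := h.kernel₂_vanish_left hb hq.symm (g := fun _ => 1) (memLp_const _) fun _ _ _ => rfl
    simpa using this
  have h2 : ∀ ω, (∑ p, ∑ q, b p q (X p ω) (X q ω)) - ∑ p, m p
      = ∑ p, ∑ q, b' p q (X p ω) (X q ω) := fun ω => by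
    simp only [b', sum_sub_distrib]
    simp
  rw [variance_eq_integral hQ.aemeasurable, hEQ]
  simp_rw [h2]
  rw [h1]
  have h3 : ∀ p, variance (fun ω => b p p (X p ω) (X p ω)) μ
      = ∫ ω, b' p p (X p ω) (X p ω) ^ 2 ∂μ := fun p => by
    rw [variance_eq_integral (hb.memLp p p).aemeasurable, hmi]
    simp [b']
  have h4 : ∀ p, ∑ q, (∫ ω, b' p q (X p ω) (X q ω) ^ 2 ∂μ
        + ∫ ω, b' p q (X p ω) (X q ω) * b' q p (X q ω) (X p ω) ∂μ)
      = ∑ q, (∫ ω, b p q (X p ω) (X q ω) ^ 2 ∂μ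
        + ∫ ω, b p q (X p ω) (X q ω) * b q p (X q ω) (X p ω) ∂μ)
        + (2 * variance (fun ω => b p p (X p ω) (X p ω)) μ
          - 2 * ∫ ω, b p p (X p ω) (X p ω) ^ 2 ∂μ) := fun p => by
    rw [← Finset.add_sum_erase _ _ (mem_univ p),
      ← Finset.add_sum_erase _ (fun q => ∫ ω, b p q (X p ω) (X q ω) ^ 2 ∂μ
        + ∫ ω, b p q (X p ω) (X q ω) * b q p (X q ω) (X p ω) ∂μ) (mem_univ p), h3]
    have h5 : ∑ q ∈ Finset.univ.erase p, (∫ ω, b' p q (X p ω) (X q ω) ^ 2 ∂μ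
        + ∫ ω, b' p q (X p ω) (X q ω) * b' q p (X q ω) (X p ω) ∂μ)
      = ∑ q ∈ Finset.univ.erase p, (∫ ω, b p q (X p ω) (X q ω) ^ 2 ∂μ
        + ∫ ω, b p q (X p ω) (X q ω) * b q p (X q ω) (X p ω) ∂μ) := by
      refine sum_congr rfl fun q hq => ?_
      have hqp := Finset.ne_of_mem_erase hq
      simp only [b', hqp, hqp.symm, if_false, sub_zero]
    rw [h5]
    have h6 : ∫ ω, b' p p (X p ω) (X p ω) * b' p p (X p ω) (X p ω) ∂μ
      = ∫ ω, b' p p (X p ω) (X p ω) ^ 2 ∂μ := by simp only [sq]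
    have h7 : ∫ ω, b p p (X p ω) (X p ω) * b p p (X p ω) (X p ω) ∂μ
      = ∫ ω, b p p (X p ω) (X p ω) ^ 2 ∂μ := by simp only [sq]
    rw [h6, h7]
    ring
  simp_rw [h4, ← h3]
  rw [sum_add_distrib]
  simp only [sum_sub_distrib, ← mul_sum]
  ring

end QuadraticVariance

section VonMises

variable {ι : Type*} [Fintype ι] [DecidableEq ι] {𝒴 : ι → Type*} [∀ i, MeasurableSpace (𝒴 i)]
  {Ω : Type*} [MeasurableSpace Ω]

/-- Independent samples of sizes `s i` from `P i`, together with degenerate symmetric kernels. -/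
structure VonMises (μ : Measure Ω) (P : ∀ i, Measure (𝒴 i)) (s : ι → ℕ)
    (X : ∀ p : Σ i, Fin (s i), Ω → 𝒴 p.1) (h₁ : ∀ i, 𝒴 i → ℝ) (h₂ : ∀ i j, 𝒴 i → 𝒴 j → ℝ)
    (h₃ : ∀ i j k, 𝒴 i → 𝒴 j → 𝒴 k → ℝ) : Prop where
  indep : IndepCoord μ (fun p : Σ i, Fin (s i) => P p.1) X
  meas₁ : ∀ i, Measurable (h₁ i)
  meas₂ : ∀ i j, Measurable fun z : 𝒴 i × 𝒴 j => h₂ i j z.1 z.2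
  meas₃ : ∀ i j k, Measurable fun z : 𝒴 i × 𝒴 j × 𝒴 k => h₃ i j k z.1 z.2.1 z.2.2
  kernel₁ : Kernel₁ μ (fun p : Σ i, Fin (s i) => P p.1) X fun p => h₁ p.1
  kernel₂ : Kernel₂ μ (fun p : Σ i, Fin (s i) => P p.1) X fun p q => h₂ p.1 q.1
  kernel₃ : Kernel₃ μ (fun p : Σ i, Fin (s i) => P p.1) X fun p q r => h₃ p.1 q.1 r.1
  symm₂ : ∀ p q, ∀ᵐ ω ∂μ, h₂ q.1 p.1 (X q ω) (X p ω) = h₂ p.1 q.1 (X p ω) (X q ω)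
  symm₃₁ : ∀ p r, ∀ᵐ ω ∂μ,
    h₃ r.1 p.1 r.1 (X r ω) (X p ω) (X r ω) = h₃ p.1 r.1 r.1 (X p ω) (X r ω) (X r ω)
  symm₃₂ : ∀ p r, ∀ᵐ ω ∂μ,
    h₃ r.1 r.1 p.1 (X r ω) (X r ω) (X p ω) = h₃ p.1 r.1 r.1 (X p ω) (X r ω) (X r ω)

variable {μ : Measure Ω} [IsProbabilityMeasure μ] {P : ∀ i, Measure (𝒴 i)}
  [∀ i, IsProbabilityMeasure (P i)] {s : ι → ℕ} {X : ∀ p : Σ i, Fin (s i), Ω → 𝒴 p.1}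
  {h₁ : ∀ i, 𝒴 i → ℝ} {h₂ : ∀ i j, 𝒴 i → 𝒴 j → ℝ} {h₃ : ∀ i j k, 𝒴 i → 𝒴 j → 𝒴 k → ℝ}

/-- The linear term. -/
def linTerm (X : ∀ p : Σ i, Fin (s i), Ω → 𝒴 p.1) (h₁ : ∀ i, 𝒴 i → ℝ) (ω : Ω) : ℝ :=
  ∑ p : Σ i, Fin (s i), h₁ p.1 (X p ω) / s p.1

/-- The quadratic term. -/
def quadTerm (X : ∀ p : Σ i, Fin (s i), Ω → 𝒴 p.1) (h₂ : ∀ i j, 𝒴 i → 𝒴 j → ℝ)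
    (ω : Ω) : ℝ :=
  ∑ p : Σ i, Fin (s i), ∑ q : Σ i, Fin (s i), h₂ p.1 q.1 (X p ω) (X q ω) / (2 * s p.1 * s q.1)

/-- The cubic term. -/
def cubTerm (X : ∀ p : Σ i, Fin (s i), Ω → 𝒴 p.1)
    (h₃ : ∀ i j k, 𝒴 i → 𝒴 j → 𝒴 k → ℝ) (ω : Ω) : ℝ :=
  ∑ p : Σ i, Fin (s i), ∑ q : Σ i, Fin (s i), ∑ r : Σ i, Fin (s i),
    h₃ p.1 q.1 r.1 (X p ω) (X q ω) (X r ω) / (6 * s p.1 * s q.1 * s r.1)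

namespace VonMises

theorem kernel₁_div (h : VonMises μ P s X h₁ h₂ h₃) :
    Kernel₁ μ (fun p : Σ i, Fin (s i) => P p.1) X fun p x => h₁ p.1 x / s p.1 :=
  ⟨fun p => (h.kernel₁.memLp p).mul_const _, fun p => by
    rw [integral_div]; simp [h.kernel₁.centred p]⟩

theorem kernel₂_div (h : VonMises μ P s X h₁ h₂ h₃) :
    Kernel₂ μ (fun p : Σ i, Fin (s i) => P p.1) X
      fun p q x y => h₂ p.1 q.1 x y / (2 * s p.1 * s q.1) :=
  ⟨fun p q => (h.kernel₂.memLp p q).mul_const _,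
    fun p q hpq => (h.kernel₂.left p q hpq).mono fun ω hω => by rw [integral_div, hω, zero_div],
    fun p q hpq => (h.kernel₂.right p q hpq).mono fun ω hω => by rw [integral_div, hω, zero_div]⟩

theorem kernel₃_div (h : VonMises μ P s X h₁ h₂ h₃) :
    Kernel₃ μ (fun p : Σ i, Fin (s i) => P p.1) X
      fun p q r x y z => h₃ p.1 q.1 r.1 x y z / (6 * s p.1 * s q.1 * s r.1) :=
  ⟨fun p q r => (h.kernel₃.memLp p q r).mul_const _,
    fun p q r h1 h2 => (h.kernel₃.left p q r h1 h2).mono fun ω hω => by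
      rw [integral_div, hω, zero_div],
    fun p q r h1 h2 => (h.kernel₃.mid p q r h1 h2).mono fun ω hω => by
      rw [integral_div, hω, zero_div],
    fun p q r h1 h2 => (h.kernel₃.right p q r h1 h2).mono fun ω hω => by
      rw [integral_div, hω, zero_div]⟩

theorem memLp_lin (h : VonMises μ P s X h₁ h₂ h₃) : MemLp (linTerm X h₁) 2 μ :=
  memLp_finsetSum _ fun p _ => h.kernel₁_div.memLp p

theorem memLp_quad (h : VonMises μ P s X h₁ h₂ h₃) : MemLp (quadTerm X h₂) 2 μ :=
  memLp_finsetSum _ fun p _ => memLp_finsetSum _ fun q _ => h.kernel₂_div.memLp p q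

theorem memLp_cub (h : VonMises μ P s X h₁ h₂ h₃) : MemLp (cubTerm X h₃) 2 μ :=
  memLp_finsetSum _ fun p _ => memLp_finsetSum _ fun q _ => memLp_finsetSum _ fun r _ =>
    h.kernel₃_div.memLp p q r

theorem integral_one (h : VonMises μ P s X h₁ h₂ h₃) (p : Σ i, Fin (s i)) {f : 𝒴 p.1 → ℝ}
    (hf : Measurable f) : ∫ ω, f (X p ω) ∂μ = ∫ x, f x ∂P p.1 :=
  h.indep.integral_comp hf.aestronglyMeasurable

theorem integral_two (h : VonMises μ P s X h₁ h₂ h₃) {p q : Σ i, Fin (s i)} (hpq : p ≠ q)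
    {f : 𝒴 p.1 × 𝒴 q.1 → ℝ} (hf : Measurable f) :
    ∫ ω, f (X p ω, X q ω) ∂μ = ∫ z, f z ∂((P p.1).prod (P q.1)) := by
  have := h.indep.measurePreserving_pair hpq
  rw [← this.map_eq, integral_map this.measurable.aemeasurable hf.aestronglyMeasurable]

theorem integral_lin (h : VonMises μ P s X h₁ h₂ h₃) : ∫ ω, linTerm X h₁ ω ∂μ = 0 := by
  simp only [linTerm]
  rw [integral_finsetSum _ fun p _ => (h.kernel₁_div.memLp p).integrable (by norm_num)]
  refine Finset.sum_eq_zero fun p _ => ?_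
  rw [h.integral_one p ((h.meas₁ p.1).div_const _)]
  exact h.kernel₁_div.centred p

theorem variance_lin (h : VonMises μ P s X h₁ h₂ h₃) :
    variance (linTerm X h₁) μ = ∑ i, (∫ x, h₁ i x ^ 2 ∂P i) / s i := by
  rw [variance_of_integral_eq_zero h.memLp_lin.aemeasurable h.integral_lin]
  simp only [linTerm]
  rw [h.indep.integral_sq_sum h.kernel₁_div, sum_sigma]
  refine sum_congr rfl fun i _ => ?_
  have : ∀ l : Fin (s i), ∫ ω, (h₁ i (X ⟨i, l⟩ ω) / s i) ^ 2 ∂μ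
      = (∫ x, h₁ i x ^ 2 ∂P i) / (s i : ℝ) ^ 2 := fun l => by
    rw [h.integral_one ⟨i, l⟩ (f := fun x => (h₁ i x / s i) ^ 2)
      (((h.meas₁ i).div_const _).pow_const 2)]
    simp_rw [div_pow]
    rw [integral_div]
  simp only [this, sum_const, card_univ, card_fin, nsmul_eq_mul]
  rcases eq_or_ne (s i) 0 with h0 | h0
  · simp [h0]
  · field_simp

theorem covariance_lin_quad (h : VonMises μ P s X h₁ h₂ h₃) :
    2 * covariance (linTerm X h₁) (quadTerm X h₂) μ
      = ∑ i, (∫ x, h₁ i x * h₂ i i x x ∂P i) / (s i : ℝ) ^ 2 := by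
  rw [covariance_eq_sub h.memLp_lin h.memLp_quad, h.integral_lin, zero_mul, sub_zero]
  have h0 : ∫ ω, (linTerm X h₁ * quadTerm X h₂) ω ∂μ = _ :=
    h.indep.integral_sum_mul_kernel₂ h.kernel₁_div h.kernel₂_div
  rw [h0, sum_sigma, mul_sum]
  refine sum_congr rfl fun i _ => ?_
  have : ∀ l : Fin (s i), ∫ ω, h₁ i (X ⟨i, l⟩ ω) / s i *
      (h₂ i i (X ⟨i, l⟩ ω) (X ⟨i, l⟩ ω) / (2 * s i * s i)) ∂μ
      = (∫ x, h₁ i x * h₂ i i x x ∂P i) / (2 * (s i : ℝ) ^ 3) := fun l => by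
    have hm : Measurable fun x => h₂ i i x x := (h.meas₂ i i).comp (by fun_prop : Measurable fun x => (x, x))
    rw [h.integral_one ⟨i, l⟩ (f := fun x => h₁ i x / s i * (h₂ i i x x / (2 * s i * s i)))
      (((h.meas₁ i).div_const _).mul (hm.div_const _)), ← integral_div]
    congr 1; funext x; rw [div_mul_div_comm]; congr 1; ring
  simp only [this, sum_const, card_univ, card_fin, nsmul_eq_mul]
  rcases eq_or_ne (s i) 0 with h0 | h0
  · simp [h0]
  · field_simp

theorem integral_sq_quad (h : VonMises μ P s X h₁ h₂ h₃) {p q : Σ i, Fin (s i)} (hpq : p ≠ q) :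
    ∫ ω, (h₂ p.1 q.1 (X p ω) (X q ω) / (2 * s p.1 * s q.1)) ^ 2 ∂μ
      = (∫ z, h₂ p.1 q.1 z.1 z.2 ^ 2 ∂((P p.1).prod (P q.1))) / (2 * s p.1 * s q.1) ^ 2 := by
  rw [h.integral_two hpq (f := fun z => (h₂ p.1 q.1 z.1 z.2 / (2 * s p.1 * s q.1)) ^ 2)
    (((h.meas₂ _ _).div_const _).pow_const 2)]
  simp_rw [div_pow]
  rw [integral_div]

theorem integral_sq_quad_diag (h : VonMises μ P s X h₁ h₂ h₃) (p : Σ i, Fin (s i)) :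
    ∫ ω, (h₂ p.1 p.1 (X p ω) (X p ω) / (2 * s p.1 * s p.1)) ^ 2 ∂μ
      = (∫ x, h₂ p.1 p.1 x x ^ 2 ∂(P p.1)) / (2 * s p.1 * s p.1) ^ 2 := by
  have hm : Measurable fun x => h₂ p.1 p.1 x x :=
    (h.meas₂ _ _).comp (by fun_prop : Measurable fun x => (x, x))
  rw [h.integral_one p (f := fun x => (h₂ p.1 p.1 x x / (2 * s p.1 * s p.1)) ^ 2)
    ((hm.div_const _).pow_const 2)]
  simp_rw [div_pow]
  rw [integral_div]

/-- A sum over pairs of sample points splits into the diagonal and the rest. -/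
theorem sum_pairs_eq (f : (Σ i, Fin (s i)) → (Σ i, Fin (s i)) → ℝ) (w : ι → ι → ℝ)
    (hfw : ∀ p q, p ≠ q → f p q = w p.1 q.1) :
    ∑ p, ∑ q, f p q = ∑ i, ∑ j, (s i : ℝ) * s j * w i j + ∑ p, (f p p - w p.1 p.1) := by
  have h1 : ∀ p q, f p q = w p.1 q.1 + if p = q then f p q - w p.1 q.1 else 0 := fun p q => by
    split_ifs with hpq
    · ring
    · rw [hfw p q hpq, add_zero]
  rw [sum_congr rfl fun p _ => sum_congr rfl fun q _ => h1 p q]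
  simp only [sum_add_distrib, Finset.sum_ite_eq, mem_univ, if_true]
  congr 1
  simp only [sum_sigma, sum_const, card_univ, card_fin, nsmul_eq_mul,
    mul_sum]
  exact sum_congr rfl fun i _ => sum_congr rfl fun j _ => by ring

theorem variance_quad_sub (h : VonMises μ P s X h₁ h₂ h₃) :
    variance (quadTerm X h₂) μ
      = ∑ i, ∑ j, (∫ z, h₂ i j z.1 z.2 ^ 2 ∂((P i).prod (P j))) / (2 * s i * s j)
        + ∑ p : Σ i, Fin (s i), (variance (fun ω => h₂ p.1 p.1 (X p ω) (X p ω) / (2 * s p.1 * s p.1)) μ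
          - 2 * ((∫ z, h₂ p.1 p.1 z.1 z.2 ^ 2 ∂((P p.1).prod (P p.1))) / (2 * s p.1 * s p.1) ^ 2)) := by
  have hm : ∀ p : Σ i, Fin (s i), AEStronglyMeasurable
      (fun x => h₂ p.1 p.1 x x / (2 * s p.1 * s p.1)) (P p.1) := fun p =>
    (((h.meas₂ _ _).comp (by fun_prop : Measurable fun x => (x, x))).div_const _).aestronglyMeasurable
  have h1 := h.indep.variance_kernel₂ h.kernel₂_div hm
  have h2 : ∀ p q : Σ i, Fin (s i), ∫ ω, h₂ p.1 q.1 (X p ω) (X q ω) / (2 * s p.1 * s q.1) *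
      (h₂ q.1 p.1 (X q ω) (X p ω) / (2 * s q.1 * s p.1)) ∂μ
      = ∫ ω, (h₂ p.1 q.1 (X p ω) (X q ω) / (2 * s p.1 * s q.1)) ^ 2 ∂μ := fun p q => by
    refine integral_congr_ae ((h.symm₂ p q).mono fun ω hω => ?_)
    simp only [hω]
    rw [sq]; congr 2; ring
  simp only [h2, ← two_mul] at h1
  rw [sum_pairs_eq _ (fun i j => 2 * ((∫ z, h₂ i j z.1 z.2 ^ 2 ∂((P i).prod (P j)))
    / (2 * s i * s j) ^ 2)) fun p q hpq => by rw [h.integral_sq_quad hpq], add_assoc,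
    ← sum_add_distrib] at h1
  refine h1.trans ?_
  congr 1
  · refine sum_congr rfl fun i _ => sum_congr rfl fun j _ => ?_
    rcases eq_or_ne (s i) 0 with h0 | h0
    · simp [h0]
    rcases eq_or_ne (s j) 0 with h0' | h0'
    · simp [h0']
    field_simp
  · exact sum_congr rfl fun p _ => by ring

theorem abs_variance_quad_sub_le (h : VonMises μ P s X h₁ h₂ h₃) :
    |variance (quadTerm X h₂) μ
      - ∑ i, ∑ j, (∫ z, h₂ i j z.1 z.2 ^ 2 ∂((P i).prod (P j))) / (2 * s i * s j)|
    ≤ ∑ i, ((∫ x, h₂ i i x x ^ 2 ∂P i) + ∫ z, h₂ i i z.1 z.2 ^ 2 ∂((P i).prod (P i)))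
      / (s i : ℝ) ^ 3 := by
  rw [h.variance_quad_sub, add_sub_cancel_left]
  refine (abs_sum_le_sum_abs _ _).trans ?_
  rw [sum_sigma]
  refine sum_le_sum fun i _ => ?_
  have h1 : ∀ l : Fin (s i), |variance (fun ω => h₂ i i (X ⟨i, l⟩ ω) (X ⟨i, l⟩ ω)
      / (2 * s i * s i)) μ - 2 * ((∫ z, h₂ i i z.1 z.2 ^ 2 ∂((P i).prod (P i)))
      / (2 * s i * s i) ^ 2)| ≤ ((∫ x, h₂ i i x x ^ 2 ∂P i)
      + ∫ z, h₂ i i z.1 z.2 ^ 2 ∂((P i).prod (P i))) / (s i : ℝ) ^ 4 := fun l => by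
    have h2 := variance_le_integral_sq (h.kernel₂_div.memLp ⟨i, l⟩ ⟨i, l⟩)
    rw [h.integral_sq_quad_diag ⟨i, l⟩] at h2
    dsimp only at h2
    have h3 := variance_nonneg (fun ω => h₂ i i (X ⟨i, l⟩ ω) (X ⟨i, l⟩ ω) / (2 * s i * s i)) μ
    have h4 : 0 ≤ ∫ x, h₂ i i x x ^ 2 ∂P i := integral_nonneg fun x => sq_nonneg _
    have h5 : 0 ≤ ∫ z, h₂ i i z.1 z.2 ^ 2 ∂((P i).prod (P i)) := integral_nonneg fun x => sq_nonneg _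
    have hs : (s i : ℝ) ≠ 0 := by
      have := l.pos
      exact_mod_cast this.ne'
    have hs4 : 0 < (s i : ℝ) ^ 4 := by positivity
    have h6 : ((2 * s i * s i : ℝ)) ^ 2 = 4 * (s i : ℝ) ^ 4 := by ring
    rw [h6] at h2 ⊢
    set A := ∫ x, h₂ i i x x ^ 2 ∂P i
    set W := ∫ z, h₂ i i z.1 z.2 ^ 2 ∂((P i).prod (P i))
    have h7 : A / (4 * (s i : ℝ) ^ 4) ≤ A / (s i : ℝ) ^ 4 :=
      div_le_div_of_nonneg_left h4 hs4 (by linarith)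
    have h8 : 2 * (W / (4 * (s i : ℝ) ^ 4)) ≤ W / (s i : ℝ) ^ 4 := by
      rw [← mul_div_assoc, div_le_div_iff₀ (by positivity) hs4]
      nlinarith [mul_nonneg h5 hs4.le]
    have h9 : 0 ≤ W / (4 * (s i : ℝ) ^ 4) := by positivity
    have h10 : 0 ≤ A / (s i : ℝ) ^ 4 := by positivity
    have h11 : 0 ≤ W / (s i : ℝ) ^ 4 := by positivity
    rw [add_div, abs_le]
    constructor <;> linarith
  refine (sum_le_sum fun l _ => h1 l).trans (le_of_eq ?_)
  simp only [sum_const, card_univ, card_fin, nsmul_eq_mul]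
  rcases eq_or_ne (s i) 0 with h0 | h0
  · simp [h0]
  · field_simp

theorem abs_covariance_lin_cub_sub_le (h : VonMises μ P s X h₁ h₂ h₃) :
    |2 * covariance (linTerm X h₁) (cubTerm X h₃) μ
      - ∑ i, ∑ j, (∫ z, h₁ i z.1 * h₃ i j j z.1 z.2 z.2 ∂((P i).prod (P j))) / (s i * s j)|
    ≤ ∑ i, (|∫ x, h₁ i x * h₃ i i i x x x ∂P i|
      + |∫ z, h₁ i z.1 * h₃ i i i z.1 z.2 z.2 ∂((P i).prod (P i))|) / (s i : ℝ) ^ 3 := by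
  rw [covariance_eq_sub h.memLp_lin h.memLp_cub, h.integral_lin, zero_mul, sub_zero]
  have h0 : ∫ ω, (linTerm X h₁ * cubTerm X h₃) ω ∂μ = _ :=
    h.indep.integral_sum_mul_kernel₃ h.kernel₁_div h.kernel₃_div
      (fun p r => (h.symm₃₁ p r).mono fun ω hω => by rw [hω]; congr 1; ring)
      (fun p r => (h.symm₃₂ p r).mono fun ω hω => by rw [hω]; congr 1; ring)
  let u : ι → ι → ℝ := fun i j => ∫ z, h₁ i z.1 * h₃ i j j z.1 z.2 z.2 ∂((P i).prod (P j))
  let y : ι → ℝ := fun i => ∫ x, h₁ i x * h₃ i i i x x x ∂P i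
  have h1 : ∀ p q : Σ i, Fin (s i), p ≠ q → ∫ ω, h₁ p.1 (X p ω) / s p.1 *
      (h₃ p.1 q.1 q.1 (X p ω) (X q ω) (X q ω) / (6 * s p.1 * s q.1 * s q.1)) ∂μ
      = u p.1 q.1 / (6 * (s p.1 : ℝ) ^ 2 * (s q.1 : ℝ) ^ 2) := fun p q hpq => by
    rw [h.integral_two hpq (f := fun z => h₁ p.1 z.1 / s p.1 *
      (h₃ p.1 q.1 q.1 z.1 z.2 z.2 / (6 * s p.1 * s q.1 * s q.1))), ← integral_div]
    · congr 1; funext z; rw [div_mul_div_comm]; congr 1; ring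
    · exact (((h.meas₁ _).comp measurable_fst).div_const _).mul
        (((h.meas₃ _ _ _).comp (by fun_prop : Measurable fun z : 𝒴 p.1 × 𝒴 q.1 =>
          (z.1, z.2, z.2))).div_const _)
  have h2 : ∀ p : Σ i, Fin (s i), ∫ ω, h₁ p.1 (X p ω) / s p.1 *
      (h₃ p.1 p.1 p.1 (X p ω) (X p ω) (X p ω) / (6 * s p.1 * s p.1 * s p.1)) ∂μ
      = y p.1 / (6 * (s p.1 : ℝ) ^ 4) := fun p => by
    rw [h.integral_one p (f := fun x => h₁ p.1 x / s p.1 *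
      (h₃ p.1 p.1 p.1 x x x / (6 * s p.1 * s p.1 * s p.1))), ← integral_div]
    · congr 1; funext z; rw [div_mul_div_comm]; congr 1; ring
    · exact ((h.meas₁ _).div_const _).mul
        (((h.meas₃ _ _ _).comp (by fun_prop : Measurable fun x : 𝒴 p.1 => (x, x, x))).div_const _)
  rw [h0, sum_pairs_eq _ (fun i j => u i j / (6 * (s i : ℝ) ^ 2 * (s j : ℝ) ^ 2)) h1]
  simp only [h2]
  have h3 : ∑ i, ∑ j, (s i : ℝ) * s j * (u i j / (6 * (s i : ℝ) ^ 2 * (s j : ℝ) ^ 2))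
      = (∑ i, ∑ j, u i j / (s i * s j)) / 6 := by
    rw [sum_div]
    refine sum_congr rfl fun i _ => ?_
    rw [sum_div]
    refine sum_congr rfl fun j _ => ?_
    rcases eq_or_ne (s i) 0 with h0 | h0
    · simp [h0]
    rcases eq_or_ne (s j) 0 with h0' | h0'
    · simp [h0']
    field_simp
  rw [h3]
  have h4 : 2 * (3 * ((∑ i, ∑ j, u i j / (s i * s j)) / 6 + ∑ p : Σ i, Fin (s i),
      (y p.1 / (6 * (s p.1 : ℝ) ^ 4) - u p.1 p.1 / (6 * (s p.1 : ℝ) ^ 2 * (s p.1 : ℝ) ^ 2)))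
      - 2 * ∑ p : Σ i, Fin (s i), y p.1 / (6 * (s p.1 : ℝ) ^ 4)) - ∑ i, ∑ j, u i j / (s i * s j)
      = ∑ p : Σ i, Fin (s i), (y p.1 / 3 - u p.1 p.1) / (s p.1 : ℝ) ^ 4 := by
    have : ∑ p : Σ i, Fin (s i), (y p.1 / 3 - u p.1 p.1) / (s p.1 : ℝ) ^ 4
      = ∑ p : Σ i, Fin (s i), (6 * (y p.1 / (6 * (s p.1 : ℝ) ^ 4)
        - u p.1 p.1 / (6 * (s p.1 : ℝ) ^ 2 * (s p.1 : ℝ) ^ 2))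
        - 4 * (y p.1 / (6 * (s p.1 : ℝ) ^ 4))) := by
      refine sum_congr rfl fun p _ => ?_
      have hs : (s p.1 : ℝ) ≠ 0 := by
        have := p.2.pos
        exact_mod_cast this.ne'
      field_simp
      ring
    rw [this]
    simp only [sum_sub_distrib, ← mul_sum]
    ring
  refine le_of_eq_of_le (congrArg _ h4) ?_
  refine (abs_sum_le_sum_abs _ _).trans ?_
  rw [sum_sigma]
  refine sum_le_sum fun i _ => ?_
  have h5 : ∀ _l : Fin (s i), |(y i / 3 - u i i) / (s i : ℝ) ^ 4|
      ≤ (|y i| + |u i i|) / (s i : ℝ) ^ 4 := fun _ => by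
    rw [abs_div, abs_of_nonneg (by positivity : (0 : ℝ) ≤ (s i : ℝ) ^ 4)]
    gcongr
    refine (abs_sub _ _).trans ?_
    rw [abs_div]
    have := abs_nonneg (y i)
    have h3 : |(3 : ℝ)| = 3 := by norm_num
    rw [h3]
    linarith
  refine (sum_le_sum fun l _ => h5 l).trans (le_of_eq ?_)
  simp only [sum_const, card_univ, card_fin, nsmul_eq_mul]
  rcases eq_or_ne (s i) 0 with h0 | h0
  · simp [h0]
  · field_simp
    rfl

theorem integral_sq_cub_le (h : VonMises μ P s X h₁ h₂ h₃) :
    ∫ ω, cubTerm X h₃ ω ^ 2 ∂μ ≤ ∑ p : Σ i, Fin (s i), ∑ q : Σ i, Fin (s i), ∑ r : Σ i, Fin (s i),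
      (cubicWeight ![p, q, r] : ℝ) *
        ∫ ω, (h₃ p.1 q.1 r.1 (X p ω) (X q ω) (X r ω) / (6 * s p.1 * s q.1 * s r.1)) ^ 2 ∂μ :=
  by
  have := h.indep.integral_sq_kernel₃_le h.kernel₃_div
  unfold cubTerm
  convert this

/-- The variance of a third order von Mises expansion. -/
theorem abs_variance_sub_le (h : VonMises μ P s X h₁ h₂ h₃) {e : Ω → ℝ} (he : MemLp e 2 μ)
    (c₀ : ℝ) {A qv cv ev : ℝ}
    (hA : A = ∑ i, ((∫ x, h₂ i i x x ^ 2 ∂P i) + ∫ z, h₂ i i z.1 z.2 ^ 2 ∂((P i).prod (P i)))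
      / (s i : ℝ) ^ 3)
    (hqv : qv = ∑ i, ∑ j, (∫ z, h₂ i j z.1 z.2 ^ 2 ∂((P i).prod (P j))) / (2 * s i * s j) + A)
    (hcv : ∫ ω, cubTerm X h₃ ω ^ 2 ∂μ ≤ cv) (hev : ∫ ω, e ω ^ 2 ∂μ ≤ ev) :
    |variance (fun ω => c₀ + (linTerm X h₁ ω + quadTerm X h₂ ω + cubTerm X h₃ ω + e ω)) μ
      - (∑ i, (∫ x, h₁ i x ^ 2 ∂P i) / s i
        + ∑ i, (∫ x, h₁ i x * h₂ i i x x ∂P i) / (s i : ℝ) ^ 2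
        + ∑ i, ∑ j, (∫ z, h₂ i j z.1 z.2 ^ 2 ∂((P i).prod (P j))) / (2 * s i * s j)
        + ∑ i, ∑ j, (∫ z, h₁ i z.1 * h₃ i j j z.1 z.2 z.2 ∂((P i).prod (P j))) / (s i * s j))|
    ≤ A + ∑ i, (|∫ x, h₁ i x * h₃ i i i x x x ∂P i|
      + |∫ z, h₁ i z.1 * h₃ i i i z.1 z.2 z.2 ∂((P i).prod (P i))|) / (s i : ℝ) ^ 3
      + (2 * (√qv * √cv) + cv + 2 * (√(2 * (2 * (∑ i, (∫ x, h₁ i x ^ 2 ∂P i) / s i) + 2 * qv)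
        + 2 * cv) * √ev) + ev) := by
  have hq := h.abs_variance_quad_sub_le
  rw [← hA] at hq
  have h1 := abs_variance_sum_sub_le h.memLp_lin h.memLp_quad h.memLp_cub he c₀
    (qv := qv) (cv := cv) (ev := ev) (by rw [hqv]; linarith [(abs_le.1 hq).2])
    ((variance_le_integral_sq h.memLp_cub).trans hcv) ((variance_le_integral_sq he).trans hev)
  have h2 := h.abs_covariance_lin_cub_sub_le
  rw [h.covariance_lin_quad, h.variance_lin] at h1
  obtain ⟨a1, b1⟩ := abs_le.1 hq
  obtain ⟨a2, b2⟩ := abs_le.1 h1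
  obtain ⟨a3, b3⟩ := abs_le.1 h2
  rw [abs_le]
  constructor <;> linarith

end VonMises

end VonMises

section Scale

variable {ι : Type*} [Fintype ι]

/-- All sizes are comparable up to the factor `c`. -/
structure Stage (c θ : ℝ) (n : ι → ℕ) (B R : ℕ) : Prop where
  pos : 0 < θ
  le_one : θ ≤ 1
  one_le : 1 ≤ c
  one_le_scale : 1 ≤ θ * avg n
  n_le : ∀ i, (n i : ℝ) ≤ c * avg n
  le_n : ∀ i, avg n ≤ c * n i
  s_le : ∀ i, (subSize θ n i : ℝ) ≤ c * (θ * avg n)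
  le_s : ∀ i, θ * avg n ≤ c * subSize θ n i
  three_le : ∀ i, 3 ≤ n i
  R_le : (R : ℝ) ≤ c * (θ * avg n)
  le_R : θ * avg n ≤ c * R
  two_le_R : 2 ≤ R
  two_le_B : 2 ≤ B

theorem BalancedData.eventually_three_le {n : ℕ → ι → ℕ} (h : BalancedData n) :
    ∀ᶠ k in atTop, ∀ i, 3 ≤ n k i :=
  eventually_all.2 fun i => (h.1 i).eventually_ge_atTop 3

theorem tendsto_avg [Nonempty ι] {n : ℕ → ι → ℕ} (h : BalancedData n) :
    Tendsto (fun k => avg (n k)) atTop atTop := by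
  obtain ⟨c, hc, hk⟩ := h.2
  let i : ι := Classical.arbitrary ι
  have h1 : Tendsto (fun k => (n k i : ℝ) / c) atTop atTop :=
    (tendsto_natCast_atTop_atTop.comp (h.1 i)).atTop_div_const hc
  refine tendsto_atTop_mono' _ (hk.mono fun k hk => ?_) h1
  have hm : (0 : ℝ) < card ι := by exact_mod_cast Fintype.card_pos
  show (n k i : ℝ) / c ≤ avg (n k)
  rw [avg, div_le_div_iff₀ hc hm, mul_comm, sum_mul]
  calc (card ι : ℝ) * n k i = ∑ _j : ι, (n k i : ℝ) := by simp
    _ ≤ ∑ j, (n k j : ℝ) * c := sum_le_sum fun j _ => (hk i j).trans_eq (mul_comm _ _)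

theorem tendsto_outer [Nonempty ι] {n : ℕ → ι → ℕ} {θ : ℕ → ℝ} {N B R : ℕ → ℕ}
    (hθn : Tendsto (fun k => θ k * avg (n k)) atTop atTop)
    (hN : Tendsto (fun k => (N k : ℝ) / (θ k * avg (n k))) atTop atTop)
    (hR : (fun k => (R k : ℝ)) =Θ[atTop] (fun k => θ k * avg (n k)))
    (hBR : ∀ k, B k * R k = N k) : Tendsto (fun k => (B k : ℝ)) atTop atTop := by
  obtain ⟨c, hc, h1⟩ := hR.1.exists_pos
  rw [isBigOWith_iff] at h1
  refine tendsto_atTop_mono' _ ?_ (hN.atTop_div_const hc)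
  filter_upwards [h1, hθn.eventually_ge_atTop 1] with k hk hS
  rw [← hBR k]
  have hS' : 0 < θ k * avg (n k) := by linarith
  rw [Real.norm_of_nonneg (by positivity), Real.norm_of_nonneg hS'.le] at hk
  rw [div_div, div_le_iff₀ (by positivity)]
  push_cast
  have : (0 : ℝ) ≤ B k := by positivity
  nlinarith

theorem eventually_stage [Nonempty ι] {n : ℕ → ι → ℕ} {θ : ℕ → ℝ} {N B R : ℕ → ℕ}
    (hbal : BalancedData n) (hθ : ∀ k, 0 < θ k ∧ θ k ≤ 1)
    (hθn : Tendsto (fun k => θ k * avg (n k)) atTop atTop)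
    (hN : Tendsto (fun k => (N k : ℝ) / (θ k * avg (n k))) atTop atTop)
    (hR : (fun k => (R k : ℝ)) =Θ[atTop] (fun k => θ k * avg (n k))) (hBR : ∀ k, B k * R k = N k) :
    ∃ c : ℝ, 1 ≤ c ∧ ∀ᶠ k in atTop, Stage c (θ k) (n k) (B k) (R k) := by
  obtain ⟨c, hc, hcn⟩ := hbal.2
  obtain ⟨c₁, hc₁, h1⟩ := hR.1.exists_pos
  obtain ⟨c₂, hc₂, h2⟩ := hR.2.exists_pos
  rw [isBigOWith_iff] at h1 h2
  have hB := tendsto_outer hθn hN hR hBR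
  have hn := hbal.eventually_three_le
  refine ⟨1 + 2 * c + c₁ + c₂, by linarith, ?_⟩
  filter_upwards [hcn, h1, h2, hn, hB.eventually_ge_atTop 2, hθn.eventually_ge_atTop 1,
    hθn.eventually_ge_atTop c, hθn.eventually_ge_atTop (2 * c₂)]
    with k hcn h1 h2 hn hB hS1 hSc hSR
  have hm : (0 : ℝ) < card ι := by exact_mod_cast Fintype.card_pos
  have hS0 : 0 < θ k * avg (n k) := by linarith
  have ha : 0 < avg (n k) := pos_of_mul_pos_right hS0 (hθ k).1.le
  rw [Real.norm_of_nonneg (by positivity : (0 : ℝ) ≤ R k), Real.norm_of_nonneg hS0.le] at h1 h2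
  have e1 : ∀ i, (n k i : ℝ) ≤ c * avg (n k) := fun i => by
    rw [avg, mul_div_assoc', le_div_iff₀ hm, mul_sum]
    calc (n k i : ℝ) * card ι = ∑ _j : ι, (n k i : ℝ) := by simp [mul_comm]
      _ ≤ _ := sum_le_sum fun j _ => hcn i j
  have e2 : ∀ i, avg (n k) ≤ c * n k i := fun i => by
    rw [avg, div_le_iff₀ hm]
    calc ∑ j, (n k j : ℝ) ≤ ∑ _j : ι, c * n k i := sum_le_sum fun j _ => hcn j i
      _ = _ := by simp [mul_comm]
  have e3 : ∀ i, (subSize (θ k) (n k) i : ℝ) ≤ θ k * n k i := fun i =>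
    Nat.floor_le (by have := (hθ k).1; positivity)
  have e4 : ∀ i, θ k * n k i ≤ 2 * subSize (θ k) (n k) i := fun i => by
    have h3 : (1 : ℝ) ≤ θ k * n k i := by
      have := mul_le_mul_of_nonneg_left (e2 i) (hθ k).1.le
      by_contra! hlt
      nlinarith
    have h4 : 1 ≤ subSize (θ k) (n k) i := (Nat.one_le_floor_iff _).2 h3
    have h5 : θ k * n k i < subSize (θ k) (n k) i + 1 := Nat.lt_floor_add_one _
    have h6 : (1 : ℝ) ≤ subSize (θ k) (n k) i := by exact_mod_cast h4
    linarith
  have hle : ∀ {b x : ℝ}, b ≤ 1 + 2 * c + c₁ + c₂ → 0 ≤ x →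
      b * x ≤ (1 + 2 * c + c₁ + c₂) * x := fun h hx => mul_le_mul_of_nonneg_right h hx
  refine ⟨(hθ k).1, (hθ k).2, by linarith, hS1, fun i => ?_, fun i => ?_, fun i => ?_, fun i => ?_,
    hn, ?_, ?_, ?_, by exact_mod_cast hB⟩
  · exact (e1 i).trans (hle (by linarith) ha.le)
  · exact (e2 i).trans (hle (by linarith) (by positivity))
  · refine (e3 i).trans (le_trans ?_ (hle (b := c) (by linarith) hS0.le))
    have := mul_le_mul_of_nonneg_left (e1 i) (hθ k).1.le
    linarith
  · refine le_trans ?_ (hle (b := 2 * c) (by linarith) (by positivity))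
    have h3 := mul_le_mul_of_nonneg_left (e2 i) (hθ k).1.le
    have h4 := mul_le_mul_of_nonneg_left (e4 i) hc.le
    linarith
  · exact h1.trans (hle (by linarith) hS0.le)
  · exact h2.trans (hle (by linarith) (by positivity))
  · have : (2 : ℝ) ≤ R k := by
      by_contra! hlt
      nlinarith
    exact_mod_cast this

namespace Stage

variable {c θ : ℝ} {n : ι → ℕ} {B R : ℕ}

theorem c_pos (h : Stage c θ n B R) : 0 < c := by linarith [h.one_le]

theorem avg_pos (h : Stage c θ n B R) : 0 < avg n :=
  pos_of_mul_pos_right (by linarith [h.one_le_scale] : 0 < θ * avg n) h.pos.le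

theorem scale_le (h : Stage c θ n B R) : θ * avg n ≤ avg n := by
  have := mul_le_mul_of_nonneg_right h.le_one h.avg_pos.le
  linarith

theorem one_le_avg (h : Stage c θ n B R) : 1 ≤ avg n := h.one_le_scale.trans h.scale_le

theorem n_pos (h : Stage c θ n B R) (i : ι) : 0 < n i := by have := h.three_le i; omega

theorem neZero_n (h : Stage c θ n B R) (i : ι) : NeZero (n i) := ⟨(h.n_pos i).ne'⟩

theorem s_pos (h : Stage c θ n B R) (i : ι) : 0 < subSize θ n i := by
  have h1 := h.le_s i
  have h2 := h.one_le_scale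
  rcases Nat.eq_zero_or_pos (subSize θ n i) with h0 | h0
  · rw [h0] at h1; norm_num at h1; linarith
  · exact h0

theorem inv_n_le (h : Stage c θ n B R) (i : ι) : (n i : ℝ)⁻¹ ≤ c / avg n := by
  have : (0 : ℝ) < n i := by exact_mod_cast h.n_pos i
  rw [inv_eq_one_div, div_le_div_iff₀ this h.avg_pos]
  linarith [h.le_n i]

theorem scale_pos (h : Stage c θ n B R) : 0 < θ * avg n := by linarith [h.one_le_scale]

theorem inv_s_le (h : Stage c θ n B R) (i : ι) : (subSize θ n i : ℝ)⁻¹ ≤ c / (θ * avg n) := by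
  have : (0 : ℝ) < subSize θ n i := by exact_mod_cast h.s_pos i
  rw [inv_eq_one_div, div_le_div_iff₀ this h.scale_pos]
  linarith [h.le_s i]

theorem scale_pow_le [Nonempty ι] (h : Stage c θ n B R) (p : ℕ) :
    ‖(θ * avg n) ^ p * (avg (subSize θ n) ^ p)⁻¹‖ ≤ c ^ p := by
  have hS := h.scale_pos
  have h1 : θ * avg n ≤ c * avg (subSize θ n) := by
    have hι : (0 : ℝ) < card ι := by exact_mod_cast Fintype.card_pos
    conv_rhs => rw [avg]
    rw [mul_div_assoc', le_div_iff₀ hι, mul_sum]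
    calc θ * avg n * card ι = ∑ _i : ι, θ * avg n := by simp [mul_comm]
      _ ≤ _ := sum_le_sum fun i _ => h.le_s i
  have := pos_of_mul_pos_right (hS.trans_le h1) h.c_pos.le
  rw [Real.norm_of_nonneg (by positivity), ← div_eq_mul_inv, div_le_iff₀ (by positivity), ← mul_pow]
  gcongr

end Stage

end Scale

theorem third_order_error_le {S κ η M A Q Λ C D : ℝ} (hS : 1 ≤ S) (hκ : 0 ≤ κ)
    (hη : 0 ≤ η) (hM1 : 1 ≤ M) (hA : A ≤ 2 * M * κ / S ^ 3) (hC : C ≤ 2 * M * κ / S ^ 3)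
    (hL : Λ ≤ M * κ / S) (hQ : Q ≤ M * κ / S ^ 2)
    (main : D ≤ A + C + (2 * (√(Q + A) * √(κ / S ^ 3)) + κ / S ^ 3
      + 2 * (√(2 * (2 * Λ + 2 * (Q + A)) + 2 * (κ / S ^ 3)) * √(η / S ^ 3)) + η / S ^ 3)) :
    S ^ 2 * D ≤ 9 * M * (κ / √S) + 10 * M * (√κ * √η) + η := by
  have hS0 : 0 < S := by linarith
  have hS32 : κ / S ^ 3 ≤ κ / S ^ 2 := by
    gcongr 1
    exact pow_le_pow_right₀ hS (by norm_num)
  have hS21 : κ / S ^ 2 ≤ κ / S := by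
    gcongr
    exact le_self_pow₀ hS (by norm_num)
  have hM2 : M ≤ M ^ 2 := le_self_pow₀ hM1 (by norm_num)
  have hMκ3 : M * (κ / S ^ 3) ≤ M * (κ / S ^ 2) := by gcongr
  have hMκ2 : M * (κ / S ^ 2) ≤ M * (κ / S) := by gcongr
  have hκ3 : κ / S ^ 3 ≤ M * (κ / S ^ 3) := le_mul_of_one_le_left (by positivity) hM1
  have e1 : 2 * M * κ / S ^ 3 = 2 * (M * (κ / S ^ 3)) := by ring
  have e2 : M * κ / S ^ 2 = M * (κ / S ^ 2) := by ring
  have e3 : M * κ / S = M * (κ / S) := by ring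
  rw [e1] at hA hC
  rw [e2] at hQ
  rw [e3] at hL
  have hMM : M * (κ / S) ≤ M ^ 2 * (κ / S) := by gcongr
  have hMM2 : M * (κ / S ^ 2) ≤ M ^ 2 * (κ / S ^ 2) := by gcongr
  have hp1 : 0 ≤ M ^ 2 * (κ / S) := by positivity
  have hp2 : 0 ≤ M ^ 2 * (κ / S ^ 2) := by positivity
  have q1 : √(Q + A) ≤ 2 * M * (√κ / S) := by
    refine Real.sqrt_le_iff.2 ⟨by positivity, ?_⟩
    rw [mul_pow, div_pow, Real.sq_sqrt hκ, mul_pow]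
    linarith
  have q2 : √(κ / S ^ 3) ≤ √κ / (S * √S) := by
    refine Real.sqrt_le_iff.2 ⟨by positivity, ?_⟩
    rw [div_pow, mul_pow, Real.sq_sqrt hκ, Real.sq_sqrt hS0.le]
    exact le_of_eq (by ring)
  have q3 : √(η / S ^ 3) ≤ √η / (S * √S) := by
    refine Real.sqrt_le_iff.2 ⟨by positivity, ?_⟩
    rw [div_pow, mul_pow, Real.sq_sqrt hη, Real.sq_sqrt hS0.le]
    exact le_of_eq (by ring)
  have q4 : √(2 * (2 * Λ + 2 * (Q + A)) + 2 * (κ / S ^ 3)) ≤ 5 * M * (√κ / √S) := by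
    refine Real.sqrt_le_iff.2 ⟨by positivity, ?_⟩
    rw [mul_pow, div_pow, Real.sq_sqrt hκ, Real.sq_sqrt hS0.le, mul_pow]
    linarith
  have r1 : √(Q + A) * √(κ / S ^ 3) ≤ 2 * M * (√κ / S) * (√κ / (S * √S)) := by gcongr
  have r2 : √(2 * (2 * Λ + 2 * (Q + A)) + 2 * (κ / S ^ 3)) * √(η / S ^ 3)
      ≤ 5 * M * (√κ / √S) * (√η / (S * √S)) := by gcongr
  have r1' : S ^ 2 * (2 * M * (√κ / S) * (√κ / (S * √S))) = 2 * M * (κ / √S) := by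
    rw [show κ / √S = √κ * √κ / √S by rw [Real.mul_self_sqrt hκ]]
    field_simp
  have r2' : S ^ 2 * (5 * M * (√κ / √S) * (√η / (S * √S))) = 5 * M * (√κ * √η) := by
    have h3 : √S * √S = S := Real.mul_self_sqrt hS0.le
    calc _ = 5 * M * (√κ * √η) * (S / (√S * √S)) := by field_simp
      _ = _ := by rw [h3]; field_simp
  have hS2 : (0 : ℝ) ≤ S ^ 2 := by positivity
  have s1 := mul_le_mul_of_nonneg_left r1 hS2
  have s2 := mul_le_mul_of_nonneg_left r2 hS2
  rw [r1'] at s1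
  rw [r2'] at s2
  have t1 : S ^ 2 * (M * (κ / S ^ 3)) ≤ M * (κ / √S) := by
    have : S ^ 2 * (M * (κ / S ^ 3)) = M * (κ / S) := by field_simp
    rw [this]
    gcongr
    rw [Real.sqrt_le_left (by linarith)]
    exact le_self_pow₀ hS (by norm_num)
  have t2 : S ^ 2 * (η / S ^ 3) ≤ η := by
    have : S ^ 2 * (η / S ^ 3) = η / S := by field_simp
    rw [this]
    exact div_le_self hη hS
  have u1 := mul_le_mul_of_nonneg_left main hS2
  have u2 := mul_le_mul_of_nonneg_left hA hS2
  have u3 := mul_le_mul_of_nonneg_left hC hS2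
  have u4 := mul_le_mul_of_nonneg_left hκ3 hS2
  refine u1.trans ?_
  linarith

section Scaled

variable {Ω : Type*} [MeasurableSpace Ω] {ι : Type*} [Fintype ι] [DecidableEq ι]
  {𝒴 : ι → Type*} [∀ i, MeasurableSpace (𝒴 i)]
  {μ : Measure Ω} [IsProbabilityMeasure μ] {P : ∀ i, Measure (𝒴 i)}
  [∀ i, IsProbabilityMeasure (P i)] {s : ι → ℕ} {X : ∀ p : Σ i, Fin (s i), Ω → 𝒴 p.1}
  {h₁ : ∀ i, 𝒴 i → ℝ} {h₂ : ∀ i j, 𝒴 i → 𝒴 j → ℝ} {h₃ : ∀ i j k, 𝒴 i → 𝒴 j → 𝒴 k → ℝ}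

/-- The variance of a third order von Mises expansion up to the order of the inverse square of the
sample size. -/
theorem VonMises.scaled_variance_sub_le (h : VonMises μ P s X h₁ h₂ h₃) {e : Ω → ℝ}
    (he : MemLp e 2 μ) (c₀ : ℝ) {c S κ η M : ℝ} (hc : 1 ≤ c) (hS : 1 ≤ S) (hκ : 0 ≤ κ) (hη : 0 ≤ η)
    (hM : M = ((card ι : ℝ) + 1) ^ 2 * c ^ 3) (hs : ∀ i, (s i : ℝ)⁻¹ ≤ c / S)
    (b₁ : ∀ i, ∫ x, h₁ i x ^ 2 ∂P i ≤ κ) (b₂ : ∀ i, ∫ x, h₂ i i x x ^ 2 ∂P i ≤ κ)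
    (b₃ : ∀ i j, ∫ z, h₂ i j z.1 z.2 ^ 2 ∂((P i).prod (P j)) ≤ κ)
    (b₄ : ∀ i, |∫ x, h₁ i x * h₃ i i i x x x ∂P i| ≤ κ)
    (b₅ : ∀ i, |∫ z, h₁ i z.1 * h₃ i i i z.1 z.2 z.2 ∂((P i).prod (P i))| ≤ κ)
    (b₆ : S ^ 3 * ∫ ω, cubTerm X h₃ ω ^ 2 ∂μ ≤ κ) (b₇ : S ^ 3 * ∫ ω, e ω ^ 2 ∂μ ≤ η) :
    S ^ 2 * |variance (fun ω => c₀ + (linTerm X h₁ ω + quadTerm X h₂ ω + cubTerm X h₃ ω + e ω)) μ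
      - (∑ i, (∫ x, h₁ i x ^ 2 ∂P i) / s i
        + ∑ i, (∫ x, h₁ i x * h₂ i i x x ∂P i) / (s i : ℝ) ^ 2
        + ∑ i, ∑ j, (∫ z, h₂ i j z.1 z.2 ^ 2 ∂((P i).prod (P j))) / (2 * s i * s j)
        + ∑ i, ∑ j, (∫ z, h₁ i z.1 * h₃ i j j z.1 z.2 z.2 ∂((P i).prod (P j))) / (s i * s j))|
    ≤ 9 * M * (κ / √S) + 10 * M * (√κ * √η) + η := by
  have hS0 : 0 < S := by linarith
  have hc0 : 0 < c := by linarith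
  have hm : (0 : ℝ) ≤ card ι := by positivity
  set m : ℝ := (card ι : ℝ) with hmdef
  have hc3 : 1 ≤ c ^ 3 := one_le_pow₀ hc
  have hM1 : 1 ≤ M := by
    rw [hM]
    exact one_le_mul_of_one_le_of_one_le (one_le_pow₀ (by linarith)) hc3
  have hmM : m * c ^ 3 ≤ M := by rw [hM]; gcongr; nlinarith
  have hmM2 : m ^ 2 * c ^ 2 ≤ M := by
    rw [hM]; gcongr <;> linarith
  have hmM1 : m * c ≤ M := by
    refine le_trans ?_ hmM
    gcongr
    exact le_self_pow₀ hc (by norm_num)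
  have hs3 : ∀ i {t : ℝ}, 0 ≤ t → t / (s i : ℝ) ^ 3 ≤ t * (c ^ 3 / S ^ 3) := fun i t ht => by
    rw [div_eq_mul_inv, ← inv_pow, ← div_pow]
    gcongr
    exact hs i
  have hcard : ∀ t : ℝ, ∑ _i : ι, t = m * t := fun t => by simp [hmdef]
  have hQ0 : ∀ i j, 0 ≤ ∫ z, h₂ i j z.1 z.2 ^ 2 ∂((P i).prod (P j)) := fun i j =>
    integral_nonneg fun _ => sq_nonneg _
  have hA : ∑ i, ((∫ x, h₂ i i x x ^ 2 ∂P i) + ∫ z, h₂ i i z.1 z.2 ^ 2 ∂((P i).prod (P i)))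
      / (s i : ℝ) ^ 3 ≤ 2 * M * κ / S ^ 3 := by
    refine (sum_le_sum fun i _ => (hs3 i (add_nonneg (integral_nonneg fun _ => sq_nonneg _)
      (hQ0 i i))).trans (mul_le_mul_of_nonneg_right (add_le_add (b₂ i) (b₃ i i)) (by positivity))).trans ?_
    rw [hcard]
    calc m * ((κ + κ) * (c ^ 3 / S ^ 3)) = 2 * (m * c ^ 3) * κ / S ^ 3 := by ring
      _ ≤ _ := by gcongr
  have hC : ∑ i, (|∫ x, h₁ i x * h₃ i i i x x x ∂P i|
      + |∫ z, h₁ i z.1 * h₃ i i i z.1 z.2 z.2 ∂((P i).prod (P i))|) / (s i : ℝ) ^ 3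
      ≤ 2 * M * κ / S ^ 3 := by
    refine (sum_le_sum fun i _ => (hs3 i (by positivity)).trans
      (mul_le_mul_of_nonneg_right (add_le_add (b₄ i) (b₅ i)) (by positivity))).trans ?_
    rw [hcard]
    calc m * ((κ + κ) * (c ^ 3 / S ^ 3)) = 2 * (m * c ^ 3) * κ / S ^ 3 := by ring
      _ ≤ _ := by gcongr
  have hL : ∑ i, (∫ x, h₁ i x ^ 2 ∂P i) / s i ≤ M * κ / S := by
    have : ∀ i, (∫ x, h₁ i x ^ 2 ∂P i) / s i ≤ κ * (c / S) := fun i => by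
      rw [div_eq_mul_inv]
      exact mul_le_mul (b₁ i) (hs i) (by positivity) hκ
    refine (sum_le_sum fun i _ => this i).trans ?_
    rw [hcard]
    calc m * (κ * (c / S)) = (m * c) * κ / S := by ring
      _ ≤ _ := by gcongr
  have hQ : ∑ i, ∑ j, (∫ z, h₂ i j z.1 z.2 ^ 2 ∂((P i).prod (P j))) / (2 * s i * s j)
      ≤ M * κ / S ^ 2 := by
    have : ∀ i j, (∫ z, h₂ i j z.1 z.2 ^ 2 ∂((P i).prod (P j))) / (2 * s i * s j)
        ≤ κ * (c / S * (c / S)) := fun i j => by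
      calc _ = (∫ z, h₂ i j z.1 z.2 ^ 2 ∂((P i).prod (P j))) * ((s i : ℝ)⁻¹ * (s j : ℝ)⁻¹) / 2 := by
            rw [div_eq_mul_inv]; simp only [mul_inv]; ring
        _ ≤ (∫ z, h₂ i j z.1 z.2 ^ 2 ∂((P i).prod (P j))) * ((s i : ℝ)⁻¹ * (s j : ℝ)⁻¹) :=
            half_le_self (mul_nonneg (hQ0 i j) (by positivity))
        _ ≤ _ := mul_le_mul (b₃ i j) (mul_le_mul (hs i) (hs j) (by positivity) (by positivity))
            (by positivity) hκ
    refine (sum_le_sum fun i _ => sum_le_sum fun j _ => this i j).trans ?_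
    rw [sum_congr rfl fun i _ => hcard _, hcard]
    calc m * (m * (κ * (c / S * (c / S)))) = (m ^ 2 * c ^ 2) * κ / S ^ 2 := by
          field_simp
      _ ≤ _ := by gcongr
  have main := h.abs_variance_sub_le he c₀ rfl rfl (cv := κ / S ^ 3) (ev := η / S ^ 3)
    (by rw [le_div_iff₀ (by positivity)]; linarith) (by rw [le_div_iff₀ (by positivity)]; linarith)
  exact third_order_error_le hS hκ hη hM1 hA hC hL hQ main

end Scaled

section Weights

variable {ι : Type*} [Fintype ι] [DecidableEq ι]

theorem sum_cubicWeight_div_le {s : ι → ℕ} {c S : ℝ} (hc : 1 ≤ c) (hS : 1 ≤ S)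
    (h₁ : ∀ i, (s i : ℝ)⁻¹ ≤ c / S) (h₂ : ∀ i, (s i : ℝ) ≤ c * S) :
    S ^ 3 * ∑ p : Σ i, Fin (s i), ∑ q : Σ i, Fin (s i), ∑ r : Σ i, Fin (s i),
      (cubicWeight ![p, q, r] : ℝ) * (1 / (6 * s p.1 * s q.1 * s r.1)) ^ 2
      ≤ 729 * (card ι : ℝ) ^ 3 * c ^ 9 := by
  have hS0 : 0 < S := by linarith
  have hc0 : 0 < c := by linarith
  have e1 : ∀ p q r : Σ i, Fin (s i), (1 / (6 * s p.1 * s q.1 * s r.1) : ℝ) ^ 2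
      ≤ (c / S) ^ 6 := fun p q r => by
    have h : (1 / (6 * s p.1 * s q.1 * s r.1) : ℝ)
        ≤ (c / S) * (c / S) * (c / S) := by
      calc (1 / (6 * s p.1 * s q.1 * s r.1) : ℝ)
          = (1 / 6) * ((s p.1 : ℝ)⁻¹ * (s q.1 : ℝ)⁻¹ * (s r.1 : ℝ)⁻¹) := by
            simp only [one_div, mul_inv]; ring
        _ ≤ 1 * ((s p.1 : ℝ)⁻¹ * (s q.1 : ℝ)⁻¹ * (s r.1 : ℝ)⁻¹) := by gcongr; norm_num
        _ ≤ _ := by rw [one_mul]; gcongr <;> apply h₁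
    calc _ ≤ ((c / S) * (c / S) * (c / S)) ^ 2 := by gcongr
      _ = _ := by ring
  have hI : (card (Σ i, Fin (s i)) : ℝ) ≤ card ι * (c * S) := by
    rw [Fintype.card_sigma]
    push_cast
    calc ∑ i, (card (Fin (s i)) : ℝ) ≤ ∑ _i : ι, c * S :=
          sum_le_sum fun i _ => by simpa using h₂ i
      _ = _ := by simp
  calc _ ≤ S ^ 3 * ∑ p : Σ i, Fin (s i), ∑ q : Σ i, Fin (s i), ∑ r : Σ i, Fin (s i),
      (cubicWeight ![p, q, r] : ℝ) * (c / S) ^ 6 := by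
        refine mul_le_mul_of_nonneg_left (sum_le_sum fun p _ => sum_le_sum fun q _ =>
          sum_le_sum fun r _ => mul_le_mul_of_nonneg_left (e1 p q r) (by positivity))
          (by positivity)
    _ = S ^ 3 * ((∑ p : Σ i, Fin (s i), ∑ q : Σ i, Fin (s i), ∑ r : Σ i, Fin (s i),
      (cubicWeight ![p, q, r] : ℝ)) * (c / S) ^ 6) := by simp only [sum_mul]
    _ ≤ S ^ 3 * ((729 * (card ι * (c * S)) ^ 3) * (c / S) ^ 6) := by
        gcongr
        exact sum_cubicWeight_le.trans (by gcongr)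
    _ = _ := by field_simp

variable {Ω : Type*} [MeasurableSpace Ω] {𝒴 : ι → Type*} [∀ i, MeasurableSpace (𝒴 i)]
  {μ : Measure Ω} [IsProbabilityMeasure μ] {P : ∀ i, Measure (𝒴 i)}
  [∀ i, IsProbabilityMeasure (P i)] {s : ι → ℕ} {X : ∀ p : Σ i, Fin (s i), Ω → 𝒴 p.1}
  {h₁ : ∀ i, 𝒴 i → ℝ} {h₂ : ∀ i j, 𝒴 i → 𝒴 j → ℝ} {h₃ : ∀ i j k, 𝒴 i → 𝒴 j → 𝒴 k → ℝ}

theorem VonMises.integral_sq_cub_le' (h : VonMises μ P s X h₁ h₂ h₃) :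
    ∫ ω, cubTerm X h₃ ω ^ 2 ∂μ ≤ ∑ p : Σ i, Fin (s i), ∑ q : Σ i, Fin (s i), ∑ r : Σ i, Fin (s i),
      (cubicWeight ![p, q, r] : ℝ) * (1 / (6 * s p.1 * s q.1 * s r.1)) ^ 2 *
        ∫ ω, h₃ p.1 q.1 r.1 (X p ω) (X q ω) (X r ω) ^ 2 ∂μ := by
  refine h.integral_sq_cub_le.trans (le_of_eq ?_)
  refine sum_congr rfl fun p _ => sum_congr rfl fun q _ =>
    sum_congr rfl fun r _ => ?_
  rw [← integral_const_mul, ← integral_const_mul]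
  refine integral_congr_ae (of_forall fun ω => ?_)
  simp only
  ring

end Weights

theorem measurable_av {κ Ω : Type*} [Fintype κ] [MeasurableSpace Ω] {f : κ → Ω → ℝ}
    (hf : ∀ z, Measurable (f z)) : Measurable fun ω => av fun z => f z ω :=
  (measurable_fun_sum _ fun z _ => hf z).div_const _

theorem measurable_integral_right {α β : Type*} [MeasurableSpace α] [MeasurableSpace β]
    {ν : Measure β} [SFinite ν] {f : α → β → ℝ} (hf : Measurable fun z : α × β => f z.1 z.2) :
    Measurable fun x => ∫ y, f x y ∂ν :=
  (StronglyMeasurable.integral_prod_right' (f := fun z : α × β => f z.1 z.2)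
    hf.stronglyMeasurable).measurable

theorem measurable_integral_left {α β : Type*} [MeasurableSpace α] [MeasurableSpace β]
    {ν : Measure α} [SFinite ν] {f : α → β → ℝ} (hf : Measurable fun z : α × β => f z.1 z.2) :
    Measurable fun y => ∫ x, f x y ∂ν :=
  measurable_integral_right (f := fun y x => f x y) (hf.comp measurable_swap)

instance : ENNReal.HolderTriple 4 4 2 := ⟨by
  rw [show (4 : ℝ≥0∞) = 2 * 2 by norm_num, ENNReal.mul_inv (by simp) (by simp), ← two_mul,
    ← mul_assoc, ENNReal.mul_inv_cancel (by simp) (by simp), one_mul]⟩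

section Moments

variable {Ω : Type*} [MeasurableSpace Ω] {μ : Measure Ω} {f : Ω → ℝ} {A : ℕ → Ω → ℝ}

theorem covariance_eq_integral_mul [IsProbabilityMeasure μ] {X Y : Ω → ℝ} (hX : MemLp X 2 μ)
    (hY : MemLp Y 2 μ)
    (h0 : ∫ ω, X ω ∂μ = 0) : covariance X Y μ = ∫ ω, X ω * Y ω ∂μ := by
  rw [covariance_eq_sub hX hY, h0]
  simp

theorem variance_eq_integral_sq [IsProbabilityMeasure μ] {X : Ω → ℝ} (hX : MemLp X 2 μ)
    (h0 : ∫ ω, X ω ∂μ = 0) : variance X μ = ∫ ω, X ω ^ 2 ∂μ := by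
  rw [variance_eq_sub hX, h0]
  simp

theorem memLp_of_lintegral_enorm_pow {p : ℕ} (hf : AEStronglyMeasurable f μ) (hp : p ≠ 0)
    (h : ∫⁻ ω, ‖f ω‖ₑ ^ p ∂μ ≠ ∞) :
    MemLp f p μ := by
  refine ⟨hf, ?_⟩
  rw [eLpNorm_lt_top_iff_lintegral_rpow_enorm_lt_top (by exact_mod_cast hp) (by simp)]
  simpa using lt_top_iff_ne_top.2 h

theorem OP.bp_of_sub {c : ℝ} (h : OP μ fun k ω => A k ω - c) : BP μ A :=
  (h.bp.add (BP.const c)).congr (of_forall fun _ => of_forall fun _ => by ring)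

theorem OP.sq_sub {c : ℝ} (h : OP μ fun k ω => A k ω - c) : OP μ fun k ω => A k ω ^ 2 - c ^ 2 :=
  (h.mul_bp (h.bp_of_sub.add (BP.const c))).congr
    (of_forall fun _ => of_forall fun _ => by ring)

theorem lintegral_enorm_pow_ne_top {p : ℕ} (hp : p ≠ 0) (hf : MemLp f p μ) :
    ∫⁻ ω, ‖f ω‖ₑ ^ p ∂μ ≠ ∞ := by
  have := lintegral_rpow_enorm_lt_top_of_eLpNorm_lt_top (by exact_mod_cast hp) (by simp) hf.2
  simpa using this.ne

theorem integral_sq_le_of_lintegral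
    (hf : AEStronglyMeasurable f μ) {C : ℝ≥0∞} (hC : C ≠ ∞) (h : ∫⁻ ω, ‖f ω‖ₑ ^ 2 ∂μ ≤ C) :
    ∫ ω, f ω ^ 2 ∂μ ≤ C.toReal := by
  rw [integral_eq_lintegral_of_nonneg_ae (of_forall fun _ => sq_nonneg _) (hf.pow 2)]
  refine ENNReal.toReal_mono hC (le_of_eq_of_le (lintegral_congr fun x => ?_) h)
  rw [← Real.enorm_of_nonneg (sq_nonneg _), enorm_pow]

theorem lintegral_enorm_sq_eq_ofReal
    (hf : MemLp f 2 μ) : ∫⁻ ω, ‖f ω‖ₑ ^ 2 ∂μ = ENNReal.ofReal (∫ ω, f ω ^ 2 ∂μ) := by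
  rw [ofReal_integral_eq_lintegral_ofReal hf.integrable_sq
    (of_forall fun _ => sq_nonneg _)]
  refine lintegral_congr fun x => ?_
  rw [← Real.enorm_of_nonneg (sq_nonneg _), enorm_pow]

theorem OP.of_integral_sq
    (hA : ∀ k, MemLp (A k) 2 μ) (h : Tendsto (fun k => ∫ ω, A k ω ^ 2 ∂μ) atTop (𝓝 0)) :
    OP μ A := by
  refine OP.of_sq (OP.of_lintegral (fun k => ((hA k).aestronglyMeasurable.pow 2).aemeasurable) ?_)
  simp_rw [enorm_pow, lintegral_enorm_sq_eq_ofReal (hA _)]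
  simpa using ENNReal.tendsto_ofReal h

theorem _root_.MeasureTheory.MemLp.sq_of_four (h : MemLp f 4 μ) : MemLp (fun ω => f ω ^ 2) 2 μ := by
  simpa only [sq] using! h.mul h

theorem _root_.MeasureTheory.MemLp.integrable_pow_four
    (h : MemLp f 4 μ) : Integrable (fun ω => f ω ^ 4) μ := by
  have := h.sq_of_four.integrable_sq
  simpa only [← pow_mul] using this

end Moments

section DataMoments

variable {ι : Type*} [Fintype ι] [DecidableEq ι] {𝒳 : ι → Type*} [∀ i, MeasurableSpace (𝒳 i)]
  {F : ∀ i, Measure (𝒳 i)} [∀ i, IsProbabilityMeasure (F i)]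

theorem exists_moment_bound_triple {i j k : ι} {h : 𝒳 i → 𝒳 j → 𝒳 k → ℝ}
    (hm : Measurable fun p : 𝒳 i × 𝒳 j × 𝒳 k => h p.1 p.2.1 p.2.2) {p : ℕ} (hp : p ≠ 0)
    (hC : ∀ b < 2, ∀ c < 3, MemLp (fun x : Data 𝒳 => h (x i 0) (x j b) (x k c)) p (dataLaw F)) :
    ∃ C : ℝ≥0∞, C ≠ ∞ ∧ ∀ a b c : ℕ, ∫⁻ x, ‖h (x i a) (x j b) (x k c)‖ₑ ^ p ∂(dataLaw F) ≤ C := by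
  refine ⟨∑ b ∈ Finset.range 2, ∑ c ∈ Finset.range 3,
    ∫⁻ x : Data 𝒳, ‖h (x i 0) (x j b) (x k c)‖ₑ ^ p ∂(dataLaw F),
    (ENNReal.sum_lt_top.2 fun b hb => ENNReal.sum_lt_top.2 fun c hc => lt_top_iff_ne_top.2
      (lintegral_enorm_pow_ne_top hp (hC b (Finset.mem_range.1 hb) c (Finset.mem_range.1 hc)))).ne,
    fun a b c => ?_⟩
  refine lintegral_triple_le F (n := fun _ => a + b + c + 3) (by intro i; omega)
    (G := fun _ u v w => ‖h u v w‖ₑ ^ p) (fun j₂ j₃ => ?_) (fun j₂ h₂ j₃ h₃ => ?_)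
    (by omega) (by omega) (by omega)
  · exact (hm.comp (f := fun x : Data 𝒳 => (x i 0, x j j₂, x k j₃))
      (by fun_prop)).enorm.pow_const p
  · refine le_trans ?_ (single_le_sum (fun _ _ => zero_le) (Finset.mem_range.2 h₂))
    exact single_le_sum (f := fun c => ∫⁻ x : Data 𝒳,
      ‖h (x i 0) (x j j₂) (x k c)‖ₑ ^ p ∂(dataLaw F)) (fun _ _ => zero_le) (Finset.mem_range.2 h₃)

theorem exists_moment_bound_pair {i j : ι} {h : 𝒳 i → 𝒳 j → ℝ}
    (hm : Measurable fun p : 𝒳 i × 𝒳 j => h p.1 p.2) {p : ℕ} (hp : p ≠ 0)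
    (hC : ∀ b < 2, MemLp (fun x : Data 𝒳 => h (x i 0) (x j b)) p (dataLaw F)) :
    ∃ C : ℝ≥0∞, C ≠ ∞ ∧ ∀ a b : ℕ, ∫⁻ x, ‖h (x i a) (x j b)‖ₑ ^ p ∂(dataLaw F) ≤ C := by
  obtain ⟨C, hC0, hC1⟩ := exists_moment_bound_triple (F := F) (k := i) (h := fun u v _ => h u v)
    (hm.comp (f := fun p : 𝒳 i × 𝒳 j × 𝒳 i => (p.1, p.2.1)) (by fun_prop)) hp
    fun b hb c _ => hC b hb
  exact ⟨C, hC0, fun a b => hC1 a b a⟩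

theorem exists_moment_bound_single {i : ι} {h : 𝒳 i → ℝ} (hm : Measurable h) {p : ℕ} (hp : p ≠ 0)
    (hC : MemLp h p (F i)) :
    ∃ C : ℝ≥0∞, C ≠ ∞ ∧ ∀ a : ℕ, ∫⁻ x : Data 𝒳, ‖h (x i a)‖ₑ ^ p ∂(dataLaw F) ≤ C := by
  refine ⟨_, lintegral_enorm_pow_ne_top hp hC, fun a => le_of_eq ?_⟩
  have := ((indepCoord_data F).measurePreserving ⟨i, a⟩).lintegral_comp
    (f := fun y => ‖h y‖ₑ ^ p) (hm.enorm.pow_const p)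
  exact this

end DataMoments

section Orders

variable {κ : ℕ → Type*} [∀ k, Fintype (κ k)] {Ω : Type*} [MeasurableSpace Ω] {μ : Measure Ω}
  [IsProbabilityMeasure μ] {f g : ∀ k, κ k → Ω → ℝ}

theorem OP.av_pow_of_lintegral {p : ℕ} (hm : ∀ k z, Measurable (f k z))
    {δ : ℕ → ℝ≥0∞} (hδ : Tendsto δ atTop (𝓝 0))
    (h : ∀ᶠ k in atTop, ∀ z, ∫⁻ ω, ‖f k z ω‖ₑ ^ p ∂μ ≤ δ k) :
    OP μ (fun k ω => av fun z => f k z ω ^ p) :=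
  OP.av_of_lintegral (fun k z => ((hm k z).pow_const p).aemeasurable) hδ
    (h.mono fun k hk z => by simpa only [enorm_pow] using hk z)

theorem BP.av_pow_of_lintegral {p : ℕ} (hm : ∀ k z, Measurable (f k z))
    {C : ℝ≥0∞} (hC : C ≠ ∞) (h : ∀ᶠ k in atTop, ∀ z, ∫⁻ ω, ‖f k z ω‖ₑ ^ p ∂μ ≤ C) :
    BP μ (fun k ω => av fun z => f k z ω ^ p) :=
  BP.av_of_lintegral (fun k z => ((hm k z).pow_const p).aemeasurable) hC
    (h.mono fun k hk z => by simpa only [enorm_pow] using hk z)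

theorem OP.av_sq_of_four (h : OP μ fun k ω => av fun z => f k z ω ^ 4) :
    OP μ fun k ω => av fun z => f k z ω ^ 2 := by
  refine OP.of_sq (h.mono (of_forall fun k => of_forall fun ω => ?_))
  rw [abs_of_nonneg (sq_nonneg _), abs_of_nonneg (av_nonneg fun z => by positivity)]
  refine (av_sq_le _).trans (av_mono fun z => le_of_eq (by ring))

theorem BP.av_sq_of_four (h : BP μ fun k ω => av fun z => f k z ω ^ 4) :
    BP μ fun k ω => av fun z => f k z ω ^ 2 := by
  refine BP.of_sq (h.mono (of_forall fun k => of_forall fun ω => ?_))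
  rw [abs_of_nonneg (sq_nonneg _), abs_of_nonneg (av_nonneg fun z => by positivity)]
  refine (av_sq_le _).trans (av_mono fun z => le_of_eq (by ring))

theorem BP.av_sq_of_sub (hf : BP μ fun k ω => av fun z => f k z ω ^ 2)
    (hg : OP μ fun k ω => av fun z => (g k z ω - f k z ω) ^ 2) :
    BP μ fun k ω => av fun z => g k z ω ^ 2 := by
  simpa only [add_sub_cancel] using hf.av_sq_add hg.bp

theorem BP.av_four_of_sub (hf : BP μ fun k ω => av fun z => f k z ω ^ 4)
    (hg : OP μ fun k ω => av fun z => (g k z ω - f k z ω) ^ 4) :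
    BP μ fun k ω => av fun z => g k z ω ^ 4 := by
  have h1 := BP.av_sq_add (f := fun k z ω => f k z ω ^ 2) (g := fun k z ω => (g k z ω - f k z ω) ^ 2)
    (by simpa only [← pow_mul] using hf) (by simpa only [← pow_mul] using hg.bp)
  refine (h1.const_mul 4).mono (of_forall fun k => of_forall fun ω => ?_)
  rw [← av_const_mul, abs_of_nonneg (av_nonneg fun z => by positivity),
    abs_of_nonneg (av_nonneg fun z => by positivity)]
  refine av_mono fun z => ?_
  have h2 : g k z ω ^ 2 ≤ 2 * (f k z ω ^ 2 + (g k z ω - f k z ω) ^ 2) := by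
    nlinarith [sq_nonneg (2 * f k z ω - g k z ω)]
  calc g k z ω ^ 4 = (g k z ω ^ 2) ^ 2 := by ring
    _ ≤ (2 * (f k z ω ^ 2 + (g k z ω - f k z ω) ^ 2)) ^ 2 := by gcongr
    _ = _ := by ring

end Orders

section Projection

theorem enorm_integral_sq_le {β : Type*} [MeasurableSpace β] {ν : Measure β}
    [IsProbabilityMeasure ν] {f : β → ℝ} (hf : AEStronglyMeasurable f ν) :
    ‖∫ y, f y ∂ν‖ₑ ^ 2 ≤ ∫⁻ y, ‖f y‖ₑ ^ 2 ∂ν := by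
  have h1 := eLpNorm_le_eLpNorm_of_exponent_le (p := 1) (q := 2) (by norm_num) hf
  rw [eLpNorm_one_eq_lintegral_enorm, eLpNorm_eq_lintegral_rpow_enorm_toReal (by norm_num)
    (by norm_num)] at h1
  have h2 := (enorm_integral_le_lintegral_enorm f).trans h1
  calc ‖∫ y, f y ∂ν‖ₑ ^ 2 ≤ ((∫⁻ y, ‖f y‖ₑ ^ (2 : ℝ≥0∞).toReal ∂ν) ^ (1 / (2 : ℝ≥0∞).toReal)) ^ 2 := by
        gcongr
    _ = _ := by
      rw [← ENNReal.rpow_natCast, ← ENNReal.rpow_mul]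
      norm_num

theorem memLp_integral_right {α β : Type*} [MeasurableSpace α] [MeasurableSpace β] {μ : Measure α}
    [SFinite μ] {ν : Measure β} [IsProbabilityMeasure ν] {f : α → β → ℝ}
    (hm : Measurable fun z : α × β => f z.1 z.2)
    (hf : MemLp (fun z : α × β => f z.1 z.2) 2 (μ.prod ν)) :
    MemLp (fun x => ∫ y, f x y ∂ν) 2 μ := by
  refine ⟨(measurable_integral_right hm).aestronglyMeasurable, ?_⟩
  rw [eLpNorm_lt_top_iff_lintegral_rpow_enorm_lt_top (by norm_num) (by norm_num)]
  have h1 := lintegral_enorm_pow_ne_top (p := 2) (by norm_num) hf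
  rw [lintegral_prod _ (hm.enorm.pow_const 2).aemeasurable] at h1
  refine lt_of_le_of_lt (lintegral_mono fun x => ?_) (lt_top_iff_ne_top.2 h1)
  have := enorm_integral_sq_le (ν := ν) (f := f x) (hm.comp measurable_prodMk_left).aestronglyMeasurable
  simpa using this

theorem integral_sub_integral_self {β : Type*} [MeasurableSpace β] {ν : Measure β}
    [IsProbabilityMeasure ν] (f : β → ℝ) : ∫ y, (f y - ∫ z, f z ∂ν) ∂ν = 0 := by
  by_cases hf : Integrable f ν
  · rw [integral_sub hf (integrable_const _)]; simp
  · simp [integral_undef hf]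

variable {ι : Type*} [Fintype ι] [DecidableEq ι] {𝒳 : ι → Type*} [∀ i, MeasurableSpace (𝒳 i)]
  {F : ∀ i, Measure (𝒳 i)} [∀ i, IsProbabilityMeasure (F i)]

theorem memLp_prod_of_data {i j : ι} {h : 𝒳 i → 𝒳 j → ℝ} {p : ℝ≥0∞}
    (hm : Measurable fun p : 𝒳 i × 𝒳 j => h p.1 p.2)
    (hL : ∀ b < 2, MemLp (fun x : Data 𝒳 => h (x i 0) (x j b)) p (dataLaw F)) :
    MemLp (fun z : 𝒳 i × 𝒳 j => h z.1 z.2) p ((F i).prod (F j)) := by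
  have hmp := (indepCoord_data F).measurePreserving_pair (p := ⟨i, 0⟩) (q := ⟨j, 1⟩) (by
    intro h; simp at h)
  rw [← hmp.map_eq, memLp_map_measure_iff hm.aestronglyMeasurable hmp.measurable.aemeasurable]
  exact hL 1 (by norm_num)

theorem memLp_proj {i j : ι} {h : 𝒳 i → 𝒳 j → ℝ} (hm : Measurable fun p : 𝒳 i × 𝒳 j => h p.1 p.2)
    (hL : ∀ b < 2, MemLp (fun x : Data 𝒳 => h (x i 0) (x j b)) 2 (dataLaw F)) :
    MemLp (fun y => ∫ z, h y z ∂(F j)) 2 (F i) :=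
  memLp_integral_right hm (memLp_prod_of_data hm hL)

/-- The mean square error of an empirical average over one argument. -/
theorem lintegral_av_sub_integral_sq_le {i j : ι} {h : 𝒳 i → 𝒳 j → ℝ}
    (hm : Measurable fun p : 𝒳 i × 𝒳 j => h p.1 p.2)
    (hL : ∀ b < 2, MemLp (fun x : Data 𝒳 => h (x i 0) (x j b)) 2 (dataLaw F)) :
    ∃ C : ℝ, 0 ≤ C ∧ ∀ N a : ℕ, ∫⁻ x : Data 𝒳, ‖(av fun b : Fin N => h (x i a) (x j b))
      - ∫ y, h (x i a) y ∂(F j)‖ₑ ^ 2 ∂(dataLaw F) ≤ if N = 0 then ∞ else ENNReal.ofReal (C / N) := by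
  have hpL := memLp_proj hm hL
  have hmm : Measurable fun y => ∫ z, h y z ∂(F j) := measurable_integral_right hm
  obtain ⟨C₁, hC₁, h1⟩ := exists_moment_bound_pair (p := 2) hm (by norm_num) hL
  obtain ⟨C₂, hC₂, h2⟩ := exists_moment_bound_single (p := 2) hmm (by norm_num) hpL
  refine ⟨2 * C₁.toReal + 2 * C₂.toReal, by positivity, fun N a => ?_⟩
  split_ifs with hN
  · exact le_top
  have hN0 : (N : ℝ) ≠ 0 := by exact_mod_cast hN
  let r : ℕ → Data 𝒳 → ℝ := fun b x => h (x i a) (x j b) - ∫ y, h (x i a) y ∂(F j)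
  have hdL : ∀ b, MemLp (fun x : Data 𝒳 => h (x i a) (x j b)) 2 (dataLaw F) := memLp_pair F hL a
  have hqL : MemLp (fun x : Data 𝒳 => ∫ y, h (x i a) y ∂(F j)) 2 (dataLaw F) :=
    hpL.comp_measurePreserving ((indepCoord_data F).measurePreserving ⟨i, a⟩)
  have hr : ∀ b, MemLp (r b) 2 (dataLaw F) := fun b => (hdL b).sub hqL
  have hr2 : ∀ b, ∫ x, r b x ^ 2 ∂(dataLaw F) ≤ 2 * C₁.toReal + 2 * C₂.toReal := fun b => by
    have e1 := integral_sq_le_of_lintegral (hdL b).aestronglyMeasurable hC₁ (h1 a b)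
    have e2 := integral_sq_le_of_lintegral hqL.aestronglyMeasurable hC₂ (h2 a)
    have e3 : ∫ x, r b x ^ 2 ∂(dataLaw F) ≤ ∫ x : Data 𝒳, (2 * h (x i a) (x j b) ^ 2
        + 2 * (∫ y, h (x i a) y ∂(F j)) ^ 2) ∂(dataLaw F) := by
      refine integral_mono (hr b).integrable_sq
        (((hdL b).integrable_sq.const_mul 2).add (hqL.integrable_sq.const_mul 2)) fun x => ?_
      simp only [r]
      nlinarith [sq_nonneg (h (x i a) (x j b) + ∫ y, h (x i a) y ∂(F j))]
    rw [integral_add ((hdL b).integrable_sq.const_mul 2) (hqL.integrable_sq.const_mul 2),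
      integral_const_mul, integral_const_mul] at e3
    linarith
  have hkill : ∀ b b' : ℕ, b ≠ b' → (⟨i, a⟩ : Σ _ : ι, ℕ) ≠ ⟨j, b⟩ →
      ∫ x, r b x * r b' x ∂(dataLaw F) = 0 := fun b b' hbb hab => by
    obtain ⟨u, hu⟩ := (indepCoord_data F).exists_update ⟨j, b⟩
    have o1 : ∀ z, (u z) i a = z.1 i a := fun z => hu.other ⟨i, a⟩ hab z
    have o2 : ∀ z, (u z) j b' = z.1 j b' := fun z => hu.other ⟨j, b'⟩
      (by intro h; simp only [Sigma.mk.injEq, heq_eq_eq, true_and] at h; exact hbb h.symm) z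
    have o3 : ∀ z, (u z) j b = z.2 := fun z => hu.same z
    refine hu.integral_eq_zero ((hr b).integrable_mul (hr b')) (of_forall fun x => ?_)
      fun z => ?_
    · simp only [r, o1, o3]
      exact integral_sub_integral_self _
    · simp only [r, o1, o2]
  have horth : ∀ b b' : Fin N, b ≠ b' → ∫ x, r b x * r b' x ∂(dataLaw F) = 0 := fun b b' hbb => by
    have hbb' : (b : ℕ) ≠ b' := fun h => hbb (Fin.ext h)
    by_cases hab : (⟨i, a⟩ : Σ _ : ι, ℕ) = ⟨j, (b : ℕ)⟩
    · have : (⟨i, a⟩ : Σ _ : ι, ℕ) ≠ ⟨j, (b' : ℕ)⟩ := by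
        rw [hab]; intro h; simp only [Sigma.mk.injEq, heq_eq_eq, true_and] at h; exact hbb' h
      have := hkill b' b hbb'.symm this
      simpa only [mul_comm] using this
    · exact hkill b b' hbb' hab
  have heq : ∀ x : Data 𝒳, (av fun b : Fin N => h (x i a) (x j b)) - ∫ y, h (x i a) y ∂(F j)
      = (∑ b : Fin N, r b x) / N := fun x => by
    simp only [r, av, card_fin, sum_sub_distrib, sum_const, card_univ,
      nsmul_eq_mul]
    field_simp
  have hsumL : MemLp (fun x => ∑ b : Fin N, r b x) 2 (dataLaw F) := memLp_finsetSum _ fun b _ => hr b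
  simp_rw [heq]
  rw [lintegral_enorm_sq_eq_ofReal (by simpa only [div_eq_mul_inv] using hsumL.mul_const (N : ℝ)⁻¹)]
  refine ENNReal.ofReal_le_ofReal ?_
  simp_rw [div_pow]
  rw [integral_div]
  have hsq : ∫ x, (∑ b : Fin N, r b x) ^ 2 ∂(dataLaw F)
      = ∑ b : Fin N, ∫ x, r b x ^ 2 ∂(dataLaw F) := by
    simp_rw [sq]
    rw [integral_sum_mul_sum (fun b : Fin N => hr b) (fun b : Fin N => hr b)]
    refine sum_congr rfl fun b _ => ?_
    exact Finset.sum_eq_single b (fun b' _ hb => horth b b' hb.symm) (by simp)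
  rw [hsq]
  have : ∑ b : Fin N, ∫ x, r b x ^ 2 ∂(dataLaw F) ≤ N * (2 * C₁.toReal + 2 * C₂.toReal) := by
    refine (sum_le_sum fun (b : Fin N) _ => hr2 b).trans (le_of_eq ?_)
    simp [mul_add]
  have hNp : (0 : ℝ) < N := by positivity
  rw [div_le_div_iff₀ (by positivity) hNp]
  nlinarith

theorem bp_av_proj_sq {i j : ι} {h : 𝒳 i → 𝒳 j → ℝ} (hm : Measurable fun p : 𝒳 i × 𝒳 j => h p.1 p.2)
    (hL : ∀ b < 2, MemLp (fun x : Data 𝒳 => h (x i 0) (x j b)) 2 (dataLaw F))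
    {κ : ℕ → Type*} [∀ k, Fintype (κ k)] (α : ∀ k, κ k → ℕ) {N : ℕ → ℕ}
    (hN : ∀ᶠ k in atTop, N k ≠ 0) :
    BP (dataLaw F) fun k x => N k * av fun z => ((av fun b : Fin (N k) => h (x i (α k z)) (x j b))
      - ∫ y, h (x i (α k z)) y ∂(F j)) ^ 2 := by
  obtain ⟨C, hC0, hC⟩ := lintegral_av_sub_integral_sq_le hm hL
  have hmeas : ∀ k (z : κ k), Measurable fun x : Data 𝒳 =>
      (av fun b : Fin (N k) => h (x i (α k z)) (x j b)) - ∫ y, h (x i (α k z)) y ∂(F j) :=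
    fun k z => by
      refine (measurable_av fun b : Fin (N k) => hm.comp
        (f := fun x : Data 𝒳 => (x i (α k z), x j b)) (by fun_prop)).sub ?_
      exact (measurable_integral_right hm).comp (f := fun x : Data 𝒳 => x i (α k z)) (by fun_prop)
  simp_rw [← av_const_mul]
  refine BP.av_of_lintegral (C := ENNReal.ofReal C)
    (fun k z => (((hmeas k z).pow_const 2).const_mul _).aemeasurable) (by finiteness) ?_
  filter_upwards [hN] with k hk z
  simp_rw [enorm_mul, enorm_pow]
  rw [lintegral_const_mul' _ _ (by finiteness)]
  have h1 := hC (N k) (α k z)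
  rw [if_neg hk] at h1
  refine (mul_le_mul' le_rfl h1).trans (le_of_eq ?_)
  have : (N k : ℝ) ≠ 0 := by exact_mod_cast hk
  rw [Real.enorm_of_nonneg (by positivity), ← ENNReal.ofReal_mul (by positivity)]
  congr 1
  field_simp

theorem op_av_proj_sq {i j : ι} {h : 𝒳 i → 𝒳 j → ℝ} (hm : Measurable fun p : 𝒳 i × 𝒳 j => h p.1 p.2)
    (hL : ∀ b < 2, MemLp (fun x : Data 𝒳 => h (x i 0) (x j b)) 2 (dataLaw F))
    {κ : ℕ → Type*} [∀ k, Fintype (κ k)] (α : ∀ k, κ k → ℕ) {N : ℕ → ℕ}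
    (hN : Tendsto N atTop atTop) :
    OP (dataLaw F) fun k x => av fun z => ((av fun b : Fin (N k) => h (x i (α k z)) (x j b))
      - ∫ y, h (x i (α k z)) y ∂(F j)) ^ 2 := by
  have hN0 : ∀ᶠ k in atTop, N k ≠ 0 := (hN.eventually_ge_atTop 1).mono fun k hk => by omega
  have h1 := (bp_av_proj_sq hm hL α hN0).small_mul (c := fun k => (N k : ℝ)⁻¹)
    (tendsto_inv_atTop_zero.comp (tendsto_natCast_atTop_atTop.comp hN))
  refine h1.congr (hN0.mono fun k hk => of_forall fun x => ?_)
  have : (N k : ℝ) ≠ 0 := by exact_mod_cast hk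
  field_simp

/-- The law of large numbers for averages over pairs. -/
theorem op_av_pair_sub_integral {i j : ι} {h : 𝒳 i → 𝒳 j → ℝ} {f : 𝒳 i → ℝ}
    (hm : Measurable fun p : 𝒳 i × 𝒳 j => h p.1 p.2)
    (hL : ∀ b < 2, MemLp (fun x : Data 𝒳 => h (x i 0) (x j b)) 2 (dataLaw F))
    (hf : Measurable f) (hfL : MemLp f 2 (F i)) {n : ℕ → ι → ℕ}
    (hn : ∀ i, Tendsto (fun k => n k i) atTop atTop) :
    OP (dataLaw F) fun k x => (av fun z : Fin (n k i) × Fin (n k j) => f (x i z.1)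
      * h (x i z.1) (x j z.2)) - ∫ y, f y * ∫ z, h y z ∂(F j) ∂(F i) := by
  have hmm : Measurable fun y => ∫ z, h y z ∂(F j) := measurable_integral_right hm
  have hpL := memLp_proj hm hL
  have h1 := op_av_proj_sq hm hL (fun k (z : Fin (n k i)) => (z : ℕ)) (hn j)
  obtain ⟨C, hC, h2⟩ := exists_moment_bound_single (p := 2) hf (by norm_num) hfL
  have h3 : BP (dataLaw F) fun k x => av fun z : Fin (n k i) => f (x i z) ^ 2 :=
    BP.av_pow_of_lintegral (fun k z => hf.comp (f := fun x : Data 𝒳 => x i z) (by fun_prop)) hC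
      (of_forall fun k z => h2 _)
  have h4 := op_av_sub_integral F (hf.mul hmm) (hfL.integrable_mul hpL) (hn i)
  refine ((h1.av_mul h3).add h4).congr (of_forall fun k => of_forall fun x => ?_)
  simp only [Pi.mul_apply]
  rw [← add_sub_assoc, ← av_add, av_prod fun (a : Fin (n k i)) (b : Fin (n k j)) =>
    f (x i a) * h (x i a) (x j b)]
  congr 2
  funext a
  rw [av_const_mul]
  ring

end Projection

section FourthMoment

variable {I : Type*} [Fintype I] [DecidableEq I] {Ω : Type*} [MeasurableSpace Ω] {α : I → Type*}
  [∀ p, MeasurableSpace (α p)] {μ : Measure Ω} [IsProbabilityMeasure μ] {P : ∀ p, Measure (α p)}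
  [∀ p, IsProbabilityMeasure (P p)] {X : ∀ p, Ω → α p} {a : ∀ p, α p → ℝ}

/-- The fourth moment of a sum of independent centred variables. -/
theorem IndepCoord.integral_pow_four (h : IndepCoord μ P X) (hL : ∀ p, MemLp (a p) 4 (P p))
    (h0 : ∀ p, ∫ x, a p x ∂P p = 0) :
    ∫ ω, (∑ p, a p (X p ω)) ^ 4 ∂μ = 3 * (∑ p, ∫ x, a p x ^ 2 ∂P p) ^ 2
      - 3 * (∑ p, (∫ x, a p x ^ 2 ∂P p) ^ 2) + ∑ p, ∫ x, a p x ^ 4 ∂P p := by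
  have hX : ∀ p, MemLp (fun ω => a p (X p ω)) 4 μ := fun p =>
    (hL p).comp_measurePreserving (h.measurePreserving p)
  have hXX : ∀ p q, MemLp (fun ω => a p (X p ω) * a q (X q ω)) 2 μ := fun p q => (hX q).mul (hX p)
  let e : I → I → I → I → ℝ := fun p q r s =>
    ∫ ω, (a p (X p ω) * a q (X q ω)) * (a r (X r ω) * a s (X s ω)) ∂μ
  have hsum : ∫ ω, (∑ p, a p (X p ω)) ^ 4 ∂μ = ∑ p, ∑ q, ∑ r, ∑ s, e p q r s := by
    rw [← integral_double_sum_mul_double_sum hXX hXX]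
    refine integral_congr_ae (of_forall fun ω => ?_)
    simp only [← Finset.sum_mul_sum]
    ring
  have v1 : ∀ p q r s, p ≠ q → p ≠ r → p ≠ s → e p q r s = 0 := fun p q r s hq hr hs => by
    obtain ⟨u, hu⟩ := h.exists_update p
    have e1 : e p q r s
        = ∫ ω, a p (X p ω) * (a q (X q ω) * (a r (X r ω) * a s (X s ω))) ∂μ := by
      simp only [e, mul_assoc]
    rw [e1]
    refine hu.integral_eq_zero ?_ (of_forall fun ω => ?_) fun z => ?_
    · have := (hXX p q).integrable_mul (hXX r s)
      simpa only [Pi.mul_def, mul_assoc] using this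
    · simp only [hu.same, h0]
    · simp only [hu.other q hq.symm, hu.other r hr.symm, hu.other s hs.symm]
  have p1 : ∀ p q r s, e p q r s = e q p r s := fun p q r s =>
    integral_congr_ae (of_forall fun ω => by ring)
  have p2 : ∀ p q r s, e p q r s = e r s p q := fun p q r s =>
    integral_congr_ae (of_forall fun ω => by ring)
  have p3 : ∀ p q r s, e p q r s = e p r q s := fun p q r s =>
    integral_congr_ae (of_forall fun ω => by ring)
  have p4 : ∀ p q r s, e p q r s = e p q s r := fun p q r s =>
    integral_congr_ae (of_forall fun ω => by ring)
  have hdiag : ∀ p, e p p p p = ∫ x, a p x ^ 4 ∂P p := fun p => by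
    rw [← h.integral_comp (hL p).integrable_pow_four.aestronglyMeasurable]
    exact integral_congr_ae (of_forall fun ω => by ring)
  have hpair : ∀ p r, p ≠ r → e p p r r = (∫ x, a p x ^ 2 ∂P p) * ∫ x, a r x ^ 2 ∂P r :=
    fun p r hpr => by
    have hmp := h.measurePreserving_pair hpr
    rw [← integral_prod_mul, ← hmp.map_eq, integral_map hmp.measurable.aemeasurable]
    · exact integral_congr_ae (of_forall fun ω => by ring)
    · rw [hmp.map_eq]
      exact (hL p).sq_of_four.aestronglyMeasurable.comp_fst.mul
        (hL r).sq_of_four.aestronglyMeasurable.comp_snd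
  rw [hsum, sum_of_vanish_singletons e v1 (fun p q r s h1 h2 h3 => by rw [p1, v1 _ _ _ _ h1 h2 h3])
    (fun p q r s h1 h2 h3 => by rw [p2, v1 _ _ _ _ h3 h1 h2])
    (fun p q r s h1 h2 h3 => by rw [p2, p1, v1 _ _ _ _ h3 h1 h2])]
  have e3 : ∀ p r, e p p r r + e p r p r + e p r r p = 3 * e p p r r := fun p r => by
    rw [p4 p r r p, ← p3 p p r r]; ring
  simp_rw [e3, ← mul_sum, hdiag]
  have e4 : ∀ p, ∑ r, e p p r r = (∫ x, a p x ^ 2 ∂P p) * (∑ r, ∫ x, a r x ^ 2 ∂P r)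
      - (∫ x, a p x ^ 2 ∂P p) ^ 2 + ∫ x, a p x ^ 4 ∂P p := fun p => by
    rw [← Finset.sum_erase_add _ _ (mem_univ p), hdiag,
      ← Finset.sum_erase_add _ (fun r => ∫ x, a r x ^ 2 ∂P r) (mem_univ p),
      sum_congr rfl fun r hr => hpair p r (Finset.ne_of_mem_erase hr).symm, ← mul_sum]
    ring
  simp_rw [e4, sum_add_distrib, sum_sub_distrib, ← sum_mul]
  ring

theorem IndepCoord.kernel₁ (h : IndepCoord μ P X) (hL : ∀ p, MemLp (a p) 2 (P p))
    (h0 : ∀ p, ∫ x, a p x ∂P p = 0) : Kernel₁ μ P X a :=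
  ⟨fun p => (hL p).comp_measurePreserving (h.measurePreserving p), h0⟩

theorem IndepCoord.integral_sum_sq (h : IndepCoord μ P X) (hL : ∀ p, MemLp (a p) 2 (P p))
    (h0 : ∀ p, ∫ x, a p x ∂P p = 0) :
    ∫ ω, (∑ p, a p (X p ω)) ^ 2 ∂μ = ∑ p, ∫ x, a p x ^ 2 ∂P p := by
  rw [h.integral_sq_sum (h.kernel₁ hL h0)]
  exact sum_congr rfl fun p _ =>
    h.integral_comp (f := fun x => a p x ^ 2) ((hL p).aestronglyMeasurable.pow 2)

end FourthMoment

section Noise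

variable {𝒰 : Type*} [MeasurableSpace 𝒰] {ρ : Measure 𝒰} [IsProbabilityMeasure ρ] {R : ℕ}
  {η : 𝒰 → ℝ}

theorem integral_sq_le_sqrt {Ω : Type*} [MeasurableSpace Ω] {μ : Measure Ω} [IsProbabilityMeasure μ]
    {f : Ω → ℝ} (h : MemLp f 2 μ) : (∫ ω, f ω ∂μ) ^ 2 ≤ ∫ ω, f ω ^ 2 ∂μ := by
  have := variance_nonneg f μ
  rw [variance_eq_sub h] at this
  simpa using this

theorem memLp_mean {p : ℝ≥0∞} (hη : MemLp η p ρ) :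
    MemLp (fun u : Fin R → 𝒰 => (∑ r, η (u r)) / R) p (Measure.pi fun _ : Fin R => ρ) := by
  simpa only [div_eq_mul_inv, Function.comp_def] using (memLp_finsetSum _ fun r _ => hη.comp_measurePreserving
    ((indepCoord_pi fun _ : Fin R => ρ).measurePreserving r)).mul_const (R : ℝ)⁻¹

theorem integral_mean (hη : Integrable η ρ) (h0 : ∫ u, η u ∂ρ = 0) :
    ∫ u : Fin R → 𝒰, (∑ r, η (u r)) / R ∂(Measure.pi fun _ => ρ) = 0 := by
  have hi : ∀ r, Integrable (fun u : Fin R → 𝒰 => η (u r)) (Measure.pi fun _ => ρ) := fun r =>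
    ((indepCoord_pi fun _ : Fin R => ρ).measurePreserving r).integrable_comp_of_integrable hη
  rw [integral_div, integral_finsetSum _ fun r _ => hi r]
  simp_rw [(indepCoord_pi fun _ : Fin R => ρ).integral_comp hη.aestronglyMeasurable, h0]
  simp

theorem integral_mean_sq (hR : R ≠ 0) (hη : MemLp η 2 ρ) (h0 : ∫ u, η u ∂ρ = 0) :
    ∫ u : Fin R → 𝒰, ((∑ r, η (u r)) / R) ^ 2 ∂(Measure.pi fun _ => ρ)
      = (∫ u, η u ^ 2 ∂ρ) / R := by
  have hR' : (R : ℝ) ≠ 0 := by exact_mod_cast hR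
  simp_rw [div_pow]
  rw [integral_div, (indepCoord_pi fun _ : Fin R => ρ).integral_sum_sq (a := fun _ => η)
    (fun _ => hη) fun _ => h0]
  simp
  field_simp

theorem integral_mean_pow_four_le (hR : R ≠ 0) (hη : MemLp η 4 ρ) (h0 : ∫ u, η u ∂ρ = 0) :
    ∫ u : Fin R → 𝒰, ((∑ r, η (u r)) / R) ^ 4 ∂(Measure.pi fun _ => ρ)
      ≤ 3 * (∫ u, η u ^ 2 ∂ρ) ^ 2 / R ^ 2 + (∫ u, η u ^ 4 ∂ρ) / R ^ 3 := by
  have hR' : (0 : ℝ) < R := by exact_mod_cast Nat.pos_of_ne_zero hR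
  simp_rw [div_pow]
  rw [integral_div, (indepCoord_pi fun _ : Fin R => ρ).integral_pow_four (a := fun _ => η)
    (fun _ => hη) fun _ => h0]
  simp only [sum_const, card_univ, card_fin, nsmul_eq_mul]
  have : 3 * (∫ u, η u ^ 2 ∂ρ) ^ 2 / R ^ 2 + (∫ u, η u ^ 4 ∂ρ) / R ^ 3
      = (3 * (R * ∫ u, η u ^ 2 ∂ρ) ^ 2 + R * ∫ u, η u ^ 4 ∂ρ) / (R : ℝ) ^ 4 := by
    field_simp
  rw [this]
  gcongr
  have : 0 ≤ (R : ℝ) * (∫ u, η u ^ 2 ∂ρ) ^ 2 := by positivity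
  linarith

theorem sum_sub_mean_sq (y : Fin R → ℝ) (hR : R ≠ 0) :
    ∑ r, (y r - (∑ r, y r) / R) ^ 2 = (∑ r, y r ^ 2) - (∑ r, y r) ^ 2 / R := by
  have hR0 : (R : ℝ) ≠ 0 := by exact_mod_cast hR
  simp_rw [sub_sq, sum_add_distrib, sum_sub_distrib, mul_assoc, ← mul_sum,
    ← sum_mul]
  simp only [sum_const, card_univ, card_fin, nsmul_eq_mul]
  field_simp
  ring

theorem integral_sampleVar (hR : 2 ≤ R) (hη : MemLp η 2 ρ) (h0 : ∫ u, η u ∂ρ = 0) :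
    ∫ u : Fin R → 𝒰, (∑ r, (η (u r) - (∑ r, η (u r)) / R) ^ 2) / (R - 1)
      ∂(Measure.pi fun _ => ρ) = ∫ u, η u ^ 2 ∂ρ := by
  have hR2 : (2 : ℝ) ≤ R := by exact_mod_cast hR
  have hR0 : (R : ℝ) ≠ 0 := by positivity
  have hR1 : (R : ℝ) - 1 ≠ 0 := by linarith
  have hI := indepCoord_pi fun _ : Fin R => ρ
  have hi : ∀ r : Fin R, Integrable (fun u : Fin R → 𝒰 => η (u r) ^ 2) (Measure.pi fun _ => ρ) :=
    fun r => (hI.measurePreserving r).integrable_comp_of_integrable hη.integrable_sq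
  have hS : MemLp (fun u : Fin R → 𝒰 => ∑ r, η (u r)) 2 (Measure.pi fun _ => ρ) :=
    memLp_finsetSum _ fun r _ => hη.comp_measurePreserving (hI.measurePreserving r)
  simp_rw [fun u : Fin R → 𝒰 => sum_sub_mean_sq (fun r => η (u r)) (by omega : R ≠ 0)]
  rw [integral_div, integral_sub (integrable_finsetSum _ fun r _ => hi r)
    (hS.integrable_sq.div_const _), integral_finsetSum _ fun r _ => hi r, integral_div,
    hI.integral_sum_sq (a := fun _ => η) (fun _ => hη) fun _ => h0]
  have : ∀ r : Fin R, ∫ u : Fin R → 𝒰, η (u r) ^ 2 ∂(Measure.pi fun _ => ρ) = ∫ u, η u ^ 2 ∂ρ :=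
    fun r => hI.integral_comp (f := fun u => η u ^ 2) (hη.aestronglyMeasurable.pow 2)
  simp only [this, sum_const, card_univ, card_fin, nsmul_eq_mul]
  field_simp

/-- The mean square error of the sample variance. -/
theorem integral_sampleVar_sub_sq_le (hR : 2 ≤ R) (hη : MemLp η 4 ρ) (h0 : ∫ u, η u ∂ρ = 0) :
    ∫ u : Fin R → 𝒰, ((∑ r, (η (u r) - (∑ r, η (u r)) / R) ^ 2) / (R - 1)
      - ∫ u, η u ^ 2 ∂ρ) ^ 2 ∂(Measure.pi fun _ => ρ) ≤ 18 * (∫ u, η u ^ 4 ∂ρ) / R := by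
  classical
  have hR2 : (2 : ℝ) ≤ R := by exact_mod_cast hR
  have hR0 : (R : ℝ) ≠ 0 := by positivity
  have hR1 : (R : ℝ) - 1 ≠ 0 := by linarith
  set v := ∫ u, η u ^ 2 ∂ρ with hv
  set m := ∫ u, η u ^ 4 ∂ρ with hm'
  let ν : Measure (Fin R → 𝒰) := Measure.pi fun _ => ρ
  have hI := indepCoord_pi fun _ : Fin R => ρ
  have hvm : v ^ 2 ≤ m := by
    have := integral_sq_le_sqrt hη.sq_of_four
    simpa only [← pow_mul] using this
  have hm0 : 0 ≤ m := (sq_nonneg v).trans hvm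
  have hq : MemLp (fun u => η u ^ 2 - v) 2 ρ := hη.sq_of_four.sub (memLp_const v)
  have hq0 : ∫ u, (η u ^ 2 - v) ∂ρ = 0 := integral_sub_integral_self _
  have hq2 : ∫ u, (η u ^ 2 - v) ^ 2 ∂ρ ≤ m := by
    have e1 : variance (fun u => η u ^ 2) ρ = ∫ u, (η u ^ 2 - v) ^ 2 ∂ρ :=
      variance_eq_integral hη.sq_of_four.aestronglyMeasurable.aemeasurable
    have e2 := variance_eq_sub hη.sq_of_four
    rw [← e1, e2]
    simp only [Pi.pow_apply, ← pow_mul]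
    have := sq_nonneg (∫ u, η u ^ 2 ∂ρ)
    linarith
  have hb : Kernel₂ ν (fun _ => ρ) (fun r u => u r)
      (fun p q y z => if p = q then 0 else η y * η z) := by
    refine ⟨fun p q => ?_, fun p q hpq => of_forall fun u => ?_,
      fun p q hpq => of_forall fun u => ?_⟩
    · split_ifs
      · exact MemLp.zero'
      · exact (hη.comp_measurePreserving (hI.measurePreserving q)).mul
          (hη.comp_measurePreserving (hI.measurePreserving p))
    · simp only [hpq, if_false]
      rw [integral_mul_const, h0, zero_mul]
    · simp only [hpq, if_false]
      rw [integral_const_mul, h0, mul_zero]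
  have h1 := hI.integral_sum_sq (a := fun _ u => η u ^ 2 - v) (fun _ => hq) fun _ => hq0
  have h2 := hI.integral_sq_kernel₂_le hb (by simp) (κ := m) fun p q => by
    split_ifs with hpq
    · simpa using hm0
    · have hmp := hI.measurePreserving_pair hpq
      have e1 : ∫ u : Fin R → 𝒰, (η (u p) * η (u q)) ^ 2 ∂ν
          = ∫ z, η z.1 ^ 2 * η z.2 ^ 2 ∂(ρ.prod ρ) := by
        rw [← hmp.map_eq, integral_map hmp.measurable.aemeasurable]
        · exact integral_congr_ae (of_forall fun u => by ring)
        · rw [hmp.map_eq]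
          exact hη.sq_of_four.aestronglyMeasurable.comp_fst.mul
            hη.sq_of_four.aestronglyMeasurable.comp_snd
      rw [e1, integral_prod_mul (fun u => η u ^ 2) (fun u => η u ^ 2), ← hv, ← sq]
      exact hvm
  have hL1 : MemLp (fun u : Fin R → 𝒰 => ∑ r, (η (u r) ^ 2 - v)) 2 ν :=
    memLp_finsetSum _ fun r _ => hq.comp_measurePreserving (hI.measurePreserving r)
  have hL2 : MemLp (fun u : Fin R → 𝒰 => ∑ p, ∑ q, if p = q then 0 else η (u p) * η (u q)) 2 ν :=
    memLp_finsetSum _ fun p _ => memLp_finsetSum _ fun q _ => hb.memLp p q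
  have hdec : ∀ u : Fin R → 𝒰, (∑ r, (η (u r) - (∑ r, η (u r)) / R) ^ 2) / (R - 1) - v
      = (∑ r, (η (u r) ^ 2 - v)) / R
        - (∑ p, ∑ q, if p = q then 0 else η (u p) * η (u q)) / (R * (R - 1)) := fun u => by
    have e1 : (∑ p, ∑ q, if p = q then (0 : ℝ) else η (u p) * η (u q))
        = (∑ r, η (u r)) ^ 2 - ∑ r, η (u r) ^ 2 := by
      rw [sq, Finset.sum_mul_sum, ← sum_sub_distrib]
      refine sum_congr rfl fun p _ => ?_
      rw [← Finset.sum_erase_add _ _ (mem_univ p),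
        ← Finset.sum_erase_add _ (fun q => η (u p) * η (u q)) (mem_univ p)]
      rw [sum_congr rfl fun q hq => if_neg (Finset.ne_of_mem_erase hq).symm]
      simp only [if_true]
      ring
    have e2 := sum_sub_mean_sq (fun r => η (u r)) (by omega : R ≠ 0)
    rw [e1, e2, sum_sub_distrib]
    simp only [sum_const, card_univ, card_fin, nsmul_eq_mul]
    field_simp
    ring
  simp_rw [hdec]
  have hle : ∫ u : Fin R → 𝒰, ((∑ r, (η (u r) ^ 2 - v)) / R
        - (∑ p, ∑ q, if p = q then 0 else η (u p) * η (u q)) / (R * (R - 1))) ^ 2 ∂ν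
      ≤ ∫ u : Fin R → 𝒰, (2 / R ^ 2 * (∑ r, (η (u r) ^ 2 - v)) ^ 2 + 2 / (R * (R - 1)) ^ 2 *
        (∑ p, ∑ q, if p = q then 0 else η (u p) * η (u q)) ^ 2) ∂ν := by
    refine integral_mono_of_nonneg (of_forall fun u => sq_nonneg _)
      ((hL1.integrable_sq.const_mul _).add (hL2.integrable_sq.const_mul _))
      (of_forall fun u => ?_)
    have : ∀ s t : ℝ, (s / R - t / (R * (R - 1))) ^ 2
        ≤ 2 / R ^ 2 * s ^ 2 + 2 / (R * (R - 1)) ^ 2 * t ^ 2 := fun s t => by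
      have e : 2 / R ^ 2 * s ^ 2 + 2 / (R * (R - 1)) ^ 2 * t ^ 2
        = 2 * (s / R) ^ 2 + 2 * (t / (R * (R - 1))) ^ 2 := by
        rw [div_pow, div_pow, mul_div_assoc', mul_div_assoc', div_mul_eq_mul_div, div_mul_eq_mul_div]
      rw [e]
      nlinarith [sq_nonneg (s / R + t / (R * (R - 1)))]
    exact this _ _
  refine hle.trans ?_
  rw [integral_add (hL1.integrable_sq.const_mul _) (hL2.integrable_sq.const_mul _),
    integral_const_mul, integral_const_mul, h1]
  simp only [sum_const, card_univ, card_fin, nsmul_eq_mul] at h2 ⊢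
  calc _ ≤ 2 / (R : ℝ) ^ 2 * (R * m) + 2 / (R * (R - 1)) ^ 2 * (2 * (R : ℝ) ^ 2 * m) := by
        gcongr
    _ = 2 * m / R + 4 * m / (R - 1) ^ 2 := by field_simp; ring
    _ ≤ 2 * m / R + 16 * m / R := by
        refine add_le_add le_rfl ?_
        rw [div_le_div_iff₀ (pow_pos (by linarith) 2) (by linarith)]
        have : (R : ℝ) ≤ 4 * (R - 1) ^ 2 := by nlinarith
        linarith [mul_le_mul_of_nonneg_left this hm0]
    _ = _ := by ring

end Noise

section Group

variable {𝒥 : Type*} [Finite 𝒥] [MeasurableSpace 𝒥] [MeasurableSingletonClass 𝒥] {π : Measure 𝒥}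
  [IsProbabilityMeasure π]

theorem memLp_prod_of_finite {β : Type*} [MeasurableSpace β] {ν : Measure β}
    [IsProbabilityMeasure ν] {f : 𝒥 → β → ℝ} (hm : ∀ J, Measurable (f J)) {p : ℝ≥0∞} (hp0 : p ≠ 0)
    (hp : p ≠ ∞) (hL : ∀ J, MemLp (f J) p ν) :
    MemLp (fun z : 𝒥 × β => f z.1 z.2) p (π.prod ν) := by
  have hmm : Measurable fun z : 𝒥 × β => f z.1 z.2 := measurable_from_prod_countable_right hm
  rw [← integrable_norm_rpow_iff hmm.aestronglyMeasurable hp0 hp,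
    integrable_prod_iff (hmm.norm.pow_const _).aestronglyMeasurable]
  exact ⟨of_forall fun J => (integrable_norm_rpow_iff
    (hm J).aestronglyMeasurable hp0 hp).2 (hL J), Integrable.of_finite⟩

variable {𝒰 : Type*} [MeasurableSpace 𝒰] {ρ : Measure 𝒰} [IsProbabilityMeasure ρ] {R : ℕ}

/-- The average of the outputs of a group of simulation runs. -/
def groupMean (h : 𝒥 → 𝒰 → ℝ) (z : 𝒥 × (Fin R → 𝒰)) : ℝ := (∑ r, h z.1 (z.2 r)) / R

/-- The sample variance of the outputs of a group of simulation runs. -/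
def groupVar (h : 𝒥 → 𝒰 → ℝ) (z : 𝒥 × (Fin R → 𝒰)) : ℝ :=
  (∑ r, (h z.1 (z.2 r) - groupMean h z) ^ 2) / (R - 1)

/-- Simulation runs with mean `ψ` and finite fourth moments. -/
structure Runs (ρ : Measure 𝒰) (h : 𝒥 → 𝒰 → ℝ) (ψ : 𝒥 → ℝ) : Prop where
  meas : ∀ J, Measurable (h J)
  memLp : ∀ J, MemLp (h J) 4 ρ
  mean : ∀ J, ∫ u, h J u ∂ρ = ψ J

variable {h : 𝒥 → 𝒰 → ℝ} {ψ : 𝒥 → ℝ}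

theorem groupMean_eq (hR : R ≠ 0) (z : 𝒥 × (Fin R → 𝒰)) :
    groupMean h z = ψ z.1 + groupMean (fun J u => h J u - ψ J) z := by
  have : (R : ℝ) ≠ 0 := by exact_mod_cast hR
  simp only [groupMean, sum_sub_distrib, sum_const, card_univ,
    card_fin, nsmul_eq_mul]
  field_simp
  ring

theorem groupVar_eq (hR : R ≠ 0) (z : 𝒥 × (Fin R → 𝒰)) :
    groupVar h z = groupVar (fun J u => h J u - ψ J) z := by
  simp only [groupVar]
  congr 1
  refine sum_congr rfl fun r _ => ?_
  rw [groupMean_eq (ψ := ψ) hR z]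
  ring

theorem Runs.sub (hr : Runs ρ h ψ) : Runs ρ (fun J u => h J u - ψ J) fun _ => 0 := by
  refine ⟨fun J => (hr.meas J).sub_const _, fun J => (hr.memLp J).sub (memLp_const _), fun J => ?_⟩
  rw [← hr.mean J]
  exact integral_sub_integral_self _

theorem measurable_groupMean (hm : ∀ J, Measurable (h J)) (J : 𝒥) :
    Measurable fun u : Fin R → 𝒰 => groupMean h (J, u) :=
  (measurable_fun_sum _ fun r _ => (hm J).comp (measurable_pi_apply r)).div_const _

theorem measurable_groupVar (hm : ∀ J, Measurable (h J)) (J : 𝒥) :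
    Measurable fun u : Fin R → 𝒰 => groupVar h (J, u) :=
  (measurable_fun_sum _ fun r _ => (((hm J).comp (measurable_pi_apply r)).sub
    (measurable_groupMean hm J)).pow_const 2).div_const _

theorem Runs.memLp_slice (hr : Runs ρ h ψ) (J : 𝒥) :
    MemLp (fun u : Fin R → 𝒰 => groupMean h (J, u)) 4 (Measure.pi fun _ => ρ) :=
  memLp_mean (hr.memLp J)

theorem Runs.memLp_groupMean (hr : Runs ρ h ψ) :
    MemLp (groupMean (R := R) h) 4 (π.prod (Measure.pi fun _ => ρ)) :=
  memLp_prod_of_finite (f := fun J (u : Fin R → 𝒰) => groupMean h (J, u))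
    (measurable_groupMean hr.meas) (by norm_num) (by norm_num) fun J => memLp_mean (hr.memLp J)

theorem Runs.memLp_groupVar (hr : Runs ρ h ψ) :
    MemLp (groupVar (R := R) h) 2 (π.prod (Measure.pi fun _ => ρ)) := by
  refine memLp_prod_of_finite (f := fun J (u : Fin R → 𝒰) => groupVar h (J, u))
    (measurable_groupVar hr.meas) (by norm_num) (by norm_num) fun J => ?_
  have : MemLp (fun u : Fin R → 𝒰 => ∑ r, (h J (u r) - groupMean h (J, u)) ^ 2) 2
      (Measure.pi fun _ => ρ) := memLp_finsetSum _ fun r _ =>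
    (((hr.memLp J).comp_measurePreserving
      ((indepCoord_pi fun _ : Fin R => ρ).measurePreserving r)).sub (memLp_mean (hr.memLp J))).sq_of_four
  simpa only [groupVar, div_eq_mul_inv] using this.mul_const ((R : ℝ) - 1)⁻¹

theorem Runs.integral_groupMean (hr : Runs ρ h ψ) (hR : R ≠ 0) :
    ∫ z, groupMean (R := R) h z ∂(π.prod (Measure.pi fun _ => ρ)) = ∫ J, ψ J ∂π := by
  rw [integral_prod _ ((hr.memLp_groupMean).integrable (by norm_num))]
  refine integral_congr_ae (of_forall fun J => ?_)
  simp only [groupMean_eq (h := h) (ψ := ψ) hR]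
  rw [integral_add (integrable_const _)
    ((hr.sub.memLp_slice J).integrable (by norm_num))]
  simp only [groupMean]
  rw [integral_mean ((hr.sub.memLp J).integrable (by norm_num)) (hr.sub.mean J)]
  simp

theorem Runs.integral_groupVar (hr : Runs ρ h ψ) (hR : 2 ≤ R) :
    ∫ z, groupVar (R := R) h z ∂(π.prod (Measure.pi fun _ => ρ))
      = ∫ J, ∫ u, (h J u - ψ J) ^ 2 ∂ρ ∂π := by
  rw [integral_prod _ ((hr.memLp_groupVar).integrable (by norm_num))]
  refine integral_congr_ae (of_forall fun J => ?_)
  simp only [groupVar_eq (h := h) (ψ := ψ) (by omega : R ≠ 0)]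
  exact integral_sampleVar hR ((hr.sub.memLp J).mono_exponent (by norm_num)) (hr.sub.mean J)

/-- The conditional second moment of a deviation of the group mean. -/
theorem Runs.integral_groupMean_sub_sq (hr : Runs ρ h ψ) (hR : R ≠ 0) (J : 𝒥) (t : ℝ) :
    ∫ u : Fin R → 𝒰, (groupMean h (J, u) - t) ^ 2 ∂(Measure.pi fun _ => ρ)
      = (ψ J - t) ^ 2 + (∫ u, (h J u - ψ J) ^ 2 ∂ρ) / R := by
  have hL := hr.sub.memLp_slice (R := R) J
  have e : ∀ u : Fin R → 𝒰, (groupMean h (J, u) - t) ^ 2 = (ψ J - t) ^ 2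
      + 2 * (ψ J - t) * groupMean (fun J u => h J u - ψ J) (J, u)
      + groupMean (fun J u => h J u - ψ J) (J, u) ^ 2 := fun u => by
    rw [groupMean_eq (ψ := ψ) hR]; ring
  simp_rw [e]
  have hi : Integrable (fun u : Fin R → 𝒰 => (ψ J - t) ^ 2
      + 2 * (ψ J - t) * groupMean (fun J u => h J u - ψ J) (J, u)) (Measure.pi fun _ => ρ) :=
    (integrable_const _).add ((hL.integrable (by norm_num)).const_mul _)
  rw [integral_add hi (hL.mono_exponent (by norm_num : (2 : ℝ≥0∞) ≤ 4)).integrable_sq,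
    integral_add (integrable_const _) ((hL.integrable (by norm_num)).const_mul _),
    integral_const_mul]
  have e1 := integral_mean (R := R) ((hr.sub.memLp J).integrable (by norm_num)) (hr.sub.mean J)
  have e2 := integral_mean_sq hR ((hr.sub.memLp J).mono_exponent (by norm_num)) (hr.sub.mean J)
  simp only [groupMean]
  rw [e1, e2]
  simp

theorem Runs.integral_dev_sq (hr : Runs ρ h ψ) (hR : R ≠ 0) :
    ∫ z : 𝒥 × (Fin R → 𝒰), (groupMean h z - ∫ J, ψ J ∂π) ^ 2 ∂(π.prod (Measure.pi fun _ => ρ))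
      = variance ψ π + (∫ J, ∫ u, (h J u - ψ J) ^ 2 ∂ρ ∂π) / R := by
  have hL : MemLp (fun z : 𝒥 × (Fin R → 𝒰) => groupMean h z - ∫ J, ψ J ∂π) 4
    (π.prod (Measure.pi fun _ => ρ)) := hr.memLp_groupMean.sub (memLp_const _)
  rw [integral_prod _ (hL.mono_exponent (by norm_num : (2 : ℝ≥0∞) ≤ 4)).integrable_sq]
  simp_rw [hr.integral_groupMean_sub_sq hR]
  rw [integral_add Integrable.of_finite Integrable.of_finite, integral_div,
    variance_eq_integral (measurable_of_finite _).aemeasurable]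

theorem add_pow_four_le (s t : ℝ) : (s + t) ^ 4 ≤ 8 * s ^ 4 + 8 * t ^ 4 := by
  have h1 : (s + t) ^ 2 ≤ 2 * s ^ 2 + 2 * t ^ 2 := by nlinarith [sq_nonneg (s - t)]
  have h2 : ((s + t) ^ 2) ^ 2 ≤ (2 * s ^ 2 + 2 * t ^ 2) ^ 2 :=
    pow_le_pow_left₀ (sq_nonneg _) h1 2
  nlinarith [sq_nonneg (s ^ 2 - t ^ 2)]

theorem Runs.integral_dev_pow_four_le (hr : Runs ρ h ψ) (hR : R ≠ 0) (t : ℝ) :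
    ∫ z : 𝒥 × (Fin R → 𝒰), (groupMean h z - t) ^ 4 ∂(π.prod (Measure.pi fun _ => ρ))
      ≤ 8 * (∫ J, (ψ J - t) ^ 4 ∂π)
        + 8 * (3 * (∫ J, (∫ u, (h J u - ψ J) ^ 2 ∂ρ) ^ 2 ∂π) / R ^ 2
          + (∫ J, ∫ u, (h J u - ψ J) ^ 4 ∂ρ ∂π) / R ^ 3) := by
  have hL : MemLp (fun z : 𝒥 × (Fin R → 𝒰) => groupMean h z - t) 4
    (π.prod (Measure.pi fun _ => ρ)) := hr.memLp_groupMean.sub (memLp_const _)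
  rw [integral_prod _ hL.integrable_pow_four]
  have key : ∀ J, ∫ u : Fin R → 𝒰, (groupMean h (J, u) - t) ^ 4 ∂(Measure.pi fun _ => ρ)
      ≤ 8 * (ψ J - t) ^ 4 + 8 * (3 * (∫ u, (h J u - ψ J) ^ 2 ∂ρ) ^ 2 / R ^ 2
        + (∫ u, (h J u - ψ J) ^ 4 ∂ρ) / R ^ 3) := fun J => by
    have hn := hr.sub.memLp_slice (R := R) J
    have hb := integral_mean_pow_four_le hR (hr.sub.memLp J) (hr.sub.mean J)
    calc _ ≤ ∫ u : Fin R → 𝒰, (8 * (ψ J - t) ^ 4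
          + 8 * groupMean (fun J u => h J u - ψ J) (J, u) ^ 4) ∂(Measure.pi fun _ => ρ) := by
          refine integral_mono_of_nonneg (of_forall fun u => by positivity)
            ((integrable_const _).add (hn.integrable_pow_four.const_mul 8))
            (of_forall fun u => ?_)
          dsimp only
          rw [groupMean_eq (ψ := ψ) hR, add_sub_right_comm]
          exact add_pow_four_le _ _
      _ ≤ _ := by
          rw [integral_add (integrable_const _) (hn.integrable_pow_four.const_mul 8),
            integral_const, probReal_univ, one_smul, integral_const_mul]
          exact add_le_add le_rfl (mul_le_mul_of_nonneg_left hb (by norm_num))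
  refine (integral_mono Integrable.of_finite Integrable.of_finite key).trans (le_of_eq ?_)
  rw [integral_add Integrable.of_finite Integrable.of_finite, integral_const_mul,
    integral_const_mul, integral_add Integrable.of_finite Integrable.of_finite, integral_div,
    integral_div, integral_const_mul]

/-- A lower bound for the variance of squared deviations of the group mean. -/
theorem Runs.le_integral_dev_sq_sub_sq (hr : Runs ρ h ψ) (hR : R ≠ 0) (t a w : ℝ) :
    (1 / 2) * variance (fun J => (ψ J - t) ^ 2) π
        - (∫ J, ((∫ u, (h J u - ψ J) ^ 2 ∂ρ) - w) ^ 2 ∂π) / R ^ 2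
      ≤ ∫ z : 𝒥 × (Fin R → 𝒰), ((groupMean h z - t) ^ 2 - a) ^ 2
        ∂(π.prod (Measure.pi fun _ => ρ)) := by
  have hL : MemLp (fun z : 𝒥 × (Fin R → 𝒰) => groupMean h z - t) 4
    (π.prod (Measure.pi fun _ => ρ)) := hr.memLp_groupMean.sub (memLp_const _)
  have hL2 : MemLp (fun z : 𝒥 × (Fin R → 𝒰) => (groupMean h z - t) ^ 2 - a) 2
    (π.prod (Measure.pi fun _ => ρ)) := hL.sq_of_four.sub (memLp_const a)
  rw [integral_prod _ hL2.integrable_sq]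
  have key : ∀ J, (1 / 2) * ((ψ J - t) ^ 2 - (a - w / R)) ^ 2
      - ((∫ u, (h J u - ψ J) ^ 2 ∂ρ) - w) ^ 2 / R ^ 2
      ≤ ∫ u : Fin R → 𝒰, ((groupMean h (J, u) - t) ^ 2 - a) ^ 2 ∂(Measure.pi fun _ => ρ) := fun J => by
    have hLJ : MemLp (fun u : Fin R → 𝒰 => groupMean h (J, u) - t) 4 (Measure.pi fun _ => ρ) :=
      (memLp_mean (hr.memLp J)).sub (memLp_const _)
    have h1 := integral_sq_le_sqrt (hLJ.sq_of_four.sub (memLp_const a))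
    have h2 : ∫ u : Fin R → 𝒰, ((groupMean h (J, u) - t) ^ 2 - a) ∂(Measure.pi fun _ => ρ)
        = (ψ J - t) ^ 2 + (∫ u, (h J u - ψ J) ^ 2 ∂ρ) / R - a := by
      rw [integral_sub (hLJ.sq_of_four.integrable (by norm_num)) (integrable_const _),
        hr.integral_groupMean_sub_sq hR]
      simp
    simp only [Pi.sub_apply] at h1
    rw [h2] at h1
    refine le_trans ?_ h1
    rw [← div_pow, sub_div]
    nlinarith [sq_nonneg ((ψ J - t) ^ 2 - (a - w / R)
      + 2 * ((∫ u, (h J u - ψ J) ^ 2 ∂ρ) / R - w / R))]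
  refine le_trans ?_ (integral_mono Integrable.of_finite Integrable.of_finite key)
  rw [integral_sub Integrable.of_finite Integrable.of_finite, integral_div, integral_const_mul]
  gcongr
  rw [variance_eq_integral (measurable_of_finite _).aemeasurable]
  set b := a - w / R
  have hX2 : ∀ c : ℝ, ∫ J, ((ψ J - t) ^ 2 - c) ^ 2 ∂π
      = ∫ J, ((ψ J - t) ^ 2) ^ 2 ∂π - 2 * c * ∫ J, (ψ J - t) ^ 2 ∂π + c ^ 2 := fun c => by
    have e : ∀ J, ((ψ J - t) ^ 2 - c) ^ 2 = ((ψ J - t) ^ 2) ^ 2 - 2 * c * (ψ J - t) ^ 2 + c ^ 2 :=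
      fun J => by ring
    simp_rw [e]
    rw [integral_add Integrable.of_finite (integrable_const _),
      integral_sub Integrable.of_finite Integrable.of_finite, integral_const_mul]
    simp
  rw [hX2, hX2]
  nlinarith [sq_nonneg (∫ J, (ψ J - t) ^ 2 ∂π - b)]

theorem Runs.integral_groupVar_sub_sq_le (hr : Runs ρ h ψ) (hR : 2 ≤ R) (t : ℝ) :
    ∫ z : 𝒥 × (Fin R → 𝒰), (groupVar h z - t) ^ 2 ∂(π.prod (Measure.pi fun _ => ρ))
      ≤ 36 * (∫ J, ∫ u, (h J u - ψ J) ^ 4 ∂ρ ∂π) / R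
        + 2 * ∫ J, ((∫ u, (h J u - ψ J) ^ 2 ∂ρ) - t) ^ 2 ∂π := by
  have hL : MemLp (fun z : 𝒥 × (Fin R → 𝒰) => groupVar h z - t) 2
    (π.prod (Measure.pi fun _ => ρ)) := hr.memLp_groupVar.sub (memLp_const _)
  rw [integral_prod _ hL.integrable_sq]
  have key : ∀ J, ∫ u : Fin R → 𝒰, (groupVar h (J, u) - t) ^ 2 ∂(Measure.pi fun _ => ρ)
      ≤ 36 * (∫ u, (h J u - ψ J) ^ 4 ∂ρ) / R + 2 * ((∫ u, (h J u - ψ J) ^ 2 ∂ρ) - t) ^ 2 := fun J => by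
    have hb := integral_sampleVar_sub_sq_le hR (hr.sub.memLp J) (hr.sub.mean J)
    have hLJ : MemLp (fun u : Fin R → 𝒰 => groupVar (fun J u => h J u - ψ J) (J, u)
        - ∫ u, (h J u - ψ J) ^ 2 ∂ρ) 2 (Measure.pi fun _ => ρ) := by
      have : MemLp (fun u : Fin R → 𝒰 => ∑ r, (h J (u r) - ψ J
          - groupMean (fun J u => h J u - ψ J) (J, u)) ^ 2) 2
          (Measure.pi fun _ => ρ) := memLp_finsetSum _ fun r _ =>
        (((hr.sub.memLp J).comp_measurePreserving
          ((indepCoord_pi fun _ : Fin R => ρ).measurePreserving r)).sub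
          (memLp_mean (hr.sub.memLp J))).sq_of_four
      have h2 := this.mul_const ((R : ℝ) - 1)⁻¹
      simp only [groupVar, div_eq_mul_inv]
      exact h2.sub (memLp_const _)
    calc _ ≤ ∫ u : Fin R → 𝒰, (2 * (groupVar (fun J u => h J u - ψ J) (J, u)
          - ∫ u, (h J u - ψ J) ^ 2 ∂ρ) ^ 2 + 2 * ((∫ u, (h J u - ψ J) ^ 2 ∂ρ) - t) ^ 2)
          ∂(Measure.pi fun _ => ρ) := by
          refine integral_mono_of_nonneg (of_forall fun u => sq_nonneg _)
            ((hLJ.integrable_sq.const_mul 2).add (integrable_const _))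
            (of_forall fun u => ?_)
          dsimp only
          rw [groupVar_eq (ψ := ψ) (by omega : R ≠ 0)]
          generalize groupVar (fun J u => h J u - ψ J) (J, u) = s
          generalize ∫ u, (h J u - ψ J) ^ 2 ∂ρ = v
          nlinarith [sq_nonneg ((s - v) - (v - t))]
      _ ≤ _ := by
          rw [integral_add (hLJ.integrable_sq.const_mul 2) (integrable_const _),
            integral_const_mul]
          simp only [integral_const, probReal_univ, one_smul]
          simp only [groupVar, groupMean]
          gcongr ?_ + _
          refine (mul_le_mul_of_nonneg_left hb (by norm_num)).trans (le_of_eq (by ring))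
  refine (integral_mono Integrable.of_finite Integrable.of_finite key).trans (le_of_eq ?_)
  rw [integral_add Integrable.of_finite Integrable.of_finite, integral_const_mul,
    integral_div, integral_const_mul]

end Group

section Perturbation

variable {𝒥 : Type*} [Finite 𝒥] [MeasurableSpace 𝒥] [MeasurableSingletonClass 𝒥] {π : Measure 𝒥}
  [IsProbabilityMeasure π]

theorem integral_pow_four_add_le (L e : 𝒥 → ℝ) :
    ∫ J, (L J + e J) ^ 4 ∂π ≤ 8 * (∫ J, L J ^ 4 ∂π) + 8 * ∫ J, e J ^ 4 ∂π := by
  rw [← integral_const_mul, ← integral_const_mul,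
    ← integral_add Integrable.of_finite Integrable.of_finite]
  exact integral_mono Integrable.of_finite Integrable.of_finite fun J => add_pow_four_le _ _

theorem integral_sub_mean_pow_four_le (e : 𝒥 → ℝ) :
    ∫ J, (e J - ∫ J, e J ∂π) ^ 4 ∂π ≤ 16 * ∫ J, e J ^ 4 ∂π := by
  have h1 := integral_pow_four_add_le (π := π) e fun _ => -∫ J, e J ∂π
  have h2 : (∫ J, e J ∂π) ^ 4 ≤ ∫ J, e J ^ 4 ∂π := by
    have a1 := integral_sq_le_sqrt (μ := π) (f := e) MemLp.of_discrete
    have a2 := integral_sq_le_sqrt (μ := π) (f := fun J => e J ^ 2) MemLp.of_discrete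
    simp only [← pow_mul] at a2
    calc (∫ J, e J ∂π) ^ 4 = ((∫ J, e J ∂π) ^ 2) ^ 2 := by ring
      _ ≤ (∫ J, e J ^ 2 ∂π) ^ 2 := pow_le_pow_left₀ (sq_nonneg _) a1 2
      _ ≤ _ := a2
  simp only [integral_const, probReal_univ, one_smul, Even.neg_pow (by decide : Even 4)] at h1
  simp only [sub_eq_add_neg]
  linarith

theorem le_variance_sq_add (L e : 𝒥 → ℝ) :
    (1 / 2) * variance (fun J => L J ^ 2) π
        - (8 * (√(∫ J, L J ^ 4 ∂π) * √(∫ J, e J ^ 4 ∂π)) + 2 * ∫ J, e J ^ 4 ∂π)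
      ≤ variance (fun J => (L J + e J) ^ 2) π := by
  have h1 := variance_add_le (μ := π) (f := fun J => (L J + e J) ^ 2)
    (g := fun J => -(2 * L J * e J + e J ^ 2)) MemLp.of_discrete MemLp.of_discrete
  have e1 : (fun J => (L J + e J) ^ 2 + -(2 * L J * e J + e J ^ 2)) = fun J => L J ^ 2 := by
    funext J; ring
  rw [e1] at h1
  have h2 : variance (fun J => -(2 * L J * e J + e J ^ 2)) π
      ≤ 8 * (√(∫ J, L J ^ 4 ∂π) * √(∫ J, e J ^ 4 ∂π)) + 2 * ∫ J, e J ^ 4 ∂π := by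
    refine (variance_le_integral_sq MemLp.of_discrete).trans ?_
    have a1 := sq_integral_mul_le (μ := π) (f := fun J => L J ^ 2) (g := fun J => e J ^ 2)
      MemLp.of_discrete MemLp.of_discrete
    have a2 : ∫ J, L J ^ 2 * e J ^ 2 ∂π ≤ √(∫ J, L J ^ 4 ∂π) * √(∫ J, e J ^ 4 ∂π) := by
      rw [← Real.sqrt_mul (integral_nonneg fun J => by positivity)]
      refine Real.le_sqrt_of_sq_le (le_trans a1 (le_of_eq ?_))
      simp only [← pow_mul]
    calc ∫ J, (-(2 * L J * e J + e J ^ 2)) ^ 2 ∂π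
        ≤ ∫ J, (8 * (L J ^ 2 * e J ^ 2) + 2 * e J ^ 4) ∂π := by
          refine integral_mono Integrable.of_finite Integrable.of_finite fun J => ?_
          dsimp only
          nlinarith [sq_nonneg (2 * L J * e J - e J ^ 2)]
      _ = 8 * (∫ J, L J ^ 2 * e J ^ 2 ∂π) + 2 * ∫ J, e J ^ 4 ∂π := by
          rw [integral_add Integrable.of_finite Integrable.of_finite, integral_const_mul,
            integral_const_mul]
      _ ≤ _ := by gcongr
  linarith

end Perturbation

section Anova

variable {Z : Type*} [MeasurableSpace Z] {γ : Measure Z} [IsProbabilityMeasure γ] {y w : Z → ℝ}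

/-- The centred squared deviation from the mean. -/
def sqDev (γ : Measure Z) (y : Z → ℝ) (z : Z) : ℝ :=
  (y z - ∫ z, y z ∂γ) ^ 2 - ∫ z, (y z - ∫ z, y z ∂γ) ^ 2 ∂γ

/-- The smaller order part of the error of the ANOVA estimate. -/
def anovaError (γ : Measure Z) (y w : Z → ℝ) {B : ℕ} (R : ℕ) (C : Fin B → Z) : ℝ :=
  (∑ b, (y (C b) - ∫ z, y z ∂γ) ^ 2 - (∑ b, (y (C b) - ∫ z, y z ∂γ)) ^ 2) / (B * (B - 1))
    - (∑ b, (w (C b) - ∫ z, w z ∂γ)) / (B * R)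

theorem anovaEstimate_eq {θ : ℝ} {B R : ℕ} (hB : 2 ≤ B) {Y : Fin B → Fin R → ℝ} {C : Fin B → Z}
    (hy : ∀ b, (∑ r, Y b r) / R = y (C b))
    (hw : ∀ b, (∑ r, (Y b r - y (C b)) ^ 2) / ((R : ℝ) - 1) = w (C b)) :
    anovaEstimate θ Y = θ * (∫ z, (y z - ∫ z, y z ∂γ) ^ 2 ∂γ - (∫ z, w z ∂γ) / R)
      + (θ / B * ∑ b, sqDev γ y (C b) + θ * anovaError γ y w R C) := by
  have hB1 : (B : ℝ) ≠ 0 := by positivity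
  have hB2 : (B : ℝ) - 1 ≠ 0 := by
    have : (2 : ℝ) ≤ B := by exact_mod_cast hB
    linarith
  simp only [anovaEstimate, hy]
  set t := ∫ z, y z ∂γ
  set τ := ∫ z, w z ∂γ
  have e1 : (∑ b, ∑ r, (Y b r - y (C b)) ^ 2) / ((B : ℝ) * ((R : ℝ) - 1)) = (∑ b, w (C b)) / B := by
    simp_rw [← hw, ← sum_div]
    rw [div_div, mul_comm]
  have e2 : ∑ b, (y (C b) - (∑ b, y (C b)) / B) ^ 2
      = ∑ b, (y (C b) - t) ^ 2 - (∑ b, (y (C b) - t)) ^ 2 / B := by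
    have h : ∀ b, (y (C b) - (∑ b, y (C b)) / B) ^ 2 = (y (C b) - t) ^ 2
        - 2 * ((∑ b, (y (C b) - t)) / B) * (y (C b) - t) + ((∑ b, (y (C b) - t)) / B) ^ 2 := fun b => by
      have : (∑ b, y (C b)) / B = t + (∑ b, (y (C b) - t)) / B := by
        simp only [sum_sub_distrib, sum_const, card_univ, card_fin,
          nsmul_eq_mul]
        field_simp
        ring
      rw [this]; ring
    simp_rw [h]
    rw [sum_add_distrib, sum_sub_distrib, ← mul_sum]
    simp only [sum_const, card_univ, card_fin, nsmul_eq_mul]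
    field_simp
    ring
  have e3 : ∑ b, sqDev γ y (C b) = ∑ b, (y (C b) - t) ^ 2 - B * ∫ z, (y z - t) ^ 2 ∂γ := by
    simp only [sqDev, sum_sub_distrib, sum_const, card_univ, card_fin,
      nsmul_eq_mul, t]
  have e4 : ∑ b, (w (C b) - τ) = ∑ b, w (C b) - B * τ := by
    simp only [sum_sub_distrib, sum_const, card_univ, card_fin,
      nsmul_eq_mul]
  rw [e1, e2, e3, anovaError, e4]
  generalize ∑ b, (y (C b) - t) ^ 2 = a₁
  generalize ∑ b, (y (C b) - t) = a₂
  generalize ∑ b, w (C b) = a₃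
  generalize ∫ z, (y z - t) ^ 2 ∂γ = a₄
  rcases eq_or_ne (R : ℝ) 0 with hR | hR
  · simp only [hR, div_zero, mul_zero]
    field_simp
    ring
  · field_simp
    ring

variable {Ω : Type*} [MeasurableSpace Ω] {Γ : Measure Ω} [IsProbabilityMeasure Γ] {B R : ℕ}
  {C : Fin B → Ω → Z}

theorem memLp_sub_integral {p : ℝ≥0∞} (hy : MemLp y p γ) :
    MemLp (fun z => y z - ∫ z, y z ∂γ) p γ := hy.sub (memLp_const _)

theorem integral_sub_mean_sq_le (hw : MemLp w 2 γ) (t : ℝ) :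
    ∫ z, (w z - ∫ z, w z ∂γ) ^ 2 ∂γ ≤ ∫ z, (w z - t) ^ 2 ∂γ := by
  have h := variance_le_integral_sq (μ := γ) (f := fun z => w z - t) (hw.sub (memLp_const t))
  rwa [variance_sub_const hw.aestronglyMeasurable, variance_eq_integral hw.aemeasurable] at h

theorem IndepCoord.integral_sum_sub_mean_sq (hC : IndepCoord Γ (fun _ => γ) C) (hy : MemLp y 2 γ) :
    ∫ ω, (∑ b, (y (C b ω) - ∫ z, y z ∂γ)) ^ 2 ∂Γ = B * ∫ z, (y z - ∫ z, y z ∂γ) ^ 2 ∂γ := by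
  rw [hC.integral_sum_sq (a := fun _ z => y z - ∫ z, y z ∂γ) (fun _ => memLp_sub_integral hy)
    fun _ => integral_sub_integral_self _]
  simp

theorem lintegral_anovaError_le (hC : IndepCoord Γ (fun _ => γ) C) (hB : 2 ≤ B)
    (hy : MemLp y 2 γ) (hw : MemLp w 2 γ) (t : ℝ) :
    ∫⁻ ω, ‖anovaError γ y w R fun b => C b ω‖ₑ ∂Γ ≤ ENNReal.ofReal
      (4 * (∫ z, (y z - ∫ z, y z ∂γ) ^ 2 ∂γ) / B + √(∫ z, (w z - t) ^ 2 ∂γ) / (R * √B)) := by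
  have hB2 : (2 : ℝ) ≤ B := by exact_mod_cast hB
  have hB0 : (0 : ℝ) < B := by linarith
  have hB1 : (0 : ℝ) < B - 1 := by linarith
  have hA : ∀ b, MemLp (fun ω => y (C b ω) - ∫ z, y z ∂γ) 2 Γ := fun b =>
    (memLp_sub_integral hy).comp_measurePreserving (hC.measurePreserving b)
  have hW : ∀ b, MemLp (fun ω => w (C b ω) - ∫ z, w z ∂γ) 2 Γ := fun b =>
    (memLp_sub_integral hw).comp_measurePreserving (hC.measurePreserving b)
  have hA1 : Integrable (fun ω => ∑ b, (y (C b ω) - ∫ z, y z ∂γ) ^ 2) Γ :=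
    integrable_finsetSum _ fun b _ => (hA b).integrable_sq
  have hA2 : Integrable (fun ω => (∑ b, (y (C b ω) - ∫ z, y z ∂γ)) ^ 2) Γ :=
    (memLp_finsetSum _ fun b _ => hA b).integrable_sq
  have hWs : MemLp (fun ω => ∑ b, (w (C b ω) - ∫ z, w z ∂γ)) 2 Γ := memLp_finsetSum _ fun b _ => hW b
  have hW1 := (hWs.integrable (by norm_num)).abs
  have eA : ∫ ω, ∑ b, (y (C b ω) - ∫ z, y z ∂γ) ^ 2 ∂Γ = B * ∫ z, (y z - ∫ z, y z ∂γ) ^ 2 ∂γ := by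
    rw [integral_finsetSum _ fun b _ => (hA b).integrable_sq]
    simp_rw [hC.integral_comp (f := fun z => (y z - ∫ z, y z ∂γ) ^ 2)
      ((memLp_sub_integral hy).aestronglyMeasurable.pow 2)]
    simp
  have eW : ∫ ω, |∑ b, (w (C b ω) - ∫ z, w z ∂γ)| ∂Γ ≤ √B * √(∫ z, (w z - t) ^ 2 ∂γ) := by
    have h := integral_sq_le_sqrt hWs.abs
    simp only [Pi.abs_apply, sq_abs] at h
    rw [hC.integral_sum_sub_mean_sq hw] at h
    rw [← Real.sqrt_mul hB0.le]
    exact Real.le_sqrt_of_sq_le (h.trans (mul_le_mul_of_nonneg_left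
      (integral_sub_mean_sq_le hw t) hB0.le))
  have hA3 : Integrable (fun ω => (∑ b, (y (C b ω) - ∫ z, y z ∂γ) ^ 2
      + (∑ b, (y (C b ω) - ∫ z, y z ∂γ)) ^ 2) / (B * (B - 1))) Γ := (hA1.add hA2).div_const _
  have hW2 : Integrable (fun ω => |∑ b, (w (C b ω) - ∫ z, w z ∂γ)| / (B * R)) Γ := hW1.div_const _
  calc ∫⁻ ω, ‖anovaError γ y w R fun b => C b ω‖ₑ ∂Γ
      ≤ ∫⁻ ω, ENNReal.ofReal ((∑ b, (y (C b ω) - ∫ z, y z ∂γ) ^ 2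
          + (∑ b, (y (C b ω) - ∫ z, y z ∂γ)) ^ 2) / (B * (B - 1))
          + |∑ b, (w (C b ω) - ∫ z, w z ∂γ)| / (B * R)) ∂Γ := by
        refine lintegral_mono fun ω => ?_
        rw [Real.enorm_eq_ofReal_abs]
        refine ENNReal.ofReal_le_ofReal ((abs_sub _ _).trans (add_le_add ?_ ?_))
        · rw [abs_div, abs_of_pos (mul_pos hB0 hB1)]
          gcongr
          refine (abs_sub _ _).trans (le_of_eq ?_)
          rw [abs_of_nonneg (sum_nonneg fun b _ => sq_nonneg _), abs_of_nonneg (sq_nonneg _)]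
        · rw [abs_div, abs_of_nonneg (a := (B * R : ℝ)) (by positivity)]
    _ = ENNReal.ofReal (∫ ω, ((∑ b, (y (C b ω) - ∫ z, y z ∂γ) ^ 2
          + (∑ b, (y (C b ω) - ∫ z, y z ∂γ)) ^ 2) / (B * (B - 1))
          + |∑ b, (w (C b ω) - ∫ z, w z ∂γ)| / (B * R)) ∂Γ) :=
        (ofReal_integral_eq_lintegral_ofReal (hA3.add hW2) (of_forall fun ω => add_nonneg
          (div_nonneg (by positivity) (mul_pos hB0 hB1).le) (by positivity))).symm
    _ ≤ _ := by
        refine ENNReal.ofReal_le_ofReal ?_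
        rw [integral_add hA3 hW2, integral_div, integral_div,
          integral_add hA1 hA2, eA, hC.integral_sum_sub_mean_sq hy]
        have ha : 0 ≤ ∫ z, (y z - ∫ z, y z ∂γ) ^ 2 ∂γ := integral_nonneg fun z => sq_nonneg _
        refine add_le_add ?_ ?_
        · rw [div_le_div_iff₀ (mul_pos hB0 hB1) hB0]
          nlinarith [mul_nonneg ha (mul_nonneg hB0.le (by linarith : (0 : ℝ) ≤ B - 2))]
        · refine (div_le_div_of_nonneg_right eW (by positivity)).trans (le_of_eq ?_)
          nth_rw 2 [← Real.mul_self_sqrt hB0.le]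
          rcases eq_or_ne (R : ℝ) 0 with hR | hR
          · simp [hR]
          · field_simp

theorem integral_sqDev (hq : MemLp (sqDev γ y) 2 γ) : ∫ z, sqDev γ y z ∂γ = 0 := by
  have h1 : Integrable (fun z => (y z - ∫ z, y z ∂γ) ^ 2) γ :=
    ((hq.integrable (by norm_num)).add (integrable_const _)).congr
      (of_forall fun z => by simp only [sqDev, Pi.add_apply]; exact sub_add_cancel _ _)
  simp only [sqDev]
  exact integral_sub_integral_self _

theorem integral_mean_sqDev_sq (hC : IndepCoord Γ (fun _ => γ) C) (hB : B ≠ 0)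
    (hq : MemLp (sqDev γ y) 2 γ) (θ : ℝ) :
    MemLp (fun ω => θ / B * ∑ b, sqDev γ y (C b ω)) 2 Γ ∧
      ∫ ω, θ / B * ∑ b, sqDev γ y (C b ω) ∂Γ = 0 ∧
      ∫ ω, (θ / B * ∑ b, sqDev γ y (C b ω)) ^ 2 ∂Γ = θ ^ 2 / B * ∫ z, sqDev γ y z ^ 2 ∂γ := by
  have hL : ∀ b, MemLp (fun ω => sqDev γ y (C b ω)) 2 Γ := fun b =>
    hq.comp_measurePreserving (hC.measurePreserving b)
  refine ⟨(memLp_finsetSum _ fun b _ => hL b).const_mul _, ?_, ?_⟩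
  · rw [integral_const_mul, integral_finsetSum _ fun b _ => (hL b).integrable (by norm_num)]
    simp_rw [hC.integral_comp (f := sqDev γ y) hq.aestronglyMeasurable, integral_sqDev hq]
    simp
  · simp_rw [mul_pow]
    rw [integral_const_mul, hC.integral_sum_sq (a := fun _ => sqDev γ y) (fun _ => hq)
      fun _ => integral_sqDev hq]
    have : (B : ℝ) ≠ 0 := by exact_mod_cast hB
    simp only [sum_const, card_univ, card_fin, nsmul_eq_mul]
    field_simp

end Anova

section Joint

variable {X Y : Type*} [MeasurableSpace X] [MeasurableSpace Y] {μ : Measure X}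
  [IsProbabilityMeasure μ] {κ : Measure Y} [IsProbabilityMeasure κ]

theorem measure_prod_le_of_lintegral_le {f : X × Y → ℝ} (hf : Measurable f) {φ : X → ℝ} {s : Set X}
    (h : ∀ x ∉ s, ∫⁻ y, ‖f (x, y)‖ₑ ∂κ ≤ ENNReal.ofReal (φ x)) {ε : ℝ} (hε : 0 < ε) (δ : ℝ) :
    (μ.prod κ) {z | ε < |f z|} ≤ ENNReal.ofReal (δ / ε) + (μ s + μ {x | δ < |φ x|}) := by
  set T := toMeasurable μ (s ∪ {x | δ < |φ x|})
  rw [Measure.prod_apply (measurableSet_lt measurable_const hf.abs)]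
  calc _ ≤ ∫⁻ x, (ENNReal.ofReal (δ / ε) + T.indicator 1 x) ∂μ := by
        refine lintegral_mono fun x => ?_
        dsimp only
        by_cases hx : x ∈ T
        · rw [Set.indicator_of_mem hx]
          exact prob_le_one.trans le_add_self
        · have hx' : x ∉ s ∪ {x | δ < |φ x|} := fun h' => hx (subset_toMeasurable _ _ h')
          simp only [Set.mem_union, not_or, Set.mem_ofPred_eq, not_lt] at hx'
          refine le_trans ?_ le_self_add
          have h1 := (h x hx'.1).trans (ENNReal.ofReal_le_ofReal ((le_abs_self _).trans hx'.2))
          rw [ENNReal.ofReal_div_of_pos hε]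
          refine (measure_mono fun y (hy : ε < |f (x, y)|) => ?_).trans
            ((meas_ge_le_lintegral_div (f := fun y => ‖f (x, y)‖ₑ)
              (hf.comp measurable_prodMk_left).enorm.aemeasurable (by positivity)
              ENNReal.ofReal_ne_top).trans (ENNReal.div_le_div_right h1 _))
          show ENNReal.ofReal ε ≤ ‖f (x, y)‖ₑ
          rw [Real.enorm_eq_ofReal_abs]
          exact ENNReal.ofReal_le_ofReal hy.le
    _ = ENNReal.ofReal (δ / ε) + μ T := by
        rw [lintegral_add_left measurable_const, lintegral_indicator_one (measurableSet_toMeasurable _ _)]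
        simp [T]
    _ ≤ _ := by
        rw [measure_toMeasurable]
        gcongr
        exact measure_union_le _ _

theorem tendsto_zero_of_le_ofReal_add {φ : ℕ → X → ℝ} (hφ : OP μ φ) {u t : ℕ → ℝ≥0∞}
    (hu : Tendsto u atTop (𝓝 0)) {ε : ℝ} (hε : 0 < ε) (key : ∀ δ : ℝ, 0 < δ → ∀ᶠ k in atTop, t k
      ≤ ENNReal.ofReal (δ / ε) + (u k + μ {x | δ < |φ k x|})) : Tendsto t atTop (𝓝 0) := by
  rw [ENNReal.tendsto_nhds_zero]
  intro η hη
  obtain ⟨η', h0, h1⟩ := ENNReal.lt_iff_exists_nnreal_btwn.1 hη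
  have h0' : (0 : ℝ≥0∞) < η' := h0
  have hη' : 0 < (η' : ℝ) := by exact_mod_cast h0'
  have h2 := hu.add (hφ (ε * (η' / 2)) (by positivity))
  rw [add_zero] at h2
  filter_upwards [key (ε * (η' / 2)) (by positivity),
    ENNReal.tendsto_nhds_zero.1 h2 (η' / 2) (ENNReal.half_pos h0'.ne')] with k h3 h4
  refine (h3.trans (add_le_add (le_of_eq ?_) h4)).trans ((ENNReal.add_halves _).le.trans h1.le)
  rw [mul_div_cancel_left₀ _ hε.ne', ENNReal.ofReal_div_of_pos (by norm_num), ENNReal.ofReal_coe_nnreal]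
  simp

/-- A conditionally centred variable and a function of the condition are orthogonal. -/
theorem integral_sq_prod_add {M : X × Y → ℝ} (hM : Measurable M) {T : X → ℝ} (hT : MemLp T 2 μ)
    (hL : ∀ x, MemLp (fun y => M (x, y)) 2 κ) (h0 : ∀ x, ∫ y, M (x, y) ∂κ = 0)
    (hi : Integrable (fun x => ∫ y, M (x, y) ^ 2 ∂κ) μ) :
    MemLp (fun z : X × Y => M z + T z.1) 2 (μ.prod κ) ∧
      ∫ z, (M z + T z.1) ^ 2 ∂(μ.prod κ) = ∫ x, ∫ y, M (x, y) ^ 2 ∂κ ∂μ + ∫ x, T x ^ 2 ∂μ := by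
  have hM2 : MemLp M 2 (μ.prod κ) := by
    rw [memLp_two_iff_integrable_sq hM.aestronglyMeasurable,
      integrable_prod_iff (hM.pow_const 2).aestronglyMeasurable]
    refine ⟨of_forall fun x => (hL x).integrable_sq, ?_⟩
    simpa only [norm_pow, Real.norm_eq_abs, sq_abs] using hi
  have hT2 : MemLp (fun z : X × Y => T z.1) 2 (μ.prod κ) :=
    hT.comp_measurePreserving measurePreserving_fst
  have hs : MemLp (fun z : X × Y => M z + T z.1) 2 (μ.prod κ) := hM2.add hT2
  refine ⟨hs, ?_⟩
  rw [integral_prod _ hs.integrable_sq, ← integral_add hi hT.integrable_sq]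
  refine integral_congr_ae (of_forall fun x => ?_)
  dsimp only
  have e : ∀ y, (M (x, y) + T x) ^ 2 = M (x, y) ^ 2 + 2 * T x * M (x, y) + T x ^ 2 := fun y => by ring
  simp_rw [e]
  have i1 := (hL x).integrable_sq
  have i2 := ((hL x).integrable (by norm_num)).const_mul (2 * T x)
  have i3 : Integrable (fun y => M (x, y) ^ 2 + 2 * T x * M (x, y)) κ := i1.add i2
  rw [integral_add i3 (integrable_const _), integral_add i1 i2, integral_const_mul, h0]
  simp

end Joint

section JointMeasurability

variable {X Z Y : Type*} [MeasurableSpace X] [MeasurableSpace Z] [MeasurableSpace Y] {γ : Measure Z}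
  [SFinite γ] {f w : X → Z → ℝ} {B R : ℕ} {C : Fin B → Y → Z}

theorem measurable_sub_integral (hf : Measurable fun p : X × Z => f p.1 p.2) :
    Measurable fun p : X × Z => f p.1 p.2 - ∫ z, f p.1 z ∂γ :=
  hf.sub ((hf.stronglyMeasurable.integral_prod_right (ν := γ)).measurable.comp measurable_fst)

theorem measurable_sqDev (hf : Measurable fun p : X × Z => f p.1 p.2) :
    Measurable fun p : X × Z => sqDev γ (f p.1) p.2 :=
  measurable_sub_integral (f := fun x z => (f x z - ∫ z, f x z ∂γ) ^ 2)
    ((measurable_sub_integral hf).pow_const 2)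

theorem measurable_anovaError (hf : Measurable fun p : X × Z => f p.1 p.2)
    (hw : Measurable fun p : X × Z => w p.1 p.2) (hC : ∀ b, Measurable (C b)) :
    Measurable fun p : X × Y => anovaError γ (f p.1) (w p.1) R fun b => C b p.2 := by
  have hc : ∀ b, Measurable fun p : X × Y => (p.1, C b p.2) := fun b =>
    measurable_fst.prodMk ((hC b).comp measurable_snd)
  have h1 := fun b => (measurable_sub_integral (γ := γ) hf).comp (hc b)
  have h2 := fun b => (measurable_sub_integral (γ := γ) hw).comp (hc b)
  exact (((measurable_fun_sum _ fun b _ => (h1 b).pow_const 2).sub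
    ((measurable_fun_sum _ fun b _ => h1 b).pow_const 2)).div_const _).sub
    ((measurable_fun_sum _ fun b _ => h2 b).div_const _)

end JointMeasurability

section StandardModel

variable {ι : Type*} [Fintype ι] [DecidableEq ι] {𝒳 : ι → Type*} [∀ i, TopologicalSpace (𝒳 i)]
  [∀ i, PolishSpace (𝒳 i)] [∀ i, MeasurableSpace (𝒳 i)] [∀ i, BorelSpace (𝒳 i)]
  {𝒰 : Type*} [MeasurableSpace 𝒰]
  {F : ∀ i, Measure (𝒳 i)} [∀ i, IsProbabilityMeasure (F i)]
  {ρ : Measure 𝒰} [IsProbabilityMeasure ρ]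
  {ψ : (∀ i, Measure (𝒳 i)) → ℝ} {H : (∀ i, Measure (𝒳 i)) → 𝒰 → ℝ}
  {g₁ : (∀ i, Measure (𝒳 i)) → ∀ i, 𝒳 i → ℝ}
  {g₂ : (∀ i, Measure (𝒳 i)) → ∀ i j, 𝒳 i → 𝒳 j → ℝ}
  {g₃ : (∀ i, Measure (𝒳 i)) → ∀ i j k, 𝒳 i → 𝒳 j → 𝒳 k → ℝ}
  {n : ℕ → ι → ℕ}

local notation "Model" => MeasurableModel F ψ H g₁ g₂ g₃
local notation "Expandable" => ThirdOrderDifferentiable ψ g₁ g₂ g₃ F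
local notation "Smooth" => SmoothAtTruth F ψ g₁ n
local notation "Smooth₃" => ThirdSmoothAtTruth F ψ g₁ g₂ g₃ n
local notation "EmpSmooth" => SmoothAtEmpirical F ψ g₁ n
local notation "EmpSmooth₃" => ThirdSmoothAtEmpirical F ψ g₁ g₂ g₃ n

section Truth

theorem measurePreserving_data (i : ι) (a : ℕ) :
    MeasurePreserving (fun x : Data 𝒳 => x i a) (dataLaw F) (F i) :=
  (indepCoord_data F).measurePreserving ⟨i, a⟩

theorem ae_mem_support : ∀ᵐ x ∂(dataLaw F), ∀ i a, x i a ∈ (F i).support := by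
  refine ae_all_iff.2 fun i => ae_all_iff.2 fun a => ?_
  exact (measurePreserving_data i a).quasiMeasurePreserving.ae
    (ae_mem_support_of_mem_hull self_mem_hull)

theorem SmoothAtTruth.memLp_data (ht : Smooth) (i : ι) (a : ℕ) :
    MemLp (fun x : Data 𝒳 => g₁ F i (x i a)) 4 (dataLaw F) :=
  (ht.moment i).comp_measurePreserving (measurePreserving_data i a)

theorem ThirdSmoothAtTruth.memLp₂_data (ht : Smooth₃) (i j : ι)
    (a b : ℕ) : MemLp (fun x : Data 𝒳 => g₂ F i j (x i a) (x j b)) 4 (dataLaw F) :=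
  memLp_pair F (ht.moment₂ i j) a b

theorem ThirdSmoothAtTruth.memLp₃_data (ht : Smooth₃) (i j k : ι) (a b c : ℕ) :
    MemLp (fun x : Data 𝒳 => g₃ F i j k (x i a) (x j b) (x k c)) 2 (dataLaw F) :=
  memLp_triple F (ht.moment₃ i j k) a b c

theorem vonMises_data (hmeas : Model) (hd : Expandable) (ht : Smooth) (ht3 : Smooth₃) (m : ι → ℕ) :
    VonMises (dataLaw F) F m (fun p x => x p.1 p.2) (g₁ F) (g₂ F) (g₃ F) := by
  have hF : ∀ i, F i ∈ hull (F i) := fun i => self_mem_hull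
  refine ⟨indepCoord_sample F m, hmeas.g₁_true, hmeas.g₂_true, hmeas.g₃_true,
    ⟨fun p => (ht.memLp_data _ _).mono_exponent (by norm_num), fun p => hd.centred₁ F hF p.1⟩,
    ⟨fun p q => (ht3.memLp₂_data _ _ _ _).mono_exponent (by norm_num), fun p q _ => ?_,
      fun p q _ => ?_⟩,
    ⟨fun p q r => ht3.memLp₃_data _ _ _ _ _ _, fun p q r _ _ => ?_, fun p q r _ _ => ?_,
      fun p q r _ _ => ?_⟩, fun p q => ?_, fun p r => ?_, fun p r => ?_⟩ <;>
  filter_upwards [ae_mem_support (F := F)] with x hx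
  · exact hd.centred₂_left hF (hx _ _)
  · exact hd.centred₂ F hF _ _ _ (hx _ _)
  · exact hd.centred₃_left hF (hx _ _) (hx _ _)
  · exact hd.centred₃_mid hF (hx _ _) (hx _ _)
  · exact hd.centred₃ F hF _ _ _ _ (hx _ _) _ (hx _ _)
  · exact (hd.symm₂ F hF _ _ _ (hx _ _) _ (hx _ _)).symm
  · exact (hd.symm₃ F hF _ _ _ _ (hx _ _) _ (hx _ _) _ (hx _ _)).1.symm
  · exact ((hd.symm₃ F hF _ _ _ _ (hx _ _) _ (hx _ _) _ (hx _ _)).1.trans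
      (hd.symm₃ F hF _ _ _ _ (hx _ _) _ (hx _ _) _ (hx _ _)).2).symm

theorem psi_empData_eq (hd : Expandable) (m : ι → ℕ) :
    ∀ᵐ x ∂(dataLaw F), ψ (empData m x) = ψ F
      + (linTerm (fun (p : Σ i, Fin (m i)) (x : Data 𝒳) => x p.1 p.2) (g₁ F) x
        + quadTerm (fun (p : Σ i, Fin (m i)) (x : Data 𝒳) => x p.1 p.2) (g₂ F) x
        + cubTerm (fun (p : Σ i, Fin (m i)) (x : Data 𝒳) => x p.1 p.2) (g₃ F) x
        + remainder3 ψ g₁ g₂ g₃ (empData m x) F) := by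
  have hF : ∀ i, F i ∈ hull (F i) := fun i => self_mem_hull
  filter_upwards [ae_mem_support (F := F)] with x hx
  have h1 := hd.taylor1_emp hF (y := fun i (j : Fin (m i)) => x i j) fun i l => hx i l
  have h2 := hd.taylor2_emp hF (y := fun i (j : Fin (m i)) => x i j) fun i l => hx i l
  have h3 := hd.taylor3_emp hF (y := fun i (j : Fin (m i)) => x i j) fun i l => hx i l
  simp only [remainder3]
  unfold empData
  rw [h1, h2, h3]
  simp only [linTerm, quadTerm, cubTerm]
  ring

theorem measurable_psi_empData (hmeas : Model) (m : ι → ℕ) :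
    Measurable fun x : Data 𝒳 => ψ (empData m x) :=
  (hmeas.ψ_emp m).comp (g := fun y : ∀ i, Fin (m i) → 𝒳 i => ψ fun i => emp (y i))
    (f := fun (x : Data 𝒳) i (j : Fin (m i)) => x i j) (by fun_prop)

/-- The variance of the plug-in estimator of `ψ F`. -/
theorem inputVariance_sub_le [Nonempty ι] (hmeas : Model) (hd : Expandable) (ht : Smooth)
    (ht3 : Smooth₃) {c : ℝ} {θ : ℕ → ℝ} {B R : ℕ → ℕ}
    (hst : ∀ᶠ k in atTop, Stage c (θ k) (n k) (B k) (R k)) :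
    ∃ C : ℝ, ∀ᶠ k in atTop, avg (n k) ^ 2 * |inputVariance F ψ (n k)
      - ∑ i, (∫ x, g₁ F i x ^ 2 ∂F i) / n k i| ≤ C := by
  obtain ⟨κ₃, hκ₃⟩ : ∃ κ₃ : ℝ, ∀ (i j k : ι) (a b c : ℕ),
      ∫ x, g₃ F i j k (x i a) (x j b) (x k c) ^ 2 ∂(dataLaw F) ≤ κ₃ := by
    let K : ℝ≥0∞ := ∑ i, ∑ j, ∑ k, ∑ b ∈ Finset.range 2, ∑ c ∈ Finset.range 3,
      ∫⁻ x : Data 𝒳, ‖g₃ F i j k (x i 0) (x j b) (x k c)‖ₑ ^ 2 ∂(dataLaw F)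
    have hfin : ∀ i j k, ∀ b < 2, ∀ c < 3,
        ∫⁻ x : Data 𝒳, ‖g₃ F i j k (x i 0) (x j b) (x k c)‖ₑ ^ 2 ∂(dataLaw F) < ∞ :=
      fun i j k b hb c hc => by
        have := lintegral_rpow_enorm_lt_top_of_eLpNorm_lt_top (by norm_num) (by norm_num)
          (ht3.moment₃ i j k b hb c hc).2
        simpa using this
    have hK : K ≠ ∞ := by
      refine (ENNReal.sum_lt_top.2 fun i _ => ENNReal.sum_lt_top.2 fun j _ =>
        ENNReal.sum_lt_top.2 fun k _ => ENNReal.sum_lt_top.2 fun b hb =>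
        ENNReal.sum_lt_top.2 fun c hc => hfin i j k b (Finset.mem_range.1 hb) c
          (Finset.mem_range.1 hc)).ne
    refine ⟨K.toReal, fun i j k a b c => ?_⟩
    have h1 : ∫⁻ x : Data 𝒳, ‖g₃ F i j k (x i a) (x j b) (x k c)‖ₑ ^ 2 ∂(dataLaw F) ≤ K := by
      refine lintegral_triple_le F (n := fun _ => a + b + c + 3) (by intro i; omega)
        (G := fun _ u v w => ‖g₃ F i j k u v w‖ₑ ^ 2) (fun j₂ j₃ => ?_) (fun j₂ h₂ j₃ h₃ => ?_)
        (by omega) (by omega) (by omega)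
      · have := (hmeas.g₃_true i j k).comp (g := fun p : 𝒳 i × 𝒳 j × 𝒳 k => g₃ F i j k p.1 p.2.1 p.2.2)
          (f := fun x : Data 𝒳 => (x i 0, x j j₂, x k j₃)) (by fun_prop)
        exact this.enorm.pow_const 2
      · refine le_trans ?_ (single_le_sum (fun _ _ => zero_le) (mem_univ i))
        refine le_trans ?_ (single_le_sum (fun _ _ => zero_le) (mem_univ j))
        refine le_trans ?_ (single_le_sum (fun _ _ => zero_le) (mem_univ k))
        refine le_trans ?_ (single_le_sum (fun _ _ => zero_le) (Finset.mem_range.2 h₂))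
        exact single_le_sum (f := fun c => ∫⁻ x : Data 𝒳,
          ‖g₃ F i j k (x i 0) (x j j₂) (x k c)‖ₑ ^ 2 ∂(dataLaw F)) (fun _ _ => zero_le)
          (Finset.mem_range.2 h₃)
    rw [integral_eq_lintegral_of_nonneg_ae (of_forall fun _ => sq_nonneg _)
      ((ht3.memLp₃_data i j k a b c).aestronglyMeasurable.pow 2)]
    refine ENNReal.toReal_mono hK (le_of_eq_of_le (lintegral_congr fun x => ?_) h1)
    rw [← Real.enorm_of_nonneg (sq_nonneg _), enorm_pow]
  let κ : ℝ := |729 * (card ι : ℝ) ^ 3 * c ^ 9 * κ₃| + (∑ i, |∫ x, g₁ F i x ^ 2 ∂F i|)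
    + (∑ i, |∫ x, g₂ F i i x x ^ 2 ∂F i|)
    + (∑ i, ∑ j, |∫ z, g₂ F i j z.1 z.2 ^ 2 ∂((F i).prod (F j))|)
    + (∑ i, |∫ x, g₁ F i x * g₃ F i i i x x x ∂F i|)
    + (∑ i, |∫ z, g₁ F i z.1 * g₃ F i i i z.1 z.2 z.2 ∂((F i).prod (F i))|)
  have hsg : ∀ (f : ι → ℝ) i, f i ≤ ∑ i, |f i| := fun f i =>
    (le_abs_self _).trans (single_le_sum (f := fun i => |f i|) (fun _ _ => abs_nonneg _)
      (mem_univ i))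
  have hsg' : ∀ (f : ι → ℝ) i, |f i| ≤ ∑ i, |f i| := fun f i =>
    (single_le_sum (f := fun i => |f i|) (fun _ _ => abs_nonneg _) (mem_univ i))
  have hsn : ∀ (f : ι → ℝ), 0 ≤ ∑ i, |f i| := fun f => sum_nonneg fun _ _ => abs_nonneg _
  have n1 := hsn fun i => ∫ x, g₁ F i x ^ 2 ∂F i
  have n2 := hsn fun i => ∫ x, g₂ F i i x x ^ 2 ∂F i
  have n3 : 0 ≤ ∑ i, ∑ j, |∫ z, g₂ F i j z.1 z.2 ^ 2 ∂((F i).prod (F j))| :=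
    sum_nonneg fun _ _ => sum_nonneg fun _ _ => abs_nonneg _
  have n4 := hsn fun i => ∫ x, g₁ F i x * g₃ F i i i x x x ∂F i
  have n5 := hsn fun i => ∫ z, g₁ F i z.1 * g₃ F i i i z.1 z.2 z.2 ∂((F i).prod (F i))
  have n6 := abs_nonneg (729 * (card ι : ℝ) ^ 3 * c ^ 9 * κ₃)
  have hκ0 : 0 ≤ κ := by positivity
  set M : ℝ := ((card ι : ℝ) + 1) ^ 2 * c ^ 3 with hM
  let T : ℝ := (∑ i, |∫ x, g₁ F i x * g₂ F i i x x ∂F i|)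
    + (∑ i, ∑ j, |∫ z, g₂ F i j z.1 z.2 ^ 2 ∂((F i).prod (F j))|)
    + ∑ i, ∑ j, |∫ z, g₁ F i z.1 * g₃ F i j j z.1 z.2 z.2 ∂((F i).prod (F j))|
  refine ⟨9 * M * κ + 10 * M * (√κ * √1) + 1 + T * c ^ 2, ?_⟩
  have hrem := (ENNReal.tendsto_nhds_zero.1 ht3.remainder) 1 one_pos
  filter_upwards [hst, hrem] with k hk hr
  have ha := hk.one_le_avg
  have ha0 := hk.avg_pos
  have V := vonMises_data hmeas hd ht ht3 (n k)
  have hψ := psi_empData_eq hd (n k)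
  set X := fun (p : Σ i, Fin (n k i)) (x : Data 𝒳) => x p.1 p.2
  set e : Data 𝒳 → ℝ := fun x => remainder3 ψ g₁ g₂ g₃ (empData (n k) x) F with he
  have hem : AEStronglyMeasurable e (dataLaw F) := by
    have h1 : AEStronglyMeasurable (fun x => ψ (empData (n k) x) - ψ F
        - (linTerm X (g₁ F) x + quadTerm X (g₂ F) x + cubTerm X (g₃ F) x)) (dataLaw F) :=
      (((measurable_psi_empData hmeas (n k)).aestronglyMeasurable).sub
        aestronglyMeasurable_const).sub ((V.memLp_lin.aestronglyMeasurable.add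
        V.memLp_quad.aestronglyMeasurable).add V.memLp_cub.aestronglyMeasurable)
    refine h1.congr (hψ.mono fun x hx => ?_)
    simp only [hx]; ring
  have hle : (∫⁻ x, ‖e x‖ₑ ^ 2 ∂(dataLaw F)) ≤ ENNReal.ofReal ((avg (n k) ^ 3)⁻¹) := by
    rw [ENNReal.ofReal_inv_of_pos (by positivity), ENNReal.ofReal_pow ha0.le]
    rw [ENNReal.le_inv_iff_mul_le, mul_comm]
    exact hr
  have heL : MemLp e 2 (dataLaw F) := by
    refine ⟨hem, ?_⟩
    rw [eLpNorm_lt_top_iff_lintegral_rpow_enorm_lt_top (by norm_num) (by norm_num)]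
    refine lt_of_le_of_lt (le_of_eq_of_le ?_ hle) ENNReal.ofReal_lt_top
    simp
  have hev : avg (n k) ^ 3 * ∫ x, e x ^ 2 ∂(dataLaw F) ≤ 1 := by
    rw [integral_eq_lintegral_of_nonneg_ae (of_forall fun _ => sq_nonneg _) (hem.pow 2)]
    have h1 : (∫⁻ x, ENNReal.ofReal (e x ^ 2) ∂(dataLaw F)) ≤ ENNReal.ofReal ((avg (n k) ^ 3)⁻¹) := by
      refine le_of_eq_of_le (lintegral_congr fun x => ?_) hle
      rw [← Real.enorm_of_nonneg (sq_nonneg _), enorm_pow]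
    have h2 := ENNReal.toReal_mono ENNReal.ofReal_ne_top h1
    rw [ENNReal.toReal_ofReal (by positivity)] at h2
    have h3 : (0 : ℝ) < avg (n k) ^ 3 := by positivity
    calc _ ≤ avg (n k) ^ 3 * (avg (n k) ^ 3)⁻¹ := by gcongr
      _ = 1 := mul_inv_cancel₀ h3.ne'
  have hcub : avg (n k) ^ 3 * ∫ ω, cubTerm X (g₃ F) ω ^ 2 ∂(dataLaw F) ≤ κ := by
    have hw := sum_cubicWeight_div_le hk.one_le ha hk.inv_n_le hk.n_le
    have hκ₃0 : 0 ≤ κ₃ := (integral_nonneg fun x => sq_nonneg _).trans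
      (hκ₃ (Classical.arbitrary ι) (Classical.arbitrary ι) (Classical.arbitrary ι) 0 0 0)
    have h1 := V.integral_sq_cub_le'
    have h2 : avg (n k) ^ 3 * ∫ ω, cubTerm X (g₃ F) ω ^ 2 ∂(dataLaw F)
        ≤ 729 * (card ι : ℝ) ^ 3 * c ^ 9 * κ₃ := by
      refine (mul_le_mul_of_nonneg_left h1 (by positivity)).trans
        (le_trans ?_ (mul_le_mul_of_nonneg_right hw hκ₃0))
      rw [mul_assoc]
      simp only [sum_mul]
      refine mul_le_mul_of_nonneg_left (sum_le_sum fun p _ => sum_le_sum fun q _ =>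
          sum_le_sum fun r _ => mul_le_mul_of_nonneg_left (hκ₃ _ _ _ _ _ _) (by positivity))
          (by positivity)
    have := le_abs_self (729 * (card ι : ℝ) ^ 3 * c ^ 9 * κ₃)
    simp only [κ]; linarith
  have hb3 : ∀ i j, ∫ z, g₂ F i j z.1 z.2 ^ 2 ∂((F i).prod (F j))
      ≤ ∑ i, ∑ j, |∫ z, g₂ F i j z.1 z.2 ^ 2 ∂((F i).prod (F j))| := fun i j =>
    (hsg (fun j => ∫ z, g₂ F i j z.1 z.2 ^ 2 ∂((F i).prod (F j))) j).trans
      (single_le_sum (f := fun i => ∑ j, |∫ z, g₂ F i j z.1 z.2 ^ 2 ∂((F i).prod (F j))|)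
        (fun _ _ => hsn _) (mem_univ i))
  have key := V.scaled_variance_sub_le heL (ψ F) hk.one_le ha hκ0 zero_le_one hM hk.inv_n_le
    (fun i => by have := hsg (fun i => ∫ x, g₁ F i x ^ 2 ∂F i) i; simp only [κ]; linarith)
    (fun i => by have := hsg (fun i => ∫ x, g₂ F i i x x ^ 2 ∂F i) i; simp only [κ]; linarith)
    (fun i j => by have := hb3 i j; simp only [κ]; linarith)
    (fun i => by
      have := hsg' (fun i => ∫ x, g₁ F i x * g₃ F i i i x x x ∂F i) i; simp only [κ]; linarith)
    (fun i => by
      have := hsg' (fun i => ∫ z, g₁ F i z.1 * g₃ F i i i z.1 z.2 z.2 ∂((F i).prod (F i))) i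
      simp only [κ]; linarith) hcub hev
  have hvar : inputVariance F ψ (n k) = variance (fun ω => ψ F + (linTerm X (g₁ F) ω
      + quadTerm X (g₂ F) ω + cubTerm X (g₃ F) ω + e ω)) (dataLaw F) :=
    variance_congr hψ
  rw [← hvar] at key
  have d1 : ∀ (f : ι → ℝ), |∑ i, f i / (n k i : ℝ) ^ 2| ≤ (∑ i, |f i|) * (c / avg (n k)) ^ 2 :=
    fun f => by
      rw [sum_mul]
      refine (abs_sum_le_sum_abs _ _).trans (sum_le_sum fun i _ => ?_)
      rw [abs_div, abs_of_nonneg (by positivity : (0 : ℝ) ≤ (n k i : ℝ) ^ 2), div_eq_mul_inv,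
        ← inv_pow]
      gcongr
      exact hk.inv_n_le i
  have d2 : ∀ (f : ι → ι → ℝ), |∑ i, ∑ j, f i j / (n k i * n k j : ℝ)|
      ≤ (∑ i, ∑ j, |f i j|) * (c / avg (n k)) ^ 2 := fun f => by
      simp only [sum_mul]
      refine (abs_sum_le_sum_abs _ _).trans (sum_le_sum fun i _ => ?_)
      refine (abs_sum_le_sum_abs _ _).trans (sum_le_sum fun j _ => ?_)
      rw [abs_div, abs_of_nonneg (by positivity : (0 : ℝ) ≤ (n k i * n k j : ℝ)), div_eq_mul_inv,
        mul_inv, sq]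
      gcongr
      · exact div_nonneg hk.c_pos.le ha0.le
      · exact hk.inv_n_le i
      · exact hk.inv_n_le j
  have t1 := d1 fun i => ∫ x, g₁ F i x * g₂ F i i x x ∂F i
  have t2 := d2 fun i j => (∫ z, g₂ F i j z.1 z.2 ^ 2 ∂((F i).prod (F j))) / 2
  have t3 := d2 fun i j => ∫ z, g₁ F i z.1 * g₃ F i j j z.1 z.2 z.2 ∂((F i).prod (F j))
  have e2 : ∑ i, ∑ j, (∫ z, g₂ F i j z.1 z.2 ^ 2 ∂((F i).prod (F j))) / (2 * n k i * n k j)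
    = ∑ i, ∑ j, ((∫ z, g₂ F i j z.1 z.2 ^ 2 ∂((F i).prod (F j))) / 2) / (n k i * n k j) :=
    sum_congr rfl fun i _ => sum_congr rfl fun j _ => by
      rw [div_div, mul_assoc]
  rw [← e2] at t2
  have t2' : ∑ i, ∑ j, |(∫ z, g₂ F i j z.1 z.2 ^ 2 ∂((F i).prod (F j))) / 2|
      ≤ ∑ i, ∑ j, |∫ z, g₂ F i j z.1 z.2 ^ 2 ∂((F i).prod (F j))| :=
    sum_le_sum fun i _ => sum_le_sum fun j _ => by
      rw [abs_div, abs_of_pos (two_pos (α := ℝ))]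
      exact half_le_self (abs_nonneg _)
  have t2'' := mul_le_mul_of_nonneg_right t2' (sq_nonneg (c / avg (n k)))
  have hTle := add_le_add (add_le_add t1 (t2.trans t2'')) t3
  rw [← add_mul, ← add_mul] at hTle
  have hT2 : avg (n k) ^ 2 * (T * (c / avg (n k)) ^ 2) = T * c ^ 2 := by field_simp
  have hsq : κ / √(avg (n k)) ≤ κ := div_le_self hκ0 (Real.one_le_sqrt.2 ha)
  have hM0 : 0 ≤ M := by have := hk.c_pos; positivity
  have hsq' := mul_le_mul_of_nonneg_left hsq (by positivity : 0 ≤ 9 * M)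
  set Λ := ∑ i, (∫ x, g₁ F i x ^ 2 ∂F i) / (n k i : ℝ)
  set A1 := ∑ i, (∫ x, g₁ F i x * g₂ F i i x x ∂F i) / (n k i : ℝ) ^ 2
  set A2 := ∑ i, ∑ j, (∫ z, g₂ F i j z.1 z.2 ^ 2 ∂((F i).prod (F j))) / (2 * n k i * n k j : ℝ)
  set A3 := ∑ i, ∑ j, (∫ z, g₁ F i z.1 * g₃ F i j j z.1 z.2 z.2 ∂((F i).prod (F j)))
    / (n k i * n k j : ℝ)
  have f1 : |inputVariance F ψ (n k) - Λ| ≤ |inputVariance F ψ (n k) - (Λ + A1 + A2 + A3)|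
      + (|A1| + |A2| + |A3|) := by
    have : inputVariance F ψ (n k) - Λ = (inputVariance F ψ (n k) - (Λ + A1 + A2 + A3))
      + (A1 + A2 + A3) := by ring
    rw [this]
    refine (abs_add_le _ _).trans (add_le_add le_rfl ((abs_add_le _ _).trans
      (add_le_add (abs_add_le _ _) le_rfl)))
  have f2 := mul_le_mul_of_nonneg_left (f1.trans (add_le_add le_rfl hTle))
    (sq_nonneg (avg (n k)))
  rw [mul_add, hT2] at f2
  exact f2.trans (add_le_add (key.trans (add_le_add (add_le_add hsq' le_rfl) le_rfl)) le_rfl)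

end Truth

section Resampling

theorem MeasurableModel.g₁_data (hm : Model) (m : ι → ℕ) (i : ι) (a : ℕ) :
    Measurable fun x : Data 𝒳 => g₁ (empData m x) i (x i a) :=
  (hm.g₁_emp m i).comp (g := fun q : (∀ i, Fin (m i) → 𝒳 i) × 𝒳 i =>
    g₁ (fun i => emp (q.1 i)) i q.2)
    (f := fun x : Data 𝒳 => (fun i (j : Fin (m i)) => x i j, x i a)) (by fun_prop)

theorem MeasurableModel.g₂_data (hm : Model) (m : ι → ℕ) (i j : ι)
    (a b : ℕ) : Measurable fun x : Data 𝒳 => g₂ (empData m x) i j (x i a) (x j b) :=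
  (hm.g₂_emp m i j).comp (g := fun q : (∀ i, Fin (m i) → 𝒳 i) × 𝒳 i × 𝒳 j =>
    g₂ (fun i => emp (q.1 i)) i j q.2.1 q.2.2)
    (f := fun x : Data 𝒳 => (fun i (j : Fin (m i)) => x i j, x i a, x j b)) (by fun_prop)

theorem MeasurableModel.g₃_data (hm : Model) (m : ι → ℕ) (i j k : ι)
    (a b c : ℕ) : Measurable fun x : Data 𝒳 => g₃ (empData m x) i j k (x i a) (x j b) (x k c) :=
  (hm.g₃_emp m i j k).comp (g := fun q : (∀ i, Fin (m i) → 𝒳 i) × 𝒳 i × 𝒳 j × 𝒳 k =>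
    g₃ (fun i => emp (q.1 i)) i j k q.2.1 q.2.2.1 q.2.2.2)
    (f := fun x : Data 𝒳 => (fun i (j : Fin (m i)) => x i j, x i a, x j b, x k c)) (by fun_prop)

theorem MeasurableModel.g₁_true_data (hm : Model) (i : ι) (a : ℕ) :
    Measurable fun x : Data 𝒳 => g₁ F i (x i a) :=
  (hm.g₁_true i).comp (f := fun x : Data 𝒳 => x i a) (by fun_prop)

theorem MeasurableModel.g₂_true_data (hm : Model) (i j : ι)
    (a b : ℕ) : Measurable fun x : Data 𝒳 => g₂ F i j (x i a) (x j b) :=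
  (hm.g₂_true i j).comp (g := fun q : 𝒳 i × 𝒳 j => g₂ F i j q.1 q.2)
    (f := fun x : Data 𝒳 => (x i a, x j b)) (by fun_prop)

theorem MeasurableModel.g₃_true_data (hm : Model) (i j k : ι)
    (a b c : ℕ) : Measurable fun x : Data 𝒳 => g₃ F i j k (x i a) (x j b) (x k c) :=
  (hm.g₃_true i j k).comp (g := fun q : 𝒳 i × 𝒳 j × 𝒳 k => g₃ F i j k q.1 q.2.1 q.2.2)
    (f := fun x : Data 𝒳 => (x i a, x j b, x k c)) (by fun_prop)

theorem integral_empData (m : ι → ℕ) (x : Data 𝒳) (i : ι) (f : 𝒳 i → ℝ) :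
    ∫ y, f y ∂(empData m x i) = av fun a : Fin (m i) => f (x i a) := by
  rw [empData, integral_emp, av, card_fin]

theorem integral_uniform_eq_av {m : ℕ} (f : Fin m → ℝ) :
    ∫ a, f a ∂(uniformOn (Set.univ : Set (Fin m))) = av f := by
  rw [integral_uniformOn_univ, av]

theorem integral_uniform_prod_eq_av {m m' : ℕ} [NeZero m] [NeZero m'] (f : Fin m × Fin m' → ℝ) :
    ∫ z, f z ∂((uniformOn (Set.univ : Set (Fin m))).prod (uniformOn (Set.univ : Set (Fin m'))))
      = av f := by
  rw [integral_prod _ (Integrable.of_finite)]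
  simp_rw [integral_uniform_eq_av (m := m')]
  rw [integral_uniform_eq_av, ← av_prod fun a b => f (a, b)]

variable (m s : ι → ℕ)

theorem empData_mem_hull [∀ i, NeZero (m i)] {x : Data 𝒳} (hx : ∀ i a, x i a ∈ (F i).support)
    (i : ι) : empData m x i ∈ hull (F i) :=
  emp_mem_hull (NeZero.ne _) fun _ => hx i _

theorem resample_mem_hull (hs : ∀ i, s i ≠ 0) {x : Data 𝒳}
    (hx : ∀ i a, x i a ∈ (F i).support) (J : Idx m s) (i : ι) : resample x J i ∈ hull (F i) :=
  emp_mem_hull (hs i) fun _ => hx i _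

theorem vonMises_boot (hd : Expandable) [∀ i, NeZero (m i)]
    {x : Data 𝒳} (hx : ∀ i a, x i a ∈ (F i).support) :
    VonMises (uniformOn Set.univ : Measure (Idx m s))
      (fun i => uniformOn (Set.univ : Set (Fin (m i)))) s (fun p J => J p.1 p.2)
      (fun i a => g₁ (empData m x) i (x i a))
      (fun i j a b => g₂ (empData m x) i j (x i a) (x j b))
      (fun i j k a b c => g₃ (empData m x) i j k (x i a) (x j b) (x k c)) := by
  have hF := empData_mem_hull (F := F) m hx
  refine ⟨indepCoord_idx m s, fun i => measurable_of_finite _, fun i j => measurable_of_finite _,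
    fun i j k => measurable_of_finite _,
    ⟨fun p => MemLp.of_discrete, fun p => ?_⟩,
    ⟨fun p q => MemLp.of_discrete, fun p q _ => of_forall fun J => ?_,
      fun p q _ => of_forall fun J => ?_⟩,
    ⟨fun p q r => MemLp.of_discrete, fun p q r _ _ => of_forall fun J => ?_,
      fun p q r _ _ => of_forall fun J => ?_,
      fun p q r _ _ => of_forall fun J => ?_⟩,
    fun p q => of_forall fun J => ?_, fun p r => of_forall fun J => ?_,
    fun p r => of_forall fun J => ?_⟩
  · rw [integral_uniform_eq_av, ← integral_empData m x p.1 (g₁ (empData m x) p.1)]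
    exact hd.centred₁ _ hF p.1
  · rw [integral_uniform_eq_av, ← integral_empData m x p.1
      fun y => g₂ (empData m x) p.1 q.1 y (x q.1 (J q.1 q.2))]
    exact hd.centred₂_left hF (hx _ _)
  · rw [integral_uniform_eq_av, ← integral_empData m x q.1
      fun y => g₂ (empData m x) p.1 q.1 (x p.1 (J p.1 p.2)) y]
    exact hd.centred₂ _ hF _ _ _ (hx _ _)
  · rw [integral_uniform_eq_av, ← integral_empData m x p.1
      fun y => g₃ (empData m x) p.1 q.1 r.1 y (x q.1 (J q.1 q.2)) (x r.1 (J r.1 r.2))]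
    exact hd.centred₃_left hF (hx _ _) (hx _ _)
  · rw [integral_uniform_eq_av, ← integral_empData m x q.1
      fun y => g₃ (empData m x) p.1 q.1 r.1 (x p.1 (J p.1 p.2)) y (x r.1 (J r.1 r.2))]
    exact hd.centred₃_mid hF (hx _ _) (hx _ _)
  · rw [integral_uniform_eq_av, ← integral_empData m x r.1
      fun y => g₃ (empData m x) p.1 q.1 r.1 (x p.1 (J p.1 p.2)) (x q.1 (J q.1 q.2)) y]
    exact hd.centred₃ _ hF _ _ _ _ (hx _ _) _ (hx _ _)
  · exact (hd.symm₂ _ hF _ _ _ (hx _ _) _ (hx _ _)).symm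
  · exact (hd.symm₃ _ hF _ _ _ _ (hx _ _) _ (hx _ _) _ (hx _ _)).1.symm
  · exact ((hd.symm₃ _ hF _ _ _ _ (hx _ _) _ (hx _ _) _ (hx _ _)).1.trans
      (hd.symm₃ _ hF _ _ _ _ (hx _ _) _ (hx _ _) _ (hx _ _)).2).symm

variable {m s}

theorem remainder1_resample (hd : Expandable) [∀ i, NeZero (m i)]
    {x : Data 𝒳} (hx : ∀ i a, x i a ∈ (F i).support) (J : Idx m s) :
    ψ (resample x J) = ψ (empData m x)
      + (linTerm (fun (p : Σ i, Fin (s i)) (J : Idx m s) => J p.1 p.2)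
        (fun i (a : Fin (m i)) => g₁ (empData m x) i (x i a)) J
      + remainder1 ψ g₁ (resample x J) (empData m x)) := by
  have h1 := hd.taylor1_emp (empData_mem_hull (F := F) m hx)
    (y := fun i (j : Fin (s i)) => x i (J i j)) fun i l => hx _ _
  simp only [remainder1]
  rw [show resample x J = fun i => emp fun j : Fin (s i) => x i (J i j) from rfl, h1]
  simp only [linTerm]
  ring

theorem remainder3_resample (hd : Expandable) [∀ i, NeZero (m i)]
    {x : Data 𝒳} (hx : ∀ i a, x i a ∈ (F i).support) (J : Idx m s) :
    ψ (resample x J) = ψ (empData m x)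
      + (linTerm (fun (p : Σ i, Fin (s i)) (J : Idx m s) => J p.1 p.2)
        (fun i (a : Fin (m i)) => g₁ (empData m x) i (x i a)) J
      + quadTerm (fun (p : Σ i, Fin (s i)) (J : Idx m s) => J p.1 p.2)
        (fun i j (a : Fin (m i)) (b : Fin (m j)) => g₂ (empData m x) i j (x i a) (x j b)) J
      + cubTerm (fun (p : Σ i, Fin (s i)) (J : Idx m s) => J p.1 p.2)
        (fun i j k (a : Fin (m i)) (b : Fin (m j)) (c : Fin (m k)) => g₃ (empData m x) i j k (x i a) (x j b) (x k c)) J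
      + remainder3 ψ g₁ g₂ g₃ (resample x J) (empData m x)) := by
  have h1 := hd.taylor1_emp (empData_mem_hull (F := F) m hx)
    (y := fun i (j : Fin (s i)) => x i (J i j)) fun i l => hx _ _
  have h2 := hd.taylor2_emp (empData_mem_hull (F := F) m hx)
    (y := fun i (j : Fin (s i)) => x i (J i j)) fun i l => hx _ _
  have h3 := hd.taylor3_emp (empData_mem_hull (F := F) m hx)
    (y := fun i (j : Fin (s i)) => x i (J i j)) fun i l => hx _ _
  simp only [remainder3]
  rw [show resample x J = fun i => emp fun j : Fin (s i) => x i (J i j) from rfl, h1, h2, h3]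
  simp only [linTerm, quadTerm, cubTerm]
  ring

/-- The variance of `ψ` at a uniform resample, given the data. -/
def bootVar (ψ : (∀ i, Measure (𝒳 i)) → ℝ) (m s : ι → ℕ) (x : Data 𝒳) : ℝ :=
  variance (fun J : Idx m s => ψ (resample x J)) (uniformOn Set.univ)

end Resampling

section Uniform

variable {s : ℕ → ι → ℕ}

theorem tendsto_sum_range_zero {α : Type*} {S : Finset α} {f : ℕ → α → ℝ≥0∞}
    (h : ∀ b ∈ S, Tendsto (fun k => f k b) atTop (𝓝 0)) :
    Tendsto (fun k => ∑ b ∈ S, f k b) atTop (𝓝 0) := by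
  have := tendsto_finsetSum S h
  simpa using this

theorem influence₁_uniform (hm : Model)
    (he : EmpSmooth s) (hn : ∀ᶠ k in atTop, ∀ i, 3 ≤ n k i) (i : ι) :
    ∃ δ : ℕ → ℝ≥0∞, Tendsto δ atTop (𝓝 0) ∧ ∀ᶠ k in atTop, ∀ a < n k i,
      ∫⁻ x : Data 𝒳, ‖g₁ (empData (n k) x) i (x i a) - g₁ F i (x i a)‖ₑ ^ 4 ∂(dataLaw F) ≤ δ k :=
  ⟨_, he.influence i, hn.mono fun _ hk _ ha =>
    lintegral_single_le F hk (G := fun P y => ‖g₁ P i y - g₁ F i y‖ₑ ^ 4)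
      (((hm.g₁_data _ _ _).sub (hm.g₁_true_data _ _)).enorm.pow_const 4) le_rfl ha⟩

theorem influence₂_uniform (hm : Model)
    (he : EmpSmooth₃ s) (hn : ∀ᶠ k in atTop, ∀ i, 3 ≤ n k i) (i j : ι) :
    ∃ δ : ℕ → ℝ≥0∞, Tendsto δ atTop (𝓝 0) ∧ ∀ᶠ k in atTop, ∀ a < n k i, ∀ b < n k j,
      ∫⁻ x : Data 𝒳, ‖g₂ (empData (n k) x) i j (x i a) (x j b) - g₂ F i j (x i a) (x j b)‖ₑ ^ 2
        ∂(dataLaw F) ≤ δ k := by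
  refine ⟨_, tendsto_sum_range_zero (S := Finset.range 2) fun b hb =>
    he.influence₂ i j b (Finset.mem_range.1 hb), hn.mono fun k hk a ha b hb => ?_⟩
  refine lintegral_pair_le F hk (G := fun P y z => ‖g₂ P i j y z - g₂ F i j y z‖ₑ ^ 2)
    (fun b => ((hm.g₂_data _ _ _ _ _).sub (hm.g₂_true_data _ _ _ _)).enorm.pow_const 2)
    (fun b hb => ?_) ha hb
  exact single_le_sum (f := fun b => ∫⁻ x : Data 𝒳, ‖g₂ (empData (n k) x) i j (x i 0) (x j b)
    - g₂ F i j (x i 0) (x j b)‖ₑ ^ 2 ∂(dataLaw F)) (fun _ _ => zero_le) (Finset.mem_range.2 hb)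

theorem influence₃_uniform (hm : Model) (he : EmpSmooth₃ s) (hn : ∀ᶠ k in atTop, ∀ i, 3 ≤ n k i)
    (i j l : ι) :
    ∃ δ : ℕ → ℝ≥0∞, Tendsto δ atTop (𝓝 0) ∧ ∀ᶠ k in atTop, ∀ a < n k i, ∀ b < n k j, ∀ c < n k l,
      ∫⁻ x : Data 𝒳, ‖g₃ (empData (n k) x) i j l (x i a) (x j b) (x l c)
        - g₃ F i j l (x i a) (x j b) (x l c)‖ₑ ^ 2 ∂(dataLaw F) ≤ δ k := by
  refine ⟨_, tendsto_sum_range_zero (S := Finset.range 2) fun b hb =>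
    tendsto_sum_range_zero (S := Finset.range 3) fun c hc =>
    he.influence₃ i j l b (Finset.mem_range.1 hb) c (Finset.mem_range.1 hc),
    hn.mono fun k hk a ha b hb c hc => ?_⟩
  refine lintegral_triple_le F hk (G := fun P y z w => ‖g₃ P i j l y z w - g₃ F i j l y z w‖ₑ ^ 2)
    (fun b c => ((hm.g₃_data _ _ _ _ _ _ _).sub (hm.g₃_true_data _ _ _ _ _ _)).enorm.pow_const 2)
    (fun b hb c hc => ?_) ha hb hc
  refine le_trans ?_ (single_le_sum (fun _ _ => zero_le) (Finset.mem_range.2 hb))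
  exact single_le_sum (f := fun c => ∫⁻ x : Data 𝒳, ‖g₃ (empData (n k) x) i j l (x i 0)
    (x j b) (x l c) - g₃ F i j l (x i 0) (x j b) (x l c)‖ₑ ^ 2 ∂(dataLaw F)) (fun _ _ => zero_le)
    (Finset.mem_range.2 hc)

/-- The remainder in the expansion of the empirical influence function. -/
def influenceRemainder (F : ∀ i, Measure (𝒳 i))
    (g₁ : (∀ i, Measure (𝒳 i)) → ∀ i, 𝒳 i → ℝ)
    (g₂ : (∀ i, Measure (𝒳 i)) → ∀ i j, 𝒳 i → 𝒳 j → ℝ) (m : ι → ℕ) (i : ι) (a : ℕ)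
    (x : Data 𝒳) : ℝ :=
  g₁ (empData m x) i (x i a) - (g₁ F i (x i a)
      + ∑ j, sint (empData m x j) (F j) (fun y => g₂ F i j (x i a) y)
      - sint (empData m x i) (F i) (g₁ F i))

theorem measurable_influenceRemainder (hm : Model) (m : ι → ℕ) (i : ι)
    (a : ℕ) : Measurable (influenceRemainder F g₁ g₂ m i a) := by
  unfold influenceRemainder sint
  simp_rw [integral_empData m]
  refine (hm.g₁_data m i a).sub (((hm.g₁_true_data i a).add ?_).sub ?_)
  · refine measurable_fun_sum _ fun j _ => Measurable.sub ?_ ?_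
    · exact measurable_av fun b : Fin (m j) => hm.g₂_true_data i j a b
    · exact (measurable_integral_right (hm.g₂_true i j)).comp
        (f := fun x : Data 𝒳 => x i a) (by fun_prop)
  · exact (measurable_av fun b : Fin (m i) => hm.g₁_true_data i b).sub_const _

theorem influenceRemainder_uniform (hm : Model)
    (he : EmpSmooth₃ s) (hn : ∀ᶠ k in atTop, ∀ i, 3 ≤ n k i) (i : ι) :
    ∃ δ : ℕ → ℝ≥0∞, Tendsto δ atTop (𝓝 0) ∧ ∀ᶠ k in atTop, ∀ a < n k i,
      ENNReal.ofReal (avg (n k)) * ∫⁻ x : Data 𝒳, ‖influenceRemainder F g₁ g₂ (n k) i a x‖ₑ ^ 2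
        ∂(dataLaw F) ≤ δ k := by
  refine ⟨_, he.influence₁ i, hn.mono fun k hk a ha => ?_⟩
  refine mul_le_mul' le_rfl ?_
  exact lintegral_single_le F hk (G := fun P y => ‖g₁ P i y - (g₁ F i y
      + ∑ j, sint (P j) (F j) (fun z => g₂ F i j y z) - sint (P i) (F i) (g₁ F i))‖ₑ ^ 2)
    ((measurable_influenceRemainder hm (n k) i 0).enorm.pow_const 2) le_rfl ha

end Uniform

section Influence

variable {s : ℕ → ι → ℕ}
  {κ : ℕ → Type*} [∀ k, Fintype (κ k)]

theorem bp_av_g₁_four (hm : Model) (ht : Smooth) (i : ι) (α : ∀ k, κ k → ℕ) :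
    BP (dataLaw F) fun k x => av fun z => g₁ F i (x i (α k z)) ^ 4 := by
  obtain ⟨C, hC, h⟩ := exists_moment_bound_single (p := 4) (hm.g₁_true i) (by norm_num) (ht.moment i)
  exact BP.av_pow_of_lintegral (fun k z => hm.g₁_true_data i _) hC
    (of_forall fun k z => h _)

theorem op_av_g₁_sub_four (hm : Model) (he : EmpSmooth s)
    (hn : ∀ᶠ k in atTop, ∀ i, 3 ≤ n k i) {i : ι} {α : ∀ k, κ k → ℕ} (hα : ∀ k z, α k z < n k i) :
    OP (dataLaw F) fun k x => av fun z =>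
      (g₁ (empData (n k) x) i (x i (α k z)) - g₁ F i (x i (α k z))) ^ 4 := by
  obtain ⟨δ, hδ, h⟩ := influence₁_uniform hm he hn i
  exact OP.av_pow_of_lintegral
    (fun k z => (hm.g₁_data _ i _).sub (hm.g₁_true_data i _)) hδ
    (h.mono fun k hk z => hk _ (hα k z))

theorem bp_av_g₂_four (hm : Model) (ht : Smooth₃) (i j : ι) (α β : ∀ k, κ k → ℕ) :
    BP (dataLaw F) fun k x => av fun z => g₂ F i j (x i (α k z)) (x j (β k z)) ^ 4 := by
  obtain ⟨C, hC, h⟩ := exists_moment_bound_pair (p := 4) (hm.g₂_true i j) (by norm_num)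
    (ht.moment₂ i j)
  exact BP.av_pow_of_lintegral (fun k z => hm.g₂_true_data i j _ _) hC
    (of_forall fun k z => h _ _)

theorem op_av_g₂_sub_sq (hm : Model)
    (he : EmpSmooth₃ s) (hn : ∀ᶠ k in atTop, ∀ i, 3 ≤ n k i) {i j : ι}
    {α β : ∀ k, κ k → ℕ} (hα : ∀ k z, α k z < n k i) (hβ : ∀ k z, β k z < n k j) :
    OP (dataLaw F) fun k x => av fun z => (g₂ (empData (n k) x) i j (x i (α k z)) (x j (β k z))
      - g₂ F i j (x i (α k z)) (x j (β k z))) ^ 2 := by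
  obtain ⟨δ, hδ, h⟩ := influence₂_uniform hm he hn i j
  exact OP.av_pow_of_lintegral
    (fun k z => (hm.g₂_data _ i j _ _).sub (hm.g₂_true_data i j _ _)) hδ
    (h.mono fun k hk z => hk _ (hα k z) _ (hβ k z))

theorem bp_av_g₃_sq (hm : Model) (ht : Smooth₃) (i j l : ι) (α β γ : ∀ k, κ k → ℕ) :
    BP (dataLaw F) fun k x => av fun z =>
      g₃ F i j l (x i (α k z)) (x j (β k z)) (x l (γ k z)) ^ 2 := by
  obtain ⟨C, hC, h⟩ := exists_moment_bound_triple (p := 2) (hm.g₃_true i j l) (by norm_num)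
    (ht.moment₃ i j l)
  exact BP.av_pow_of_lintegral (fun k z => hm.g₃_true_data i j l _ _ _) hC
    (of_forall fun k z => h _ _ _)

theorem op_av_g₃_sub_sq (hm : Model) (he : EmpSmooth₃ s) (hn : ∀ᶠ k in atTop, ∀ i, 3 ≤ n k i)
    {i j l : ι} {α β γ : ∀ k, κ k → ℕ} (hα : ∀ k z, α k z < n k i) (hβ : ∀ k z, β k z < n k j)
    (hγ : ∀ k z, γ k z < n k l) :
    OP (dataLaw F) fun k x => av fun z =>
      (g₃ (empData (n k) x) i j l (x i (α k z)) (x j (β k z)) (x l (γ k z))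
        - g₃ F i j l (x i (α k z)) (x j (β k z)) (x l (γ k z))) ^ 2 := by
  obtain ⟨δ, hδ, h⟩ := influence₃_uniform hm he hn i j l
  exact OP.av_pow_of_lintegral
    (fun k z => (hm.g₃_data _ i j l _ _ _).sub (hm.g₃_true_data i j l _ _ _)) hδ
    (h.mono fun k hk z => hk _ (hα k z) _ (hβ k z) _ (hγ k z))

theorem bp_av_ghat₁_four (hm : Model) (ht : Smooth)
    (he : EmpSmooth s) (hn : ∀ᶠ k in atTop, ∀ i, 3 ≤ n k i) {i : ι}
    {α : ∀ k, κ k → ℕ} (hα : ∀ k z, α k z < n k i) :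
    BP (dataLaw F) fun k x => av fun z => g₁ (empData (n k) x) i (x i (α k z)) ^ 4 :=
  (bp_av_g₁_four hm ht i α).av_four_of_sub (op_av_g₁_sub_four hm he hn hα)

theorem bp_av_ghat₂_sq (hm : Model) (ht : Smooth₃)
    (he : EmpSmooth₃ s) (hn : ∀ᶠ k in atTop, ∀ i, 3 ≤ n k i) {i j : ι}
    {α β : ∀ k, κ k → ℕ} (hα : ∀ k z, α k z < n k i) (hβ : ∀ k z, β k z < n k j) :
    BP (dataLaw F) fun k x => av fun z =>
      g₂ (empData (n k) x) i j (x i (α k z)) (x j (β k z)) ^ 2 :=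
  (bp_av_g₂_four hm ht i j α β).av_sq_of_four.av_sq_of_sub (op_av_g₂_sub_sq hm he hn hα hβ)

theorem bp_av_ghat₃_sq (hm : Model) (ht : Smooth₃)
    (he : EmpSmooth₃ s) (hn : ∀ᶠ k in atTop, ∀ i, 3 ≤ n k i)
    {i j l : ι} {α β γ : ∀ k, κ k → ℕ} (hα : ∀ k z, α k z < n k i) (hβ : ∀ k z, β k z < n k j)
    (hγ : ∀ k z, γ k z < n k l) :
    BP (dataLaw F) fun k x => av fun z =>
      g₃ (empData (n k) x) i j l (x i (α k z)) (x j (β k z)) (x l (γ k z)) ^ 2 :=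
  (bp_av_g₃_sq hm ht i j l α β γ).av_sq_of_sub (op_av_g₃_sub_sq hm he hn hα hβ hγ)

/-- The main terms of the bootstrap variance. -/
def bootMain (g₁ : (∀ i, Measure (𝒳 i)) → ∀ i, 𝒳 i → ℝ)
    (g₂ : (∀ i, Measure (𝒳 i)) → ∀ i j, 𝒳 i → 𝒳 j → ℝ)
    (g₃ : (∀ i, Measure (𝒳 i)) → ∀ i j k, 𝒳 i → 𝒳 j → 𝒳 k → ℝ) (m s : ι → ℕ) (x : Data 𝒳) : ℝ :=
  ∑ i, (av fun a : Fin (m i) => g₁ (empData m x) i (x i a) ^ 2) / s i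
    + ∑ i, (av fun a : Fin (m i) => g₁ (empData m x) i (x i a)
        * g₂ (empData m x) i i (x i a) (x i a)) / (s i : ℝ) ^ 2
    + ∑ i, ∑ j, (av fun z : Fin (m i) × Fin (m j) =>
        g₂ (empData m x) i j (x i z.1) (x j z.2) ^ 2) / (2 * s i * s j)
    + ∑ i, ∑ j, (av fun z : Fin (m i) × Fin (m j) => g₁ (empData m x) i (x i z.1)
        * g₃ (empData m x) i j j (x i z.1) (x j z.2) (x j z.2)) / (s i * s j)

/-- The weighted mean square of the third order terms. -/
def bootCub (g₃ : (∀ i, Measure (𝒳 i)) → ∀ i j k, 𝒳 i → 𝒳 j → 𝒳 k → ℝ)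
    (m s : ι → ℕ) (x : Data 𝒳) : ℝ :=
  ∑ p : Σ i, Fin (s i), ∑ q : Σ i, Fin (s i), ∑ r : Σ i, Fin (s i),
      (cubicWeight ![p, q, r] : ℝ) * (1 / (6 * s p.1 * s q.1 * s r.1)) ^ 2 *
        bootMean fun J : Idx m s => g₃ (empData m x) p.1 q.1 r.1 (x p.1 (J p.1 p.2))
          (x q.1 (J q.1 q.2)) (x r.1 (J r.1 r.2)) ^ 2

theorem bp_bootCub (hm : Model) (ht : Smooth₃)
    {c : ℝ} {θ : ℕ → ℝ} {B R : ℕ → ℕ} (hst : ∀ᶠ k in atTop, Stage c (θ k) (n k) (B k) (R k))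
    (he : EmpSmooth₃ fun k => subSize (θ k) (n k)) :
    BP (dataLaw F) fun k x => (θ k * avg (n k)) ^ 3
      * bootCub g₃ (n k) (subSize (θ k) (n k)) x := by
  have hn : ∀ᶠ k in atTop, ∀ i, 3 ≤ n k i := hst.mono fun k hk => hk.three_le
  obtain ⟨C, hC, hb⟩ : ∃ C : ℝ≥0, True ∧ ∀ᶠ k in atTop, ∀ i j l, ∀ a < n k i, ∀ b < n k j,
      ∀ c < n k l, ∫⁻ x : Data 𝒳, ‖g₃ (empData (n k) x) i j l (x i a) (x j b) (x l c)‖ₑ ^ 2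
        ∂(dataLaw F) ≤ C := by
    have h1 : ∀ i j l, ∃ C : ℝ≥0∞, C ≠ ∞ ∧ ∀ᶠ k in atTop, ∀ a < n k i, ∀ b < n k j,
      ∀ c < n k l, ∫⁻ x : Data 𝒳, ‖g₃ (empData (n k) x) i j l (x i a) (x j b) (x l c)‖ₑ ^ 2
        ∂(dataLaw F) ≤ C := fun i j l => by
      obtain ⟨δ, hδ, h⟩ := influence₃_uniform hm he hn i j l
      obtain ⟨C, hC, h2⟩ := exists_moment_bound_triple (p := 2) (hm.g₃_true i j l) (by norm_num)
        (ht.moment₃ i j l)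
      refine ⟨2 * 1 + 2 * C, by finiteness, ?_⟩
      filter_upwards [h, ENNReal.tendsto_nhds_zero.1 hδ 1 one_pos] with k h3 h4 a ha b hb c hc
      have h5 : ∀ x : Data 𝒳, ‖g₃ (empData (n k) x) i j l (x i a) (x j b) (x l c)‖ₑ ^ 2
          ≤ 2 * ‖g₃ (empData (n k) x) i j l (x i a) (x j b) (x l c)
              - g₃ F i j l (x i a) (x j b) (x l c)‖ₑ ^ 2
            + 2 * ‖g₃ F i j l (x i a) (x j b) (x l c)‖ₑ ^ 2 := fun x => by
        rw [← enorm_pow, ← enorm_pow, ← enorm_pow, Real.enorm_of_nonneg (sq_nonneg _),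
          Real.enorm_of_nonneg (sq_nonneg _), Real.enorm_of_nonneg (sq_nonneg _)]
        rw [← ENNReal.ofReal_ofNat 2, ← ENNReal.ofReal_mul (by norm_num),
          ← ENNReal.ofReal_mul (by norm_num), ← ENNReal.ofReal_add (by positivity) (by positivity)]
        apply ENNReal.ofReal_le_ofReal
        nlinarith [sq_nonneg (g₃ (empData (n k) x) i j l (x i a) (x j b) (x l c)
              - 2 * g₃ F i j l (x i a) (x j b) (x l c))]
      refine (lintegral_mono h5).trans ?_
      rw [lintegral_add_right _ (((hm.g₃_true_data i j l a b c).enorm.pow_const 2).const_mul 2),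
        lintegral_const_mul' _ _ (by finiteness), lintegral_const_mul' _ _ (by finiteness)]
      gcongr
      · exact (h3 a ha b hb c hc).trans h4
      · exact h2 a b c
    choose C hC h2 using h1
    refine ⟨(∑ i, ∑ j, ∑ l, C i j l).toNNReal, trivial, ?_⟩
    rw [ENNReal.coe_toNNReal (ENNReal.sum_lt_top.2 fun i _ => ENNReal.sum_lt_top.2 fun j _ =>
      ENNReal.sum_lt_top.2 fun l _ => lt_top_iff_ne_top.2 (hC i j l)).ne]
    filter_upwards [eventually_all.2 fun i => eventually_all.2 fun j => eventually_all.2 fun l =>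
      h2 i j l] with k hk i j l a ha b hb c hc
    refine (hk i j l a ha b hb c hc).trans ?_
    refine le_trans ?_ (single_le_sum (fun _ _ => zero_le) (mem_univ i))
    refine le_trans ?_ (single_le_sum (fun _ _ => zero_le) (mem_univ j))
    exact single_le_sum (f := C i j) (fun _ _ => zero_le) (mem_univ l)
  have hmeasT : ∀ k (p q r : Σ i, Fin (subSize (θ k) (n k) i)), Measurable fun x : Data 𝒳 =>
      bootMean fun J : Idx (n k) (subSize (θ k) (n k)) => g₃ (empData (n k) x) p.1 q.1 r.1
        (x p.1 (J p.1 p.2)) (x q.1 (J q.1 q.2)) (x r.1 (J r.1 r.2)) ^ 2 := fun k p q r =>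
    (measurable_fun_sum _ fun J _ => (hm.g₃_data _ _ _ _ _ _ _).pow_const 2).div_const _
  refine BP.of_lintegral (C := ENNReal.ofReal (729 * (card ι : ℝ) ^ 3 * c ^ 9) * C)
    (fun k => ((measurable_fun_sum _ fun p _ => measurable_fun_sum _ fun q _ =>
      measurable_fun_sum _ fun r _ => (hmeasT k p q r).const_mul _).const_mul _).aemeasurable)
    (by finiteness) ?_
  filter_upwards [hst, hb] with k hk hb
  have hS0 := hk.scale_pos
  have := hk.neZero_n
  have hT : ∀ p q r : Σ i, Fin (subSize (θ k) (n k) i), ∫⁻ x : Data 𝒳,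
      ‖bootMean fun J : Idx (n k) (subSize (θ k) (n k)) => g₃ (empData (n k) x) p.1 q.1 r.1
        (x p.1 (J p.1 p.2)) (x q.1 (J q.1 q.2)) (x r.1 (J r.1 r.2)) ^ 2‖ₑ ∂(dataLaw F) ≤ C :=
    fun p q r => lintegral_enorm_av_le (fun J => ((hm.g₃_data _ _ _ _ _ _ _).pow_const 2).aemeasurable)
      fun J => by simpa only [enorm_pow] using hb _ _ _ _ (J p.1 p.2).2 _ (J q.1 q.2).2 _ (J r.1 r.2).2
  have hw := sum_cubicWeight_div_le hk.one_le hk.one_le_scale hk.inv_s_le hk.s_le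
  have hw' := ENNReal.ofReal_le_ofReal hw
  refine le_trans ?_ (mul_le_mul' hw' le_rfl)
  rw [ENNReal.ofReal_mul (by positivity), ENNReal.ofReal_sum_of_nonneg (fun _ _ => by positivity),
    mul_assoc, sum_mul]
  simp_rw [enorm_mul]
  rw [lintegral_const_mul']
  swap
  · finiteness
  rw [Real.enorm_of_nonneg (by positivity)]
  refine mul_le_mul' le_rfl ?_
  have e1 : ∀ (w : Data 𝒳 → ℝ) (A : ℝ) (hA : 0 ≤ A), (∫⁻ x, ‖w x‖ₑ ∂(dataLaw F) ≤ C) →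
      ∫⁻ x, ‖A * w x‖ₑ ∂(dataLaw F) ≤ ENNReal.ofReal A * C := fun w A hA h => by
    simp_rw [enorm_mul]
    rw [lintegral_const_mul' _ _ (by finiteness), Real.enorm_of_nonneg hA]
    gcongr
  have e2 : ∀ {J : Type _} [Fintype J] (w : J → Data 𝒳 → ℝ) (D : J → ℝ≥0∞),
      (∀ j, Measurable (w j)) → (∀ j, ∫⁻ x, ‖w j x‖ₑ ∂(dataLaw F) ≤ D j) →
      ∫⁻ x, ‖∑ j, w j x‖ₑ ∂(dataLaw F) ≤ ∑ j, D j := fun w D hw hD => by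
    refine (lintegral_mono fun x => enorm_sum_le _ _).trans ?_
    rw [lintegral_finsetSum _ fun j _ => (hw j).enorm]
    exact sum_le_sum fun j _ => hD j
  refine e2 _ _ (fun p => measurable_fun_sum _ fun q _ => measurable_fun_sum _
    fun r _ => (hmeasT k p q r).const_mul _) fun p => ?_
  rw [ENNReal.ofReal_sum_of_nonneg (fun _ _ => by positivity), sum_mul]
  refine e2 _ _ (fun q => measurable_fun_sum _
    fun r _ => (hmeasT k p q r).const_mul _) fun q => ?_
  rw [ENNReal.ofReal_sum_of_nonneg (fun _ _ => by positivity), sum_mul]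
  exact e2 _ _ (fun r => (hmeasT k p q r).const_mul _) fun r => e1 _ _ (by positivity) (hT p q r)

end Influence

section Limits

variable {s : ℕ → ι → ℕ}

theorem op_bootVar_sub [Nonempty ι] (hm : Model) (hd : Expandable) (ht : Smooth)
    (ht3 : Smooth₃) {c : ℝ} {θ : ℕ → ℝ} {B R : ℕ → ℕ}
    (hst : ∀ᶠ k in atTop, Stage c (θ k) (n k) (B k) (R k))
    (hθn : Tendsto (fun k => θ k * avg (n k)) atTop atTop)
    (he : EmpSmooth fun k => subSize (θ k) (n k)) (he3 : EmpSmooth₃ fun k => subSize (θ k) (n k)) :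
    OP (dataLaw F) fun k x => (θ k * avg (n k)) ^ 2 * (bootVar ψ (n k) (subSize (θ k) (n k)) x
      - bootMain g₁ g₂ g₃ (n k) (subSize (θ k) (n k)) x) := by
  have hn : ∀ᶠ k in atTop, ∀ i, 3 ≤ n k i := hst.mono fun k hk => hk.three_le
  let K₁ : ι → ℕ → Data 𝒳 → ℝ := fun i k x =>
    av fun a : Fin (n k i) => g₁ (empData (n k) x) i (x i a) ^ 2
  let K₂ : ι → ℕ → Data 𝒳 → ℝ := fun i k x =>
    av fun a : Fin (n k i) => g₂ (empData (n k) x) i i (x i a) (x i a) ^ 2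
  let K₃ : ι → ι → ℕ → Data 𝒳 → ℝ := fun i j k x =>
    av fun z : Fin (n k i) × Fin (n k j) => g₂ (empData (n k) x) i j (x i z.1) (x j z.2) ^ 2
  let K₄ : ι → ℕ → Data 𝒳 → ℝ := fun i k x => |av fun a : Fin (n k i) =>
    g₁ (empData (n k) x) i (x i a) * g₃ (empData (n k) x) i i i (x i a) (x i a) (x i a)|
  let K₅ : ι → ℕ → Data 𝒳 → ℝ := fun i k x => |av fun z : Fin (n k i) × Fin (n k i) =>
    g₁ (empData (n k) x) i (x i z.1) * g₃ (empData (n k) x) i i i (x i z.1) (x i z.2) (x i z.2)|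
  let K₆ : ℕ → Data 𝒳 → ℝ := fun k x => (θ k * avg (n k)) ^ 3
      * bootCub g₃ (n k) (subSize (θ k) (n k)) x
  let κ : ℕ → Data 𝒳 → ℝ := fun k x => (∑ i, K₁ i k x) + (∑ i, K₂ i k x) + (∑ i, ∑ j, K₃ i j k x)
    + (∑ i, K₄ i k x) + (∑ i, K₅ i k x) + K₆ k x
  let η : ℕ → Data 𝒳 → ℝ := fun k x => (θ k * avg (n k)) ^ 3 *
    bootMean fun J : Idx (n k) (subSize (θ k) (n k)) =>
      remainder3 ψ g₁ g₂ g₃ (resample x J) (empData (n k) x) ^ 2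
  have hκ : BP (dataLaw F) κ := by
    refine (((((BP.sum _ fun i _ => ?_).add (BP.sum _ fun i _ => ?_)).add
      (BP.sum _ fun i _ => BP.sum _ fun j _ => ?_)).add (BP.sum _ fun i _ => ?_)).add
      (BP.sum _ fun i _ => ?_)).add (bp_bootCub hm ht3 hst he3)
    · exact (bp_av_ghat₁_four hm ht he hn fun k z => z.2).av_sq_of_four
    · exact bp_av_ghat₂_sq hm ht3 he3 hn (fun k z => z.2) fun k z => z.2
    · exact bp_av_ghat₂_sq hm ht3 he3 hn (fun k z => z.1.2) fun k z => z.2.2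
    · exact (BP.av_mul (bp_av_ghat₁_four hm ht he hn fun k z => z.2).av_sq_of_four
        (bp_av_ghat₃_sq hm ht3 he3 hn (fun k z => z.2) (fun k z => z.2) fun k z => z.2)).abs
    · exact (BP.av_mul (bp_av_ghat₁_four hm ht he hn fun k z => z.1.2).av_sq_of_four
        (bp_av_ghat₃_sq hm ht3 he3 hn (fun k z => z.1.2) (fun k z => z.2.2) fun k z => z.2.2)).abs
  have hη : OP (dataLaw F) η := by
    refine he3.remainder.op (IsBigO.of_bound (c ^ 3) ?_)
    filter_upwards [hst] with k hk
    have hS0 := hk.scale_pos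
    rw [norm_one, mul_one]
    exact hk.scale_pow_le _
  set M : ℝ := ((card ι : ℝ) + 1) ^ 2 * c ^ 3 with hM
  have hlim : OP (dataLaw F) fun k x => 9 * M * ((√(θ k * avg (n k)))⁻¹ * κ k x)
      + 10 * M * (√(κ k x) * √(η k x)) + η k x := by
    refine ((OP.const_mul _ (hκ.small_mul ?_)).add (OP.const_mul _ (hκ.sqrt.mul_op hη.sqrt))).add hη
    exact tendsto_inv_atTop_zero.comp (Real.tendsto_sqrt_atTop.comp hθn)
  refine hlim.mono ?_
  filter_upwards [hst] with k hk
  filter_upwards [ae_mem_support (F := F)] with x hx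
  have := hk.neZero_n
  have V := vonMises_boot (n k) (subSize (θ k) (n k)) hd hx
  have hS0 := hk.scale_pos
  have k1 : ∀ i, 0 ≤ K₁ i k x := fun i => av_nonneg fun z => sq_nonneg _
  have k2 : ∀ i, 0 ≤ K₂ i k x := fun i => av_nonneg fun z => sq_nonneg _
  have k3 : ∀ i j, 0 ≤ K₃ i j k x := fun i j => av_nonneg fun z => sq_nonneg _
  have k4 : ∀ i, 0 ≤ K₄ i k x := fun i => abs_nonneg _
  have k5 : ∀ i, 0 ≤ K₅ i k x := fun i => abs_nonneg _
  have hbm : ∀ f : Idx (n k) (subSize (θ k) (n k)) → ℝ, (∀ J, 0 ≤ f J) → 0 ≤ bootMean f :=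
    fun f hf => div_nonneg (sum_nonneg fun J _ => hf J) (Nat.cast_nonneg _)
  have k6 : 0 ≤ K₆ k x := mul_nonneg (by positivity) (sum_nonneg fun p _ =>
    sum_nonneg fun q _ => sum_nonneg fun r _ => mul_nonneg (by positivity)
      (hbm _ fun J => sq_nonneg _))
  have s1 := sum_nonneg fun i (_ : i ∈ Finset.univ) => k1 i
  have s2 := sum_nonneg fun i (_ : i ∈ Finset.univ) => k2 i
  have s3 := sum_nonneg fun i (_ : i ∈ Finset.univ) =>
    sum_nonneg fun j (_ : j ∈ Finset.univ) => k3 i j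
  have s4 := sum_nonneg fun i (_ : i ∈ Finset.univ) => k4 i
  have s5 := sum_nonneg fun i (_ : i ∈ Finset.univ) => k5 i
  have hκdef : κ k x = (∑ i, K₁ i k x) + (∑ i, K₂ i k x) + (∑ i, ∑ j, K₃ i j k x)
    + (∑ i, K₄ i k x) + (∑ i, K₅ i k x) + K₆ k x := rfl
  have hκ0 : 0 ≤ κ k x := by rw [hκdef]; positivity
  have hη0 : 0 ≤ η k x := mul_nonneg (by positivity) (hbm _ fun J => sq_nonneg _)
  have hM0 : 0 ≤ M := by have := hk.c_pos; positivity
  have single : ∀ (f : ι → ℝ), (∀ i, 0 ≤ f i) → ∀ i, f i ≤ ∑ i, f i := fun f hf i =>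
    single_le_sum (fun i _ => hf i) (mem_univ i)
  have key := V.scaled_variance_sub_le (e := fun J => remainder3 ψ g₁ g₂ g₃ (resample x J)
      (empData (n k) x)) MemLp.of_discrete (ψ (empData (n k) x)) (κ := κ k x) (η := η k x)
    hk.one_le hk.one_le_scale hκ0 hη0 hM hk.inv_s_le
    (fun i => by
      rw [integral_uniform_eq_av]
      have : K₁ i k x ≤ κ k x := by rw [hκdef]; linarith [single _ k1 i]
      exact this)
    (fun i => by
      rw [integral_uniform_eq_av]
      have : K₂ i k x ≤ κ k x := by rw [hκdef]; linarith [single _ k2 i]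
      exact this)
    (fun i j => by
      rw [integral_uniform_prod_eq_av]
      have : K₃ i j k x ≤ κ k x := by
        have h1 := single _ (k3 i) j
        have h2 := single (fun i => ∑ j, K₃ i j k x) (fun i => sum_nonneg fun j _ => k3 i j) i
        rw [hκdef]; linarith
      exact this)
    (fun i => by
      rw [integral_uniform_eq_av]
      have : K₄ i k x ≤ κ k x := by rw [hκdef]; linarith [single _ k4 i]
      exact this)
    (fun i => by
      rw [integral_uniform_prod_eq_av]
      have : K₅ i k x ≤ κ k x := by rw [hκdef]; linarith [single _ k5 i]
      exact this)
    (by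
      have h1 := mul_le_mul_of_nonneg_left V.integral_sq_cub_le' (pow_nonneg hS0.le 3)
      refine h1.trans ?_
      simp_rw [← bootMean_eq_integral]
      have : K₆ k x ≤ κ k x := by rw [hκdef]; linarith
      exact this)
    (by rw [← bootMean_eq_integral])
  have hvar : bootVar ψ (n k) (subSize (θ k) (n k)) x = variance (fun J => _)
      (uniformOn (Set.univ : Set (Idx (n k) (subSize (θ k) (n k))))) :=
    variance_congr (of_forall fun J => remainder3_resample (F := F) hd hx J)
  rw [← hvar] at key
  simp_rw [integral_uniform_prod_eq_av, integral_uniform_eq_av] at key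
  rw [abs_mul, abs_of_nonneg (by positivity : (0 : ℝ) ≤ (θ k * avg (n k)) ^ 2)]
  refine le_trans key (le_trans (le_of_eq ?_) (le_abs_self _))
  rw [div_eq_inv_mul]

theorem op_av_ghat₁_sq (hm : Model) (ht : Smooth) (he : EmpSmooth s) (hb : BalancedData n) (i : ι) :
    OP (dataLaw F) fun k x => (av fun a : Fin (n k i) => g₁ (empData (n k) x) i (x i a) ^ 2)
      - ∫ y, g₁ F i y ^ 2 ∂(F i) := by
  have hn := hb.eventually_three_le
  have h0 := (op_av_g₁_sub_four hm he hn (κ := fun k => Fin (n k i)) (i := i)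
    (α := fun k z => z) fun k z => z.2).av_sq_of_four
  have h1 := (bp_av_g₁_four hm ht i (κ := fun k => Fin (n k i)) fun k z => z).av_sq_of_four
  have h2 := OP.av_mul_sub h0 h0 h1 h1
  have h3 := op_av_sub_integral F ((hm.g₁_true i).pow_const 2)
    ((ht.moment i).mono_exponent (p := 2) (by norm_num)).integrable_sq (hb.1 i)
  refine (h2.add h3).congr (of_forall fun k => of_forall fun x => ?_)
  simp only [sq]
  ring

theorem ThirdSmoothAtTruth.memLp_diag (hm : Model) (ht3 : Smooth₃) (i : ι) :
    MemLp (fun y => g₂ F i i y y) 4 (F i) := by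
  have hmp := measurePreserving_data (F := F) i 0
  have hmeas : Measurable fun y => g₂ F i i y y :=
    (hm.g₂_true i i).comp (f := fun y => (y, y)) (by fun_prop)
  rw [← hmp.map_eq, memLp_map_measure_iff hmeas.aestronglyMeasurable hmp.measurable.aemeasurable]
  exact ht3.memLp₂_data i i 0 0

theorem op_av_ghat₁_mul_ghat₂ (hm : Model) (ht : Smooth) (ht3 : Smooth₃) (he : EmpSmooth s)
    (he3 : EmpSmooth₃ s) (hb : BalancedData n) (i : ι) :
    OP (dataLaw F) fun k x => (av fun a : Fin (n k i) => g₁ (empData (n k) x) i (x i a)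
      * g₂ (empData (n k) x) i i (x i a) (x i a)) - ∫ y, g₁ F i y * g₂ F i i y y ∂(F i) := by
  have hn := hb.eventually_three_le
  have h0 := (op_av_g₁_sub_four hm he hn (κ := fun k => Fin (n k i)) (i := i)
    (α := fun k z => z) fun k z => z.2).av_sq_of_four
  have h1 := (bp_av_g₁_four hm ht i (κ := fun k => Fin (n k i)) fun k z => z).av_sq_of_four
  have h0' := op_av_g₂_sub_sq hm he3 hn (κ := fun k => Fin (n k i)) (i := i) (j := i)
    (α := fun k z => z) (β := fun k z => z) (fun k z => z.2) fun k z => z.2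
  have h1' := (bp_av_g₂_four hm ht3 i i (κ := fun k => Fin (n k i)) (fun k z => z)
    fun k z => z).av_sq_of_four
  have h2 := OP.av_mul_sub h0 h0' h1 h1'
  have hmeas : Measurable fun y => g₂ F i i y y :=
    (hm.g₂_true i i).comp (f := fun y => (y, y)) (by fun_prop)
  have h3 := op_av_sub_integral F ((hm.g₁_true i).mul hmeas)
    (((ht.moment i).mono_exponent (p := 2) (by norm_num)).integrable_mul
      ((ht3.memLp_diag hm i).mono_exponent (p := 2) (by norm_num))) (hb.1 i)
  refine (h2.add h3).congr (of_forall fun k => of_forall fun x => ?_)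
  simp only [Pi.mul_apply]
  ring

theorem op_av_ghat₂_sq (hm : Model) (ht3 : Smooth₃)
    (he3 : EmpSmooth₃ s) (hb : BalancedData n) (i j : ι) :
    OP (dataLaw F) fun k x => (av fun z : Fin (n k i) × Fin (n k j) =>
        g₂ (empData (n k) x) i j (x i z.1) (x j z.2) ^ 2)
      - ∫ y, ∫ z, g₂ F i j y z ^ 2 ∂(F j) ∂(F i) := by
  have hn := hb.eventually_three_le
  have h0 := op_av_g₂_sub_sq hm he3 hn (κ := fun k => Fin (n k i) × Fin (n k j)) (i := i) (j := j)
    (α := fun k z => z.1) (β := fun k z => z.2) (fun k z => z.1.2) fun k z => z.2.2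
  have h1 := (bp_av_g₂_four hm ht3 i j (κ := fun k => Fin (n k i) × Fin (n k j)) (fun k z => z.1)
    fun k z => z.2).av_sq_of_four
  have h2 := OP.av_mul_sub h0 h0 h1 h1
  have h3 := op_av_pair_sub_integral (F := F) (f := fun _ : 𝒳 i => 1)
    (h := fun y z => g₂ F i j y z ^ 2) ((hm.g₂_true i j).pow_const 2)
    (fun b hb => by
      have := (ht3.moment₂ i j b hb).norm_rpow_div 2
      have h4 : (4 / 2 : ℝ≥0∞) = 2 := by
        rw [show (4 : ℝ≥0∞) = 2 * 2 by norm_num,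
          ENNReal.mul_div_cancel_right (by norm_num) (by norm_num)]
      rw [h4] at this
      simpa using this) measurable_const (memLp_const 1) hb.1
  refine (h2.add h3).congr (of_forall fun k => of_forall fun x => ?_)
  simp only [sq, one_mul]
  ring

theorem op_av_ghat₁_mul_ghat₃ (hm : Model) (ht : Smooth) (ht3 : Smooth₃) (he : EmpSmooth s)
    (he3 : EmpSmooth₃ s) (hb : BalancedData n) (i j : ι) :
    OP (dataLaw F) fun k x => (av fun z : Fin (n k i) × Fin (n k j) =>
        g₁ (empData (n k) x) i (x i z.1) * g₃ (empData (n k) x) i j j (x i z.1) (x j z.2) (x j z.2))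
      - ∫ y, g₁ F i y * ∫ z, g₃ F i j j y z z ∂(F j) ∂(F i) := by
  have hn := hb.eventually_three_le
  have h0 := (op_av_g₁_sub_four hm he hn (κ := fun k => Fin (n k i) × Fin (n k j)) (i := i)
    (α := fun k z => z.1) fun k z => z.1.2).av_sq_of_four
  have h1 := (bp_av_g₁_four hm ht i (κ := fun k => Fin (n k i) × Fin (n k j))
    fun k z => z.1).av_sq_of_four
  have h0' := op_av_g₃_sub_sq hm he3 hn (κ := fun k => Fin (n k i) × Fin (n k j)) (i := i) (j := j)
    (l := j) (α := fun k z => z.1) (β := fun k z => z.2) (γ := fun k z => z.2)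
    (fun k z => z.1.2) (fun k z => z.2.2) fun k z => z.2.2
  have h1' := bp_av_g₃_sq hm ht3 i j j (κ := fun k => Fin (n k i) × Fin (n k j)) (fun k z => z.1)
    (fun k z => z.2) fun k z => z.2
  have h2 := OP.av_mul_sub h0 h0' h1 h1'
  have h3 := op_av_pair_sub_integral (F := F) (f := g₁ F i)
    (h := fun y z => g₃ F i j j y z z)
    ((hm.g₃_true i j j).comp (f := fun p : 𝒳 i × 𝒳 j => (p.1, p.2, p.2)) (by fun_prop))
    (fun b _ => ht3.memLp₃_data i j j 0 b b) (hm.g₁_true i)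
    ((ht.moment i).mono_exponent (by norm_num)) hb.1
  refine (h2.add h3).congr (of_forall fun k => of_forall fun x => ?_)
  ring

end Limits

section Linearization

variable {s : ℕ → ι → ℕ}

theorem BP.avg_mul {c : ℝ} (hn : ∀ᶠ k in atTop, ∀ i, avg (n k) ≤ c * n k i)
    {Ω : Type*} [MeasurableSpace Ω] {μ : Measure Ω} {i : ι} {A : ℕ → Ω → ℝ}
    (h : BP μ fun k ω => (n k i : ℝ) * A k ω) : BP μ fun k ω => avg (n k) * A k ω := by
  refine (h.const_mul c).mono (hn.mono fun k hk => of_forall fun ω => ?_)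
  have h0 : 0 ≤ avg (n k) := div_nonneg (sum_nonneg fun i _ => Nat.cast_nonneg _)
    (Nat.cast_nonneg _)
  rw [abs_mul, ← mul_assoc, abs_mul (c * _), abs_of_nonneg h0,
    abs_of_nonneg (h0.trans (hk i))]
  exact mul_le_mul_of_nonneg_right (hk i) (abs_nonneg _)

theorem avg_nonneg (m : ι → ℕ) : 0 ≤ avg m :=
  div_nonneg (sum_nonneg fun _ _ => Nat.cast_nonneg _) (Nat.cast_nonneg _)

/-- The empirical average of `ĝᵢ²` up to terms of order `o_p (avg n ^ (-1/2))`. -/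
theorem op_av_ghat₁_sq_sub (hm : Model) (ht : Smooth) (ht3 : Smooth₃) (he3 : EmpSmooth₃ s)
    (hb : BalancedData n) {c : ℝ} (hn : ∀ᶠ k in atTop, ∀ i, avg (n k) ≤ c * n k i)
    (ha : Tendsto (fun k => avg (n k)) atTop atTop) (hg : ∀ i, ∫ y, g₁ F i y ∂(F i) = 0) (i : ι) :
    OP (dataLaw F) fun k x => √(avg (n k)) *
      ((av fun a : Fin (n k i) => g₁ (empData (n k) x) i (x i a) ^ 2)
        - (av fun a : Fin (n k i) => g₁ F i (x i a) ^ 2)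
        - 2 * ∑ j, av fun a : Fin (n k i) => g₁ F i (x i a) *
          sint (empData (n k) x j) (F j) (fun y => g₂ F i j (x i a) y)) := by
  have hn3 := hb.eventually_three_le
  have hn0 : ∀ i, ∀ᶠ k in atTop, n k i ≠ 0 := fun i => hn3.mono fun k hk => by
    have := hk i; omega
  let e : ∀ k, Fin (n k i) → Data 𝒳 → ℝ := fun k a => influenceRemainder F g₁ g₂ (n k) i a
  let Q : ι → ∀ k, Fin (n k i) → Data 𝒳 → ℝ := fun j k a x =>
    sint (empData (n k) x j) (F j) (fun y => g₂ F i j (x i a) y)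
  let G : ∀ k, Data 𝒳 → ℝ := fun k x => av fun a : Fin (n k i) => g₁ F i (x i a)
  have he : OP (dataLaw F) fun k x => av fun a => (√(avg (n k)) * e k a x) ^ 2 := by
    obtain ⟨δ, hδ, h⟩ := influenceRemainder_uniform hm he3 hn3 i
    refine OP.av_pow_of_lintegral (fun k a =>
      (measurable_influenceRemainder hm (n k) i a).const_mul _) hδ (h.mono fun k hk a => ?_)
    refine le_trans (le_of_eq ?_) (hk a a.2)
    simp_rw [enorm_mul, mul_pow]
    rw [lintegral_const_mul' _ _ (by finiteness), ← enorm_pow, Real.sq_sqrt (avg_nonneg _),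
      Real.enorm_of_nonneg (avg_nonneg _)]
  have hQ : ∀ j, BP (dataLaw F) fun k x => av fun a => (√(avg (n k)) * Q j k a x) ^ 2 := fun j => by
    have h1 := (bp_av_proj_sq (hm.g₂_true i j)
      (fun b _ => (ht3.memLp₂_data i j 0 b).mono_exponent (by norm_num))
      (fun k (z : Fin (n k i)) => (z : ℕ)) (hn0 j)).avg_mul hn
    refine h1.congr (of_forall fun k => of_forall fun x => ?_)
    rw [← av_const_mul]
    simp only [Q, sint, integral_empData, mul_pow, Real.sq_sqrt (avg_nonneg _)]
  have hG : BP (dataLaw F) fun k x => (√(avg (n k)) * G k x) ^ 2 := by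
    have h1 := (bp_av_proj_sq (F := F) (i := i) (j := i) (h := fun _ y => g₁ F i y)
      ((hm.g₁_true i).comp measurable_snd)
      (fun b _ => (ht.memLp_data i b).mono_exponent (by norm_num))
      (fun k (z : Unit) => 0) (hn0 i)).avg_mul hn
    refine h1.congr (of_forall fun k => of_forall fun x => ?_)
    simp only [hg, sub_zero, mul_pow, Real.sq_sqrt (avg_nonneg _), G]
    simp [av]
  have hg1 : BP (dataLaw F) fun k x => av fun a : Fin (n k i) => g₁ F i (x i a) ^ 2 :=
    (bp_av_g₁_four hm ht i (κ := fun k => Fin (n k i)) fun k z => z).av_sq_of_four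
  have hinv : Tendsto (fun k => (√(avg (n k)))⁻¹) atTop (𝓝 0) :=
    tendsto_inv_atTop_zero.comp (Real.tendsto_sqrt_atTop.comp ha)
  have hsumQ : BP (dataLaw F) fun k x => av fun a => (∑ j, √(avg (n k)) * Q j k a x) ^ 2 := by
    refine ((BP.sum Finset.univ fun j _ => hQ j).const_mul (card ι)).mono
      (of_forall fun k => of_forall fun x => ?_)
    rw [abs_of_nonneg (av_nonneg fun a => sq_nonneg _), ← av_sum, ← av_const_mul,
      abs_of_nonneg (av_nonneg fun a => mul_nonneg (Nat.cast_nonneg _)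
        (sum_nonneg fun j _ => sq_nonneg _))]
    refine av_mono fun a => ?_
    exact sq_sum_le_card_mul_sum_sq
  have hconst : BP (dataLaw F) fun k x => av fun _ : Fin (n k i) => (-(√(avg (n k)) * G k x)) ^ 2 := by
    refine hG.mono ((hn0 i).mono fun k hk => of_forall fun x => le_of_eq ?_)
    have hk' : (n k i : ℝ) ≠ 0 := by exact_mod_cast hk
    congr 1
    simp only [av, sum_const, card_univ, card_fin, nsmul_eq_mul, neg_sq]
    field_simp
  have hr : BP (dataLaw F) fun k x => av fun a =>
      (((∑ j, √(avg (n k)) * Q j k a x) + -(√(avg (n k)) * G k x)) + √(avg (n k)) * e k a x) ^ 2 :=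
    (hsumQ.av_sq_add hconst).av_sq_add he.bp
  have hfin := ((hr.small_mul hinv).add ((he.av_mul hg1).const_mul 2)).sub
    ((hG.small_mul hinv).const_mul 2)
  refine hfin.congr ?_
  filter_upwards [ha.eventually_gt_atTop 0] with k hk
  refine of_forall fun x => ?_
  set r : ℝ := √(avg (n k)) with hr'
  have hr0 : r ≠ 0 := (Real.sqrt_pos.2 hk).ne'
  have hexp : ∀ a : Fin (n k i), g₁ (empData (n k) x) i (x i a)
      = g₁ F i (x i a) + ((∑ j, Q j k a x) - G k x + e k a x) := fun a => by
    simp only [Q, G, e, influenceRemainder, sint, integral_empData, hg]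
    ring
  have h1 : ∀ a : Fin (n k i), (∑ j, r * Q j k a x) + -(r * G k x) + r * e k a x
      = r * ((∑ j, Q j k a x) - G k x + e k a x) := fun a => by
    rw [← mul_sum]; ring
  have e1 : (av fun a : Fin (n k i) => g₁ (empData (n k) x) i (x i a) ^ 2)
      = (av fun a : Fin (n k i) => g₁ F i (x i a) ^ 2)
        + (2 * (∑ j, av fun a : Fin (n k i) => g₁ F i (x i a) * Q j k a x)
          + 2 * (av fun a : Fin (n k i) => e k a x * g₁ F i (x i a)) - 2 * (G k x * G k x)
          + av fun a : Fin (n k i) => ((∑ j, Q j k a x) - G k x + e k a x) ^ 2) := by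
    rw [← av_sum, ← av_const_mul, ← av_const_mul]
    rw [show 2 * (G k x * G k x) = av fun a : Fin (n k i) => 2 * G k x * g₁ F i (x i a) by
      rw [av_const_mul]; ring]
    rw [← av_add, ← av_sub, ← av_add, ← av_add]
    congr 1
    funext a
    rw [hexp a, ← mul_sum]
    ring
  simp_rw [h1, mul_pow, mul_assoc]
  rw [av_const_mul, av_const_mul, e1]
  field_simp
  simp only [Q]
  ring

end Linearization

section Cross

variable {s : ℕ → ι → ℕ}

theorem zVec_some (i j : ι) (y : 𝒳 j) : zVec F (g₁ F) (g₂ F) j (some i) y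
    = ∫ z, g₁ F i z * g₂ F i j z y ∂(F i) := rfl

theorem measurable_zVec (hm : Model) (j : ι) (a : Option ι) :
    Measurable (zVec F (g₁ F) (g₂ F) j a) := by
  cases a with
  | none => exact (hm.g₁_true j).pow_const 2
  | some i =>
    exact measurable_integral_left (f := fun z y => g₁ F i z * g₂ F i j z y)
      (((hm.g₁_true i).comp measurable_fst).mul (hm.g₂_true i j))

theorem memLp_g₁_mul_g₂_data (ht : Smooth) (ht3 : Smooth₃) (i j : ι) (a b : ℕ) :
    MemLp (fun x : Data 𝒳 => g₁ F i (x i a) * g₂ F i j (x i a) (x j b)) 2 (dataLaw F) := by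
  have : ENNReal.HolderTriple 4 4 2 := ⟨by
    rw [show (4 : ℝ≥0∞) = 2 * 2 by norm_num, ENNReal.mul_inv (by simp) (by simp), ← two_mul,
      ← mul_assoc, ENNReal.mul_inv_cancel (by simp) (by simp), one_mul]⟩
  exact (ht3.memLp₂_data i j a b).mul (ht.memLp_data i a)

theorem memLp_g₁_mul_g₂ (hm : Model) (ht : Smooth) (ht3 : Smooth₃) (i j : ι) :
    MemLp (fun z : 𝒳 i × 𝒳 j => g₁ F i z.1 * g₂ F i j z.1 z.2) 2 ((F i).prod (F j)) :=
  memLp_prod_of_data (h := fun y z => g₁ F i y * g₂ F i j y z)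
    (((hm.g₁_true i).comp measurable_fst).mul (hm.g₂_true i j))
    fun b _ => memLp_g₁_mul_g₂_data ht ht3 i j 0 b

theorem memLp_zVec (hm : Model) (ht : Smooth) (ht3 : Smooth₃) (j : ι) (a : Option ι) :
    MemLp (zVec F (g₁ F) (g₂ F) j a) 2 (F j) := by
  cases a with
  | none =>
    have := (ht.moment j).norm_rpow_div 2
    rw [show (4 : ℝ≥0∞) / 2 = 2 by
      rw [show (4 : ℝ≥0∞) = 2 * 2 by norm_num,
        ENNReal.mul_div_cancel_right (by norm_num) (by norm_num)]] at this
    simp only [Real.norm_eq_abs, ENNReal.toReal_ofNat, Real.rpow_ofNat, sq_abs] at this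
    exact this
  | some i =>
    exact memLp_integral_right (f := fun y z => g₁ F i z * g₂ F i j z y)
      ((((hm.g₁_true i).comp measurable_fst).mul (hm.g₂_true i j)).comp measurable_swap)
      ((memLp_g₁_mul_g₂ hm ht ht3 i j).comp_measurePreserving Measure.measurePreserving_swap)

theorem ae_integral_g₂_eq_zero (hd : Expandable) (i j : ι) :
    ∀ᵐ y ∂(F i), ∫ z, g₂ F i j y z ∂(F j) = 0 := by
  filter_upwards [ae_mem_support_of_mem_hull (self_mem_hull (F := F i))] with y hy
  exact hd.centred₂ F (fun i => self_mem_hull) i j y hy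

theorem integral_zVec_some (hm : Model) (hd : Expandable) (ht : Smooth) (ht3 : Smooth₃) (i j : ι) :
    ∫ y, zVec F (g₁ F) (g₂ F) j (some i) y ∂(F j) = 0 := by
  simp_rw [zVec_some]
  rw [← integral_integral_swap
    (f := fun z y => g₁ F i z * g₂ F i j z y)
    ((memLp_g₁_mul_g₂ hm ht ht3 i j).integrable (by norm_num))]
  refine integral_eq_zero_of_ae ?_
  filter_upwards [ae_integral_g₂_eq_zero hd i j] with y hy
  rw [integral_const_mul, hy, mul_zero, Pi.zero_apply]

/-- The degenerate part of `gᵢ gᵢⱼ`. -/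
def crossKernel (F : ∀ i, Measure (𝒳 i)) (g₁ : (∀ i, Measure (𝒳 i)) → ∀ i, 𝒳 i → ℝ)
    (g₂ : (∀ i, Measure (𝒳 i)) → ∀ i j, 𝒳 i → 𝒳 j → ℝ) (i j : ι) (y : 𝒳 i) (z : 𝒳 j) : ℝ :=
  g₁ F i y * g₂ F i j y z - zVec F (g₁ F) (g₂ F) j (some i) z

theorem memLp_crossKernel_data (hm : Model) (ht : Smooth) (ht3 : Smooth₃) (i j : ι) (a b : ℕ) :
    MemLp (fun x : Data 𝒳 => crossKernel F g₁ g₂ i j (x i a) (x j b)) 2 (dataLaw F) :=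
  (memLp_g₁_mul_g₂_data ht ht3 i j a b).sub
    ((memLp_zVec hm ht ht3 j (some i)).comp_measurePreserving (measurePreserving_data j b))

theorem measurable_crossKernel (hm : Model) (i j : ι) :
    Measurable fun z : 𝒳 i × 𝒳 j => crossKernel F g₁ g₂ i j z.1 z.2 :=
  (((hm.g₁_true i).comp measurable_fst).mul (hm.g₂_true i j)).sub
    ((measurable_zVec hm j (some i)).comp measurable_snd)

open Classical in
theorem kernel₂_cross (hm : Model) (hd : Expandable) (ht : Smooth)
    (ht3 : Smooth₃) (m : ι → ℕ) (w : ι → ι → ℝ) :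
    Kernel₂ (dataLaw F) (fun p : Σ i : ι, Fin (m i) => F p.1) (fun p x => x p.1 p.2)
      (fun p q y z => if p = q then 0 else w p.1 q.1 * crossKernel F g₁ g₂ p.1 q.1 y z) := by
  refine ⟨fun p q => ?_, fun p q hpq => of_forall fun x => ?_, fun p q hpq => ?_⟩
  · split_ifs with h
    · exact MemLp.zero'
    · exact (memLp_crossKernel_data hm ht ht3 _ _ _ _).const_mul _
  · simp only [hpq, if_false]
    rw [integral_const_mul]
    simp only [crossKernel, zVec_some]
    rw [integral_sub_integral_self, mul_zero]
  · have hmp := measurePreserving_data (F := F) p.1 p.2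
    filter_upwards [hmp.quasiMeasurePreserving.ae (ae_integral_g₂_eq_zero hd p.1 q.1),
      hmp.quasiMeasurePreserving.ae
        ((memLp_g₁_mul_g₂ hm ht ht3 p.1 q.1).integrable (by norm_num)).prod_right_ae] with x h1 h2
    simp only [hpq, if_false]
    rw [integral_const_mul]
    simp only [crossKernel]
    rw [integral_sub h2 ((memLp_zVec hm ht ht3 q.1 (some p.1)).integrable (by norm_num)),
      integral_zVec_some hm hd ht ht3, integral_const_mul, h1]
    ring

/-- Cross terms between the data are asymptotically linear. -/
theorem op_av_g₁_mul_sint_sub (hm : Model) (hd : Expandable) (ht : Smooth)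
    (ht3 : Smooth₃) (hb : BalancedData n) {c : ℝ}
    (hn : ∀ᶠ k in atTop, ∀ i, avg (n k) ≤ c * n k i ∧ (n k i : ℝ) ≤ c * avg (n k))
    (ha : Tendsto (fun k => avg (n k)) atTop atTop) :
    OP (dataLaw F) fun k x => avg (n k) * √(avg (n k)) * ∑ i, ∑ j, 1 / (n k i : ℝ) *
      ((av fun a : Fin (n k i) => g₁ F i (x i a) *
          sint (empData (n k) x j) (F j) (fun y => g₂ F i j (x i a) y))
        - av fun b : Fin (n k j) => zVec F (g₁ F) (g₂ F) j (some i) (x j b)) := by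
  classical
  have hn3 := hb.eventually_three_le
  let w : ℕ → ι → ι → ℝ := fun k i j => 1 / ((n k i : ℝ) ^ 2 * n k j)
  let D : ℕ → Data 𝒳 → ℝ := fun k x => ∑ p : Σ i, Fin (n k i), ∑ q : Σ i, Fin (n k i),
    if p = q then 0 else w k p.1 q.1 * crossKernel F g₁ g₂ p.1 q.1 (x p.1 p.2) (x q.1 q.2)
  have hK := fun k => kernel₂_cross hm hd ht ht3 (n k) (w k)
  have hDL : ∀ k, MemLp (D k) 2 (dataLaw F) := fun k =>
    memLp_finsetSum _ fun p _ => memLp_finsetSum _ fun q _ => (hK k).memLp p q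
  have hc0 : 0 < c := by
    obtain ⟨k, hk, h0⟩ := (hn.and (ha.eventually_gt_atTop 0)).exists
    rcases isEmpty_or_nonempty ι with h | ⟨⟨i⟩⟩
    · simp [avg] at h0
    · exact pos_of_mul_pos_left (h0.trans_le (hk i).1) (Nat.cast_nonneg _)
  obtain ⟨C, hC0, hC⟩ : ∃ C : ℝ, 0 ≤ C ∧ ∀ i j (a b : ℕ),
      ∫ x, crossKernel F g₁ g₂ i j (x i a) (x j b) ^ 2 ∂(dataLaw F) ≤ C := by
    choose C hC h using fun i j => exists_moment_bound_pair (F := F) (p := 2)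
      (measurable_crossKernel hm i j) (by norm_num)
      (fun b _ => memLp_crossKernel_data hm ht ht3 i j 0 b)
    refine ⟨∑ i, ∑ j, (C i j).toReal, sum_nonneg fun i _ => sum_nonneg fun j _ =>
      ENNReal.toReal_nonneg, fun i j a b => ?_⟩
    refine (integral_sq_le_of_lintegral (memLp_crossKernel_data hm ht ht3 i j a b).aestronglyMeasurable
      (hC i j) (h i j a b)).trans ?_
    refine (single_le_sum (f := fun j => (C i j).toReal)
      (fun j _ => ENNReal.toReal_nonneg) (mem_univ j)).trans ?_
    exact single_le_sum (f := fun i => ∑ j, (C i j).toReal)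
      (fun i _ => sum_nonneg fun j _ => ENNReal.toReal_nonneg) (mem_univ i)
  have hoff : OP (dataLaw F) fun k x => avg (n k) * √(avg (n k)) * D k x := by
    refine OP.of_integral_sq (fun k => (hDL k).const_mul _) ?_
    have hlim : Tendsto (fun k => 2 * ((card ι : ℝ)) ^ 2 * C * c ^ 6 * (avg (n k))⁻¹)
        atTop (𝓝 0) := by
      simpa using (tendsto_inv_atTop_zero.comp ha).const_mul (2 * ((card ι : ℝ)) ^ 2 * C * c ^ 6)
    refine squeeze_zero' (of_forall fun k => integral_nonneg fun x => sq_nonneg _) ?_ hlim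
    filter_upwards [hn, ha.eventually_gt_atTop 0, hn3] with k hk h0 hk3
    have hnp : ∀ i, (0 : ℝ) < n k i := fun i => by exact_mod_cast (by have := hk3 i; omega)
    have h1 := (indepCoord_sample F (n k)).integral_sq_kernel₂_le (hK k) (by simp)
      (κ := (c ^ 3 / avg (n k) ^ 3) ^ 2 * C) fun p q => by
        split_ifs with hpq
        · simp only [ne_eq, OfNat.ofNat_ne_zero, not_false_eq_true, zero_pow, integral_zero]
          positivity
        · simp_rw [mul_pow]
          rw [integral_const_mul]
          have hw : w k p.1 q.1 ≤ c ^ 3 / avg (n k) ^ 3 := by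
            simp only [w]
            rw [div_le_div_iff₀ (by have := hnp p.1; have := hnp q.1; positivity) (by positivity)]
            calc 1 * avg (n k) ^ 3 = avg (n k) * avg (n k) * avg (n k) := by ring
              _ ≤ (c * n k p.1) * (c * n k p.1) * (c * n k q.1) := by
                have := hnp p.1
                gcongr <;> exact (hk _).1
              _ = _ := by ring
          have hw0 : 0 ≤ w k p.1 q.1 := div_nonneg zero_le_one (by positivity)
          exact mul_le_mul (pow_le_pow_left₀ hw0 hw 2) (hC _ _ _ _)
            (integral_nonneg fun x => sq_nonneg _) (by positivity)
    have hcard : (card (Σ i : ι, Fin (n k i)) : ℝ) = card ι * avg (n k) := by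
      rw [Fintype.card_sigma]
      have : (card ι : ℝ) ≠ 0 := fun h => by simp [avg, h] at h0
      simp only [card_fin, avg, Nat.cast_sum]
      field_simp
    rw [hcard] at h1
    simp_rw [mul_pow]
    rw [integral_const_mul, Real.sq_sqrt h0.le]
    calc avg (n k) ^ 2 * avg (n k) * ∫ x, D k x ^ 2 ∂(dataLaw F)
        ≤ avg (n k) ^ 2 * avg (n k) * (2 * (card ι * avg (n k)) ^ 2 *
          ((c ^ 3 / avg (n k) ^ 3) ^ 2 * C)) := by gcongr
      _ = _ := by field_simp
  have hdiag : ∀ i, OP (dataLaw F) fun k x => avg (n k) * √(avg (n k)) * (1 / (n k i : ℝ) ^ 2) *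
      av fun a : Fin (n k i) => crossKernel F g₁ g₂ i i (x i a) (x i a) := fun i => by
    have h1 : BP (dataLaw F) fun k x => av fun a : Fin (n k i) =>
        crossKernel F g₁ g₂ i i (x i a) (x i a) := by
      have e1 := BP.av_mul (bp_av_g₁_four hm ht i (κ := fun k => Fin (n k i)) fun k z => z).av_sq_of_four
        (bp_av_g₂_four hm ht3 i i (κ := fun k => Fin (n k i)) (fun k z => z) fun k z => z).av_sq_of_four
      have e2 := op_av_sub_integral F (measurable_zVec hm i (some i))
        ((memLp_zVec hm ht ht3 i (some i)).integrable (by norm_num)) (hb.1 i)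
      rw [integral_zVec_some hm hd ht ht3] at e2
      refine (e1.sub e2.bp).congr (of_forall fun k => of_forall fun x => ?_)
      simp only [crossKernel]
      rw [av_sub, sub_zero]
    refine h1.small_mul (squeeze_zero' (of_forall fun k =>
        mul_nonneg (mul_nonneg (avg_nonneg _) (Real.sqrt_nonneg _)) (by positivity)) ?_
      (g := fun k => c ^ 2 * (√(avg (n k)))⁻¹) ?_)
    · filter_upwards [hn, ha.eventually_gt_atTop 0, hn3] with k hk h0 hk3
      have hnp : (0 : ℝ) < n k i := by exact_mod_cast (by have := hk3 i; omega)
      have hr := Real.sqrt_pos.2 h0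
      have := (hk i).1
      rw [mul_one_div, div_le_iff₀ (by positivity)]
      rw [mul_assoc, inv_mul_eq_div, mul_div_assoc', le_div_iff₀ hr]
      calc avg (n k) * √(avg (n k)) * √(avg (n k)) = avg (n k) * avg (n k) := by
            rw [mul_assoc, Real.mul_self_sqrt h0.le]
        _ ≤ (c * n k i) * (c * n k i) := by gcongr
        _ = _ := by ring
    · simpa using (tendsto_inv_atTop_zero.comp (Real.tendsto_sqrt_atTop.comp ha)).const_mul (c ^ 2)
  refine (hoff.add (OP.sum Finset.univ fun i _ => hdiag i)).congr ?_
  filter_upwards [hn3] with k hk3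
  filter_upwards [ae_mem_support (F := F)] with x hx
  have hnp : ∀ i, (n k i : ℝ) ≠ 0 := fun i => by exact_mod_cast (by have := hk3 i; omega)
  have hs : ∀ i j (a : ℕ), sint (empData (n k) x j) (F j) (fun y => g₂ F i j (x i a) y)
      = av fun b : Fin (n k j) => g₂ F i j (x i a) (x j b) := fun i j a => by
    rw [sint, integral_empData, hd.centred₂ F (fun i => self_mem_hull) i j _ (hx i a), sub_zero]
  have hterm : ∀ i j, 1 / (n k i : ℝ) * ((av fun a : Fin (n k i) => g₁ F i (x i a) *
          sint (empData (n k) x j) (F j) (fun y => g₂ F i j (x i a) y))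
        - av fun b : Fin (n k j) => zVec F (g₁ F) (g₂ F) j (some i) (x j b))
      = ∑ a : Fin (n k i), ∑ b : Fin (n k j),
          w k i j * crossKernel F g₁ g₂ i j (x i a) (x j b) := fun i j => by
    simp only [hs, ← av_const_mul]
    simp only [av, crossKernel, card_fin, w, mul_sum, mul_sub, sum_sub_distrib,
      ← sum_div, sum_const, card_univ, nsmul_eq_mul]
    simp only [← mul_sum]
    have := hnp i
    have := hnp j
    field_simp
  simp_rw [hterm]
  have hall : ∑ i, ∑ j, ∑ a : Fin (n k i), ∑ b : Fin (n k j),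
      w k i j * crossKernel F g₁ g₂ i j (x i a) (x j b)
      = ∑ p : Σ i, Fin (n k i), ∑ q : Σ i, Fin (n k i),
        w k p.1 q.1 * crossKernel F g₁ g₂ p.1 q.1 (x p.1 p.2) (x q.1 q.2) := by
    rw [sum_sigma]
    refine sum_congr rfl fun i _ => ?_
    rw [sum_comm]
    refine sum_congr rfl fun a _ => ?_
    rw [sum_sigma]
  have hd' : ∑ i, avg (n k) * √(avg (n k)) * (1 / (n k i : ℝ) ^ 2) *
      (av fun a : Fin (n k i) => crossKernel F g₁ g₂ i i (x i a) (x i a))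
      = avg (n k) * √(avg (n k)) * ∑ p : Σ i, Fin (n k i),
        w k p.1 p.1 * crossKernel F g₁ g₂ p.1 p.1 (x p.1 p.2) (x p.1 p.2) := by
    rw [sum_sigma, mul_sum]
    refine sum_congr rfl fun i _ => ?_
    dsimp only
    rw [← mul_sum]
    simp only [av, w, card_fin]
    have := hnp i
    field_simp
  rw [hall, hd', ← mul_add]
  congr 1
  rw [← sum_add_distrib]
  refine sum_congr rfl fun p _ => ?_
  rw [← Finset.sum_erase_add _ _ (mem_univ p)]
  rw [← Finset.sum_erase_add (a := p) Finset.univ (fun q => if p = q then 0 else _)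
    (mem_univ p)]
  simp only [if_true, add_zero]
  congr 1
  refine sum_congr rfl fun q hq => ?_
  rw [if_neg (Finset.ne_of_mem_erase hq).symm]

end Cross

section LinearStatistic

variable {s : ℕ → ι → ℕ}

/-- The linear statistic whose variance is `zVariance`. -/
def zTerm (F : ∀ i, Measure (𝒳 i)) (h₁ : ∀ i, 𝒳 i → ℝ) (h₂ : ∀ i j, 𝒳 i → 𝒳 j → ℝ)
    (m : ι → ℕ) (x : Data 𝒳) : ℝ :=
  ∑ j, av fun b : Fin (m j) => ∑ a, lamVec m j a *
    (zVec F h₁ h₂ j a (x j b) - ∫ y, zVec F h₁ h₂ j a y ∂(F j))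

theorem op_sum_av_ghat₁_sq_sub (hm : Model) (hd : Expandable) (ht : Smooth)
    (ht3 : Smooth₃) (he3 : EmpSmooth₃ s) (hb : BalancedData n) {c : ℝ}
    (hn : ∀ᶠ k in atTop, ∀ i, avg (n k) ≤ c * n k i ∧ (n k i : ℝ) ≤ c * avg (n k))
    (ha : Tendsto (fun k => avg (n k)) atTop atTop) :
    OP (dataLaw F) fun k x => avg (n k) * √(avg (n k)) *
      ((∑ i, (av fun a : Fin (n k i) => g₁ (empData (n k) x) i (x i a) ^ 2) / n k i)
        - (∑ i, (∫ y, g₁ F i y ^ 2 ∂(F i)) / n k i) - zTerm F (g₁ F) (g₂ F) (n k) x) := by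
  have hn3 := hb.eventually_three_le
  have h1 := fun i => op_av_ghat₁_sq_sub hm ht ht3 he3 hb (hn.mono fun k hk i => (hk i).1) ha
    (fun i => hd.centred₁ F (fun i => self_mem_hull) i) i
  have h2 := op_av_g₁_mul_sint_sub hm hd ht ht3 hb hn ha
  have h3 : ∀ i, (fun k => avg (n k) / n k i) =O[atTop] fun _ => (1 : ℝ) := fun i => by
    refine IsBigO.of_bound c ?_
    filter_upwards [hn, hn3] with k hk hk3
    have hnp : (0 : ℝ) < n k i := by exact_mod_cast (by have := hk3 i; omega)
    rw [Real.norm_of_nonneg (div_nonneg (avg_nonneg _) hnp.le), norm_one, mul_one,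
      div_le_iff₀ hnp]
    exact (hk i).1
  refine ((OP.sum Finset.univ fun i _ => (h1 i).bdd_mul (h3 i)).add (h2.const_mul 2)).congr ?_
  filter_upwards [hn3] with k hk3
  refine of_forall fun x => ?_
  have hnp : ∀ i, (n k i : ℝ) ≠ 0 := fun i => by exact_mod_cast (by have := hk3 i; omega)
  have hz : zTerm F (g₁ F) (g₂ F) (n k) x
      = (∑ i, (1 / (n k i : ℝ)) * ((av fun a : Fin (n k i) => g₁ F i (x i a) ^ 2)
          - ∫ y, g₁ F i y ^ 2 ∂(F i)))
        + 2 * ∑ i, ∑ j, 1 / (n k i : ℝ) *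
          av fun b : Fin (n k j) => zVec F (g₁ F) (g₂ F) j (some i) (x j b) := by
    rw [sum_comm, mul_sum, zTerm, ← sum_add_distrib]
    refine sum_congr rfl fun j _ => ?_
    simp only [Fintype.sum_option, integral_zVec_some hm hd ht ht3, sub_zero, lamVec]
    rw [av_add, av_const_mul, av_sub, av_sum, mul_sum]
    have hc : ∀ v : ℝ, (av fun _ : Fin (n k j) => v) = v := fun v => by simp [av, hnp]
    rw [hc]
    refine congrArg₂ _ rfl (sum_congr rfl fun i _ => ?_)
    rw [av_const_mul]
    ring
  rw [hz]
  simp only [mul_sub, sum_sub_distrib, mul_sum, mul_add]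
  have e1 : ∀ i, avg (n k) / (n k i : ℝ) * (√(avg (n k)) *
      av fun a : Fin (n k i) => g₁ (empData (n k) x) i (x i a) ^ 2)
      = avg (n k) * √(avg (n k)) *
        ((av fun a : Fin (n k i) => g₁ (empData (n k) x) i (x i a) ^ 2) / n k i) := fun i => by ring
  have e2 : ∀ i, avg (n k) / (n k i : ℝ) * (√(avg (n k)) *
      av fun a : Fin (n k i) => g₁ F i (x i a) ^ 2)
      = avg (n k) * √(avg (n k)) *
        (1 / (n k i : ℝ) * av fun a : Fin (n k i) => g₁ F i (x i a) ^ 2) := fun i => by ring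
  have e3 : ∀ i, avg (n k) * √(avg (n k)) * ((∫ y, g₁ F i y ^ 2 ∂(F i)) / n k i)
      = avg (n k) * √(avg (n k)) * (1 / (n k i : ℝ) * ∫ y, g₁ F i y ^ 2 ∂(F i)) := fun i => by ring
  have e4 : ∀ i j, avg (n k) / (n k i : ℝ) * (√(avg (n k)) * (2 *
      av fun a : Fin (n k i) => g₁ F i (x i a) *
          sint (empData (n k) x j) (F j) (fun y => g₂ F i j (x i a) y)))
      = 2 * (avg (n k) * √(avg (n k)) * (1 / (n k i : ℝ) *
      av fun a : Fin (n k i) => g₁ F i (x i a) *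
          sint (empData (n k) x j) (F j) (fun y => g₂ F i j (x i a) y))) := fun i j => by ring
  have e5 : ∀ i j, 2 * (avg (n k) * √(avg (n k)) * (1 / (n k i : ℝ) *
      av fun b : Fin (n k j) => zVec F (g₁ F) (g₂ F) j (some i) (x j b)))
      = avg (n k) * √(avg (n k)) * (2 * (1 / (n k i : ℝ) *
      av fun b : Fin (n k j) => zVec F (g₁ F) (g₂ F) j (some i) (x j b))) := fun i j => by ring
  simp only [e1, e2, e3, e4, e5]
  ring

end LinearStatistic

section VarianceEstimate

variable {s : ℕ → ι → ℕ}

/-- The bias in terms of integrals. -/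
theorem biasTerm_eq (hm : Model) (hd : Expandable) (ht : Smooth)
    (ht3 : Smooth₃) (θ : ℝ) (m s : ι → ℕ) :
    biasTerm F (g₁ F) (g₂ F) (g₃ F) θ m s
      = (∑ i, 1 / ((m i : ℝ) * s i) * ∫ y, g₁ F i y * g₂ F i i y y ∂(F i))
        + (∑ i, ∑ j, 1 / ((m i : ℝ) * s j) *
          ∫ y, g₁ F i y * ∫ z, g₃ F i j j y z z ∂(F j) ∂(F i))
        + (∑ i, Int.fract (θ * (m i : ℝ)) * (∫ y, g₁ F i y ^ 2 ∂(F i)) / ((m i : ℝ) * s i))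
        + ∑ i, ∑ j, (∫ y, ∫ z, g₂ F i j y z ^ 2 ∂(F j) ∂(F i)) / (2 * m i * s j) := by
  have hg : ∀ i, ∫ y, g₁ F i y ∂(F i) = 0 := hd.centred₁ F (fun i => self_mem_hull)
  have hgL : ∀ i, MemLp (g₁ F i) 2 (F i) := fun i => (ht.moment i).mono_exponent (by norm_num)
  have h2L : ∀ i j, MemLp (fun z : 𝒳 i × 𝒳 j => g₂ F i j z.1 z.2) 2 ((F i).prod (F j)) :=
    fun i j => memLp_prod_of_data (hm.g₂_true i j)
      fun b _ => (ht3.memLp₂_data i j 0 b).mono_exponent (by norm_num)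
  have h3L : ∀ i j, MemLp (fun y => ∫ z, g₃ F i j j y z z ∂(F j)) 2 (F i) := fun i j =>
    memLp_proj (F := F) (h := fun y z => g₃ F i j j y z z)
      ((hm.g₃_true i j j).comp (f := fun p : 𝒳 i × 𝒳 j => (p.1, p.2, p.2)) (by fun_prop))
      fun b _ => ht3.memLp₃_data i j j 0 b b
  simp only [biasTerm]
  refine congrArg₂ _ (congrArg₂ _ (congrArg₂ _ ?_ ?_) ?_) ?_
  · refine sum_congr rfl fun i _ => ?_
    rw [covariance_eq_integral_mul (hgL i) ((ht3.memLp_diag hm i).mono_exponent (by norm_num)) (hg i)]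
  · refine sum_congr rfl fun i _ => sum_congr rfl fun j _ => ?_
    rw [covariance_eq_integral_mul (hgL i) (h3L i j) (hg i)]
  · refine sum_congr rfl fun i _ => ?_
    rw [variance_eq_integral_sq (hgL i) (hg i)]
  · refine sum_congr rfl fun i _ => sum_congr rfl fun j _ => ?_
    rw [variance_eq_integral_sq (h2L i j), integral_prod _ (h2L i j).integrable_sq]
    rw [integral_prod _ ((h2L i j).integrable (by norm_num))]
    refine integral_eq_zero_of_ae ?_
    filter_upwards [ae_integral_g₂_eq_zero hd i j] with y hy
    simpa using hy

theorem Stage.mul_inv_le {c θ : ℝ} {m : ι → ℕ} {B R : ℕ} [Nonempty ι] (h : Stage c θ m B R)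
    (i j : ι) {w : ℝ} (hw0 : 0 ≤ w) (hw1 : w ≤ 1) :
    |θ * avg m ^ 2 * (w / (m i * subSize θ m j))| ≤ c ^ 2 := by
  have h1 := h.n_pos i
  have h2 := h.s_pos j
  have h3 := h.avg_pos
  have h4 := h.scale_pos
  have h5 := h.pos
  have hmi : (0 : ℝ) < m i := by exact_mod_cast h1
  have hsj : (0 : ℝ) < subSize θ m j := by exact_mod_cast h2
  rw [abs_of_nonneg (by positivity), mul_div_assoc', div_le_iff₀ (by positivity)]
  calc θ * avg m ^ 2 * w ≤ θ * avg m ^ 2 * 1 := by gcongr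
    _ = avg m * (θ * avg m) := by ring
    _ ≤ (c * m i) * (c * subSize θ m j) :=
      mul_le_mul (h.le_n i) (h.le_s j) h4.le (h3.le.trans (h.le_n i))
    _ = _ := by ring

theorem div_subSize_eq {θ : ℝ} {m : ι → ℕ} (hθ : 0 ≤ θ) {i : ι} (hm : m i ≠ 0)
    (hs : subSize θ m i ≠ 0) :
    θ / subSize θ m i = 1 / m i + Int.fract (θ * m i) / (m i * subSize θ m i) := by
  have h1 : Int.fract (θ * m i) = θ * m i - subSize θ m i := by
    rw [Int.fract, subSize, natCast_floor_eq_intCast_floor (by positivity)]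
  have hm' : (m i : ℝ) ≠ 0 := by exact_mod_cast hm
  have hs' : (subSize θ m i : ℝ) ≠ 0 := by exact_mod_cast hs
  rw [h1]
  field_simp
  ring

/-- The bootstrap variance estimates the input variance up to the bias and `zTerm`. -/
theorem exists_bootVar_sub_eq [Nonempty ι] (hm : Model) (hd : Expandable) (ht : Smooth)
    (ht3 : Smooth₃) (hb : BalancedData n) {c : ℝ} {θ : ℕ → ℝ}
    {B R : ℕ → ℕ} (hst : ∀ᶠ k in atTop, Stage c (θ k) (n k) (B k) (R k))
    (hθn : Tendsto (fun k => θ k * avg (n k)) atTop atTop)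
    (he : EmpSmooth fun k => subSize (θ k) (n k)) (he3 : EmpSmooth₃ fun k => subSize (θ k) (n k)) :
    ∃ D₁ D₂ : ℕ → Data 𝒳 → ℝ, (OP (dataLaw F) fun k x => θ k * avg (n k) ^ 2 * D₁ k x) ∧
      (OP (dataLaw F) fun k x => avg (n k) * √(avg (n k)) * D₂ k x) ∧
      ∀ᶠ k in atTop, ∀ x, θ k * bootVar ψ (n k) (subSize (θ k) (n k)) x - inputVariance F ψ (n k)
        - biasTerm F (g₁ F) (g₂ F) (g₃ F) (θ k) (n k) (subSize (θ k) (n k))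
        - zTerm F (g₁ F) (g₂ F) (n k) x = D₁ k x + D₂ k x := by
  have ha := tendsto_avg hb
  let S : ℕ → ι → ℕ := fun k => subSize (θ k) (n k)
  let v₁ : ι → ℝ := fun i => ∫ y, g₁ F i y ^ 2 ∂(F i)
  let v₂ : ι → ℝ := fun i => ∫ y, g₁ F i y * g₂ F i i y y ∂(F i)
  let v₃ : ι → ι → ℝ := fun i j => ∫ y, ∫ z, g₂ F i j y z ^ 2 ∂(F j) ∂(F i)
  let v₄ : ι → ι → ℝ := fun i j => ∫ y, g₁ F i y * ∫ z, g₃ F i j j y z z ∂(F j) ∂(F i)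
  let V₁ : ι → ℕ → Data 𝒳 → ℝ := fun i k x =>
    av fun a : Fin (n k i) => g₁ (empData (n k) x) i (x i a) ^ 2
  let V₂ : ι → ℕ → Data 𝒳 → ℝ := fun i k x =>
    av fun a : Fin (n k i) => g₁ (empData (n k) x) i (x i a) * g₂ (empData (n k) x) i i (x i a) (x i a)
  let V₃ : ι → ι → ℕ → Data 𝒳 → ℝ := fun i j k x =>
    av fun z : Fin (n k i) × Fin (n k j) => g₂ (empData (n k) x) i j (x i z.1) (x j z.2) ^ 2
  let V₄ : ι → ι → ℕ → Data 𝒳 → ℝ := fun i j k x => av fun z : Fin (n k i) × Fin (n k j) =>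
    g₁ (empData (n k) x) i (x i z.1) * g₃ (empData (n k) x) i j j (x i z.1) (x j z.2) (x j z.2)
  have o₁ : ∀ i, OP (dataLaw F) fun k x => V₁ i k x - v₁ i := op_av_ghat₁_sq hm ht he hb
  have o₂ : ∀ i, OP (dataLaw F) fun k x => V₂ i k x - v₂ i :=
    op_av_ghat₁_mul_ghat₂ hm ht ht3 he he3 hb
  have o₃ : ∀ i j, OP (dataLaw F) fun k x => V₃ i j k x - v₃ i j := op_av_ghat₂_sq hm ht3 he3 hb
  have o₄ : ∀ i j, OP (dataLaw F) fun k x => V₄ i j k x - v₄ i j :=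
    op_av_ghat₁_mul_ghat₃ hm ht ht3 he he3 hb
  let f : ℕ → ι → ℝ := fun k i => Int.fract (θ k * n k i)
  have f0 : ∀ k i, 0 ≤ f k i := fun k i => Int.fract_nonneg _
  have f1 : ∀ k i, f k i ≤ 1 := fun k i => (Int.fract_lt_one _).le
  have bdd : ∀ (i j : ι) (w : ℕ → ℝ), (∀ k, 0 ≤ w k) → (∀ k, w k ≤ 1) →
      (fun k => θ k * avg (n k) ^ 2 * (w k / (n k i * S k j))) =O[atTop] fun _ => (1 : ℝ) :=
    fun i j w h0 h1 => IsBigO.of_bound (c ^ 2) (hst.mono fun k hk => by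
      rw [norm_one, mul_one]
      exact hk.mul_inv_le i j (h0 k) (h1 k))
  have rem : ∀ (i j : ι) (w : ℕ → ℝ), (∀ k, 0 ≤ w k) → (∀ k, w k ≤ 1) →
      Tendsto (fun k => θ k * avg (n k) ^ 2 * (w k / (n k i * S k j)) * (S k i : ℝ)⁻¹) atTop (𝓝 0) := by
    intro i j w h0 h1
    refine squeeze_zero_norm' (a := fun k => c ^ 3 * (θ k * avg (n k))⁻¹) (hst.mono fun k hk => ?_) ?_
    · rw [norm_mul]
      have e1 := hk.mul_inv_le i j (h0 k) (h1 k)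
      have e2 := hk.inv_s_le i
      rw [Real.norm_of_nonneg (r := ((S k i : ℝ)⁻¹)) (by positivity)]
      calc _ ≤ c ^ 2 * (c / (θ k * avg (n k))) := by gcongr; exact e1
        _ = _ := by ring
    · simpa using (tendsto_inv_atTop_zero.comp hθn).const_mul (c ^ 3)
  have one0 : ∀ _ : ℕ, (0 : ℝ) ≤ 1 := fun _ => zero_le_one
  have one1 : ∀ _ : ℕ, (1 : ℝ) ≤ 1 := fun _ => le_rfl
  refine ⟨fun k x => θ k * (bootVar ψ (n k) (S k) x - bootMain g₁ g₂ g₃ (n k) (S k) x)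
      + ∑ i, f k i / (n k i * S k i) * (V₁ i k x - v₁ i)
      + ∑ i, (1 / (n k i * S k i) * (V₂ i k x - v₂ i)
        + f k i / (n k i * S k i) * (S k i : ℝ)⁻¹ * V₂ i k x)
      + ∑ i, ∑ j, (1 / (n k i * S k j) * (1 / 2 * (V₃ i j k x - v₃ i j))
        + f k i / (n k i * S k j) * (S k i : ℝ)⁻¹ * (1 / 2 * V₃ i j k x))
      + ∑ i, ∑ j, (1 / (n k i * S k j) * (V₄ i j k x - v₄ i j)
        + f k i / (n k i * S k j) * (S k i : ℝ)⁻¹ * V₄ i j k x),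
    fun k x => ((∑ i, V₁ i k x / n k i) - (∑ i, v₁ i / n k i) - zTerm F (g₁ F) (g₂ F) (n k) x)
      - (inputVariance F ψ (n k) - ∑ i, v₁ i / n k i), ?_, ?_, ?_⟩
  · have t0 := op_bootVar_sub hm hd ht ht3 hst hθn he he3
    have t1 := OP.sum (μ := dataLaw F) Finset.univ fun i _ =>
      (o₁ i).bdd_mul (bdd i i (fun k => f k i) (fun k => f0 k i) fun k => f1 k i)
    have bpo : ∀ {V : ℕ → Data 𝒳 → ℝ} {v : ℝ}, (OP (dataLaw F) fun k x => V k x - v) →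
        BP (dataLaw F) V := fun {V v} h => by
      simpa using h.bp.add (BP.const v)
    have t2 := OP.sum (μ := dataLaw F) Finset.univ fun i _ =>
      ((o₂ i).bdd_mul (bdd i i (fun _ => 1) one0 one1)).add ((bpo (o₂ i)).small_mul
        (rem i i (fun k => f k i) (fun k => f0 k i) fun k => f1 k i))
    have t3 := OP.sum (μ := dataLaw F) Finset.univ fun i _ => OP.sum Finset.univ fun j _ =>
      (((o₃ i j).const_mul (1 / 2)).bdd_mul (bdd i j (fun _ => 1) one0 one1)).add
        (((bpo (o₃ i j)).const_mul (1 / 2)).small_mul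
        (rem i j (fun k => f k i) (fun k => f0 k i) fun k => f1 k i))
    have t4 := OP.sum (μ := dataLaw F) Finset.univ fun i _ => OP.sum Finset.univ fun j _ =>
      ((o₄ i j).bdd_mul (bdd i j (fun _ => 1) one0 one1)).add ((bpo (o₄ i j)).small_mul
        (rem i j (fun k => f k i) (fun k => f0 k i) fun k => f1 k i))
    refine ((((t0.add t1).add t2).add t3).add t4).congr
      (of_forall fun k => of_forall fun x => ?_)
    simp only [mul_add, mul_sum, sum_add_distrib, S]
    simp only [mul_assoc]
    ring
  · have t1 := op_sum_av_ghat₁_sq_sub hm hd ht ht3 he3 hb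
      (hst.mono fun k hk i => ⟨hk.le_n i, hk.n_le i⟩) ha
    obtain ⟨C, hC⟩ := inputVariance_sub_le hm hd ht ht3 hst
    have t2 : Tendsto (fun k => avg (n k) * √(avg (n k)) *
        (inputVariance F ψ (n k) - ∑ i, v₁ i / n k i)) atTop (𝓝 0) := by
      refine squeeze_zero_norm' (a := fun k => C * (√(avg (n k)))⁻¹) ?_ ?_
      · filter_upwards [hC, ha.eventually_gt_atTop 0] with k hk h0
        have hr := Real.sqrt_pos.2 h0
        rw [norm_mul, Real.norm_of_nonneg (by positivity), Real.norm_eq_abs, ← div_eq_mul_inv,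
          le_div_iff₀ hr]
        refine le_trans (le_of_eq ?_) hk
        have := Real.mul_self_sqrt h0.le
        linear_combination (avg (n k) * |inputVariance F ψ (n k) - ∑ i, v₁ i / n k i|) * this
      · simpa using (tendsto_inv_atTop_zero.comp (Real.tendsto_sqrt_atTop.comp ha)).const_mul C
    refine (t1.sub (OP.of_tendsto t2)).congr
      (of_forall fun k => of_forall fun x => ?_)
    exact mul_sub _ _ _
  · filter_upwards [hst] with k hk x
    rw [biasTerm_eq hm hd ht ht3]
    have hmi : ∀ i, (n k i : ℝ) ≠ 0 := fun i => by exact_mod_cast (hk.n_pos i).ne'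
    have hsi : ∀ i, (S k i : ℝ) ≠ 0 := fun i => by exact_mod_cast (hk.s_pos i).ne'
    have hdiv : ∀ i, θ k / S k i = 1 / n k i + f k i / (n k i * S k i) := fun i =>
      div_subSize_eq hk.pos.le (hk.n_pos i).ne' (hk.s_pos i).ne'
    have hmain : θ k * bootMain g₁ g₂ g₃ (n k) (S k) x
        = (∑ i, V₁ i k x / n k i) + (∑ i, f k i / (n k i * S k i) * V₁ i k x)
          + (∑ i, (1 / (n k i * S k i) * V₂ i k x + f k i / (n k i * S k i) * (S k i : ℝ)⁻¹ * V₂ i k x))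
          + (∑ i, ∑ j, (1 / (n k i * S k j) * (1 / 2 * V₃ i j k x)
            + f k i / (n k i * S k j) * (S k i : ℝ)⁻¹ * (1 / 2 * V₃ i j k x)))
          + ∑ i, ∑ j, (1 / (n k i * S k j) * V₄ i j k x
            + f k i / (n k i * S k j) * (S k i : ℝ)⁻¹ * V₄ i j k x) := by
      have a1 : ∀ i, θ k * (V₁ i k x / S k i) = V₁ i k x / n k i + f k i / (n k i * S k i) * V₁ i k x :=
        fun i => by linear_combination (V₁ i k x) * hdiv i
      have a2 : ∀ i, θ k * (V₂ i k x / (S k i : ℝ) ^ 2) = 1 / (n k i * S k i) * V₂ i k x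
          + f k i / (n k i * S k i) * (S k i : ℝ)⁻¹ * V₂ i k x := fun i => by
        linear_combination (exp := 1) (V₂ i k x * (S k i : ℝ)⁻¹) * hdiv i
      have a3 : ∀ i j, θ k * (V₃ i j k x / (2 * S k i * S k j))
          = 1 / (n k i * S k j) * (1 / 2 * V₃ i j k x)
            + f k i / (n k i * S k j) * (S k i : ℝ)⁻¹ * (1 / 2 * V₃ i j k x) := fun i j => by
        linear_combination (exp := 1) (1 / 2 * V₃ i j k x * (S k j : ℝ)⁻¹) * hdiv i
      have a4 : ∀ i j, θ k * (V₄ i j k x / (S k i * S k j))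
          = 1 / (n k i * S k j) * V₄ i j k x
            + f k i / (n k i * S k j) * (S k i : ℝ)⁻¹ * V₄ i j k x := fun i j => by
        linear_combination (exp := 1) (V₄ i j k x * (S k j : ℝ)⁻¹) * hdiv i
      simp only [bootMain, mul_add, mul_sum]
      rw [show (∑ i, V₁ i k x / n k i) + (∑ i, f k i / (n k i * S k i) * V₁ i k x)
        = ∑ i, (V₁ i k x / n k i + f k i / (n k i * S k i) * V₁ i k x)
        from Finset.sum_add_distrib.symm]
      exact congrArg₂ _ (congrArg₂ _ (congrArg₂ _ (sum_congr rfl fun i _ => a1 i)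
        (sum_congr rfl fun i _ => a2 i))
        (sum_congr rfl fun i _ => sum_congr rfl fun j _ => a3 i j))
        (sum_congr rfl fun i _ => sum_congr rfl fun j _ => a4 i j)
    have b3 : ∑ i, Int.fract (θ k * n k i) * v₁ i / (n k i * S k i)
        = ∑ i, f k i / (n k i * S k i) * v₁ i := sum_congr rfl fun i _ => by
      simp only [f]; ring
    have b4 : ∑ i, ∑ j, v₃ i j / (2 * n k i * S k j)
        = ∑ i, ∑ j, 1 / (n k i * S k j) * (1 / 2 * v₃ i j) :=
      sum_congr rfl fun i _ => sum_congr rfl fun j _ => by ring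
    have hθb : θ k * bootVar ψ (n k) (S k) x = θ k * (bootVar ψ (n k) (S k) x
      - bootMain g₁ g₂ g₃ (n k) (S k) x) + θ k * bootMain g₁ g₂ g₃ (n k) (S k) x := by ring
    show θ k * bootVar ψ (n k) (S k) x - inputVariance F ψ (n k)
      - ((∑ i, 1 / ((n k i : ℝ) * S k i) * v₂ i) + (∑ i, ∑ j, 1 / ((n k i : ℝ) * S k j) * v₄ i j)
        + (∑ i, Int.fract (θ k * n k i) * v₁ i / (n k i * S k i))
        + ∑ i, ∑ j, v₃ i j / (2 * n k i * S k j)) - _ = _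
    rw [hθb, hmain, b3, b4]
    simp only [mul_sub, sum_add_distrib, sum_sub_distrib]
    ring

end VarianceEstimate

section Replications

variable {m s : ι → ℕ}

/-- The linear part of `ψ` at a resample, given the data. -/
def bootLin (g₁ : (∀ i, Measure (𝒳 i)) → ∀ i, 𝒳 i → ℝ) (x : Data 𝒳) (J : Idx m s) : ℝ :=
  linTerm (fun (p : Σ i, Fin (s i)) (J : Idx m s) => J p.1 p.2)
    (fun i (a : Fin (m i)) => g₁ (empData m x) i (x i a)) J

theorem centred_boot (hd : Expandable) [∀ i, NeZero (m i)]
    {x : Data 𝒳} (hx : ∀ i a, x i a ∈ (F i).support) (p : Σ i, Fin (s i)) :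
    ∫ a : Fin (m p.1), g₁ (empData m x) p.1 (x p.1 a) / s p.1
      ∂(uniformOn (Set.univ : Set (Fin (m p.1)))) = 0 := by
  rw [integral_div, integral_uniform_eq_av, ← integral_empData,
    hd.centred₁ _ (empData_mem_hull (F := F) m hx), zero_div]

theorem sum_sigma_div_pow (f : ι → ℝ) (p : ℕ) (hs : ∀ i, s i ≠ 0) :
    ∑ q : Σ i, Fin (s i), f q.1 / (s q.1 : ℝ) ^ (p + 1) = ∑ i, f i / (s i : ℝ) ^ p := by
  rw [sum_sigma]
  refine sum_congr rfl fun i _ => ?_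
  have : (s i : ℝ) ≠ 0 := by exact_mod_cast hs i
  simp only [sum_const, card_univ, card_fin, nsmul_eq_mul]
  rw [pow_succ]
  field_simp

theorem integral_bootLin_sq (hd : Expandable) [∀ i, NeZero (m i)]
    (hs : ∀ i, s i ≠ 0) {x : Data 𝒳} (hx : ∀ i a, x i a ∈ (F i).support) :
    ∫ J : Idx m s, bootLin g₁ x J ^ 2 ∂(uniformOn Set.univ)
      = ∑ i, (av fun a : Fin (m i) => g₁ (empData m x) i (x i a) ^ 2) / s i := by
  have h := (indepCoord_idx m s).integral_sum_sq
    (a := fun (p : Σ i, Fin (s i)) (a : Fin (m p.1)) => g₁ (empData m x) p.1 (x p.1 a) / s p.1) (fun p => MemLp.of_discrete)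
    (centred_boot hd hx)
  simp only [bootLin, linTerm]
  rw [h]
  simp_rw [integral_uniform_eq_av, div_pow, div_eq_mul_inv (_ ^ 2) _, mul_comm _ ((_ : ℝ)⁻¹),
    av_const_mul, mul_comm ((_ : ℝ)⁻¹) _, ← div_eq_mul_inv]
  have := sum_sigma_div_pow (fun i => av fun a : Fin (m i) => g₁ (empData m x) i (x i a) ^ 2) 1 hs
  simpa only [pow_one] using this

theorem integral_bootLin_pow_four (hd : Expandable) [∀ i, NeZero (m i)]
    (hs : ∀ i, s i ≠ 0) {x : Data 𝒳} (hx : ∀ i a, x i a ∈ (F i).support) :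
    ∫ J : Idx m s, bootLin g₁ x J ^ 4 ∂(uniformOn Set.univ)
      = 3 * (∑ i, (av fun a : Fin (m i) => g₁ (empData m x) i (x i a) ^ 2) / s i) ^ 2
        - 3 * (∑ i, (av fun a : Fin (m i) => g₁ (empData m x) i (x i a) ^ 2) ^ 2 / (s i : ℝ) ^ 3)
        + ∑ i, (av fun a : Fin (m i) => g₁ (empData m x) i (x i a) ^ 4) / (s i : ℝ) ^ 3 := by
  have h := (indepCoord_idx m s).integral_pow_four
    (a := fun (p : Σ i, Fin (s i)) (a : Fin (m p.1)) => g₁ (empData m x) p.1 (x p.1 a) / s p.1) (fun p => MemLp.of_discrete)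
    (centred_boot hd hx)
  simp only [bootLin, linTerm]
  rw [h]
  simp_rw [integral_uniform_eq_av, div_pow, div_eq_mul_inv (_ ^ 2) _, div_eq_mul_inv (_ ^ 4) _,
    mul_comm _ ((_ : ℝ)⁻¹), av_const_mul, mul_comm ((_ : ℝ)⁻¹) _, ← div_eq_mul_inv, div_pow, ← pow_mul]
  have h1 := sum_sigma_div_pow (fun i => av fun a : Fin (m i) => g₁ (empData m x) i (x i a) ^ 2) 1 hs
  have h2 := sum_sigma_div_pow (fun i => (av fun a : Fin (m i) => g₁ (empData m x) i (x i a) ^ 2) ^ 2)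
    3 hs
  have h3 := sum_sigma_div_pow (fun i => av fun a : Fin (m i) => g₁ (empData m x) i (x i a) ^ 4) 3 hs
  simp only [pow_one] at h1
  norm_num at h1 h2 h3 ⊢
  rw [h1, h2, h3]

/-- `ψ` at a resample, centred, is the linear part plus the centred remainder. -/
theorem psi_resample_sub_mean (hd : Expandable) [∀ i, NeZero (m i)]
    {x : Data 𝒳} (hx : ∀ i a, x i a ∈ (F i).support) (J : Idx m s) :
    ψ (resample x J) - ∫ J : Idx m s, ψ (resample x J) ∂(uniformOn Set.univ)
      = bootLin g₁ x J + (remainder1 ψ g₁ (resample x J) (empData m x)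
        - ∫ J : Idx m s, remainder1 ψ g₁ (resample x J) (empData m x) ∂(uniformOn Set.univ)) := by
  have h0 : ∫ J : Idx m s, bootLin g₁ x J ∂(uniformOn Set.univ) = 0 :=
    (vonMises_boot m s hd hx).integral_lin
  have h1 := fun J : Idx m s => remainder1_resample hd hx J
  simp_rw [h1]
  rw [integral_add (integrable_const _) Integrable.of_finite,
    integral_add Integrable.of_finite Integrable.of_finite]
  simp only [bootLin] at h0 ⊢
  rw [h0]
  simp only [integral_const, probReal_univ, one_smul]
  ring

theorem resample_eq_mixed (x : Data 𝒳) (J : Idx m s) : resample x J = mixed (fun _ => true) x J := by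
  funext i; simp [mixed]

/-- The data for which all simulation runs at resamples have finite fourth moments. -/
def GoodData (F : ∀ i, Measure (𝒳 i)) (ρ : Measure 𝒰) (ψ : (∀ i, Measure (𝒳 i)) → ℝ)
    (H : (∀ i, Measure (𝒳 i)) → 𝒰 → ℝ) (m s : ι → ℕ) (x : Data 𝒳) : Prop :=
  (∀ i a, x i a ∈ (F i).support) ∧
    bootMeanENN (fun J : Idx m s => simMoment4 ρ ψ H (resample x J)) ≠ ∞

theorem GoodData.simMoment4_ne_top [∀ i, NeZero (m i)] {x : Data 𝒳} (hx : GoodData F ρ ψ H m s x)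
    (J : Idx m s) : simMoment4 ρ ψ H (resample x J) ≠ ∞ := by
  have h := hx.2
  rw [bootMeanENN, ENNReal.div_eq_inv_mul] at h
  have h1 := fun h' => h (ENNReal.mul_eq_top.2 (Or.inl ⟨ENNReal.inv_ne_zero.2 (ENNReal.natCast_ne_top _), h'⟩))
  exact (ENNReal.sum_ne_top.1 h1) J (mem_univ J)

theorem measurable_H_resample (hm : Model) (J : Idx m s) :
    Measurable fun z : Data 𝒳 × 𝒰 => H (resample z.1 J) z.2 :=
  (hm.H_emp s).comp (g := fun q : (∀ i, Fin (s i) → 𝒳 i) × 𝒰 => H (fun i => emp (q.1 i)) q.2)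
    (f := fun z : Data 𝒳 × 𝒰 => (fun i (l : Fin (s i)) => z.1 i (J i l), z.2)) (by fun_prop)

theorem GoodData.runs (hm : Model) (hsim : UnbiasedSimulation F ρ ψ H)
    [∀ i, NeZero (m i)] (hs : ∀ i, s i ≠ 0) {x : Data 𝒳} (hx : GoodData F ρ ψ H m s x) :
    Runs ρ (fun (J : Idx m s) u => H (resample x J) u) fun J => ψ (resample x J) := by
  have hmeas : ∀ J : Idx m s, Measurable fun u => H (resample x J) u := fun J =>
    (measurable_H_resample hm J).comp (f := fun u => (x, u)) (by fun_prop)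
  refine ⟨hmeas, fun J => ?_, fun J => (hsim _ (resample_mem_hull m s hs hx.1 J)).2⟩
  have h1 := memLp_of_lintegral_enorm_pow (p := 4) (μ := ρ)
    ((hmeas J).sub_const (ψ (resample x J))).aestronglyMeasurable (by norm_num)
    (hx.simMoment4_ne_top J)
  have h2 := h1.add (memLp_const (ψ (resample x J)))
  refine (memLp_congr_ae (of_forall fun u => ?_)).1 h2
  simp

theorem GoodData.integral_pow_four (hm : Model)
    [∀ i, NeZero (m i)] {x : Data 𝒳} (hx : GoodData F ρ ψ H m s x) :
    ∫ J : Idx m s, ∫ u, (H (resample x J) u - ψ (resample x J)) ^ 4 ∂ρ ∂(uniformOn Set.univ)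
      = (bootMeanENN fun J : Idx m s => simMoment4 ρ ψ H (resample x J)).toReal := by
  have hmeas : ∀ J : Idx m s, Measurable fun u => H (resample x J) u := fun J =>
    (measurable_H_resample hm J).comp (f := fun u => (x, u)) (by fun_prop)
  rw [bootMeanENN_eq_lintegral, ← integral_toReal (measurable_of_finite _).aemeasurable
    (of_forall fun J => lt_top_iff_ne_top.2 (hx.simMoment4_ne_top J))]
  refine integral_congr_ae (of_forall fun J => ?_)
  dsimp only
  rw [integral_eq_lintegral_of_nonneg_ae (of_forall fun _ => by positivity)
    (((hmeas J).sub_const _).pow_const 4).aestronglyMeasurable, simMoment4]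
  congr 1
  refine lintegral_congr fun u => ?_
  rw [← Real.enorm_of_nonneg (by positivity), enorm_pow]

end Replications

section Conditional

/-- The law of one resample and one group of simulation seeds. -/
abbrev groupLaw (ρ : Measure 𝒰) (m s : ι → ℕ) (R : ℕ) :
    Measure (Idx m s × (Fin R → 𝒰)) :=
  (uniformOn Set.univ).prod (Measure.pi fun _ => ρ)

/-- The simulation runs at the resamples of the data `x`. -/
abbrev bootRun (H : (∀ i, Measure (𝒳 i)) → 𝒰 → ℝ) {m s : ι → ℕ} (x : Data 𝒳) :
    Idx m s → 𝒰 → ℝ := fun J u => H (resample x J) u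

/-- The expectation of `ψ` at a resample. -/
abbrev bootPsi (ψ : (∀ i, Measure (𝒳 i)) → ℝ) (m s : ι → ℕ) (x : Data 𝒳) : ℝ :=
  ∫ J : Idx m s, ψ (resample x J) ∂(uniformOn Set.univ)

/-- The fourth moment of the linearization error at a resample. -/
def bootRemainder (ψ : (∀ i, Measure (𝒳 i)) → ℝ)
    (g₁ : (∀ i, Measure (𝒳 i)) → ∀ i, 𝒳 i → ℝ) (m s : ι → ℕ) (x : Data 𝒳) : ℝ :=
  ∫ J : Idx m s, remainder1 ψ g₁ (resample x J) (empData m x) ^ 4 ∂(uniformOn Set.univ)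

/-- The mean squared change of the simulation variance at a resample. -/
def bootSimVar (ρ : Measure 𝒰) (ψ : (∀ i, Measure (𝒳 i)) → ℝ)
    (H : (∀ i, Measure (𝒳 i)) → 𝒰 → ℝ) (m s : ι → ℕ) (x : Data 𝒳) : ℝ :=
  ∫ J : Idx m s, (simVar ρ ψ H (resample x J) - simVar ρ ψ H (empData m x)) ^ 2 ∂(uniformOn Set.univ)

/-- The mean fourth moment of a simulation run at a resample. -/
def bootFour (ρ : Measure 𝒰) (ψ : (∀ i, Measure (𝒳 i)) → ℝ)
    (H : (∀ i, Measure (𝒳 i)) → 𝒰 → ℝ) (m s : ι → ℕ) (x : Data 𝒳) : ℝ :=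
  (bootMeanENN fun J : Idx m s => simMoment4 ρ ψ H (resample x J)).toReal

section Bounds

variable {c θ : ℝ} {m : ι → ℕ} {B R : ℕ}

theorem Stage.mul_inv_s_pow_le (h : Stage c θ m B R) {v : ι → ℝ} (hv : ∀ i, 0 ≤ v i) :
    (θ * avg m) ^ 2 * ∑ i, v i / (subSize θ m i : ℝ) ^ 3 ≤ c ^ 3 / (θ * avg m) * ∑ i, v i := by
  have hS := h.scale_pos
  rw [mul_sum, mul_sum]
  refine sum_le_sum fun i _ => ?_
  have h1 := h.inv_s_le i
  calc (θ * avg m) ^ 2 * (v i / (subSize θ m i : ℝ) ^ 3)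
      = (θ * avg m) ^ 2 * (v i * ((subSize θ m i : ℝ)⁻¹) ^ 3) := by rw [inv_pow, div_eq_mul_inv]
    _ ≤ (θ * avg m) ^ 2 * (v i * (c / (θ * avg m)) ^ 3) := by
        have := hv i
        gcongr
    _ = _ := by field_simp

theorem Stage.sum_div_s_le (h : Stage c θ m B R) {v : ι → ℝ} (hv : ∀ i, 0 ≤ v i) :
    θ * avg m * ∑ i, v i / (subSize θ m i : ℝ) ≤ c * ∑ i, v i := by
  have hS := h.scale_pos
  rw [mul_sum, mul_sum]
  refine sum_le_sum fun i _ => ?_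
  calc θ * avg m * (v i / (subSize θ m i : ℝ))
      = θ * avg m * (v i * (subSize θ m i : ℝ)⁻¹) := by rw [div_eq_mul_inv]
    _ ≤ θ * avg m * (v i * (c / (θ * avg m))) := by
        have := hv i
        have := h.inv_s_le i
        gcongr
    _ = _ := by field_simp [h.avg_pos.ne', h.pos.ne']

theorem Stage.le_sum_div_s (h : Stage c θ m B R) {v : ι → ℝ} (hv : ∀ i, 0 ≤ v i) :
    (∑ i, v i) / c ≤ θ * avg m * ∑ i, v i / (subSize θ m i : ℝ) := by
  rw [mul_sum, sum_div]
  refine sum_le_sum fun i _ => ?_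
  have : (0 : ℝ) < subSize θ m i := by exact_mod_cast h.s_pos i
  rw [mul_div_assoc', div_le_div_iff₀ h.c_pos this]
  nlinarith [mul_le_mul_of_nonneg_left (h.s_le i) (hv i)]

theorem Stage.scale_div_R_le (h : Stage c θ m B R) : θ * avg m / R ≤ c := by
  have : (0 : ℝ) < R := by exact_mod_cast (by have := h.two_le_R; omega : 0 < R)
  rw [div_le_iff₀ this]
  exact h.le_R

theorem Stage.integral_bootLin_pow_four_le
    (hd : Expandable) (h : Stage c θ m B R) {x : Data 𝒳} (hx : ∀ i a, x i a ∈ (F i).support) :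
    (θ * avg m) ^ 2 * ∫ J : Idx m (subSize θ m), bootLin g₁ x J ^ 4 ∂(uniformOn Set.univ)
      ≤ 3 * (c * ∑ i, av fun b : Fin (m i) => g₁ (empData m x) i (x i b) ^ 2) ^ 2
        + c ^ 3 / (θ * avg m) * ∑ i, av fun b : Fin (m i) => g₁ (empData m x) i (x i b) ^ 4 := by
  have := h.neZero_n
  have hS := h.scale_pos
  rw [integral_bootLin_pow_four hd (fun i => (h.s_pos i).ne') hx]
  have hv : ∀ i, 0 ≤ av fun b : Fin (m i) => g₁ (empData m x) i (x i b) ^ 2 := fun i =>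
    av_nonneg fun b => sq_nonneg _
  have hq : ∀ i, 0 ≤ av fun b : Fin (m i) => g₁ (empData m x) i (x i b) ^ 4 := fun i =>
    av_nonneg fun b => by positivity
  have h1 := h.sum_div_s_le hv
  have h2 := h.mul_inv_s_pow_le hq
  have h3 : 0 ≤ ∑ i, (av fun b : Fin (m i) => g₁ (empData m x) i (x i b) ^ 2) ^ 2
      / (subSize θ m i : ℝ) ^ 3 := sum_nonneg fun i _ => by positivity
  have h4 : 0 ≤ θ * avg m * ∑ i, (av fun b : Fin (m i) => g₁ (empData m x) i (x i b) ^ 2)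
      / (subSize θ m i : ℝ) := mul_nonneg hS.le (sum_nonneg fun i _ => div_nonneg (hv i)
        (Nat.cast_nonneg _))
  have h5 := pow_le_pow_left₀ h4 h1 2
  rw [mul_pow] at h5
  have h6 := mul_nonneg (sq_nonneg (θ * avg m)) h3
  linarith

theorem Stage.le_variance_bootLin_sq
    (hd : Expandable) (h : Stage c θ m B R) {x : Data 𝒳} (hx : ∀ i a, x i a ∈ (F i).support) :
    2 * ((∑ i, av fun b : Fin (m i) => g₁ (empData m x) i (x i b) ^ 2) / c) ^ 2
        - 3 * (c ^ 3 / (θ * avg m)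
          * ∑ i, (av fun b : Fin (m i) => g₁ (empData m x) i (x i b) ^ 2) ^ 2)
      ≤ (θ * avg m) ^ 2 * variance (fun J : Idx m (subSize θ m) => bootLin g₁ x J ^ 2)
        (uniformOn Set.univ) := by
  have := h.neZero_n
  have hS := h.scale_pos
  have hc := h.c_pos
  rw [variance_eq_sub MemLp.of_discrete]
  simp only [Pi.pow_apply, ← pow_mul]
  norm_num only
  rw [integral_bootLin_pow_four hd (fun i => (h.s_pos i).ne') hx,
    integral_bootLin_sq hd (fun i => (h.s_pos i).ne') hx]
  have hv : ∀ i, 0 ≤ av fun b : Fin (m i) => g₁ (empData m x) i (x i b) ^ 2 := fun i =>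
    av_nonneg fun b => sq_nonneg _
  have h1 := h.le_sum_div_s hv
  have h2 := h.mul_inv_s_pow_le (v := fun i =>
    (av fun b : Fin (m i) => g₁ (empData m x) i (x i b) ^ 2) ^ 2) fun i => sq_nonneg _
  have h3 : 0 ≤ ∑ i, (av fun b : Fin (m i) => g₁ (empData m x) i (x i b) ^ 4)
      / (subSize θ m i : ℝ) ^ 3 := sum_nonneg fun i _ => div_nonneg
        (av_nonneg fun b => by positivity) (by positivity)
  have h4 : 0 ≤ (∑ i, av fun b : Fin (m i) => g₁ (empData m x) i (x i b) ^ 2) / c :=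
    div_nonneg (sum_nonneg fun i _ => hv i) hc.le
  have h5 := pow_le_pow_left₀ h4 h1 2
  rw [mul_pow] at h5
  have h6 := mul_nonneg (sq_nonneg (θ * avg m)) h3
  linarith

theorem Stage.sq_scale_div_R_le (h : Stage c θ m B R) : (θ * avg m) ^ 2 / (R : ℝ) ^ 2 ≤ c ^ 2 := by
  rw [← div_pow]
  exact pow_le_pow_left₀ (div_nonneg h.scale_pos.le (Nat.cast_nonneg _)) h.scale_div_R_le 2

theorem GoodData.le_integral_dev_sq_sub_sq {x : Data 𝒳}
    (hx : GoodData F ρ ψ H m (subSize θ m) x) (hm : Model)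
    (hsim : UnbiasedSimulation F ρ ψ H) (hd : Expandable) (h : Stage c θ m B R) (a : ℝ) :
    (∑ i, av fun b : Fin (m i) => g₁ (empData m x) i (x i b) ^ 2) ^ 2 / (2 * c ^ 2)
      - (3 / 4 * (c ^ 3 / (θ * avg m))
          * (∑ i, (av fun b : Fin (m i) => g₁ (empData m x) i (x i b) ^ 2) ^ 2)
        + 16 * (√(3 * (c * ∑ i, av fun b : Fin (m i) => g₁ (empData m x) i (x i b) ^ 2) ^ 2
          + c ^ 3 / (θ * avg m) * ∑ i, av fun b : Fin (m i) => g₁ (empData m x) i (x i b) ^ 4)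
          * √((θ * avg m) ^ 2 * bootRemainder ψ g₁ m (subSize θ m) x))
        + 16 * ((θ * avg m) ^ 2 * bootRemainder ψ g₁ m (subSize θ m) x)
        + c ^ 2 * bootSimVar ρ ψ H m (subSize θ m) x)
      ≤ (θ * avg m) ^ 2 * ∫ z, ((groupMean (bootRun H x) z - bootPsi ψ m (subSize θ m) x) ^ 2 - a) ^ 2
        ∂(groupLaw ρ m (subSize θ m) R) := by
  have := h.neZero_n
  have hS := h.scale_pos
  have hr := hx.runs hm hsim fun i => (h.s_pos i).ne'
  have hR : R ≠ 0 := by have := h.two_le_R; omega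
  let e : Idx m (subSize θ m) → ℝ := fun J => remainder1 ψ g₁ (resample x J) (empData m x)
    - ∫ J : Idx m (subSize θ m), remainder1 ψ g₁ (resample x J) (empData m x) ∂(uniformOn Set.univ)
  have he : ∫ J, e J ^ 4 ∂(uniformOn Set.univ) ≤ 16 * bootRemainder ψ g₁ m (subSize θ m) x :=
    integral_sub_mean_pow_four_le _
  have hψ : ∀ J : Idx m (subSize θ m), ψ (resample x J) - bootPsi ψ m (subSize θ m) x
    = bootLin g₁ x J + e J := psi_resample_sub_mean hd hx.1
  have hL := h.integral_bootLin_pow_four_le hd hx.1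
  have h1 := hr.le_integral_dev_sq_sub_sq (π := uniformOn Set.univ) hR (bootPsi ψ m (subSize θ m) x) a
    (simVar ρ ψ H (empData m x))
  simp_rw [hψ] at h1
  have h2 := le_variance_sq_add (π := uniformOn Set.univ) (fun J => bootLin g₁ x J) e
  have h3 := h.le_variance_bootLin_sq hd hx.1
  set L4 := ∫ J : Idx m (subSize θ m), bootLin g₁ x J ^ 4 ∂(uniformOn Set.univ)
  set E4 := ∫ J, e J ^ 4 ∂(uniformOn Set.univ)
  set S := θ * avg m
  set r := bootRemainder ψ g₁ m (subSize θ m) x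
  set d := bootSimVar ρ ψ H m (subSize θ m) x with hd'
  have hd0 : 0 ≤ d := integral_nonneg fun J => sq_nonneg _
  have h4 : S ^ 2 * (√L4 * √E4) ≤ 4 * (√(3 * (c * ∑ i, av fun b : Fin (m i) =>
      g₁ (empData m x) i (x i b) ^ 2) ^ 2 + c ^ 3 / S * ∑ i, av fun b : Fin (m i) =>
      g₁ (empData m x) i (x i b) ^ 4) * √(S ^ 2 * r)) := by
    calc S ^ 2 * (√L4 * √E4) = √(S ^ 2 * L4) * √(S ^ 2 * E4) := by
          rw [Real.sqrt_mul (sq_nonneg S), Real.sqrt_mul (sq_nonneg S), Real.sqrt_sq hS.le]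
          ring
      _ ≤ √(3 * (c * ∑ i, av fun b : Fin (m i) => g₁ (empData m x) i (x i b) ^ 2) ^ 2
            + c ^ 3 / S * ∑ i, av fun b : Fin (m i) => g₁ (empData m x) i (x i b) ^ 4)
            * √(4 ^ 2 * (S ^ 2 * r)) := by
          exact mul_le_mul (Real.sqrt_le_sqrt hL) (Real.sqrt_le_sqrt (by
            linarith [mul_le_mul_of_nonneg_left he (sq_nonneg S)])) (Real.sqrt_nonneg _)
            (Real.sqrt_nonneg _)
      _ = _ := by
          rw [Real.sqrt_mul (by norm_num : (0 : ℝ) ≤ 4 ^ 2), Real.sqrt_sq (by norm_num)]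
          ring
  have h5 : S ^ 2 * (d / (R : ℝ) ^ 2) ≤ c ^ 2 * d := by
    rw [mul_div_left_comm, mul_comm]
    exact mul_le_mul_of_nonneg_right h.sq_scale_div_R_le hd0
  have h6 := mul_le_mul_of_nonneg_left he (sq_nonneg S)
  have h7 := mul_le_mul_of_nonneg_left h1 (sq_nonneg S)
  have h8 := mul_le_mul_of_nonneg_left h2 (sq_nonneg S)
  refine le_trans ?_ h7
  have e1 : ∀ s : ℝ, s ^ 2 / (2 * c ^ 2) = 1 / 4 * (2 * (s / c) ^ 2) := fun s => by
    rw [div_pow]; ring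
  rw [e1]
  change _ ≤ S ^ 2 * (_ - d / (R : ℝ) ^ 2)
  linarith

theorem GoodData.integral_dev_pow_four_le {x : Data 𝒳}
    (hx : GoodData F ρ ψ H m (subSize θ m) x) (hm : Model)
    (hsim : UnbiasedSimulation F ρ ψ H) (hd : Expandable) (h : Stage c θ m B R) :
    (θ * avg m) ^ 2 * ∫ z, (groupMean (bootRun H x) z - bootPsi ψ m (subSize θ m) x) ^ 4
        ∂(groupLaw ρ m (subSize θ m) R)
      ≤ 64 * (3 * (c * ∑ i, av fun b : Fin (m i) => g₁ (empData m x) i (x i b) ^ 2) ^ 2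
          + c ^ 3 / (θ * avg m) * ∑ i, av fun b : Fin (m i) => g₁ (empData m x) i (x i b) ^ 4)
        + 1024 * ((θ * avg m) ^ 2 * bootRemainder ψ g₁ m (subSize θ m) x)
        + 48 * c ^ 2 * (bootSimVar ρ ψ H m (subSize θ m) x + simVar ρ ψ H (empData m x) ^ 2)
        + 8 * (c ^ 3 / (θ * avg m)) * bootFour ρ ψ H m (subSize θ m) x := by
  have := h.neZero_n
  have hS := h.scale_pos
  have hr := hx.runs hm hsim fun i => (h.s_pos i).ne'
  have hR : R ≠ 0 := by have := h.two_le_R; omega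
  let e : Idx m (subSize θ m) → ℝ := fun J => remainder1 ψ g₁ (resample x J) (empData m x)
    - ∫ J : Idx m (subSize θ m), remainder1 ψ g₁ (resample x J) (empData m x) ∂(uniformOn Set.univ)
  have he : ∫ J, e J ^ 4 ∂(uniformOn Set.univ) ≤ 16 * bootRemainder ψ g₁ m (subSize θ m) x :=
    integral_sub_mean_pow_four_le _
  have hψ : ∀ J : Idx m (subSize θ m), ψ (resample x J) - bootPsi ψ m (subSize θ m) x
    = bootLin g₁ x J + e J := psi_resample_sub_mean hd hx.1
  have hL := h.integral_bootLin_pow_four_le hd hx.1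
  have h1 := hr.integral_dev_pow_four_le (π := uniformOn Set.univ) hR (bootPsi ψ m (subSize θ m) x)
  have h2 := integral_pow_four_add_le (π := uniformOn Set.univ) (fun J => bootLin g₁ x J) e
  simp_rw [hψ] at h1
  rw [hx.integral_pow_four hm] at h1
  have hτ : ∫ J : Idx m (subSize θ m), (simVar ρ ψ H (resample x J)) ^ 2 ∂(uniformOn Set.univ)
      ≤ 2 * (bootSimVar ρ ψ H m (subSize θ m) x + simVar ρ ψ H (empData m x) ^ 2) := by
    rw [bootSimVar, mul_add, ← integral_const_mul]
    calc _ ≤ ∫ J : Idx m (subSize θ m), (2 * (simVar ρ ψ H (resample x J)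
          - simVar ρ ψ H (empData m x)) ^ 2 + 2 * simVar ρ ψ H (empData m x) ^ 2)
          ∂(uniformOn Set.univ) := integral_mono Integrable.of_finite Integrable.of_finite fun J => by
          nlinarith [sq_nonneg (simVar ρ ψ H (resample x J) - 2 * simVar ρ ψ H (empData m x))]
      _ = _ := by
          rw [integral_add Integrable.of_finite (integrable_const _)]
          simp
  have hq0 : 0 ≤ bootFour ρ ψ H m (subSize θ m) x := ENNReal.toReal_nonneg
  have hτ0 : 0 ≤ ∫ J : Idx m (subSize θ m), (simVar ρ ψ H (resample x J)) ^ 2 ∂(uniformOn Set.univ) :=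
    integral_nonneg fun J => sq_nonneg _
  change _ ≤ _ + 8 * (3 * (∫ J : Idx m (subSize θ m), (simVar ρ ψ H (resample x J)) ^ 2
    ∂(uniformOn Set.univ)) / (R : ℝ) ^ 2 + bootFour ρ ψ H m (subSize θ m) x / (R : ℝ) ^ 3) at h1
  set L4 := ∫ J : Idx m (subSize θ m), bootLin g₁ x J ^ 4 ∂(uniformOn Set.univ)
  set E4 := ∫ J, e J ^ 4 ∂(uniformOn Set.univ)
  set T := ∫ J : Idx m (subSize θ m), (simVar ρ ψ H (resample x J)) ^ 2 ∂(uniformOn Set.univ)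
  set q := bootFour ρ ψ H m (subSize θ m) x
  set S := θ * avg m
  have h5 : S ^ 2 * (T / (R : ℝ) ^ 2) ≤ c ^ 2 * T := by
    rw [mul_div_left_comm, mul_comm]
    exact mul_le_mul_of_nonneg_right h.sq_scale_div_R_le hτ0
  have h9 : S ^ 2 * (q / (R : ℝ) ^ 3) ≤ c ^ 3 / S * q := by
    have hR0 : (0 : ℝ) < R := by exact_mod_cast Nat.pos_of_ne_zero hR
    calc S ^ 2 * (q / (R : ℝ) ^ 3) = (S / R) ^ 3 / S * q := by field_simp
      _ ≤ _ := by
        have := h.scale_div_R_le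
        gcongr
  have h6 := mul_le_mul_of_nonneg_left he (sq_nonneg S)
  have h7 := mul_le_mul_of_nonneg_left h1 (sq_nonneg S)
  have h8 := mul_le_mul_of_nonneg_left h2 (sq_nonneg S)
  have h10 := mul_le_mul_of_nonneg_left hτ (sq_nonneg c)
  refine h7.trans ?_
  have e1 : 3 * T / (R : ℝ) ^ 2 = 3 * (T / (R : ℝ) ^ 2) := by ring
  rw [e1]
  linarith

theorem GoodData.integral_groupVar_sub_sq_le {x : Data 𝒳}
    (hx : GoodData F ρ ψ H m (subSize θ m) x) (hm : Model)
    (hsim : UnbiasedSimulation F ρ ψ H) (h : Stage c θ m B R) :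
    ∫ z, (groupVar (bootRun H x) z - simVar ρ ψ H (empData m x)) ^ 2 ∂(groupLaw ρ m (subSize θ m) R)
      ≤ 36 * c / (θ * avg m) * bootFour ρ ψ H m (subSize θ m) x
        + 2 * bootSimVar ρ ψ H m (subSize θ m) x := by
  have := h.neZero_n
  have hS := h.scale_pos
  have h1 := (hx.runs hm hsim fun i => (h.s_pos i).ne').integral_groupVar_sub_sq_le (R := R)
    (π := uniformOn Set.univ) h.two_le_R (simVar ρ ψ H (empData m x))
  refine h1.trans ?_
  rw [hx.integral_pow_four hm]
  have hR0 : (0 : ℝ) < R := by exact_mod_cast (by have := h.two_le_R; omega : 0 < R)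
  have h2 : (R : ℝ)⁻¹ ≤ c / (θ * avg m) := by
    rw [inv_eq_one_div, div_le_div_iff₀ hR0 hS]
    linarith [h.le_R]
  have h3 : 0 ≤ bootFour ρ ψ H m (subSize θ m) x := ENNReal.toReal_nonneg
  refine add_le_add ?_ le_rfl
  calc 36 * bootFour ρ ψ H m (subSize θ m) x / R
      = 36 * bootFour ρ ψ H m (subSize θ m) x * (R : ℝ)⁻¹ := by rw [div_eq_mul_inv]
    _ ≤ 36 * bootFour ρ ψ H m (subSize θ m) x * (c / (θ * avg m)) := by gcongr
    _ = _ := by ring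

end Bounds

variable {θ : ℕ → ℝ}

theorem bp_bootFour (hfour : BoundedFourthMoment F ρ ψ H n fun k => subSize (θ k) (n k)) :
    BP (dataLaw F) fun k x => bootFour ρ ψ H (n k) (subSize (θ k) (n k)) x := fun ε hε => by
  obtain ⟨M, hM, h⟩ := hfour (fun _ => true) ε hε
  refine ⟨M.toReal + 1, by positivity, h.mono fun k hk => (measure_mono fun x hx => ?_).trans hk.le⟩
  simp only [Set.mem_ofPred_eq] at hx ⊢
  simp_rw [← resample_eq_mixed]
  by_contra hc
  push Not at hc
  have := ENNReal.toReal_mono hM hc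
  rw [bootFour, abs_of_nonneg ENNReal.toReal_nonneg] at hx
  linarith

theorem tendsto_measure_not_goodData
    (hfour : BoundedFourthMoment F ρ ψ H n fun k => subSize (θ k) (n k)) :
    Tendsto (fun k => dataLaw F {x | ¬ GoodData F ρ ψ H (n k) (subSize (θ k) (n k)) x}) atTop (𝓝 0) := by
  rw [ENNReal.tendsto_nhds_zero]
  intro ε hε
  obtain ⟨M, hM, h⟩ := hfour (fun _ => true) ε hε
  refine h.mono fun k hk => (measure_mono_ae ?_).trans hk.le
  filter_upwards [ae_mem_support (F := F)] with x hx h'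
  change ¬ (_ ∧ _) at h'
  change M < _
  simp_rw [← resample_eq_mixed]
  rw [not_and, not_not] at h'
  rw [h' hx]
  exact lt_top_iff_ne_top.2 hM

theorem op_bootSimVar (hbvar : ConvBootstrapVariance F ρ ψ H n fun k => subSize (θ k) (n k)) :
    OP (dataLaw F) fun k x => bootSimVar ρ ψ H (n k) (subSize (θ k) (n k)) x := by
  have h := isLittleOp_one_iff.1 (hbvar fun _ => true)
  simp_rw [← resample_eq_mixed, bootMean_eq_integral] at h
  exact h

theorem op_bootRemainder [Nonempty ι] (he : EmpSmooth fun k => subSize (θ k) (n k)) {c : ℝ}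
    {B R : ℕ → ℕ} (hst : ∀ᶠ k in atTop, Stage c (θ k) (n k) (B k) (R k)) :
    OP (dataLaw F) fun k x =>
      (θ k * avg (n k)) ^ 2 * bootRemainder ψ g₁ (n k) (subSize (θ k) (n k)) x := by
  have h := (he.remainder fun _ => true).op (c := fun k => (θ k * avg (n k)) ^ 2)
    (IsBigO.of_bound (c ^ 2) ?_)
  · simp_rw [← resample_eq_mixed, bootMean_eq_integral] at h
    exact h
  filter_upwards [hst] with k hk
  have hS0 := hk.scale_pos
  rw [norm_one, mul_one]
  exact hk.scale_pow_le _

/-- Bounds for the conditional moments of a group of simulation runs, given the data. -/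
theorem exists_group_moment_bounds [Nonempty ι] (hm : Model)
    (hsim : UnbiasedSimulation F ρ ψ H) (hd : Expandable) (ht : Smooth) (hb : BalancedData n)
    (he : EmpSmooth fun k => subSize (θ k) (n k)) (hvar : ConvEmpiricalVariance F ρ ψ H n)
    (hbvar : ConvBootstrapVariance F ρ ψ H n fun k => subSize (θ k) (n k))
    (hfour : BoundedFourthMoment F ρ ψ H n fun k => subSize (θ k) (n k)) {c : ℝ} {B R : ℕ → ℕ}
    (hst : ∀ᶠ k in atTop, Stage c (θ k) (n k) (B k) (R k))
    (hθn : Tendsto (fun k => θ k * avg (n k)) atTop atTop) :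
    ∃ K δ : ℝ, 0 < δ ∧ ∃ r : ℕ → Data 𝒳 → ℝ, OP (dataLaw F) r ∧ ∀ᶠ k in atTop, ∀ x,
      GoodData F ρ ψ H (n k) (subSize (θ k) (n k)) x →
      (θ k * avg (n k)) ^ 2 * ∫ z, (groupMean (bootRun H x) z
          - bootPsi ψ (n k) (subSize (θ k) (n k)) x) ^ 4
          ∂(groupLaw ρ (n k) (subSize (θ k) (n k)) (R k)) ≤ K + r k x ∧
      (∀ a, δ - r k x ≤ (θ k * avg (n k)) ^ 2 * ∫ z, ((groupMean (bootRun H x) z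
          - bootPsi ψ (n k) (subSize (θ k) (n k)) x) ^ 2 - a) ^ 2
          ∂(groupLaw ρ (n k) (subSize (θ k) (n k)) (R k))) ∧
      ∫ z, (groupVar (bootRun H x) z - simVar ρ ψ H (empData (n k) x)) ^ 2
          ∂(groupLaw ρ (n k) (subSize (θ k) (n k)) (R k)) ≤ r k x := by
  have hn : ∀ᶠ k in atTop, ∀ i, 3 ≤ n k i := hst.mono fun k hk => hk.three_le
  have hS : Tendsto (fun k => (θ k * avg (n k))⁻¹) atTop (𝓝 0) := tendsto_inv_atTop_zero.comp hθn
  let σ : ι → ℝ := fun i => ∫ y, g₁ F i y ^ 2 ∂(F i)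
  have hF : ∀ i, F i ∈ hull (F i) := fun i => self_mem_hull
  have hσ : 0 < ∑ i, σ i := Finset.sum_pos (fun i _ => by
    have := ht.nondegenerate i
    rw [variance_of_integral_eq_zero (hm.g₁_true i).aemeasurable (hd.centred₁ F hF i)] at this
    exact this) Finset.univ_nonempty
  let v : ℕ → Data 𝒳 → ι → ℝ := fun k x i =>
    av fun b : Fin (n k i) => g₁ (empData (n k) x) i (x i b) ^ 2
  let q : ℕ → Data 𝒳 → ι → ℝ := fun k x i =>
    av fun b : Fin (n k i) => g₁ (empData (n k) x) i (x i b) ^ 4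
  have ov : ∀ i, OP (dataLaw F) fun k x => v k x i - σ i := op_av_ghat₁_sq hm ht he hb
  have bv2 : BP (dataLaw F) fun k x => ∑ i, v k x i ^ 2 := BP.sum _ fun i _ =>
    ((ov i).bp_of_sub.mul (ov i).bp_of_sub).congr
      (of_forall fun _ => of_forall fun _ => by ring)
  have bq : BP (dataLaw F) fun k x => ∑ i, q k x i := BP.sum _ fun i _ =>
    bp_av_ghat₁_four hm ht he hn fun k z => z.2
  have osv : OP (dataLaw F) fun k x => ∑ i, v k x i - ∑ i, σ i :=
    (OP.sum Finset.univ fun i _ => ov i).congr (of_forall fun _ =>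
      of_forall fun _ => (sum_sub_distrib _ _).symm)
  have osv2 := osv.sq_sub
  have oM := (bp_bootFour hfour).small_mul hS
  have oq := bq.small_mul hS
  have ov2 := bv2.small_mul hS
  have oe := op_bootRemainder he hst
  have od := op_bootSimVar hbvar
  have oτ := (isLittleOp_one_iff.1 hvar.2).sq_sub
  let U : ℕ → Data 𝒳 → ℝ := fun k x =>
    3 * (c * ∑ i, v k x i) ^ 2 + c ^ 3 / (θ k * avg (n k)) * ∑ i, q k x i
  have bU : BP (dataLaw F) U := ((osv.bp_of_sub.mul osv.bp_of_sub).const_mul (3 * c ^ 2)).add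
    (oq.const_mul (c ^ 3)).bp |>.congr (of_forall fun _ => of_forall fun _ => by
      simp only [U]; ring)
  let σ2 := ∑ i, σ i
  let τ2 := simVar ρ ψ H F
  let r₁ : ℕ → Data 𝒳 → ℝ := fun k x => 192 * c ^ 2 * ((∑ i, v k x i) ^ 2 - σ2 ^ 2)
    + 64 * c ^ 3 * ((θ k * avg (n k))⁻¹ * ∑ i, q k x i)
    + 1024 * ((θ k * avg (n k)) ^ 2 * bootRemainder ψ g₁ (n k) (subSize (θ k) (n k)) x)
    + 48 * c ^ 2 * (bootSimVar ρ ψ H (n k) (subSize (θ k) (n k)) x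
      + (simVar ρ ψ H (empData (n k) x) ^ 2 - τ2 ^ 2))
    + 8 * c ^ 3 * ((θ k * avg (n k))⁻¹ * bootFour ρ ψ H (n k) (subSize (θ k) (n k)) x)
  let r₂ : ℕ → Data 𝒳 → ℝ := fun k x => -1 / (2 * c ^ 2) * ((∑ i, v k x i) ^ 2 - σ2 ^ 2)
    + 3 / 4 * c ^ 3 * ((θ k * avg (n k))⁻¹ * ∑ i, v k x i ^ 2)
    + 16 * (√((θ k * avg (n k)) ^ 2 * bootRemainder ψ g₁ (n k) (subSize (θ k) (n k)) x) * √(U k x))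
    + 16 * ((θ k * avg (n k)) ^ 2 * bootRemainder ψ g₁ (n k) (subSize (θ k) (n k)) x)
    + c ^ 2 * bootSimVar ρ ψ H (n k) (subSize (θ k) (n k)) x
  let r₃ : ℕ → Data 𝒳 → ℝ := fun k x =>
    36 * c * ((θ k * avg (n k))⁻¹ * bootFour ρ ψ H (n k) (subSize (θ k) (n k)) x)
      + 2 * bootSimVar ρ ψ H (n k) (subSize (θ k) (n k)) x
  have h₁ : OP (dataLaw F) r₁ := ((((osv2.const_mul _).add (oq.const_mul _)).add
    (oe.const_mul _)).add ((od.add oτ).const_mul _)).add (oM.const_mul _)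
  have h₂ : OP (dataLaw F) r₂ := ((((osv2.const_mul _).add (ov2.const_mul _)).add
    ((oe.sqrt.mul_bp bU.sqrt).const_mul _)).add (oe.const_mul _)).add (od.const_mul _)
  have h₃ : OP (dataLaw F) r₃ := (oM.const_mul _).add (od.const_mul _)
  have hc : 0 < c := by
    obtain ⟨k, hk⟩ := hst.exists
    exact hk.c_pos
  refine ⟨192 * c ^ 2 * σ2 ^ 2 + 48 * c ^ 2 * τ2 ^ 2, σ2 ^ 2 / (2 * c ^ 2), by positivity,
    fun k x => |r₁ k x| + |r₂ k x| + |r₃ k x|, (h₁.abs.add h₂.abs).add h₃.abs,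
    hst.mono fun k hk x hx => ⟨?_, fun a => ?_, ?_⟩⟩
  · refine (hx.integral_dev_pow_four_le hm hsim hd hk).trans ?_
    have := le_abs_self (r₁ k x)
    refine le_trans (le_of_eq ?_) (show 192 * c ^ 2 * σ2 ^ 2 + 48 * c ^ 2 * τ2 ^ 2 + r₁ k x ≤ _ by
      linarith [abs_nonneg (r₂ k x), abs_nonneg (r₃ k x)])
    simp only [r₁, v, q]
    ring
  · refine le_trans ?_ (hx.le_integral_dev_sq_sub_sq hm hsim hd hk a)
    have := le_abs_self (r₂ k x)
    refine le_trans (show _ ≤ σ2 ^ 2 / (2 * c ^ 2) - r₂ k x by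
      linarith [abs_nonneg (r₁ k x), abs_nonneg (r₃ k x)]) (le_of_eq ?_)
    simp only [r₂, v, q, U]
    ring
  · refine (hx.integral_groupVar_sub_sq_le hm hsim hk).trans ?_
    have := le_abs_self (r₃ k x)
    refine le_trans (le_of_eq ?_) (show r₃ k x ≤ _ by
      linarith [abs_nonneg (r₁ k x), abs_nonneg (r₂ k x)])
    simp only [r₃]
    ring

end Conditional

section Final

variable {θ : ℕ → ℝ} {N B R : ℕ → ℕ} {c : ℝ}

theorem integral_zTerm_sq (hm : Model) (ht : Smooth)
    (ht3 : Smooth₃) {m : ι → ℕ} (h0 : ∀ i, m i ≠ 0) :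
    MemLp (zTerm F (g₁ F) (g₂ F) m) 2 (dataLaw F) ∧
      ∫ x, zTerm F (g₁ F) (g₂ F) m x ∂(dataLaw F) = 0 ∧
      ∫ x, zTerm F (g₁ F) (g₂ F) m x ^ 2 ∂(dataLaw F) = zVariance F (g₁ F) (g₂ F) m := by
  have hI := indepCoord_sample F m
  let Z : ∀ j, Option ι → 𝒳 j → ℝ := fun j a y =>
    zVec F (g₁ F) (g₂ F) j a y - ∫ y, zVec F (g₁ F) (g₂ F) j a y ∂(F j)
  have hZ : ∀ j a, MemLp (Z j a) 2 (F j) := fun j a => memLp_sub_integral (memLp_zVec hm ht ht3 j a)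
  let u : ∀ p : Σ j, Fin (m j), 𝒳 p.1 → ℝ := fun p y => (∑ a, lamVec m p.1 a * Z p.1 a y) / m p.1
  have huL : ∀ p, MemLp (u p) 2 (F p.1) := fun p => by
    have := (memLp_finsetSum Finset.univ fun a _ => (hZ p.1 a).const_mul (lamVec m p.1 a)).mul_const
      (m p.1 : ℝ)⁻¹
    simpa only [u, div_eq_mul_inv] using this
  have hu0 : ∀ p, ∫ y, u p y ∂(F p.1) = 0 := fun p => by
    simp only [u]
    rw [integral_div, integral_finsetSum _ fun a _ =>
      ((hZ p.1 a).integrable (by norm_num)).const_mul _]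
    simp_rw [integral_const_mul, Z, integral_sub_integral_self]
    simp
  have e : ∀ x, zTerm F (g₁ F) (g₂ F) m x = ∑ p : Σ j, Fin (m j), u p (x p.1 p.2) := fun x => by
    rw [sum_sigma, zTerm]
    refine sum_congr rfl fun j _ => ?_
    simp only [av, u, Z, card_fin, sum_div]
  have hL : ∀ p : Σ j, Fin (m j), MemLp (fun x : Data 𝒳 => u p (x p.1 p.2)) 2 (dataLaw F) := fun p =>
    (huL p).comp_measurePreserving (hI.measurePreserving p)
  refine ⟨?_, ?_, ?_⟩
  · rw [funext e]
    exact memLp_finsetSum _ fun p _ => hL p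
  · simp_rw [e]
    rw [integral_finsetSum _ fun p _ => (hL p).integrable (by norm_num)]
    refine Finset.sum_eq_zero fun p _ => ?_
    rw [hI.integral_comp (f := u p) (huL p).aestronglyMeasurable, hu0]
  · simp_rw [e]
    rw [hI.integral_sum_sq huL hu0, sum_sigma, zVariance]
    refine sum_congr rfl fun j _ => ?_
    have hm0 : (m j : ℝ) ≠ 0 := by exact_mod_cast h0 j
    have hq : ∫ y, (∑ a, lamVec m j a * Z j a y) ^ 2 ∂(F j)
        = lamVec m j ⬝ᵥ (SigmaMat F (g₁ F) (g₂ F) j).mulVec (lamVec m j) := by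
      simp_rw [sq, Finset.sum_mul_sum]
      have hi : ∀ a b, Integrable (fun y => lamVec m j a * Z j a y * (lamVec m j b * Z j b y)) (F j) :=
        fun a b => ((hZ j a).const_mul _).integrable_mul ((hZ j b).const_mul _)
      rw [integral_finsetSum _ fun a _ => integrable_finsetSum _ fun b _ => hi a b]
      refine sum_congr rfl fun a _ => ?_
      rw [integral_finsetSum _ fun b _ => hi a b, Matrix.mulVec, dotProduct, mul_sum]
      refine sum_congr rfl fun b _ => ?_
      have : ∀ y, lamVec m j a * Z j a y * (lamVec m j b * Z j b y)
          = lamVec m j a * lamVec m j b * (Z j a y * Z j b y) := fun y => by ring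
      simp_rw [this]
      rw [integral_const_mul, SigmaMat, Matrix.of_apply, covariance]
      ring
    simp only [u, div_pow, integral_div, hq, sum_const, card_univ, card_fin,
      nsmul_eq_mul]
    field_simp

theorem integral_const_add_zTerm_sq (hm : Model) (ht : Smooth) (ht3 : Smooth₃) {m : ι → ℕ}
    (h0 : ∀ i, m i ≠ 0) (b : ℝ) :
    MemLp (fun x => b + zTerm F (g₁ F) (g₂ F) m x) 2 (dataLaw F) ∧
      ∫ x, (b + zTerm F (g₁ F) (g₂ F) m x) ^ 2 ∂(dataLaw F)
        = b ^ 2 + zVariance F (g₁ F) (g₂ F) m := by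
  obtain ⟨z1, z2, z3⟩ := integral_zTerm_sq hm ht ht3 h0
  rw [← z3]
  generalize zTerm F (g₁ F) (g₂ F) m = z at z1 z2 ⊢
  have e : ∀ x, (b + z x) ^ 2 = (b ^ 2 + 2 * b * z x) + z x ^ 2 := fun x => by ring
  have i0 := (z1.integrable (by norm_num)).const_mul (2 * b)
  have i1 : Integrable (fun x => b ^ 2 + 2 * b * z x) (dataLaw F) := (integrable_const _).add i0
  refine ⟨(memLp_const b).add z1, ?_⟩
  simp_rw [e]
  rw [integral_add i1 z1.integrable_sq, integral_add (integrable_const _) i0, integral_const_mul, z2]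
  simp

theorem measurable_bootRun (hm : Model) {m s : ι → ℕ} :
    Measurable fun p : Data 𝒳 × (Idx m s × 𝒰) => bootRun H p.1 p.2.1 p.2.2 :=
  (measurable_from_prod_countable_right (f := fun q : Idx m s × (Data 𝒳 × 𝒰) =>
    H (resample q.2.1 q.1) q.2.2) fun J => measurable_H_resample hm J).comp
    (g := fun q : Idx m s × (Data 𝒳 × 𝒰) => H (resample q.2.1 q.1) q.2.2)
    (f := fun p : Data 𝒳 × (Idx m s × 𝒰) => (p.2.1, p.1, p.2.2)) (by fun_prop)

theorem measurable_groupMean_bootRun (hm : Model) {m s : ι → ℕ} {R : ℕ} :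
    Measurable fun p : Data 𝒳 × (Idx m s × (Fin R → 𝒰)) => groupMean (bootRun H p.1) p.2 :=
  (measurable_fun_sum _ fun r _ => (measurable_bootRun hm).comp
    (f := fun p : Data 𝒳 × (Idx m s × (Fin R → 𝒰)) => (p.1, p.2.1, p.2.2 r))
    (by fun_prop)).div_const _

theorem measurable_groupVar_bootRun (hm : Model) {m s : ι → ℕ} {R : ℕ} :
    Measurable fun p : Data 𝒳 × (Idx m s × (Fin R → 𝒰)) => groupVar (bootRun H p.1) p.2 :=
  (measurable_fun_sum _ fun r _ => (((measurable_bootRun hm).comp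
    (f := fun p : Data 𝒳 × (Idx m s × (Fin R → 𝒰)) => (p.1, p.2.1, p.2.2 r))
    (by fun_prop)).sub (measurable_groupMean_bootRun hm)).pow_const 2).div_const _

end Final

section MonteCarlo

section Stage

variable {c θ K δ r : ℝ} {m s : ι → ℕ} {B R : ℕ} {x : Data 𝒳}

/-- The law of the resamples and of the simulation seeds. -/
abbrev mcLaw (ρ : Measure 𝒰) (m s : ι → ℕ) (B R : ℕ) :
    Measure ((Fin B → Idx m s) × (Fin B → Fin R → 𝒰)) :=
  (Measure.pi fun _ => uniformOn Set.univ).prod (Measure.pi fun _ => Measure.pi fun _ => ρ)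

/-- The resample and the seeds of group `b`. -/
abbrev group (b : Fin B) (ζ : (Fin B → Idx m s) × (Fin B → Fin R → 𝒰)) : Idx m s × (Fin R → 𝒰) :=
  (ζ.1 b, ζ.2 b)

/-- The conditional variance of the squared deviation of a group mean. -/
def devVar (ρ : Measure 𝒰) (H : (∀ i, Measure (𝒳 i)) → 𝒰 → ℝ) (m s : ι → ℕ) (R : ℕ)
    (x : Data 𝒳) : ℝ :=
  ∫ z, sqDev (groupLaw ρ m s R) (groupMean (bootRun H x)) z ^ 2 ∂(groupLaw ρ m s R)

/-- The main part of the Monte Carlo error, for data in `G`. -/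
def mcTerm (ρ : Measure 𝒰) (H : (∀ i, Measure (𝒳 i)) → 𝒰 → ℝ) (θ : ℝ)
    (G : Set (Data 𝒳)) (ω : Experiment 𝒳 𝒰 m s B R) : ℝ :=
  G.indicator (fun _ => (1 : ℝ)) ω.1 *
    (θ / B * ∑ b, sqDev (groupLaw ρ m s R) (groupMean (bootRun H ω.1)) (group b ω.2))

theorem measurable_devVar (hm : Model) :
    Measurable (devVar (𝒳 := 𝒳) ρ H m s R) :=
  measurable_integral_right ((measurable_sqDev (f := fun x => groupMean (bootRun H x))
    (measurable_groupMean_bootRun hm)).pow_const 2)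

theorem mcTerm_moments [∀ i, NeZero (m i)] (hm : Model) {G : Set (Data 𝒳)}
    (hG : MeasurableSet G) (hB : B ≠ 0) (hV : ∀ x ∈ G, devVar ρ H m s R x ≠ 0) :
    Measurable (mcTerm (m := m) (s := s) (B := B) (R := R) ρ H θ G) ∧
      ∀ x, MemLp (fun ζ => mcTerm ρ H θ G (x, ζ)) 2 (mcLaw ρ m s B R) ∧
        ∫ ζ, mcTerm ρ H θ G (x, ζ) ∂(mcLaw ρ m s B R) = 0 ∧
        ∫ ζ, mcTerm ρ H θ G (x, ζ) ^ 2 ∂(mcLaw ρ m s B R)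
          = G.indicator (fun x => θ ^ 2 / B * devVar ρ H m s R x) x := by
  have hq := measurable_sqDev (γ := groupLaw ρ m s R) (f := fun x => groupMean (bootRun H x))
    (measurable_groupMean_bootRun hm)
  refine ⟨((measurable_const.indicator hG).comp measurable_fst).mul
    ((measurable_fun_sum _ fun b _ => hq.comp
      (f := fun ω : Experiment 𝒳 𝒰 m s B R => (ω.1, group b ω.2)) (by fun_prop)).const_mul _),
    fun x => ?_⟩
  by_cases hx : x ∈ G
  · have hqx : Measurable (sqDev (groupLaw ρ m s R) (groupMean (bootRun H x))) :=
      hq.comp (g := fun p : Data 𝒳 × (Idx m s × (Fin R → 𝒰)) =>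
        sqDev (groupLaw ρ m s R) (groupMean (bootRun H p.1)) p.2) (f := fun z => (x, z))
        measurable_prodMk_left
    have hL := (memLp_two_iff_integrable_sq (μ := groupLaw ρ m s R) hqx.aestronglyMeasurable).2
      (Integrable.of_integral_ne_zero (hV x hx))
    have h := integral_mean_sqDev_sq (indepCoord_prod_pi (I := Fin B)
      (uniformOn (Set.univ : Set (Idx m s))) (Measure.pi fun _ : Fin R => ρ)) hB hL θ
    have e : ∀ ζ, mcTerm ρ H θ G (x, ζ) = θ / B * ∑ b, sqDev (groupLaw ρ m s R)
        (groupMean (bootRun H x)) (group (B := B) b ζ) := fun ζ => by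
      rw [mcTerm, Set.indicator_of_mem hx, one_mul]
    simp_rw [e]
    rw [Set.indicator_of_mem hx, devVar]
    exact h
  · simp [mcTerm, Set.indicator_of_notMem hx]

theorem integral_mcTerm_add_sq [∀ i, NeZero (m i)] (hm : Model)
    {G : Set (Data 𝒳)} (hG : MeasurableSet G) (hB : B ≠ 0) (hV : ∀ x ∈ G, devVar ρ H m s R x ≠ 0)
    (hi : Integrable (fun x => G.indicator (fun x => θ ^ 2 / B * devVar ρ H m s R x) x) (dataLaw F))
    {T : Data 𝒳 → ℝ} (hT : MemLp T 2 (dataLaw F)) :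
    MemLp (fun ω => mcTerm ρ H θ G ω + T ω.1) 2 (experimentLaw F ρ m s B R) ∧
      ∫ ω, (mcTerm ρ H θ G ω + T ω.1) ^ 2 ∂(experimentLaw F ρ m s B R)
        = ∫ x, G.indicator (fun x => θ ^ 2 / B * devVar ρ H m s R x) x ∂(dataLaw F)
          + ∫ x, T x ^ 2 ∂(dataLaw F) := by
  obtain ⟨m1, m2⟩ := mcTerm_moments (θ := θ) hm hG hB hV
  have e : (fun x => ∫ ζ, mcTerm ρ H θ G (x, ζ) ^ 2 ∂(mcLaw ρ m s B R)) = _ :=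
    funext fun x => (m2 x).2.2
  rw [← e] at hi ⊢
  exact integral_sq_prod_add m1 hT (fun x => (m2 x).1) (fun x => (m2 x).2.1) hi

theorem GoodData.svbEstimate_eq (hx : GoodData F ρ ψ H m (subSize θ m) x)
    (hm : Model) (hsim : UnbiasedSimulation F ρ ψ H)
    (h : Stage c θ m B R) (ζ : (Fin B → Idx m (subSize θ m)) × (Fin B → Fin R → 𝒰)) :
    svbEstimate H θ (x, ζ) = θ * bootVar ψ m (subSize θ m) x
      + (θ / B * ∑ b, sqDev (groupLaw ρ m (subSize θ m) R) (groupMean (bootRun H x)) (group b ζ)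
        + θ * anovaError (groupLaw ρ m (subSize θ m) R) (groupMean (bootRun H x))
          (groupVar (bootRun H x)) R fun b => group b ζ) := by
  have := h.neZero_n
  have hr := hx.runs hm hsim fun i => (h.s_pos i).ne'
  have hR : R ≠ 0 := by have := h.two_le_R; omega
  rw [svbEstimate, anovaEstimate_eq (γ := groupLaw ρ m (subSize θ m) R)
    (y := groupMean (bootRun H x)) (w := groupVar (bootRun H x)) (C := fun b => group b ζ) h.two_le_B
    (fun b => rfl) fun b => rfl, hr.integral_groupMean hR, hr.integral_dev_sq hR,
    hr.integral_groupVar h.two_le_R, add_sub_cancel_right, bootVar]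

theorem GoodData.integral_devVar (hx : GoodData F ρ ψ H m (subSize θ m) x)
    (hm : Model) (hsim : UnbiasedSimulation F ρ ψ H) (h : Stage c θ m B R)
    (h1 : (θ * avg m) ^ 2 * ∫ z, (groupMean (bootRun H x) z - bootPsi ψ m (subSize θ m) x) ^ 4
      ∂(groupLaw ρ m (subSize θ m) R) ≤ K + r)
    (h2 : ∀ a, δ - r ≤ (θ * avg m) ^ 2 * ∫ z, ((groupMean (bootRun H x) z
      - bootPsi ψ m (subSize θ m) x) ^ 2 - a) ^ 2 ∂(groupLaw ρ m (subSize θ m) R))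
    (h3 : ∫ z, (groupVar (bootRun H x) z - simVar ρ ψ H (empData m x)) ^ 2
      ∂(groupLaw ρ m (subSize θ m) R) ≤ r) :
    δ - r ≤ (θ * avg m) ^ 2 * devVar ρ H m (subSize θ m) R x ∧
      (θ * avg m) ^ 2 * devVar ρ H m (subSize θ m) R x ≤ K + r ∧
      ∫⁻ ζ, ‖θ * avg m * √B * anovaError (groupLaw ρ m (subSize θ m) R) (groupMean (bootRun H x))
          (groupVar (bootRun H x)) R fun b => group b ζ‖ₑ ∂(mcLaw ρ m (subSize θ m) B R)
        ≤ ENNReal.ofReal (4 * ((√B)⁻¹ * √(K + r)) + c * √r) := by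
  have := h.neZero_n
  have hS := h.scale_pos
  have hr := hx.runs hm hsim fun i => (h.s_pos i).ne'
  have hR : R ≠ 0 := by have := h.two_le_R; omega
  have hB0 : (0 : ℝ) < B := by exact_mod_cast (by have := h.two_le_B; omega : 0 < B)
  have ht : ∫ z, groupMean (bootRun H x) z ∂(groupLaw ρ m (subSize θ m) R)
    = bootPsi ψ m (subSize θ m) x := hr.integral_groupMean hR
  have hy : MemLp (groupMean (bootRun H x)) 4 (groupLaw ρ m (subSize θ m) R) := hr.memLp_groupMean
  have hw : MemLp (groupVar (bootRun H x)) 2 (groupLaw ρ m (subSize θ m) R) := hr.memLp_groupVar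
  have hy2 := (memLp_sub_integral hy).sq_of_four
  have e : ∫⁻ ζ, ‖θ * avg m * √B * anovaError (groupLaw ρ m (subSize θ m) R)
        (groupMean (bootRun H x)) (groupVar (bootRun H x)) R fun b => group b ζ‖ₑ
        ∂(mcLaw ρ m (subSize θ m) B R) = ENNReal.ofReal (θ * avg m * √B)
      * ∫⁻ ζ, ‖anovaError (groupLaw ρ m (subSize θ m) R) (groupMean (bootRun H x))
        (groupVar (bootRun H x)) R fun b => group b ζ‖ₑ ∂(mcLaw ρ m (subSize θ m) B R) := by
    simp_rw [enorm_mul (θ * avg m * √B)]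
    rw [lintegral_const_mul' _ _ enorm_ne_top, Real.enorm_of_nonneg (by positivity)]
  have e := e.trans_le (mul_le_mul_right (lintegral_anovaError_le (indepCoord_prod_pi (I := Fin B)
    (uniformOn (Set.univ : Set (Idx m (subSize θ m)))) (Measure.pi fun _ : Fin R => ρ)) h.two_le_B
    (hy.mono_exponent (by norm_num)) hw (simVar ρ ψ H (empData m x))) _)
  have a1 := integral_sub_mean_sq_le hy2 0
  have a2 := integral_sq_le_sqrt hy2
  rw [← ENNReal.ofReal_mul (by positivity)] at e
  simp only [sub_zero, ← pow_mul] at a1 a2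
  norm_num only at a1 a2
  simp only [devVar, sqDev]
  rw [ht] at e a1 a2 ⊢
  refine ⟨h2 _, (mul_le_mul_of_nonneg_left a1 (sq_nonneg _)).trans h1,
    e.trans (ENNReal.ofReal_le_ofReal ?_)⟩
  set A := ∫ z, (groupMean (bootRun H x) z - bootPsi ψ m (subSize θ m) x) ^ 2
    ∂(groupLaw ρ m (subSize θ m) R)
  have hA : θ * avg m * A ≤ √(K + r) := Real.le_sqrt_of_sq_le (by
    rw [mul_pow]
    exact (mul_le_mul_of_nonneg_left a2 (sq_nonneg _)).trans h1)
  have hB1 : √(B : ℝ) * (√B)⁻¹ = 1 := mul_inv_cancel₀ (Real.sqrt_pos.2 hB0).ne'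
  have hB2 : √(B : ℝ) * √B = B := Real.mul_self_sqrt hB0.le
  have hSR := h.scale_div_R_le
  have h4 := Real.sqrt_le_sqrt h3
  set W := √(∫ z, (groupVar (bootRun H x) z - simVar ρ ψ H (empData m x)) ^ 2
    ∂(groupLaw ρ m (subSize θ m) R))
  have hB3 : √(B : ℝ) / B = (√B)⁻¹ := Real.sqrt_div_self'.trans (one_div _)
  calc θ * avg m * √B * (4 * A / B + W / (R * √B))
      = 4 * ((√B / B) * (θ * avg m * A)) + θ * avg m / R * W * (√B * (√B)⁻¹) := by ring
    _ = 4 * ((√B)⁻¹ * (θ * avg m * A)) + θ * avg m / R * W := by rw [hB1, mul_one, hB3]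
    _ ≤ _ := by
        have := h.c_pos
        have : 0 ≤ W := Real.sqrt_nonneg _
        gcongr

end Stage

variable {θ : ℕ → ℝ} {N B R : ℕ → ℕ} {c : ℝ}

/-- The Monte Carlo error is, up to smaller order terms, an average of centred variables. -/
theorem exists_mcTerm [Nonempty ι] (hm : Model)
    (hsim : UnbiasedSimulation F ρ ψ H) (hd : Expandable) (ht : Smooth) (hb : BalancedData n)
    (he : EmpSmooth fun k => subSize (θ k) (n k)) (hvar : ConvEmpiricalVariance F ρ ψ H n)
    (hbvar : ConvBootstrapVariance F ρ ψ H n fun k => subSize (θ k) (n k))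
    (hfour : BoundedFourthMoment F ρ ψ H n fun k => subSize (θ k) (n k))
    (hst : ∀ᶠ k in atTop, Stage c (θ k) (n k) (B k) (R k))
    (hθn : Tendsto (fun k => θ k * avg (n k)) atTop atTop)
    (hB : Tendsto (fun k => (B k : ℝ)) atTop atTop) (hBR : ∀ k, B k * R k = N k) :
    ∃ (G : ℕ → Set (Data 𝒳)) (C : ℝ), 0 < C ∧ (∀ᶠ k in atTop, MeasurableSet (G k) ∧
      (∀ x ∈ G k, devVar ρ H (n k) (subSize (θ k) (n k)) (R k) x ≠ 0) ∧
      Integrable (fun x => (G k).indicator (fun x => θ k ^ 2 / B k *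
        devVar ρ H (n k) (subSize (θ k) (n k)) (R k) x) x) (dataLaw F) ∧
      θ k / (N k * avg (n k)) ≤ C * ∫ x, (G k).indicator (fun x => θ k ^ 2 / B k *
        devVar ρ H (n k) (subSize (θ k) (n k)) (R k) x) x ∂(dataLaw F) ∧
      ∫ x, (G k).indicator (fun x => θ k ^ 2 / B k *
        devVar ρ H (n k) (subSize (θ k) (n k)) (R k) x) x ∂(dataLaw F)
        ≤ C * (θ k / (N k * avg (n k)))) ∧
      ∀ ε : ℝ, 0 < ε → Tendsto (fun k =>
        experimentLaw F ρ (n k) (subSize (θ k) (n k)) (B k) (R k)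
          {ω | ε * √(θ k / (N k * avg (n k))) < |svbEstimate H (θ k) ω
            - θ k * bootVar ψ (n k) (subSize (θ k) (n k)) ω.1 - mcTerm ρ H (θ k) (G k) ω|})
        atTop (𝓝 0) := by
  obtain ⟨K, δ, hδ, r, hr, hbd⟩ :=
    exists_group_moment_bounds hm hsim hd ht hb he hvar hbvar hfour hst hθn
  have hc : 0 < c := by
    obtain ⟨k, hk⟩ := hst.exists
    exact hk.c_pos
  let D : ℕ → Data 𝒳 → ℝ := fun k x => devVar ρ H (n k) (subSize (θ k) (n k)) (R k) x
  let V : ℕ → Data 𝒳 → ℝ := fun k x => (θ k * avg (n k)) ^ 2 * D k x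
  have hVm : ∀ k, Measurable (V k) := fun k => (measurable_devVar hm).const_mul _
  let G : ℕ → Set (Data 𝒳) := fun k => {x | δ / 2 ≤ V k x ∧ V k x ≤ K + 1}
  have hGm : ∀ k, MeasurableSet (G k) := fun k =>
    (measurableSet_le measurable_const (hVm k)).inter (measurableSet_le (hVm k) measurable_const)
  let s : ℕ → Set (Data 𝒳) := fun k => {x | ¬ GoodData F ρ ψ H (n k) (subSize (θ k) (n k)) x} ∪
    {x | min (δ / 2) 1 < |r k x|}
  have hs : Tendsto (fun k => dataLaw F (s k)) atTop (𝓝 0) := by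
    have h := (tendsto_measure_not_goodData hfour).add (hr (min (δ / 2) 1) (by positivity))
    rw [add_zero] at h
    exact tendsto_of_tendsto_of_tendsto_of_le_of_le tendsto_const_nhds h (fun _ => zero_le)
      fun k => measure_union_le _ _
  have hgood : ∀ k, ∀ x ∉ s k, GoodData F ρ ψ H (n k) (subSize (θ k) (n k)) x ∧
      r k x ≤ δ / 2 ∧ r k x ≤ 1 := fun k x hx => by
    simp only [s, Set.mem_union, Set.mem_ofPred_eq, not_or, not_not, not_lt, le_min_iff] at hx
    have := le_abs_self (r k x)
    exact ⟨hx.1, this.trans hx.2.1, this.trans hx.2.2⟩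
  have hsG : ∀ᶠ k in atTop, ∀ x ∉ s k, x ∈ G k := by
    filter_upwards [hbd, hst] with k hk hkS x hx
    obtain ⟨h1, h2, h3⟩ := hgood k x hx
    obtain ⟨b1, b2, b3⟩ := hk x h1
    obtain ⟨d1, d2, -⟩ := h1.integral_devVar hm hsim hkS b1 b2 b3
    exact ⟨by simp only [V, D]; linarith, by simp only [V, D]; linarith⟩
  have hrate : ∀ k, Stage c (θ k) (n k) (B k) (R k) →
      (avg (n k) ^ 2 * B k)⁻¹ ≤ c * (θ k / (N k * avg (n k))) ∧
      θ k / (N k * avg (n k)) ≤ c * (avg (n k) ^ 2 * B k)⁻¹ := fun k hk => by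
    have hR0 : (0 : ℝ) < R k := by exact_mod_cast (by have := hk.two_le_R; omega : 0 < R k)
    have hB0 : (0 : ℝ) < B k := by exact_mod_cast (by have := hk.two_le_B; omega : 0 < B k)
    have ha := hk.avg_pos
    rw [← hBR, Nat.cast_mul, ← one_div, mul_div_assoc', mul_div_assoc',
      div_le_div_iff₀ (by positivity) (by positivity), div_le_div_iff₀ (by positivity) (by positivity)]
    constructor
    · nlinarith [mul_le_mul_of_nonneg_left hk.R_le (mul_pos hB0 ha).le]
    · nlinarith [mul_le_mul_of_nonneg_left hk.le_R (mul_pos hB0 ha).le]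
  refine ⟨G, c * (4 / δ + |K| + 1), by positivity, ?_, fun ε hε => ?_⟩
  · filter_upwards [hst, hsG, hs.eventually_le_const (by norm_num : (0 : ℝ≥0∞) < 1 / 2)] with k hk h1 h2
    have ha := hk.avg_pos
    have hB0 : (0 : ℝ) < B k := by exact_mod_cast (by have := hk.two_le_B; omega : 0 < B k)
    have hθ := hk.pos
    obtain ⟨t1, t2⟩ := hrate k hk
    set T := θ k / (N k * avg (n k))
    have hw0 : 0 < (avg (n k) ^ 2 * B k)⁻¹ := by positivity
    have hDV : ∀ x, θ k ^ 2 / B k * D k x = (avg (n k) ^ 2 * B k)⁻¹ * V k x := fun x => by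
      simp only [V]; field_simp
    set w := (avg (n k) ^ 2 * B k)⁻¹
    have hi : Integrable (fun x => (G k).indicator (fun x => θ k ^ 2 / B k * D k x) x) (dataLaw F) := by
      refine Integrable.mono' (integrable_const (w * (|K| + 1)))
        (((measurable_devVar hm).const_mul _).indicator (hGm k)).aestronglyMeasurable
        (of_forall fun x => ?_)
      by_cases hx : x ∈ G k
      · rw [Set.indicator_of_mem hx, hDV, Real.norm_of_nonneg (mul_nonneg hw0.le
          (by linarith [hx.1]))]
        gcongr
        linarith [hx.2, le_abs_self K]
      · rw [Set.indicator_of_notMem hx, norm_zero]; positivity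
    have hG2 : 1 / 2 ≤ (dataLaw F).real (G k) := by
      have h3 : (dataLaw F).real (G k)ᶜ ≤ 1 / 2 := by
        refine ENNReal.toReal_le_of_le_ofReal (by norm_num)
          ((measure_mono fun x (hx : x ∉ G k) => ?_).trans (h2.trans (by
            rw [ENNReal.ofReal_div_of_pos (by norm_num)]; simp)))
        by_contra hxs
        exact hx (h1 x hxs)
      rw [probReal_compl_eq_one_sub (hGm k)] at h3
      linarith
    have lo : w * (δ / 2) * (dataLaw F).real (G k)
        ≤ ∫ x, (G k).indicator (fun x => θ k ^ 2 / B k * D k x) x ∂(dataLaw F) := by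
      rw [mul_comm, ← smul_eq_mul, ← integral_indicator_const _ (hGm k)]
      refine integral_mono ((integrable_const _).indicator (hGm k)) hi fun x => ?_
      dsimp only
      refine Set.indicator_le_indicator' fun hx => ?_
      rw [hDV]
      exact mul_le_mul_of_nonneg_left hx.1 hw0.le
    have up : ∫ x, (G k).indicator (fun x => θ k ^ 2 / B k * D k x) x ∂(dataLaw F)
        ≤ w * (|K| + 1) := by
      refine (integral_mono hi (integrable_const (w * (|K| + 1))) fun x => ?_).trans (by simp)
      dsimp only
      refine Set.indicator_le' (g := fun _ => w * (|K| + 1)) (fun x hx => ?_) (fun x _ => by positivity) x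
      rw [hDV]
      exact mul_le_mul_of_nonneg_left (by linarith [hx.2, le_abs_self K]) hw0.le
    have lo' : w ≤ 4 / δ * ∫ x, (G k).indicator (fun x => θ k ^ 2 / B k * D k x) x ∂(dataLaw F) := by
      rw [div_mul_eq_mul_div, le_div_iff₀ hδ]
      nlinarith [mul_le_mul_of_nonneg_left hG2 (mul_pos hw0 hδ).le]
    refine ⟨hGm k, fun x hx h0 => ?_, hi, ?_, ?_⟩
    · have : V k x = 0 := by simp only [V, D, h0, mul_zero]
      linarith [hx.1]
    · set I := ∫ x, (G k).indicator (fun x => θ k ^ 2 / B k * D k x) x ∂(dataLaw F)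
      have hI : 0 ≤ I := le_trans (by positivity) lo
      refine t2.trans ((mul_le_mul_of_nonneg_left lo' hc.le).trans ?_)
      rw [mul_assoc]
      gcongr
      rw [add_assoc]
      exact le_add_of_nonneg_right (by positivity)
    · have hT : 0 ≤ T := by
        by_contra hT
        nlinarith
      refine up.trans ((mul_le_mul_of_nonneg_right t1 (by positivity)).trans (le_of_eq_of_le
        (by ring : c * T * (|K| + 1) = c * (|K| + 1) * T) ?_))
      gcongr
      exact le_add_of_nonneg_left (by positivity)
  · have hφ : OP (dataLaw F) fun k x => 4 * ((√(B k : ℝ))⁻¹ * √(K + r k x)) + c * √(r k x) :=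
      ((((BP.const K).add hr.bp).sqrt.small_mul (tendsto_inv_atTop_zero.comp
        (Real.tendsto_sqrt_atTop.comp hB))).const_mul 4).add (hr.sqrt.const_mul c)
    have hs2 := hs.add hs
    rw [add_zero] at hs2
    refine tendsto_zero_of_le_ofReal_add hφ hs2 (ε := ε / √c) (by positivity) fun η hη => ?_
    filter_upwards [hbd, hst, hsG] with k hk hkS h1
    have := hkS.neZero_n
    have hf : Measurable fun ω : Experiment 𝒳 𝒰 (n k) (subSize (θ k) (n k)) (B k) (R k) =>
        θ k * avg (n k) * √(B k) * anovaError (groupLaw ρ (n k) (subSize (θ k) (n k)) (R k))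
          (groupMean (bootRun H ω.1)) (groupVar (bootRun H ω.1)) (R k) fun b => group b ω.2 :=
      (measurable_anovaError (f := fun x => groupMean (bootRun H x))
        (w := fun x => groupVar (bootRun H x)) (C := fun b => group b)
        (measurable_groupMean_bootRun hm) (measurable_groupVar_bootRun hm)
        fun b => by fun_prop).const_mul _
    have h2 := measure_prod_le_of_lintegral_le (μ := dataLaw F)
      (κ := mcLaw ρ (n k) (subSize (θ k) (n k)) (B k) (R k)) hf (s := s k) (fun x hx => by
        obtain ⟨b1, b2, b3⟩ := hk x (hgood k x hx).1
        exact ((hgood k x hx).1.integral_devVar hm hsim hkS b1 b2 b3).2.2)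
      (ε := ε / √c) (by positivity) η
    have h3 : (dataLaw F).prod (mcLaw ρ (n k) (subSize (θ k) (n k)) (B k) (R k))
        (s k ×ˢ Set.univ) = dataLaw F (s k) := by
      rw [Measure.prod_prod, measure_univ, mul_one]
    refine (measure_mono fun ω hω => ?_).trans ((measure_union_le (s k ×ˢ Set.univ) _).trans
      ((add_le_add h3.le h2).trans (le_of_eq (by ring))))
    obtain ⟨x, ζ⟩ := ω
    rw [Set.mem_union, or_iff_not_imp_left]
    intro hx
    have hx : x ∉ s k := fun h => hx ⟨h, trivial⟩
    have hw := (hrate k hkS).1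
    have ha := hkS.avg_pos
    have hB0 : (0 : ℝ) < B k := by exact_mod_cast (by have := hkS.two_le_B; omega : 0 < B k)
    simp only [Set.mem_ofPred_eq] at hω ⊢
    rw [(hgood k x hx).1.svbEstimate_eq hm hsim hkS, mcTerm, Set.indicator_of_mem (h1 x hx), one_mul,
      add_sub_cancel_left, add_sub_cancel_left, abs_mul, abs_of_pos hkS.pos] at hω
    rw [abs_mul, abs_of_nonneg (a := θ k * avg (n k) * √(B k)) (by
      have := hkS.scale_pos; positivity)]
    set T := θ k / (N k * avg (n k))
    have h4 : 1 ≤ √T * √c * (avg (n k) * √(B k)) := by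
      rw [← Real.sqrt_sq ha.le, ← Real.sqrt_mul (sq_nonneg _), mul_comm √T, ← Real.sqrt_mul hc.le,
        ← Real.sqrt_mul' _ (by positivity)]
      rw [Real.one_le_sqrt]
      rwa [inv_le_iff_one_le_mul₀ (by positivity)] at hw
    have hc0 := Real.sqrt_pos.2 hc
    calc ε / √c ≤ ε * √T * (avg (n k) * √(B k)) := by
          rw [div_le_iff₀ hc0]
          nlinarith
      _ < _ := by
          have := mul_lt_mul_of_pos_right hω (by positivity : 0 < avg (n k) * √(B k))
          linarith

end MonteCarlo

end StandardModel

end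

end SVB

open SVB

theorem theorem9 {ι : Type*} [Fintype ι] [DecidableEq ι] [Nonempty ι]
    {𝒳 : ι → Type*} [∀ i, TopologicalSpace (𝒳 i)] [∀ i, PolishSpace (𝒳 i)]
    [∀ i, MeasurableSpace (𝒳 i)] [∀ i, BorelSpace (𝒳 i)] {𝒰 : Type*} [MeasurableSpace 𝒰]
    (F : ∀ i, Measure (𝒳 i)) [∀ i, IsProbabilityMeasure (F i)]
    (ρ : Measure 𝒰) [IsProbabilityMeasure ρ]
    (ψ : (∀ i, Measure (𝒳 i)) → ℝ) (H : (∀ i, Measure (𝒳 i)) → 𝒰 → ℝ)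
    (g₁ : (∀ i, Measure (𝒳 i)) → ∀ i, 𝒳 i → ℝ) (g₂ : (∀ i, Measure (𝒳 i)) → ∀ i j, 𝒳 i → 𝒳 j → ℝ)
    (g₃ : (∀ i, Measure (𝒳 i)) → ∀ i j k, 𝒳 i → 𝒳 j → 𝒳 k → ℝ)
    (n : ℕ → ι → ℕ) (θ : ℕ → ℝ) (N B R : ℕ → ℕ)
    -- the model: measurability, and unbiased simulation runs
    (hmeas : SVB.MeasurableModel F ψ H g₁ g₂ g₃) (hsim : SVB.UnbiasedSimulation F ρ ψ H)
    -- regularity conditions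
    (hbal : SVB.BalancedData n) (hdiff : SVB.ThirdOrderDifferentiable ψ g₁ g₂ g₃ F)
    (htruth : SVB.SmoothAtTruth F ψ g₁ n)
    (hemp : SVB.SmoothAtEmpirical F ψ g₁ n (fun k => SVB.subSize (θ k) (n k)))
    (hvar : SVB.ConvEmpiricalVariance F ρ ψ H n)
    (hbvar : SVB.ConvBootstrapVariance F ρ ψ H n (fun k => SVB.subSize (θ k) (n k)))
    (hfour : SVB.BoundedFourthMoment F ρ ψ H n (fun k => SVB.subSize (θ k) (n k)))
    (htruth3 : SVB.ThirdSmoothAtTruth F ψ g₁ g₂ g₃ n)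
    (hemp3 : SVB.ThirdSmoothAtEmpirical F ψ g₁ g₂ g₃ n
      (fun k => SVB.subSize (θ k) (n k)))
    -- subsample ratio, budget, outer and inner sizes
    (hθ : ∀ k, 0 < θ k ∧ θ k ≤ 1) (hθn : Tendsto (fun k => θ k * SVB.avg (n k)) atTop atTop)
    (hN : Tendsto (fun k => (N k : ℝ) / (θ k * SVB.avg (n k))) atTop atTop)
    (hR : (fun k => (R k : ℝ)) =Θ[atTop] (fun k => θ k * SVB.avg (n k)))
    (hBR : ∀ k, B k * R k = N k) :
    ∃ E : ∀ k, SVB.Experiment 𝒳 𝒰 (n k) (SVB.subSize (θ k) (n k)) (B k) (R k) → ℝ,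
      (∀ k, MemLp (E k) 2
        (SVB.experimentLaw F ρ (n k) (SVB.subSize (θ k) (n k)) (B k) (R k))) ∧
      SVB.IsLittleOp
        (fun k => SVB.experimentLaw F ρ (n k) (SVB.subSize (θ k) (n k)) (B k) (R k))
        (fun k ω => SVB.svbEstimate H (θ k) ω - SVB.inputVariance F ψ (n k) - E k ω)
        (fun k => Real.sqrt (θ k / ((N k : ℝ) * SVB.avg (n k)))
          + (θ k)⁻¹ * (SVB.avg (n k) ^ 2)⁻¹ + SVB.avg (n k) ^ (-(3 / 2) : ℝ)) ∧
      (fun k => ∫ ω, E k ω ^ 2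
          ∂(SVB.experimentLaw F ρ (n k) (SVB.subSize (θ k) (n k)) (B k) (R k)))
        =Θ[atTop] (fun k => θ k / ((N k : ℝ) * SVB.avg (n k))
          + SVB.biasTerm F (g₁ F) (g₂ F) (g₃ F) (θ k) (n k) (SVB.subSize (θ k) (n k)) ^ 2
          + SVB.zVariance F (g₁ F) (g₂ F) (n k)) := by
  classical
  obtain ⟨c, -, hst⟩ := eventually_stage hbal hθ hθn hN hR hBR
  obtain ⟨G, C, hC, hG, hmc⟩ := exists_mcTerm hmeas hsim hdiff htruth hbal hemp hvar hbvar hfour hst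
    hθn (tendsto_outer hθn hN hR hBR) hBR
  obtain ⟨D₁, D₂, hD₁, hD₂, hD⟩ := exists_bootVar_sub_eq hmeas hdiff htruth htruth3 hbal hst hθn
    hemp hemp3
  let b : ℕ → ℝ := fun k =>
    biasTerm F (g₁ F) (g₂ F) (g₃ F) (θ k) (n k) (subSize (θ k) (n k))
  let z : ∀ k, Data 𝒳 → ℝ := fun k => zTerm F (g₁ F) (g₂ F) (n k)
  let I : ℕ → ℝ := fun k => ∫ x, (G k).indicator (fun x => θ k ^ 2 / B k *
    devVar ρ H (n k) (subSize (θ k) (n k)) (R k) x) x ∂(dataLaw F)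
  let M : ∀ k, Experiment 𝒳 𝒰 (n k) (subSize (θ k) (n k)) (B k) (R k) → ℝ := fun k ω =>
    mcTerm ρ H (θ k) (G k) ω + (b k + z k ω.1)
  have hM : ∀ᶠ k in atTop, MemLp (M k) 2
      (experimentLaw F ρ (n k) (subSize (θ k) (n k)) (B k) (R k)) ∧
      ∫ ω, M k ω ^ 2 ∂(experimentLaw F ρ (n k) (subSize (θ k) (n k)) (B k) (R k))
        = I k + (b k ^ 2 + zVariance F (g₁ F) (g₂ F) (n k)) := by
    filter_upwards [hst, hG] with k hk ⟨h1, h2, h3, _⟩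
    have := hk.neZero_n
    obtain ⟨hz, hz2⟩ := integral_const_add_zTerm_sq hmeas htruth htruth3 (m := n k)
      (fun i => (hk.n_pos i).ne') (b k)
    have hB : B k ≠ 0 := fun h => by have := hk.two_le_B; omega
    have h := integral_mcTerm_add_sq (ρ := ρ) (θ := θ k) (m := n k)
      (s := subSize (θ k) (n k)) (B := B k) (R := R k) hmeas h1 hB h2 h3 hz
    refine ⟨h.1, h.2.trans ?_⟩
    rw [hz2]
  let E : ∀ k, Experiment 𝒳 𝒰 (n k) (subSize (θ k) (n k)) (B k) (R k) → ℝ := fun k =>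
    if MemLp (M k) 2 (experimentLaw F ρ (n k) (subSize (θ k) (n k)) (B k) (R k))
    then M k else 0
  have hE : ∀ᶠ k in atTop, E k = M k := hM.mono fun k hk => if_pos hk.1
  refine ⟨E, fun k => ?_, fun ε hε => ?_, ?_⟩
  · by_cases h : MemLp (M k) 2 (experimentLaw F ρ (n k) (subSize (θ k) (n k)) (B k) (R k))
    · simp only [E, if_pos h, h]
    · simp only [E, if_neg h, MemLp.zero]
  · have h0 := ((hmc ε hε).add (hD₁ ε hε)).add (hD₂ ε hε)
    simp only [add_zero] at h0
    refine tendsto_of_tendsto_of_tendsto_of_le_of_le' tendsto_const_nhds h0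
      (Eventually.of_forall fun _ => zero_le) ?_
    filter_upwards [hst, hE, hD] with k hk hkE hkD
    have := hk.neZero_n
    have hfst : ∀ s : Set (Data 𝒳), experimentLaw F ρ (n k) (subSize (θ k) (n k)) (B k) (R k)
        (s ×ˢ Set.univ) = dataLaw F s := fun s => by
      rw [experimentLaw, Measure.prod_prod, measure_univ, mul_one]
    rw [← hfst, ← hfst]
    refine (measure_mono fun ω hω => ?_).trans ((measure_union_le _ _).trans
      (add_le_add (measure_union_le _ _) le_rfl))
    obtain ⟨x, ζ⟩ := ω
    have ha := hk.avg_pos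
    have hθ0 := hk.pos
    have hsa := Real.sqrt_pos.2 ha
    by_contra hc
    simp only [Set.mem_union, Set.mem_prod, Set.mem_univ, and_true, Set.mem_ofPred_eq, not_or,
      not_lt] at hc
    obtain ⟨⟨c1, c2⟩, c3⟩ := hc
    rw [abs_mul, abs_of_pos (by positivity)] at c2 c3
    have hpow : avg (n k) ^ (-(3 / 2) : ℝ) = (avg (n k) * √(avg (n k)))⁻¹ := by
      rw [Real.rpow_neg ha.le, Real.sqrt_eq_rpow, ← Real.rpow_one_add' ha.le (by norm_num)]
      norm_num
    simp only [Set.mem_ofPred_eq, hkE, M, hpow] at hω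
    have e : svbEstimate H (θ k) (x, ζ) - inputVariance F ψ (n k)
        - (mcTerm ρ H (θ k) (G k) (x, ζ) + (b k + z k x))
        = (svbEstimate H (θ k) (x, ζ) - θ k * bootVar ψ (n k) (subSize (θ k) (n k)) x
          - mcTerm ρ H (θ k) (G k) (x, ζ)) + D₁ k x + D₂ k x := by
      linarith [hkD x]
    rw [e, abs_of_nonneg (by positivity)] at hω
    have t1 := abs_add_three (svbEstimate H (θ k) (x, ζ)
      - θ k * bootVar ψ (n k) (subSize (θ k) (n k)) x
      - mcTerm ρ H (θ k) (G k) (x, ζ)) (D₁ k x) (D₂ k x)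
    have d1 : |D₁ k x| ≤ ε * ((θ k)⁻¹ * (avg (n k) ^ 2)⁻¹) := by
      rw [← mul_inv, ← div_eq_mul_inv, le_div_iff₀ (by positivity)]
      linarith
    have d2 : |D₂ k x| ≤ ε * (avg (n k) * √(avg (n k)))⁻¹ := by
      rw [← div_eq_mul_inv, le_div_iff₀ (by positivity)]
      linarith
    linarith
  · have key : ∀ᶠ k in atTop,
        0 ≤ I k ∧ 0 ≤ θ k / ((N k : ℝ) * avg (n k)) ∧ 0 ≤ zVariance F (g₁ F) (g₂ F) (n k) ∧
        θ k / ((N k : ℝ) * avg (n k)) ≤ C * I k ∧ I k ≤ C * (θ k / ((N k : ℝ) * avg (n k))) ∧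
        ∫ ω, E k ω ^ 2 ∂(experimentLaw F ρ (n k) (subSize (θ k) (n k)) (B k) (R k))
          = I k + (b k ^ 2 + zVariance F (g₁ F) (g₂ F) (n k)) := by
      filter_upwards [hst, hG, hM, hE] with k hk ⟨_, _, _, h4, h5⟩ h6 h7
      have hT : 0 ≤ θ k / ((N k : ℝ) * avg (n k)) :=
        div_nonneg hk.pos.le (mul_nonneg (Nat.cast_nonneg _) hk.avg_pos.le)
      refine ⟨nonneg_of_mul_nonneg_right (hT.trans h4) hC, hT, ?_, h4, h5, by rw [h7, h6.2]⟩
      rw [← (integral_zTerm_sq hmeas htruth htruth3 (fun i => (hk.n_pos i).ne')).2.2]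
      exact integral_nonneg fun x => sq_nonneg _
    refine ⟨IsBigO.of_bound (C + 1) (key.mono fun k hk => ?_),
      IsBigO.of_bound (C + 1) (key.mono fun k hk => ?_)⟩
    all_goals
      obtain ⟨k1, k2, k3, k4, k5, k6⟩ := hk
      have k7 : 0 ≤ C * (b k ^ 2 + zVariance F (g₁ F) (g₂ F) (n k)) := by positivity
      rw [k6, Real.norm_of_nonneg (by positivity), Real.norm_of_nonneg (by positivity)]
      change _ ≤ (C + 1) * _
      simp only [b] at k7 ⊢
      nlinarith
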